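/- **Setting.** Let $(V,\mathscr F)$ be a compact manifold without boundary with a smooth codimension one foliation, and let $\phi_t$, $t\in\mathbb R$, be a smooth flow on $V$ mapping leaves to leaves, with generator $\Phi$ (fixed points are allowed). Let $\iota:B\to V$ be a complete closed transversal: $B$ is a closed one-dimensional manifold and $\iota$ is an immersion, everywhere transverse to the leaves, that meets every leaf. The projection of $\Phi$ to $TB$ along the leaves generates a flow $\overline\phi$ on $B$. Let $H_B$ be the reduced holonomy groupoid: its arrows $\gamma$ from $s(\gamma)\in B$ to $r(\gamma)\in B$ are the leafwise paths from $\iota(s(\gamma))$ to $\iota(r(\gamma))$, two paths being identified when they induce the same germ of holonomy diffeomorphism of $B$. It is an étale groupoid on which $\overline\phi$ acts. Let $C_c^\infty(G_+^*)$ be the space of smooth functions on $H_B\times\mathbb R$ with compact support contained in $H_B\times(0,\infty)$, with the convolution product $$(fg)(\gamma,t)=\sum_{\gamma_1\gamma_2=\gamma}\int_{-\infty}^{\infty} f(\gamma_1,u)\,g(\overline\phi_u(\gamma_2),t-u)\,du .$$ The flow is called *non-degenerate* if: (i) at any fixed point $v\in V$, $T_v\phi_t$ does not have the eigenvalue $1$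 for $t\neq0$; (ii) each periodic orbit is transverse to the leaves, and its return map acting on the tangent space to the leaf does not have the eigenvalue $1$; (iii) if the leaf $L$ of $v$ is preserved by the flow, then the action of $T_v\phi_t$ on $T_vV/T_vL$ (the transverse spaces at $\phi_t(v)$ and at $v$ being identified by holonomy along $L$) is not the identity for $t\neq0$; (iv) closed paths in leaves preserved by the flow have trivial holonomy. **Proposition 6.7.** (a) If $H_B$ is Hausdorff, which is automatic when $\phi$ is non-degenerate, then $C_c^\infty(G_+^*)$ is an associative algebra, represented on $C^\infty(B)$ by $$(f\cdot\xi)(b)=\sum_{r(\gamma)=b}\int_0^\infty f(\gamma,t)\,\xi(\overline\phi_t(s(\gamma)))\,dt ,$$ where the sum is finite. The distributional kernel of $f$ is $k_f(b,b')=\sum_{r(\gamma)=b}\int_0^\infty f(\gamma,t)\,\delta(\overline\phi_t(s(\gamma))-b')\,dt$, a distribution of order $0$ on $B\times B$. It is a smooth kernel away from the pairs of fixed points of $\overline\phi$, but it may be singular on the diagonal: for every fixed point $b$ of $\overline\phi$ there is an $f$ for which $k_f$ is not smooth near $(b,b)$. (b) Say that the distributional kernel of an operator $P$, defined on functions on $B$,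 has the distribution $T$ on $B$ as its *restriction to the diagonal* if, for every chart $x$ of $B$, every smooth function $\eta$ supported in the domain of the chart, and every $\chi\in C_c^\infty(\mathbb R)$ with $\int\chi=1$, $$\int \eta(b)\,\bigl(P\,\delta^{\varepsilon}_{b}\bigr)(b)\,dx(b)\ \xrightarrow[\varepsilon\to0^+]{}\ T(\eta),\qquad \delta^\varepsilon_b(b')=\varepsilon^{-1}\chi\bigl((x(b')-x(b))/\varepsilon\bigr),$$ where $\delta^\varepsilon_b$ is extended by zero outside the chart. If $P$ has a smooth kernel $k(b,b')$ with respect to a smooth positive density $\mu$ on $B$, then this restriction exists and $T(1)$ is uniquely determined and equal to the operator trace $\int_B k(b,b)\,d\mu(b)$. (c) Let $\phi$ be non-degenerate. Then $\overline\phi$ has finitely many fixed points, periodic orbits and infinite orbits, and at each fixed point $b$ one has $T_b\overline\phi_t=e^{\kappa_bt}$ with an exponent $\kappa_b\neq0$. For every $f\in C_c^\infty(G_+^*)$ the kernel $k_f$ has a restriction $T_f$ to the diagonal, and $\mathrm{Tr}(f)=T_f(1)$ is uniquely determined. The functional $\mathrm{Tr}$ is linear, coincides with the operator trace when $f$ acts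 by a smooth kernel, satisfies $\mathrm{Tr}(fg)=\mathrm{Tr}(gf)$, and is given by $$\mathrm{Tr}(f)=\sum_{B_p}\sum_{n\in\mathbb Z}\int_{H_{B_p}}f(\gamma,np+r(\gamma)-s(\gamma))\,r^*db(\gamma)+\sum_{B_\infty}\int_{H_{B_\infty}}f(\gamma,r(\gamma)-s(\gamma))\,r^*db(\gamma)+\sum_b\int_0^\infty\frac{f(b,t)}{|1-e^{\kappa_bt}|}\,dt ,$$ where all sums and integrals converge. The sums run over the periodic orbits $B_p$ (of period $p>0$), the infinite orbits $B_\infty$ and the fixed points $b$ of $\overline\phi$. After the choice of a base-point, $B_p$ is identified with $\mathbb R/p\mathbb Z$ and $B_\infty$ with $\mathbb R$, so that $\overline\phi_t(b)=b+t$; the points $r(\gamma)$ and $s(\gamma)$ are then regarded as numbers (in $[0,p)$ in the periodic case) and $db$ is the Lebesgue measure. $H_{B_p}$ and $H_{B_\infty}$ are the sets of arrows with source and range in the orbit, $r^*db$ is the pullback of $db$ by the étale map $r$, and $f(b,t)$ is the value of $f$ at the unit arrow of $b$. The formula holds for every choice of base-points. -/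

import Mathlib

open Set Filter Topology MeasureTheory
open scoped Manifold ContDiff unitInterval

noncomputable section

/-! ### Flows -/

section Flows

variable {E H M : Type*} [NormedAddCommGroup E] [NormedSpace ℝ E] [TopologicalSpace H]
  [TopologicalSpace M] [ChartedSpace H M]

/-- A smooth one-parameter group of diffeomorphisms `φ t`, `t : ℝ`, of the manifold `M`. -/
structure IsSmoothFlow (J : ModelWithCorners ℝ E H) (φ : ℝ → M → M) : Prop where
  smooth : ContMDiff (𝓘(ℝ, ℝ).prod J) J ∞ (fun q : ℝ × M => φ q.1 q.2)
  map_zero : ∀ x, φ 0 x = x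
  map_add : ∀ s t x, φ (s + t) x = φ s (φ t x)

/-- The vector field generating a flow: `d/dt φ_t(x)` at `t = 0`. -/
def flowGenerator (J : ModelWithCorners ℝ E H) (φ : ℝ → M → M) (x : M) : TangentSpace J x :=
  (mfderiv 𝓘(ℝ, ℝ) J (fun t : ℝ => φ t x) 0 : ℝ → E) 1

end Flows

/-- The point `x` lies on a periodic orbit (not reduced to a fixed point), with period `p`:
`p > 0` is the smallest positive time at which the orbit returns to `x`. -/
def IsLeastPeriod {X : Type*} (φ : ℝ → X → X) (x : X) (p : ℝ) : Prop :=
  0 < p ∧ φ p x = x ∧ ∀ q, 0 < q → q < p → φ q x ≠ x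

def flowOrbit {X : Type*} (φ : ℝ → X → X) (x : X) : Set X := range (fun t => φ t x)

def fixedPts {X : Type*} (φ : ℝ → X → X) : Set X := {x | ∀ t, φ t x = x}

/-- The set of periodic orbits (fixed points excluded). -/
def periodicOrbits {X : Type*} (φ : ℝ → X → X) : Set (Set X) :=
  {O | ∃ x p, IsLeastPeriod φ x p ∧ O = flowOrbit φ x}

/-- The set of infinite orbits: those on which the flow acts freely. -/
def infiniteOrbits {X : Type*} (φ : ℝ → X → X) : Set (Set X) :=
  {O | ∃ x, (∀ t, t ≠ 0 → φ t x ≠ x) ∧ O = flowOrbit φ x}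

/-- The period of a periodic orbit. -/
def orbitPeriod {X : Type*} (φ : ℝ → X → X) (O : Set X) : ℝ :=
  sInf {p | 0 < p ∧ ∀ x ∈ O, φ p x = x}

/-- The parameter in `[0, p)` of a point `x` of a periodic orbit of period `p`, with respect to
the base-point `x₀`: it represents the class of `x` under the identification of the orbit with
`ℝ / pℤ`. -/
def periodicCoord {X : Type*} (φ : ℝ → X → X) (x₀ : X) (p : ℝ) (x : X) : ℝ :=
  Classical.epsilon (fun u : ℝ => u ∈ Ico 0 p ∧ φ u x₀ = x)

/-- The parameter in `ℝ` of a point `x` of an infinite orbit, with respect to the base-point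
`x₀`. -/
def infiniteCoord {X : Type*} (φ : ℝ → X → X) (x₀ : X) (x : X) : ℝ :=
  Classical.epsilon (fun u : ℝ => φ u x₀ = x)

/-! ### Codimension one foliations -/

/-- The local model of a manifold with a codimension one foliation with `n`-dimensional leaves:
the plaques are the slices `y = const`, where `y` is the last coordinate. -/
abbrev FolModel (n : ℕ) : Type := EuclideanSpace ℝ (Fin n) × ℝ

/-- A smooth codimension one foliation of `V`, given by an atlas of foliated charts: in a change
of charts, the new transverse coordinate depends locally only on the old one. -/
structure CodimOneFoliation (n : ℕ) (V : Type*) [TopologicalSpace V]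
    [ChartedSpace (FolModel n) V] where
  charts : Set (OpenPartialHomeomorph V (FolModel n))
  charts_subset : charts ⊆ IsManifold.maximalAtlas 𝓘(ℝ, FolModel n) ∞ V
  cover : ∀ v, ∃ e ∈ charts, v ∈ e.source
  compat : ∀ e ∈ charts, ∀ e' ∈ charts, ∀ v ∈ e.source ∩ e'.source,
    ∃ τ : ℝ → ℝ, ∀ᶠ w in 𝓝 v, (e' w).2 = τ (e w).2

namespace CodimOneFoliation

variable {n : ℕ} {V : Type*} [TopologicalSpace V] [ChartedSpace (FolModel n) V]
  (F : CodimOneFoliation n V)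

/-- Leafwise paths: continuous paths along which the transverse coordinates are locally
constant. -/
def IsLeafwise (γ : I → V) : Prop :=
  Continuous γ ∧ ∀ t, ∀ e ∈ F.charts, γ t ∈ e.source → ∀ᶠ u in 𝓝 t, (e (γ u)).2 = (e (γ t)).2

/-- Two points lie on the same leaf. -/
def SameLeaf (v w : V) : Prop := ∃ γ : I → V, F.IsLeafwise γ ∧ γ 0 = v ∧ γ 1 = w

/-- The tangent vector `w` at `v` is tangent to the leaf of `v`. -/
def IsLeafTangent (v : V) (w : TangentSpace 𝓘(ℝ, FolModel n) v) : Prop :=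
  ∀ e ∈ F.charts, v ∈ e.source →
    mfderiv 𝓘(ℝ, FolModel n) 𝓘(ℝ, ℝ) (fun x => (e x).2) v w = 0

/-- The flow `φ` is compatible with the foliation: each `φ t` maps leaves to leaves (the leaves
carrying their own topology, that is, paths inside leaves are mapped to paths inside leaves). -/
def Compatible (φ : ℝ → V → V) : Prop :=
  ∀ t, ∀ γ : I → V, F.IsLeafwise γ → F.IsLeafwise (fun u => φ t (γ u))

/-- The leaf of `v` is preserved by the (compatible) flow. -/
def LeafPreserved (φ : ℝ → V → V) (v : V) : Prop := ∀ t, F.SameLeaf v (φ t v)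

/-- `j : T → V` and `j' : T' → V` parametrize transversals to the foliation, and `γ` is a leafwise
path from `j a` to `j' (h a)`. The map `h`, defined near `a`, is the holonomy of `γ`: the path `γ`
extends to a continuous family of leafwise paths `Γ x` from `j x` to `j' (h x)`, for `x` near
`a`. Only the germ of `h` at `a` matters. -/
def IsHolonomy {T T' : Type*} [TopologicalSpace T] [TopologicalSpace T']
    (j : T → V) (j' : T' → V) (γ : I → V) (a : T) (h : T → T') : Prop :=
  ∃ U ∈ 𝓝 a, ContinuousOn h U ∧ ∃ Γ : T → I → V,
    ContinuousOn (fun q : T × I => Γ q.1 q.2) (U ×ˢ univ) ∧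
    (∀ x ∈ U, F.IsLeafwise (Γ x) ∧ Γ x 0 = j x ∧ Γ x 1 = j' (h x)) ∧ Γ a = γ

/-- The transversal through `v` (at the parameter `(e v).2`) that is vertical in the chart `e`. -/
def chartTransversal (e : OpenPartialHomeomorph V (FolModel n)) (v : V) (y : ℝ) : V :=
  e.symm ((e v).1, y)

/-- Non-degeneracy of a compatible flow. -/
structure NonDegenerate (φ : ℝ → V → V) : Prop where
  /-- At a fixed point `v`, the tangent map of `φ t` does not have the eigenvalue `1` for
  `t ≠ 0`. -/
  fixed : ∀ v, (∀ t, φ t v = v) → ∀ t, t ≠ 0 → ∀ w : FolModel n,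
    (mfderiv 𝓘(ℝ, FolModel n) 𝓘(ℝ, FolModel n) (φ t) v : FolModel n → FolModel n) w = w → w = 0
  /-- Periodic orbits are transverse to the leaves. -/
  periodic_transverse : ∀ v p, IsLeastPeriod φ v p →
    ¬ F.IsLeafTangent v (flowGenerator 𝓘(ℝ, FolModel n) φ v)
  /-- The return map of a periodic orbit, acting on the vectors tangent to the leaf, does not have
  the eigenvalue `1`. -/
  periodic : ∀ v p, IsLeastPeriod φ v p → ∀ w : FolModel n, F.IsLeafTangent v w →
    (mfderiv 𝓘(ℝ, FolModel n) 𝓘(ℝ, FolModel n) (φ p) v : FolModel n → FolModel n) w = w → w = 0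
  /-- On a leaf preserved by the flow, the transverse tangent map of `φ t` is not the identity for
  `t ≠ 0`. The transverse spaces at `φ t v` and at `v` are identified by the holonomy of a leafwise
  path `δ` from `φ t v` to `v`; `h` is the resulting map on a transversal through `v`. -/
  transverse : ∀ v, F.LeafPreserved φ v → ∀ t, t ≠ 0 → ∀ e ∈ F.charts, v ∈ e.source →
    ∀ (δ : I → V) (h : ℝ → ℝ), δ 0 = φ t v → δ 1 = v →
      F.IsHolonomy (fun y => φ t (chartTransversal e v y)) (chartTransversal e v) δ (e v).2 h →
      deriv h (e v).2 ≠ 1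
  /-- Closed leafwise paths in leaves preserved by the flow have trivial holonomy. -/
  holonomy : ∀ v, F.LeafPreserved φ v → ∀ e ∈ F.charts, v ∈ e.source →
    ∀ γ : I → V, F.IsLeafwise γ → γ 0 = v → γ 1 = v →
      F.IsHolonomy (chartTransversal e v) (chartTransversal e v) γ (e v).2 id

variable {B : Type*} [TopologicalSpace B] [ChartedSpace ℝ B]

/-- `ι : B → V` is a complete transversal: an immersion of a one-dimensional manifold, everywhere
transverse to the leaves, that meets every leaf. (As `B` has dimension one and the foliation
codimension one, transversality says that no non-zero vector is mapped to a vector tangent to the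
leaves.) -/
structure IsCompleteTransversal (ι : B → V) : Prop where
  smooth : ContMDiff 𝓘(ℝ, ℝ) 𝓘(ℝ, FolModel n) ∞ ι
  transverse : ∀ b (w : TangentSpace 𝓘(ℝ, ℝ) b),
    F.IsLeafTangent (ι b) (mfderiv 𝓘(ℝ, ℝ) 𝓘(ℝ, FolModel n) ι b w) → w = 0
  complete : ∀ v, ∃ b, F.SameLeaf v (ι b)

/-- `ψ` is the flow induced by `φ` on the transversal: its generator is the projection of the
generator of `φ` to `T B` along the tangent spaces of the leaves. -/
structure IsInducedFlow (φ : ℝ → V → V) (ι : B → V) (ψ : ℝ → B → B) : Prop where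
  isSmoothFlow : IsSmoothFlow 𝓘(ℝ, ℝ) ψ
  generator : ∀ b, F.IsLeafTangent (ι b)
    (mfderiv 𝓘(ℝ, ℝ) 𝓘(ℝ, FolModel n) ι b (flowGenerator 𝓘(ℝ, ℝ) ψ b)
      - flowGenerator 𝓘(ℝ, FolModel n) φ (ι b))

end CodimOneFoliation

/-! ### The reduced holonomy groupoid -/

/-- Arrows between points of `B`, given by their source and a germ of map `B → B` there. -/
structure GermArrow (B : Type*) [TopologicalSpace B] where
  src : B
  germ : Germ (𝓝 src) B

namespace GermArrow

variable {B : Type*} [TopologicalSpace B]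

/-- The range of an arrow. -/
def tgt (a : GermArrow B) : B := a.germ.value

/-- The arrow with source `x` given by the germ of `h` at `x`. -/
def sect (h : B → B) (x : B) : GermArrow B := ⟨x, (h : Germ (𝓝 x) B)⟩

def unit (x : B) : GermArrow B := sect id x

/-- A map representing the germ. -/
def rep (a : GermArrow B) : B → B := Quotient.out a.germ

/-- The composition of arrows (meaningful if the source of `a₁` is the range of `a₂`, and the
germs are those of continuous maps). -/
def comp (a₁ a₂ : GermArrow B) : GermArrow B := sect (a₁.rep ∘ a₂.rep) a₂.src

/-- The action of a flow on arrows: transport of germs. -/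
def flow (ψ : ℝ → B → B) (t : ℝ) (a : GermArrow B) : GermArrow B :=
  sect (fun x => ψ t (a.rep (ψ (-t) x))) (ψ t a.src)

/-- The étale topology: a basis is given by the sets of germs of a map `h` at the points of an
open set. -/
instance : TopologicalSpace (GermArrow B) :=
  TopologicalSpace.generateFrom
    {S | ∃ (h : B → B) (U : Set B), IsOpen U ∧ S = sect h '' U}

end GermArrow

/-- The reduced holonomy groupoid `H_B`. Its arrows from `b` to `b'` are the leafwise paths from
`ι b` to `ι b'`, two paths being identified when they induce the same holonomy from a
neighbourhood of `b` to a neighbourhood of `b'`; the class of a path is represented by the germ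
of its holonomy. -/
def CodimOneFoliation.holonomyArrows {n : ℕ} {V : Type*} [TopologicalSpace V]
    [ChartedSpace (FolModel n) V] (F : CodimOneFoliation n V) {B : Type*} [TopologicalSpace B]
    (ι : B → V) : Set (GermArrow B) :=
  {a | ∃ (b : B) (h : B → B) (γ : I → V), F.IsHolonomy ι ι γ b h ∧ a = GermArrow.sect h b}

/-! ### The convolution algebra and its action -/

/-- The complex vector space of smooth complex-valued functions on a manifold. -/
def smoothFun {E H : Type*} [NormedAddCommGroup E] [NormedSpace ℝ E] [TopologicalSpace H]
    (J : ModelWithCorners ℝ E H) (M : Type*) [TopologicalSpace M] [ChartedSpace H M] :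
    Submodule ℂ (M → ℂ) where
  carrier := {ξ | ContMDiff J 𝓘(ℝ, ℂ) ∞ ξ}
  add_mem' := fun ha hb => ContMDiff.add ha hb
  zero_mem' := contMDiff_const
  smul_mem' := fun c ξ hξ => by
    have h : ContDiff ℝ ∞ (fun z : ℂ => c * z) := contDiff_const.mul contDiff_id
    exact h.contMDiff.comp hξ

section Convolution

variable {B : Type*} [TopologicalSpace B] [ChartedSpace ℝ B]
  (A : Set (GermArrow B)) (ψ : ℝ → B → B)

/-- For an étale groupoid `A` of germs on `B`, the space of smooth functions on `A × ℝ` with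
compact support contained in `A × (0, ∞)`; functions are extended by zero outside `A`. Smoothness
is tested in the local sections of the source map, which are the charts of `A`. -/
def posConvAlgebra : Submodule ℂ (GermArrow B → ℝ → ℂ) where
  carrier := {f | (∃ K : Set (GermArrow B × ℝ), IsCompact K ∧ K ⊆ A ×ˢ Ioi 0 ∧
      ∀ a t, (a, t) ∉ K → f a t = 0) ∧
    ∀ (h : B → B) (U : Set B), IsOpen U → (∀ x ∈ U, GermArrow.sect h x ∈ A) →
      ContMDiffOn (𝓘(ℝ, ℝ).prod 𝓘(ℝ, ℝ)) 𝓘(ℝ, ℂ) ∞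
        (fun q : B × ℝ => f (GermArrow.sect h q.1) q.2) (U ×ˢ univ)}
  add_mem' := by
    rintro f g ⟨⟨K, hK, hKA, hf⟩, hfs⟩ ⟨⟨L, hL, hLA, hg⟩, hgs⟩
    refine ⟨⟨K ∪ L, hK.union hL, union_subset hKA hLA, fun a t hat => ?_⟩, fun h U hU hA => ?_⟩
    · simp only [mem_union, not_or] at hat
      simp [hf a t hat.1, hg a t hat.2]
    · exact (hfs h U hU hA).add (hgs h U hU hA)
  zero_mem' := ⟨⟨∅, isCompact_empty, empty_subset _, fun _ _ _ => rfl⟩,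
    fun _ _ _ _ => contMDiffOn_const⟩
  smul_mem' := by
    rintro c f ⟨⟨K, hK, hKA, hf⟩, hfs⟩
    refine ⟨⟨K, hK, hKA, fun a t hat => ?_⟩, fun h U hU hA => ?_⟩
    · simp [hf a t hat]
    · have hc : ContDiff ℝ ∞ (fun z : ℂ => c * z) := contDiff_const.mul contDiff_id
      exact hc.contMDiff.comp_contMDiffOn (hfs h U hU hA)

/-- The convolution product of the crossed product groupoid with composition law
`(γ, t)(δ, u) = (γ ψ_{-t}(δ), t + u)`:
`(f g)(γ, t) = ∑_{γ₁ γ₂ = γ} ∫ f(γ₁, u) g(ψ_u(γ₂), t - u) du`. -/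
def groupoidConvolution (f g : GermArrow B → ℝ → ℂ) : GermArrow B → ℝ → ℂ := fun γ t =>
  ∑ᶠ (q : GermArrow B × GermArrow B)
    (_ : q.1 ∈ A ∧ q.2 ∈ A ∧ q.1.src = q.2.tgt ∧ q.1.comp q.2 = γ),
    ∫ u : ℝ, f q.1 u * g (q.2.flow ψ u) (t - u)

/-- The action on functions: `(f · ξ)(b) = ∑_{r(γ) = b} ∫ f(γ, t) ξ(ψ_t(s(γ))) dt`. -/
def kernelAction (f : GermArrow B → ℝ → ℂ) (ξ : B → ℂ) : B → ℂ := fun b =>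
  ∑ᶠ (γ : GermArrow B) (_ : γ ∈ A ∧ γ.tgt = b), ∫ t : ℝ, f γ t * ξ (ψ t γ.src)

/-- `μ` is a smooth positive density on the one-dimensional manifold `B`. -/
def IsSmoothDensity [MeasurableSpace B] (μ : Measure B) : Prop :=
  ∀ e ∈ IsManifold.maximalAtlas 𝓘(ℝ, ℝ) ∞ B, ∃ ρ : ℝ → ℝ, ContDiffOn ℝ ∞ ρ e.target ∧
    (∀ x ∈ e.target, 0 < ρ x) ∧
    (μ.restrict e.source).map e =
      (volume.restrict e.target).withDensity (fun x => ENNReal.ofReal (ρ x))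

/-- The distributional kernel `k_f(b, b') = ∑_{r(γ) = b} ∫ f(γ, t) δ(ψ_t(s(γ)) - b') dt`, paired
with a test function `Ψ` on `B × B` by means of the density `μ`. -/
def distKernel [MeasurableSpace B] (μ : Measure B) (f : GermArrow B → ℝ → ℂ)
    (Ψ : B × B → ℂ) : ℂ :=
  ∫ b, (∑ᶠ (γ : GermArrow B) (_ : γ ∈ A ∧ γ.tgt = b),
    ∫ t : ℝ, f γ t * Ψ (b, ψ t γ.src)) ∂μ

/-- The distribution `k` on `B × B` is given on the set `W` by a smooth function. -/
def IsSmoothKernelOn [MeasurableSpace B] (μ : Measure B) (k : (B × B → ℂ) → ℂ)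
    (W : Set (B × B)) : Prop :=
  ∃ κ : B × B → ℂ, ContMDiffOn (𝓘(ℝ, ℝ).prod 𝓘(ℝ, ℝ)) 𝓘(ℝ, ℂ) ∞ κ W ∧
    ∀ Ψ ∈ smoothFun (𝓘(ℝ, ℝ).prod 𝓘(ℝ, ℝ)) (B × B), tsupport Ψ ⊆ W →
      k Ψ = ∫ b, ∫ b', κ (b, b') * Ψ (b, b') ∂μ ∂μ

/-- The operator with kernel `κ` (with respect to the density `μ`). -/
def integralOperator [MeasurableSpace B] (μ : Measure B) (κ : B × B → ℂ) (ξ : B → ℂ) : B → ℂ :=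
  fun b => ∫ b', κ (b, b') * ξ b' ∂μ

end Convolution

/-! ### Restriction of kernels to the diagonal -/

section Diagonal

variable {B : Type*} [TopologicalSpace B] [ChartedSpace ℝ B]

/-- The approximation `b' ↦ ε⁻¹ χ((e(b') - x) / ε)` of the Dirac measure at the point with
coordinate `x` in the chart `e`. -/
def chartMollifier (e : OpenPartialHomeomorph B ℝ) (χ : ℝ → ℝ) (ε x : ℝ) : B → ℂ :=
  open Classical in
  fun b' => if b' ∈ e.source then ((ε⁻¹ * χ ((e b' - x) / ε) : ℝ) : ℂ) else 0

/-- The distribution `T` on `B` is the restriction to the diagonal of the distributional kernel of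
the operator `P`: in every chart, the kernel of `P`, regularized by convolution with an arbitrary
mollifier and restricted to the diagonal, converges weakly to `T`. -/
def IsDiagonalRestriction (P : (B → ℂ) → (B → ℂ)) (T : smoothFun 𝓘(ℝ, ℝ) B →ₗ[ℂ] ℂ) : Prop :=
  ∀ e ∈ IsManifold.maximalAtlas 𝓘(ℝ, ℝ) ∞ B,
  ∀ η : smoothFun 𝓘(ℝ, ℝ) B, tsupport (η : B → ℂ) ⊆ e.source →
  ∀ χ : ℝ → ℝ, ContDiff ℝ ∞ χ → HasCompactSupport χ → ∫ x, χ x = 1 →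
    Tendsto (fun ε : ℝ => ∫ x in e.target,
        (η : B → ℂ) (e.symm x) * P (chartMollifier e χ ε x) (e.symm x))
      (𝓝[>] 0) (𝓝 (T η))

/-- The distributional kernel of `P` has a restriction to the diagonal, whose integral over `B`
is `τ`. -/
def HasDiagonalTrace (P : (B → ℂ) → (B → ℂ)) (τ : ℂ) : Prop :=
  ∃ T : smoothFun 𝓘(ℝ, ℝ) B →ₗ[ℂ] ℂ,
    IsDiagonalRestriction P T ∧ T ⟨fun _ => 1, contMDiff_const⟩ = τ

end Diagonal

/-! ### Integrals over the orbits -/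

section Orbits

variable {B : Type*} [TopologicalSpace B] (A : Set (GermArrow B)) (ψ : ℝ → B → B)

/-- For an orbit `O` with base-point `b₀`, the sum of `F` over the arrows of `A_O` (those with
source and range in `O`) whose range has the parameter `u`. -/
def fiberSum (b₀ : B) (O : Set B) (F : GermArrow B → ℂ) (u : ℝ) : ℂ :=
  ∑ᶠ (γ : GermArrow B) (_ : γ ∈ A ∧ γ.src ∈ O ∧ γ.tgt = ψ u b₀), F γ

/-- The integral of `F` over `A_O` with respect to `r^* db`, the pullback by the (étale) range map
of the measure `db` on `O` that the parametrization `u ↦ ψ_u(b₀)`, `u ∈ D`, carries over from the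
Lebesgue measure. -/
def orbitIntegral (b₀ : B) (D : Set ℝ) (O : Set B) (F : GermArrow B → ℂ) : ℂ :=
  ∫ u in D, fiberSum A ψ b₀ O F u

/-- The function `γ ↦ f(γ, n p + r(γ) - s(γ))` on `A_O`, for a periodic orbit `O` of period `p`
with base-point `b₀`. -/
def periodicTerm (b₀ : B) (O : Set B) (f : GermArrow B → ℝ → ℂ) (k : ℤ) (γ : GermArrow B) : ℂ :=
  f γ (k * orbitPeriod ψ O + (periodicCoord ψ b₀ (orbitPeriod ψ O) γ.tgt
    - periodicCoord ψ b₀ (orbitPeriod ψ O) γ.src))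

/-- The function `γ ↦ f(γ, r(γ) - s(γ))` on `A_O`, for an infinite orbit `O` with base-point
`b₀`. -/
def infiniteTerm (b₀ : B) (f : GermArrow B → ℝ → ℂ) (γ : GermArrow B) : ℂ :=
  f γ (infiniteCoord ψ b₀ γ.tgt - infiniteCoord ψ b₀ γ.src)

/-- The exponent `κ_b` of the flow at a fixed point `b`: the tangent map of `ψ t` at `b` is the
multiplication by `exp (κ_b t)`. -/
def flowExponent [ChartedSpace ℝ B] (b : B) : ℝ :=
  Real.log ((mfderiv 𝓘(ℝ, ℝ) 𝓘(ℝ, ℝ) (ψ 1) b : ℝ → ℝ) (1 : ℝ))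

end Orbits

end

open Set Filter Topology MeasureTheory
open scoped Manifold ContDiff unitInterval

noncomputable section

set_option linter.unusedSectionVars false
set_option linter.unusedVariables false

open GermArrow

/-- A real function with nonzero derivative on a one-dimensional manifold has a smooth local
inverse. -/
lemma exists_smooth_localInverse {B : Type*} [TopologicalSpace B] [ChartedSpace ℝ B]
    [IsManifold 𝓘(ℝ, ℝ) ∞ B] {s : B → ℝ} {b : B} (hs : ContMDiffAt 𝓘(ℝ, ℝ) 𝓘(ℝ, ℝ) ∞ s b)
    (h0 : mfderiv 𝓘(ℝ, ℝ) 𝓘(ℝ, ℝ) s b ≠ 0) :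
    ∃ ρ : ℝ → B, ContMDiffAt 𝓘(ℝ, ℝ) 𝓘(ℝ, ℝ) ∞ ρ (s b) ∧ ρ (s b) = b ∧
      (∀ᶠ x in 𝓝 b, ρ (s x) = x) ∧ ∀ᶠ y in 𝓝 (s b), s (ρ y) = y := by
  set c := chartAt ℝ b with hc
  have hbs : b ∈ c.source := mem_chart_source ℝ b
  have hcs : ContMDiffAt 𝓘(ℝ, ℝ) 𝓘(ℝ, ℝ) ∞ c.symm (c b) :=
    (contMDiffOn_symm_of_mem_maximalAtlas (IsManifold.chart_mem_maximalAtlas b)).contMDiffAt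
      (c.open_target.mem_nhds (c.map_source hbs))
  have hcc : ContMDiffAt 𝓘(ℝ, ℝ) 𝓘(ℝ, ℝ) ∞ c b :=
    (contMDiffOn_of_mem_maximalAtlas (IsManifold.chart_mem_maximalAtlas b)).contMDiffAt
      (c.open_source.mem_nhds hbs)
  have hb : c.symm (c b) = b := c.left_inv hbs
  set g : ℝ → ℝ := s ∘ c.symm with hg
  have hgm : ContMDiffAt 𝓘(ℝ, ℝ) 𝓘(ℝ, ℝ) ∞ g (c b) :=
    ContMDiffAt.comp (c b) (by rw [hb]; exact hs) hcs
  have hgd : ContDiffAt ℝ ∞ g (c b) := contMDiffAt_iff_contDiffAt.1 hgm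
  have hgdd : DifferentiableAt ℝ g (c b) := hgd.differentiableAt (by simp)
  have hsg : s =ᶠ[𝓝 b] g ∘ c := by
    filter_upwards [c.open_source.mem_nhds hbs] with x hx
    simp [hg, c.left_inv hx]
  have hd : deriv g (c b) ≠ 0 := by
    intro h
    apply h0
    rw [hsg.mfderiv_eq, mfderiv_comp b (I' := 𝓘(ℝ, ℝ)) hgdd.mdifferentiableAt
      (hcc.mdifferentiableAt (by simp))]
    have h1 : fderiv ℝ g (c b) = 0 := by
      ext
      simpa using h
    have : mfderiv 𝓘(ℝ, ℝ) 𝓘(ℝ, ℝ) g (c b) = 0 := by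
      rw [mfderiv_eq_fderiv]
      exact h1
    rw [this]
    exact ContinuousLinearMap.zero_comp _
  have hgf : HasFDerivAt g ((ContinuousLinearEquiv.unitsEquivAut ℝ (Units.mk0 _ hd) : ℝ ≃L[ℝ] ℝ)
      : ℝ →L[ℝ] ℝ) (c b) := by
    have := hgdd.hasDerivAt.hasFDerivAt
    have h2 : ((ContinuousLinearEquiv.unitsEquivAut ℝ (Units.mk0 _ hd) : ℝ ≃L[ℝ] ℝ) : ℝ →L[ℝ] ℝ)
        = ContinuousLinearMap.toSpanSingleton ℝ (deriv g (c b)) := by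
      ext
      simp
    rw [h2]
    exact this
  set G := hgd.toOpenPartialHomeomorph g hgf (by simp) with hG
  have hGc : (G : ℝ → ℝ) = g := rfl
  have hmem : c b ∈ G.source := hgd.mem_toOpenPartialHomeomorph_source hgf (by simp)
  have hGt : s b ∈ G.target := by
    have := G.map_source hmem
    rw [hGc] at this
    simpa [hg, hb] using this
  have hgcb : g (c b) = s b := by simp [hg, hb]
  have hGs : G.symm (s b) = c b := by
    rw [← hgcb, ← hGc]; exact G.left_inv hmem
  have hinv : ContDiffAt ℝ ∞ G.symm (s b) := by
    have := hgd.to_localInverse hgf (by simp)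
    rw [hgcb] at this
    exact this
  refine ⟨c.symm ∘ G.symm, ?_, ?_, ?_, ?_⟩
  · refine ContMDiffAt.comp (I' := 𝓘(ℝ, ℝ)) (s b) ?_ hinv.contMDiffAt
    rw [hGs]; exact hcs
  · simp [hGs, hb]
  · have h1 : ∀ᶠ x in 𝓝 b, c x ∈ G.source :=
      hcc.continuousAt.eventually (G.open_source.mem_nhds hmem)
    filter_upwards [h1, c.open_source.mem_nhds hbs] with x hx hx'
    have : s x = G (c x) := by rw [hGc]; simp [hg, c.left_inv hx']
    simp [this, G.left_inv hx, c.left_inv hx']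
  · filter_upwards [G.open_target.mem_nhds hGt] with y hy
    exact G.right_inv hy

namespace CodimOneFoliation

variable {n : ℕ} {V : Type*} [TopologicalSpace V] [ChartedSpace (FolModel n) V]
  {F : CodimOneFoliation n V}

lemma contMDiffAt_chart {e : OpenPartialHomeomorph V (FolModel n)} [IsManifold 𝓘(ℝ, FolModel n) ∞ V]
    (he : e ∈ F.charts) {v : V} (hv : v ∈ e.source) :
    ContMDiffAt 𝓘(ℝ, FolModel n) 𝓘(ℝ, FolModel n) ∞ e v :=
  (contMDiffOn_of_mem_maximalAtlas (F.charts_subset he)).contMDiffAt (e.open_source.mem_nhds hv)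

lemma contMDiffAt_chart_symm {e : OpenPartialHomeomorph V (FolModel n)}
    [IsManifold 𝓘(ℝ, FolModel n) ∞ V]
    (he : e ∈ F.charts) {y : FolModel n} (hy : y ∈ e.target) :
    ContMDiffAt 𝓘(ℝ, FolModel n) 𝓘(ℝ, FolModel n) ∞ e.symm y :=
  (contMDiffOn_symm_of_mem_maximalAtlas (F.charts_subset he)).contMDiffAt
    (e.open_target.mem_nhds hy)

lemma contMDiffAt_transverseCoord {e : OpenPartialHomeomorph V (FolModel n)}
    [IsManifold 𝓘(ℝ, FolModel n) ∞ V] (he : e ∈ F.charts) {v : V} (hv : v ∈ e.source) :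
    ContMDiffAt 𝓘(ℝ, FolModel n) 𝓘(ℝ, ℝ) ∞ (fun w => (e w).2) v := by
  have h : ContDiff ℝ ∞ (fun y : FolModel n => y.2) := contDiff_snd
  exact h.contMDiff.contMDiffAt.comp v (contMDiffAt_chart he hv)

lemma continuousAt_transverseCoord {e : OpenPartialHomeomorph V (FolModel n)} {v : V}
    (hv : v ∈ e.source) : ContinuousAt (fun w => (e w).2) v :=
  continuous_snd.continuousAt.comp (e.continuousAt hv)

lemma exists_transition [IsManifold 𝓘(ℝ, FolModel n) ∞ V]
    {e e' : OpenPartialHomeomorph V (FolModel n)}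
    (he : e ∈ F.charts) (he' : e' ∈ F.charts) {v : V} (hv : v ∈ e.source) (hv' : v ∈ e'.source) :
    ∃ τ : ℝ → ℝ, ContDiffAt ℝ ∞ τ (e v).2 ∧ ∀ᶠ w in 𝓝 v, (e' w).2 = τ (e w).2 := by
  obtain ⟨τ₀, h₀⟩ := F.compat e he e' he' v ⟨hv, hv'⟩
  have hpt : e.symm ((e v).1, (e v).2) = v := e.left_inv hv
  have hc : ContMDiffAt 𝓘(ℝ, ℝ) 𝓘(ℝ, FolModel n) ∞ (fun y : ℝ => e.symm ((e v).1, y)) (e v).2 := by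
    have h1 : ContDiff ℝ ∞ (fun y : ℝ => ((e v).1, y)) := contDiff_const.prodMk contDiff_id
    exact ContMDiffAt.comp (e v).2 (contMDiffAt_chart_symm he (e.map_source hv))
      h1.contMDiff.contMDiffAt
  refine ⟨fun y => (e' (e.symm ((e v).1, y))).2, ?_, ?_⟩
  · apply ContMDiffAt.contDiffAt
    refine ContMDiffAt.comp (I' := 𝓘(ℝ, FolModel n)) (e v).2 (g := fun w => (e' w).2) ?_ hc
    exact contMDiffAt_transverseCoord he' (by rw [hpt]; exact hv')
  · have hlim : Tendsto (fun w => e.symm ((e v).1, (e w).2)) (𝓝 v) (𝓝 v) := by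
      have h2 : ContinuousAt (fun y : ℝ => e.symm ((e v).1, y)) (e v).2 := hc.continuousAt
      have h3 := h2.tendsto.comp (continuousAt_transverseCoord hv).tendsto
      rwa [hpt] at h3
    filter_upwards [h₀, hlim.eventually h₀, e.open_source.mem_nhds hv,
      hlim.eventually (e.open_source.mem_nhds hv),
      (continuousAt_const.prodMk (continuousAt_transverseCoord hv) :
        ContinuousAt (fun w => ((e v).1, (e w).2)) v).eventually
        (e.open_target.mem_nhds (e.map_source hv))] with w h1 h2 h3 h4 h5
    rw [h1, h2, e.right_inv h5]

lemma IsLeafwise.transverseCoord_eq {γ : I → V} (hγ : F.IsLeafwise γ)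
    {e : OpenPartialHomeomorph V (FolModel n)} (he : e ∈ F.charts) {J : Set I}
    (hJ : IsPreconnected J) (hJe : MapsTo γ J e.source) {s t : I} (hs : s ∈ J) (ht : t ∈ J) :
    (e (γ s)).2 = (e (γ t)).2 := by
  have : IsLocallyConstant (fun u : J => (e (γ u)).2) := by
    rw [IsLocallyConstant.iff_eventually_eq]
    intro u
    exact continuous_subtype_val.continuousAt.eventually (hγ.2 u e he (hJe u.2))
  have hp : PreconnectedSpace J := Subtype.preconnectedSpace hJ
  exact this.apply_eq_of_preconnectedSpace ⟨s, hs⟩ ⟨t, ht⟩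

/-- Holonomy transport of the transverse coordinate along a leafwise path. -/
lemma exists_transport [IsManifold 𝓘(ℝ, FolModel n) ∞ V]
    (γ : C(I, V)) (hγ : F.IsLeafwise γ) {e e' : OpenPartialHomeomorph V (FolModel n)}
    (he : e ∈ F.charts) (he' : e' ∈ F.charts) (h0 : γ 0 ∈ e.source) (h1 : γ 1 ∈ e'.source) :
    ∃ T : ℝ → ℝ, ContDiffAt ℝ ∞ T (e (γ 0)).2 ∧
      ∀ᶠ Γ : C(I, V) in 𝓝 γ, F.IsLeafwise Γ → (e' (Γ 1)).2 = T (e (Γ 0)).2 := by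
  let P : I → Prop := fun t => ∀ e' ∈ F.charts, γ t ∈ e'.source → ∃ T : ℝ → ℝ,
    ContDiffAt ℝ ∞ T (e (γ 0)).2 ∧
      ∀ᶠ Γ : C(I, V) in 𝓝 γ, F.IsLeafwise Γ → (e' (Γ t)).2 = T (e (Γ 0)).2
  have hev : ∀ t, Tendsto (fun Γ : C(I, V) => Γ t) (𝓝 γ) (𝓝 (γ t)) := fun t =>
    (ContinuousEvalConst.continuous_eval_const t).tendsto γ
  have hP0 : P 0 := by
    intro e' he' h
    obtain ⟨τ, hτ, hτe⟩ := exists_transition he he' h0 h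
    exact ⟨τ, hτ, ((hev 0).eventually hτe).mono fun Γ hΓ _ => hΓ⟩
  have hloc : IsLocallyConstant P := by
    rw [IsLocallyConstant.iff_eventually_eq]
    intro t₀
    obtain ⟨e₀, he₀, hm⟩ := F.cover (γ t₀)
    obtain ⟨a, b, hab, hJ, hJs⟩ := exists_Icc_mem_subset_of_mem_nhds
      (γ.continuous.continuousAt.preimage_mem_nhds (e₀.open_source.mem_nhds hm))
    have key : ∀ s ∈ Icc a b, ∀ s' ∈ Icc a b, P s → P s' := by
      intro s hs s' hs' hPs e' he' h'
      obtain ⟨T₀, hT₀, hT₀e⟩ := hPs e₀ he₀ (hJs hs)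
      obtain ⟨τ, hτ, hτe⟩ := exists_transition he₀ he' (hJs hs') h'
      have hmaps : ∀ᶠ Γ : C(I, V) in 𝓝 γ, MapsTo Γ (Icc a b) e₀.source :=
        ContinuousMap.eventually_mapsTo isCompact_Icc e₀.open_source hJs
      have hy : T₀ (e (γ 0)).2 = (e₀ (γ s')).2 := by
        rw [← hT₀e.self_of_nhds hγ]
        exact hγ.transverseCoord_eq he₀ isPreconnected_Icc hJs hs hs'
      refine ⟨τ ∘ T₀, ContDiffAt.comp _ (by rw [hy]; exact hτ) hT₀, ?_⟩
      filter_upwards [hmaps, hT₀e, (hev s').eventually hτe] with Γ h1 h2 h3 hΓ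
      rw [h3, Function.comp_apply, ← h2 hΓ]
      congr 1
      exact hΓ.transverseCoord_eq he₀ isPreconnected_Icc h1 hs' hs
    filter_upwards [hJ] with s hs
    exact propext ⟨key s hs t₀ hab, key t₀ hab s hs⟩
  have : P 1 := by
    rw [hloc.apply_eq_of_preconnectedSpace 1 0]; exact hP0
  exact this e' he' h1

lemma eventually_of_family {X : Type*} [TopologicalSpace X] {Γ : X → I → V} {a : X} {U : Set X}
    (hU : U ∈ 𝓝 a) (hΓ : ContinuousOn (fun q : X × I => Γ q.1 q.2) (U ×ˢ univ))
    (c : C(I, V)) (hc : ∀ t, c t = Γ a t) {P : C(I, V) → Prop} (hP : ∀ᶠ Γ' in 𝓝 c, P Γ') :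
    ∀ᶠ x in 𝓝 a, ∃ Γ' : C(I, V), (∀ t, Γ' t = Γ x t) ∧ P Γ' := by
  have haU : a ∈ U := mem_of_mem_nhds hU
  let g : C(U × I, V) := ⟨fun q => Γ q.1 q.2, by
    rw [continuousOn_iff_continuous_domRestrict] at hΓ
    exact hΓ.comp (f := fun q : U × I => (⟨(q.1, q.2), ⟨q.1.2, mem_univ _⟩⟩ : (U ×ˢ univ : Set (X × I))))
      (by fun_prop)⟩
  have hg : ContinuousAt g.curry ⟨a, haU⟩ := g.curry.continuous.continuousAt
  have hca : g.curry ⟨a, haU⟩ = c := by ext t; exact (hc t).symm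
  have h1 : ∀ᶠ x : U in 𝓝 ⟨a, haU⟩, P (g.curry x) := by
    apply hg.eventually; rw [hca]; exact hP
  have h2 : ∀ᶠ x in 𝓝[U] a, ∃ hx : x ∈ U, P (g.curry ⟨x, hx⟩) := by
    rw [nhdsWithin_eq_map_subtype_coe haU, eventually_map]
    exact h1.mono fun x hx => ⟨x.2, hx⟩
  rw [nhdsWithin_eq_nhds.2 hU] at h2
  exact h2.mono fun x ⟨hx, hPx⟩ => ⟨g.curry ⟨x, hx⟩, fun t => rfl, hPx⟩

variable {T T' T'' : Type*} [TopologicalSpace T] [TopologicalSpace T'] [TopologicalSpace T'']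

lemma IsHolonomy.leafwise {j : T → V} {j' : T' → V} {γ : I → V} {a : T} {h : T → T'}
    (H : F.IsHolonomy j j' γ a h) : F.IsLeafwise γ ∧ γ 0 = j a ∧ γ 1 = j' (h a) := by
  obtain ⟨U, hU, _, Γ, _, hl, rfl⟩ := H
  exact hl a (mem_of_mem_nhds hU)

lemma IsHolonomy.continuousAt {j : T → V} {j' : T' → V} {γ : I → V} {a : T} {h : T → T'}
    (H : F.IsHolonomy j j' γ a h) : ContinuousAt h a := by
  obtain ⟨U, hU, hc, _⟩ := H
  exact hc.continuousAt hU

lemma IsHolonomy.eventually {j : T → V} {j' : T' → V} {γ : I → V} {a : T} {h : T → T'}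
    (H : F.IsHolonomy j j' γ a h) {c : C(I, V)} (hc : ∀ t, c t = γ t) {P : C(I, V) → Prop}
    (hP : ∀ᶠ Γ in 𝓝 c, P Γ) :
    ∀ᶠ x in 𝓝 a, ∃ Γ : C(I, V), P Γ ∧ F.IsLeafwise Γ ∧ Γ 0 = j x ∧ Γ 1 = j' (h x) := by
  obtain ⟨U, hU, _, Γ, hΓ, hl, rfl⟩ := H
  filter_upwards [eventually_of_family hU hΓ c hc hP, hU] with x ⟨Γ', h1, h2⟩ hx
  have : (Γ' : I → V) = Γ x := funext h1
  exact ⟨Γ', h2, by rw [this]; exact (hl x hx).1, by rw [h1]; exact (hl x hx).2.1,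
    by rw [h1]; exact (hl x hx).2.2⟩

lemma IsHolonomy.eventually_isHolonomy {j : T → V} {j' : T' → V} {γ : I → V} {a : T} {h : T → T'}
    (H : F.IsHolonomy j j' γ a h) : ∀ᶠ x in 𝓝 a, ∃ γ', F.IsHolonomy j j' γ' x h := by
  obtain ⟨U, hU, hc, Γ, hΓ, hl, _⟩ := H
  filter_upwards [eventually_mem_nhds_iff.2 hU] with x hx
  exact ⟨Γ x, U, hx, hc, Γ, hΓ, hl, rfl⟩

lemma IsHolonomy.congr {j : T → V} {j' : T' → V} {γ : I → V} {a : T} {h k : T → T'}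
    (H : F.IsHolonomy j j' γ a h) (hk : k =ᶠ[𝓝 a] h) : F.IsHolonomy j j' γ a k := by
  obtain ⟨U, hU, hc, Γ, hΓ, hl, hγ⟩ := H
  refine ⟨U ∩ {x | k x = h x}, inter_mem hU hk,
    (hc.mono inter_subset_left).congr fun x hx => hx.2, Γ,
    hΓ.mono (prod_mono inter_subset_left subset_rfl), fun x hx => ?_, hγ⟩
  rw [hx.2]
  exact hl x hx.1

lemma IsLeafwise.const (v : V) : F.IsLeafwise fun _ => v :=
  ⟨continuous_const, fun _ _ _ _ => Eventually.of_forall fun _ => rfl⟩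

lemma IsLeafwise.comp {γ : I → V} (hγ : F.IsLeafwise γ) {f : I → I} (hf : Continuous f) :
    F.IsLeafwise (γ ∘ f) :=
  ⟨hγ.1.comp hf, fun t e he ht => hf.continuousAt.eventually (hγ.2 (f t) e he ht)⟩

/-- Concatenation of two paths. -/
def concat (γ γ' : I → V) (t : I) : V :=
  if (t : ℝ) ≤ 1 / 2 then γ (projIcc 0 1 zero_le_one (2 * t))
  else γ' (projIcc 0 1 zero_le_one (2 * t - 1))

lemma concat_zero (γ γ' : I → V) : concat γ γ' 0 = γ 0 := by
  simp [concat]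

lemma concat_one (γ γ' : I → V) : concat γ γ' 1 = γ' 1 := by
  have : ¬ ((1 : ℝ) ≤ 1 / 2) := by norm_num
  simp only [concat, Icc.coe_one, this, if_false]
  norm_num

lemma continuousOn_concat {X : Type*} [TopologicalSpace X] {Γ Γ' : X → I → V} {U : Set X}
    (h : ContinuousOn (fun q : X × I => Γ q.1 q.2) (U ×ˢ univ))
    (h' : ContinuousOn (fun q : X × I => Γ' q.1 q.2) (U ×ˢ univ))
    (hm : ∀ x ∈ U, Γ x 1 = Γ' x 0) :
    ContinuousOn (fun q : X × I => concat (Γ q.1) (Γ' q.1) q.2) (U ×ˢ univ) := by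
  rw [continuousOn_iff_continuous_domRestrict] at h h' ⊢
  let S := (U ×ˢ univ : Set (X × I))
  have : (S.domRestrict fun q : X × I => concat (Γ q.1) (Γ' q.1) q.2) = fun q : S =>
      if ((q : X × I).2 : ℝ) ≤ 1 / 2 then
        Γ q.1.1 (projIcc 0 1 zero_le_one (2 * (q.1.2 : ℝ)))
      else Γ' q.1.1 (projIcc 0 1 zero_le_one (2 * (q.1.2 : ℝ) - 1)) := rfl
  change Continuous (S.domRestrict fun q : X × I => concat (Γ q.1) (Γ' q.1) q.2)
  rw [this]
  have hcp : Continuous (projIcc (0 : ℝ) 1 zero_le_one) := continuous_projIcc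
  refine Continuous.if_le ?_ ?_ (by fun_prop) (by fun_prop) ?_
  · exact h.comp (f := fun q : S => (⟨(q.1.1, projIcc 0 1 zero_le_one (2 * (q.1.2 : ℝ))),
      ⟨q.2.1, mem_univ _⟩⟩ : S)) (by fun_prop)
  · exact h'.comp (f := fun q : S => (⟨(q.1.1, projIcc 0 1 zero_le_one (2 * (q.1.2 : ℝ) - 1)),
      ⟨q.2.1, mem_univ _⟩⟩ : S)) (by fun_prop)
  · intro q hq
    rw [hq]
    norm_num
    exact hm _ q.2.1

lemma IsLeafwise.concat {γ γ' : I → V} (h : F.IsLeafwise γ) (h' : F.IsLeafwise γ')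
    (hm : γ 1 = γ' 0) : F.IsLeafwise (concat γ γ') := by
  have hcont : Continuous (CodimOneFoliation.concat γ γ') := by
    have := continuousOn_concat (X := Unit) (Γ := fun _ => γ) (Γ' := fun _ => γ') (U := univ)
      (h.1.comp continuous_snd).continuousOn (h'.1.comp continuous_snd).continuousOn
      (fun _ _ => hm)
    rw [univ_prod_univ, continuousOn_univ] at this
    exact this.comp (f := fun t : I => ((), t)) (by fun_prop)
  refine ⟨hcont, fun t e he ht => ?_⟩
  have hcp : Continuous (projIcc (0 : ℝ) 1 zero_le_one) := continuous_projIcc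
  let f : I → I := fun t => projIcc 0 1 zero_le_one (2 * (t : ℝ))
  let g : I → I := fun t => projIcc 0 1 zero_le_one (2 * (t : ℝ) - 1)
  have hf : Continuous f := by fun_prop
  have hg : Continuous g := by fun_prop
  have hdef : ∀ u : I, CodimOneFoliation.concat γ γ' u =
    if (u : ℝ) ≤ 1 / 2 then γ (f u) else γ' (g u) := fun u => rfl
  rcases lt_trichotomy (t : ℝ) (1 / 2) with h1 | h1 | h1
  · have e1 : ∀ᶠ u : I in 𝓝 t, (u : ℝ) < 1 / 2 :=
      continuous_subtype_val.continuousAt.eventually (gt_mem_nhds h1)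
    rw [hdef, if_pos h1.le] at ht ⊢
    filter_upwards [e1, (h.comp hf).2 t e he ht] with u hu hu'
    rw [hdef, if_pos hu.le]; exact hu'
  · have hft : f t = 1 := by simp [f, h1, projIcc]
    have hgt : g t = 0 := by simp [g, h1, projIcc]
    rw [hdef, if_pos h1.le] at ht ⊢
    filter_upwards [(h.comp hf).2 t e he ht,
      (h'.comp hg).2 t e he (by simpa [hgt, hft, hm] using ht)] with u hu hu'
    rw [hdef]
    split_ifs with hc
    · exact hu
    · simp only [Function.comp] at hu'
      rw [hu', hgt, hft, hm]
  · have e1 : ∀ᶠ u : I in 𝓝 t, 1 / 2 < (u : ℝ) :=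
      continuous_subtype_val.continuousAt.eventually (lt_mem_nhds h1)
    rw [hdef, if_neg (not_le.2 h1)] at ht ⊢
    filter_upwards [e1, (h'.comp hg).2 t e he ht] with u hu hu'
    rw [hdef, if_neg (not_le.2 hu)]; exact hu'

lemma IsHolonomy.trans {j : T → V} {j' : T' → V} {j'' : T'' → V} {γ γ' : I → V} {a : T}
    {h : T → T'} {h' : T' → T''} (H : F.IsHolonomy j j' γ a h)
    (H' : F.IsHolonomy j' j'' γ' (h a) h') :
    F.IsHolonomy j j'' (concat γ γ') a (h' ∘ h) := by
  have hca := H.continuousAt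
  obtain ⟨U, hU, hc, Γ, hΓ, hl, rfl⟩ := H
  obtain ⟨U', hU', hc', Γ', hΓ', hl', rfl⟩ := H'
  have hmem : U ∩ h ⁻¹' U' ∈ 𝓝 a := inter_mem hU (hca hU')
  refine ⟨U ∩ h ⁻¹' U', hmem, hc'.comp (hc.mono inter_subset_left) (fun x hx => hx.2),
    fun x => concat (Γ x) (Γ' (h x)), ?_, fun x hx => ?_, rfl⟩
  · refine continuousOn_concat (Γ := Γ) (Γ' := fun x => Γ' (h x)) ?_ ?_ ?_
    · exact hΓ.mono (prod_mono inter_subset_left subset_rfl)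
    · have hcm : ContinuousOn (fun q : T × I => (h q.1, q.2)) ((U ∩ h ⁻¹' U') ×ˢ univ) := by
        apply ContinuousOn.prodMk _ continuousOn_snd
        exact (hc.mono inter_subset_left).comp continuousOn_fst (fun q hq => hq.1)
      exact hΓ'.comp hcm (fun q hq => ⟨hq.1.2, mem_univ _⟩)
    · intro x hx
      rw [(hl x hx.1).2.2, (hl' (h x) hx.2).2.1]
  · refine ⟨(hl x hx.1).1.concat (hl' _ hx.2).1 ?_, ?_, ?_⟩
    · rw [(hl x hx.1).2.2, (hl' (h x) hx.2).2.1]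
    · exact (concat_zero _ _).trans (hl x hx.1).2.1
    · exact (concat_one _ _).trans (hl' _ hx.2).2.2

end CodimOneFoliation

namespace GermArrow

variable {B : Type*} [TopologicalSpace B]

lemma sect_eq_iff {h k : B → B} {x y : B} : sect h x = sect k y ↔ x = y ∧ h =ᶠ[𝓝 x] k := by
  constructor
  · intro H
    simp only [sect, GermArrow.mk.injEq] at H
    obtain ⟨rfl, H⟩ := H
    exact ⟨rfl, Germ.coe_eq.1 (eq_of_heq H)⟩
  · rintro ⟨rfl, H⟩
    simp only [sect]
    congr 1
    exact Germ.coe_eq.2 H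

end GermArrow

section

variable {E H M : Type*} [NormedAddCommGroup E] [NormedSpace ℝ E] [TopologicalSpace H]
  [TopologicalSpace M] [ChartedSpace H M] {J : ModelWithCorners ℝ E H} {φ : ℝ → M → M}

lemma IsSmoothFlow.continuous (hφ : IsSmoothFlow J φ) : Continuous fun q : ℝ × M => φ q.1 q.2 :=
  hφ.smooth.continuous

lemma IsSmoothFlow.continuous_comp (hφ : IsSmoothFlow J φ) {X : Type*} [TopologicalSpace X]
    {u : X → ℝ} {x : X → M} (hu : Continuous u) (hx : Continuous x) :
    Continuous fun z => φ (u z) (x z) :=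
  hφ.continuous.comp (hu.prodMk hx)

lemma IsSmoothFlow.contMDiff_at_time (hφ : IsSmoothFlow J φ) (t : ℝ) : ContMDiff J J ∞ (φ t) :=
  hφ.smooth.comp (contMDiff_const.prodMk contMDiff_id)

lemma IsSmoothFlow.contMDiff_orbit (hφ : IsSmoothFlow J φ) (x : M) :
    ContMDiff 𝓘(ℝ, ℝ) J ∞ (fun t => φ t x) :=
  hφ.smooth.comp (contMDiff_id.prodMk contMDiff_const)

lemma IsSmoothFlow.neg_apply (hφ : IsSmoothFlow J φ) (t : ℝ) (x : M) : φ (-t) (φ t x) = x := by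
  rw [← hφ.map_add, neg_add_cancel, hφ.map_zero]

lemma IsSmoothFlow.apply_neg (hφ : IsSmoothFlow J φ) (t : ℝ) (x : M) : φ t (φ (-t) x) = x := by
  rw [← hφ.map_add, add_neg_cancel, hφ.map_zero]

end

/-- The chain rule, with tangent vectors regarded as vectors of the model spaces. -/
lemma mfderiv_comp_model {E E' E'' M M' M'' : Type*} [NormedAddCommGroup E] [NormedSpace ℝ E]
    [NormedAddCommGroup E'] [NormedSpace ℝ E'] [NormedAddCommGroup E''] [NormedSpace ℝ E'']
    [TopologicalSpace M] [ChartedSpace E M] [TopologicalSpace M'] [ChartedSpace E' M']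
    [TopologicalSpace M''] [ChartedSpace E'' M''] {g : M' → M''} {f : M → M'} {x : M} {y : M'}
    (hg : MDifferentiableAt 𝓘(ℝ, E') 𝓘(ℝ, E'') g y) (hf : MDifferentiableAt 𝓘(ℝ, E) 𝓘(ℝ, E') f x)
    (hy : f x = y) (w : E) :
    (mfderiv 𝓘(ℝ, E) 𝓘(ℝ, E'') (fun z => g (f z)) x : E → E'') w =
      (mfderiv 𝓘(ℝ, E') 𝓘(ℝ, E'') g y : E' → E'')
        ((mfderiv 𝓘(ℝ, E) 𝓘(ℝ, E') f x : E → E') w) := by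
  subst hy
  exact congrArg (fun L : E →L[ℝ] E'' => L w) (mfderiv_comp x hg hf)

namespace CodimOneFoliation

variable {n : ℕ} {V : Type*} [TopologicalSpace V] [ChartedSpace (FolModel n) V]
  {F : CodimOneFoliation n V} [IsManifold 𝓘(ℝ, FolModel n) ∞ V]

lemma isLeafTangent_of_chart {e : OpenPartialHomeomorph V (FolModel n)} (he : e ∈ F.charts) {v : V}
    (hv : v ∈ e.source) {w : TangentSpace 𝓘(ℝ, FolModel n) v}
    (hw : mfderiv 𝓘(ℝ, FolModel n) 𝓘(ℝ, ℝ) (fun x => (e x).2) v w = 0) : F.IsLeafTangent v w := by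
  intro e' he' hv'
  obtain ⟨τ, hτ, hτe⟩ := exists_transition he he' hv hv'
  have h1 : (fun x => (e' x).2) =ᶠ[𝓝 v] τ ∘ (fun x => (e x).2) := hτe
  rw [h1.mfderiv_eq]
  refine (mfderiv_comp_model (hτ.differentiableAt (by simp)).mdifferentiableAt
    ((contMDiffAt_transverseCoord he hv).mdifferentiableAt (by simp)) rfl w).trans ?_
  refine (congrArg (mfderiv 𝓘(ℝ, ℝ) 𝓘(ℝ, ℝ) τ (e v).2 : ℝ → ℝ) hw).trans ?_
  exact map_zero (mfderiv 𝓘(ℝ, ℝ) 𝓘(ℝ, ℝ) τ (e v).2)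

lemma isLeafwise_of_chart {e : OpenPartialHomeomorph V (FolModel n)} (he : e ∈ F.charts)
    {γ : I → V} (hγ : Continuous γ) (hs : ∀ u, γ u ∈ e.source) {y : ℝ} (hy : ∀ u, (e (γ u)).2 = y) :
    F.IsLeafwise γ := by
  refine ⟨hγ, fun t e' he' ht => ?_⟩
  obtain ⟨τ, hτ, hτe⟩ := exists_transition he he' (hs t) ht
  filter_upwards [hγ.continuousAt.eventually hτe] with u hu
  rw [hu, hτe.self_of_nhds, hy, hy]

lemma IsLeafTangent.mfderiv_flow_eq_zero {φ : ℝ → V → V} (hφ : IsSmoothFlow 𝓘(ℝ, FolModel n) φ)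
    (hcompat : F.Compatible φ) {v : V} {w : TangentSpace 𝓘(ℝ, FolModel n) v}
    (hw : F.IsLeafTangent v w) (t : ℝ) {e' : OpenPartialHomeomorph V (FolModel n)}
    (he' : e' ∈ F.charts) (hv' : φ t v ∈ e'.source) :
    mfderiv 𝓘(ℝ, FolModel n) 𝓘(ℝ, ℝ) (fun x => (e' (φ t x)).2) v w = 0 := by
  obtain ⟨e, he, hv⟩ := F.cover v
  have hee := (contMDiffAt_chart he hv).mdifferentiableAt (n := ∞) (by simp)
  have hes := (contMDiffAt_chart_symm he (e.map_source hv)).mdifferentiableAt (n := ∞) (by simp)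
  set w' : FolModel n := mfderiv 𝓘(ℝ, FolModel n) 𝓘(ℝ, FolModel n) e v w with hw'
  have hw2 : w'.2 = 0 := by
    have h1 := hw e he hv
    have h2 : (fun x => (e x).2) = (ContinuousLinearMap.snd ℝ (EuclideanSpace ℝ (Fin n)) ℝ) ∘ e :=
      rfl
    rw [h2, mfderiv_comp v (ContinuousLinearMap.mdifferentiableAt _) hee,
      ContinuousLinearMap.mfderiv_eq] at h1
    exact h1
  let c : ℝ → V := fun r => e.symm (e v + r • w')
  have hlin : Continuous fun r : ℝ => e v + r • w' := by fun_prop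
  have hc0 : c 0 = v := by simp [c, e.left_inv hv]
  have htgt : ∀ᶠ r : ℝ in 𝓝 0, e v + r • w' ∈ e.target :=
    hlin.continuousAt.eventually (e.open_target.mem_nhds (by simpa using e.map_source hv))
  obtain ⟨δ, hδ, hball⟩ := Metric.eventually_nhds_iff_ball.1 htgt
  have hu : ∀ u : I, e v + (δ * ((u : ℝ) - 1 / 2)) • w' ∈ e.target := by
    intro u
    apply hball
    rw [mem_ball_zero_iff, Real.norm_eq_abs, abs_mul, abs_of_pos hδ]
    have : |(u : ℝ) - 1 / 2| < 1 := by
      rw [abs_lt]; constructor <;> linarith [u.2.1, u.2.2]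
    nlinarith
  have hleaf : F.IsLeafwise fun u : I => c (δ * ((u : ℝ) - 1 / 2)) := by
    apply isLeafwise_of_chart he (y := (e v).2)
    · have h3 : Continuous fun u : I => e v + (δ * ((u : ℝ) - 1 / 2)) • w' := by fun_prop
      exact e.continuousOn_symm.comp_continuous h3 hu
    · exact fun u => e.map_target (hu u)
    · intro u
      simp only [c]
      rw [e.right_inv (hu u)]
      simp [hw2]
  have hleaf' := hcompat t _ hleaf
  let g : ℝ → ℝ := fun r => (e' (φ t (c r))).2
  have hg : g =ᶠ[𝓝 0] fun _ => (e' (φ t v)).2 := by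
    have hpr : ContinuousAt (fun r : ℝ => projIcc (0 : ℝ) 1 zero_le_one (r / δ + 1 / 2)) 0 := by
      have : Continuous (projIcc (0 : ℝ) 1 zero_le_one) := continuous_projIcc
      fun_prop
    have hhalf : projIcc (0 : ℝ) 1 zero_le_one (0 / δ + 1 / 2) =
        ⟨1 / 2, by norm_num, by norm_num⟩ := by
      apply Subtype.ext
      rw [coe_projIcc]; norm_num
    have h4 := hleaf'.2 ⟨1 / 2, by norm_num, by norm_num⟩ e' he' (by simpa [hc0] using hv')
    rw [← hhalf] at h4
    have h5 := hpr.eventually h4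
    have h6 : ∀ᶠ r : ℝ in 𝓝 0, r / δ + 1 / 2 ∈ Ioo (0 : ℝ) 1 := by
      have : ContinuousAt (fun r : ℝ => r / δ + 1 / 2) 0 := by fun_prop
      exact this.eventually (isOpen_Ioo.mem_nhds (by norm_num))
    filter_upwards [h5, h6] with r hr hr'
    rw [hhalf] at hr
    have h7 : δ * (((projIcc (0 : ℝ) 1 zero_le_one (r / δ + 1 / 2) : I) : ℝ) - 1 / 2) = r := by
      rw [projIcc_of_mem _ (Ioo_subset_Icc_self hr')]
      field_simp
      ring
    simp only at hr
    rw [h7] at hr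
    simpa [g, hc0] using hr
  have hd0 : deriv g 0 = 0 := by
    rw [hg.deriv_eq]; simp
  have hf : MDifferentiableAt 𝓘(ℝ, FolModel n) 𝓘(ℝ, ℝ) (fun x => (e' (φ t x)).2) v :=
    ((contMDiffAt_transverseCoord he' hv').comp v
      (hφ.contMDiff_at_time t).contMDiffAt).mdifferentiableAt (by simp)
  have hf' : MDifferentiableAt 𝓘(ℝ, FolModel n) 𝓘(ℝ, ℝ) (fun x => (e' (φ t x)).2)
    (e.symm (e v)) := by rw [e.left_inv hv]; exact hf
  set k : FolModel n → ℝ := (fun x => (e' (φ t x)).2) ∘ e.symm with hk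
  have hkd : DifferentiableAt ℝ k (e v) :=
    (MDifferentiableAt.comp (e v) hf' hes).differentiableAt
  have hkw : fderiv ℝ k (e v) w' = 0 := by
    have h8 : HasDerivAt (fun r : ℝ => e v + r • w') w' 0 := by
      simpa using ((hasDerivAt_id (0 : ℝ)).smul_const w').const_add (e v)
    have h9 : HasFDerivAt k (fderiv ℝ k (e v)) (e v + (0 : ℝ) • w') := by
      simpa using hkd.hasFDerivAt
    have := (h9.comp_hasDerivAt 0 h8).deriv
    rw [← hd0, ← this]
    rfl
  have hfe : (fun x => (e' (φ t x)).2) =ᶠ[𝓝 v] k ∘ e := by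
    filter_upwards [e.open_source.mem_nhds hv] with x hx
    simp [hk, e.left_inv hx]
  rw [hfe.mfderiv_eq, mfderiv_comp v (I' := 𝓘(ℝ, FolModel n)) hkd.mdifferentiableAt hee,
    mfderiv_eq_fderiv]
  exact hkw

variable {B : Type*} [TopologicalSpace B] [ChartedSpace ℝ B] [IsManifold 𝓘(ℝ, ℝ) ∞ B]
  {φ : ℝ → V → V} {ι : B → V} {ψ : ℝ → B → B}

/-- The curve `s ↦ φ_{u-s}(ι(ψ_s x))`, which stays in a leaf. -/
def canonicalCurve (φ : ℝ → V → V) (ι : B → V) (ψ : ℝ → B → B) (u : ℝ) (x : B) (s : ℝ) : V :=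
  φ (u - s) (ι (ψ s x))

lemma hasDerivAt_canonicalCurve (hφ : IsSmoothFlow 𝓘(ℝ, FolModel n) φ)
    (hcompat : F.Compatible φ) (hι : F.IsCompleteTransversal ι) (hψ : F.IsInducedFlow φ ι ψ)
    (u : ℝ) (x : B) (s : ℝ) {e : OpenPartialHomeomorph V (FolModel n)}
    (he : e ∈ F.charts) (hs : canonicalCurve φ ι ψ u x s ∈ e.source) :
    HasDerivAt (fun s => (e (canonicalCurve φ ι ψ u x s)).2) 0 s := by
  have hfl := hψ.isSmoothFlow
  set x' := ψ s x with hx'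
  let M : ℝ → V := fun v => φ (-v) (ι (ψ v x'))
  have hM0 : M 0 = ι x' := by simp [M, hφ.map_zero, hfl.map_zero]
  have hcurve : ContMDiff 𝓘(ℝ, ℝ) 𝓘(ℝ, FolModel n) ∞ (fun v => ι (ψ v x')) :=
    hι.smooth.comp (hfl.contMDiff_orbit x')
  have hneg : ContMDiff 𝓘(ℝ, ℝ) 𝓘(ℝ, ℝ) ∞ (fun v : ℝ => -v) := contDiff_neg.contMDiff
  have htwo : ContMDiff (𝓘(ℝ, ℝ).prod 𝓘(ℝ, ℝ)) 𝓘(ℝ, FolModel n) ∞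
      (fun q : ℝ × ℝ => φ (-q.1) (ι (ψ q.2 x'))) :=
    hφ.smooth.comp ((hneg.comp contMDiff_fst).prodMk (hcurve.comp contMDiff_snd))
  have hM : ContMDiff 𝓘(ℝ, ℝ) 𝓘(ℝ, FolModel n) ∞ M :=
    htwo.comp (contMDiff_id.prodMk contMDiff_id)
  have hMd : (mfderiv 𝓘(ℝ, ℝ) 𝓘(ℝ, FolModel n) M 0 : ℝ → FolModel n) 1 =
      (mfderiv 𝓘(ℝ, ℝ) 𝓘(ℝ, FolModel n) ι x' (flowGenerator 𝓘(ℝ, ℝ) ψ x') : FolModel n)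
      - (flowGenerator 𝓘(ℝ, FolModel n) φ (ι x') : FolModel n) := by
    have hdiag : mfderiv 𝓘(ℝ, ℝ) (𝓘(ℝ, ℝ).prod 𝓘(ℝ, ℝ)) (fun v : ℝ => (v, v)) 0 =
        (mfderiv 𝓘(ℝ, ℝ) 𝓘(ℝ, ℝ) (fun v : ℝ => v) 0).prod
          (mfderiv 𝓘(ℝ, ℝ) 𝓘(ℝ, ℝ) (fun v : ℝ => v) 0) :=
      mfderiv_prodMk mdifferentiableAt_id mdifferentiableAt_id
    have hid : mfderiv 𝓘(ℝ, ℝ) 𝓘(ℝ, ℝ) (fun v : ℝ => v) 0 = ContinuousLinearMap.id ℝ ℝ := mfderiv_id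
    have h1 : (mfderiv 𝓘(ℝ, ℝ) 𝓘(ℝ, FolModel n) M 0 : ℝ → FolModel n) 1 =
        (mfderiv (𝓘(ℝ, ℝ).prod 𝓘(ℝ, ℝ)) 𝓘(ℝ, FolModel n)
          (fun q : ℝ × ℝ => φ (-q.1) (ι (ψ q.2 x'))) (0, 0) : ℝ × ℝ → FolModel n) (1, 1) := by
      have hd : MDifferentiableAt 𝓘(ℝ, ℝ) (𝓘(ℝ, ℝ).prod 𝓘(ℝ, ℝ)) (fun v : ℝ => (v, v)) 0 :=
        mdifferentiableAt_id.prodMk mdifferentiableAt_id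
      have hc := mfderiv_comp (I' := 𝓘(ℝ, ℝ).prod 𝓘(ℝ, ℝ)) (0 : ℝ)
        (htwo.mdifferentiableAt (by simp)) hd
      rw [hdiag, hid] at hc
      exact congrArg (fun L : ℝ →L[ℝ] FolModel n => L 1) hc
    have h2 := mfderiv_prod_eq_add_apply (p := ((0 : ℝ), (0 : ℝ))) (v := ((1 : ℝ), (1 : ℝ)))
      (htwo.mdifferentiableAt (x := ((0 : ℝ), (0 : ℝ))) (by simp))
    have h3 : (fun z : ℝ => φ (-z) (ι (ψ 0 x'))) = fun z => φ (-z) (ι x') := by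
      rw [hfl.map_zero]
    have h4 : (fun z : ℝ => φ (-0) (ι (ψ z x'))) = fun z => ι (ψ z x') := by
      funext z; rw [neg_zero, hφ.map_zero]
    have h5 : (mfderiv 𝓘(ℝ, ℝ) 𝓘(ℝ, FolModel n) (fun z : ℝ => φ (-z) (ι (ψ 0 x'))) 0 :
        ℝ → FolModel n) 1 = -(flowGenerator 𝓘(ℝ, FolModel n) φ (ι x') : FolModel n) := by
      rw [h3]
      refine (mfderiv_comp_model (f := fun z : ℝ => -z) (g := fun z => φ z (ι x')) (y := 0)
        ((hφ.contMDiff_orbit _).mdifferentiableAt (by simp))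
        (hneg.mdifferentiableAt (by simp)) (by simp) 1).trans ?_
      have h6 : (mfderiv 𝓘(ℝ, ℝ) 𝓘(ℝ, ℝ) (fun z : ℝ => -z) 0 : ℝ → ℝ) 1 = -1 := by
        have h7 : fderiv ℝ (fun z : ℝ => -z) 0 1 = -1 := by simp
        rw [mfderiv_eq_fderiv]
        exact h7
      refine (congrArg (mfderiv 𝓘(ℝ, ℝ) 𝓘(ℝ, FolModel n) (fun z => φ z (ι x')) 0 :
        ℝ → FolModel n) h6).trans ?_
      exact map_neg (mfderiv 𝓘(ℝ, ℝ) 𝓘(ℝ, FolModel n) (fun z => φ z (ι x')) 0) _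
    have h6 : (mfderiv 𝓘(ℝ, ℝ) 𝓘(ℝ, FolModel n) (fun z : ℝ => φ (-0) (ι (ψ z x'))) 0 :
        ℝ → FolModel n) 1 =
        (mfderiv 𝓘(ℝ, ℝ) 𝓘(ℝ, FolModel n) ι x' (flowGenerator 𝓘(ℝ, ℝ) ψ x') : FolModel n) := by
      rw [h4]
      exact mfderiv_comp_model (f := fun z => ψ z x') (g := ι)
        (hι.smooth.mdifferentiableAt (by simp))
        ((hfl.contMDiff_orbit _).mdifferentiableAt (by simp)) (hfl.map_zero x') 1
    rw [sub_eq_neg_add]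
    refine h1.trans (h2.trans ?_)
    exact congrArg₂ (fun a b : FolModel n => a + b) h5 h6
  have hcv : ∀ v, canonicalCurve φ ι ψ u x (s + v) = φ (u - s) (M v) := by
    intro v
    simp only [canonicalCurve, M]
    rw [← hφ.map_add, hx', ← hfl.map_add]
    congr 1
    · ring
    · rw [add_comm]
  have hs' : φ (u - s) (ι x') ∈ e.source := hs
  have htan : F.IsLeafTangent (ι x') ((mfderiv 𝓘(ℝ, ℝ) 𝓘(ℝ, FolModel n) M 0 : ℝ → FolModel n) 1) := by
    rw [hMd]; exact hψ.generator x'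
  have hz := htan.mfderiv_flow_eq_zero hφ hcompat (u - s) he hs'
  have hq : MDifferentiableAt 𝓘(ℝ, FolModel n) 𝓘(ℝ, ℝ) (fun z => (e (φ (u - s) z)).2) (ι x') :=
    ((contMDiffAt_transverseCoord he hs').comp (ι x')
      (hφ.contMDiff_at_time _).contMDiffAt).mdifferentiableAt (by simp)
  have hcomp : MDifferentiableAt 𝓘(ℝ, ℝ) 𝓘(ℝ, ℝ) (fun v => (e (φ (u - s) (M v))).2) 0 :=
    MDifferentiableAt.comp (0 : ℝ) (I' := 𝓘(ℝ, FolModel n)) (g := fun z => (e (φ (u - s) z)).2)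
      (by rw [hM0]; exact hq) (hM.mdifferentiableAt (by simp))
  have hder : HasDerivAt (fun v => (e (φ (u - s) (M v))).2) 0 0 := by
    have h6 := hcomp.differentiableAt.hasDerivAt
    have h7 : deriv (fun v => (e (φ (u - s) (M v))).2) 0 = 0 := by
      rw [← fderiv_apply_one_eq_deriv, ← mfderiv_eq_fderiv]
      exact (mfderiv_comp_model (f := M) (g := fun z => (e (φ (u - s) z)).2) hq
        (hM.mdifferentiableAt (by simp)) hM0 1).trans hz
    rwa [h7] at h6
  have h9 : (fun s => (e (canonicalCurve φ ι ψ u x s)).2) =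
      fun r => (fun v => (e (φ (u - s) (M v))).2) (r - s) := by
    funext r
    simp only
    rw [← hcv, add_sub_cancel]
  rw [h9]
  have := HasDerivAt.comp_sub_const s s (f := fun v => (e (φ (u - s) (M v))).2) (f' := 0)
    (by rw [sub_self]; exact hder)
  exact this

/-- The canonical leafwise path from `φ_u(ι x)` to `ι(ψ_u x)`. -/
def canonicalPath (φ : ℝ → V → V) (ι : B → V) (ψ : ℝ → B → B) (u : ℝ) (x : B) (r : I) : V :=
  canonicalCurve φ ι ψ u x (u * r)

lemma continuous_canonicalPath (hφ : IsSmoothFlow 𝓘(ℝ, FolModel n) φ)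
    (hι : F.IsCompleteTransversal ι) (hψ : F.IsInducedFlow φ ι ψ) :
    Continuous fun q : (ℝ × B) × I => canonicalPath φ ι ψ q.1.1 q.1.2 q.2 := by
  have h1 : Continuous fun q : (ℝ × B) × I => ψ (q.1.1 * q.2) q.1.2 :=
    hψ.isSmoothFlow.continuous_comp (by fun_prop) (by fun_prop)
  exact hφ.continuous_comp (by fun_prop) (hι.smooth.continuous.comp h1)

lemma isLeafwise_canonicalPath (hφ : IsSmoothFlow 𝓘(ℝ, FolModel n) φ)
    (hcompat : F.Compatible φ) (hι : F.IsCompleteTransversal ι) (hψ : F.IsInducedFlow φ ι ψ)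
    (u : ℝ) (x : B) : F.IsLeafwise (canonicalPath φ ι ψ u x) := by
  have hc : Continuous (canonicalCurve φ ι ψ u x) :=
    hφ.continuous_comp (by fun_prop)
      (hι.smooth.continuous.comp (hψ.isSmoothFlow.contMDiff_orbit x).continuous)
  have hm : Continuous fun r : I => u * (r : ℝ) := by fun_prop
  refine ⟨hc.comp hm, fun t e he ht => ?_⟩
  have h1 : ∀ᶠ s in 𝓝 (u * (t : ℝ)), canonicalCurve φ ι ψ u x s ∈ e.source :=
    hc.continuousAt.eventually (e.open_source.mem_nhds ht)
  obtain ⟨δ, hδ, hball⟩ := Metric.eventually_nhds_iff_ball.1 h1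
  have h2 : ∀ s ∈ Metric.ball (u * (t : ℝ)) δ, (e (canonicalCurve φ ι ψ u x s)).2 =
      (e (canonicalCurve φ ι ψ u x (u * t))).2 := by
    intro s hs
    have hd : ∀ y ∈ Metric.ball (u * (t : ℝ)) δ,
        HasDerivAt (fun s => (e (canonicalCurve φ ι ψ u x s)).2) 0 y := fun y hy =>
      hasDerivAt_canonicalCurve hφ hcompat hι hψ u x y he (hball y hy)
    exact Metric.isOpen_ball.is_const_of_deriv_eq_zero
      (convex_ball _ _).isPreconnected
      (fun y hy => (hd y hy).differentiableAt.differentiableWithinAt)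
      (fun y hy => (hd y hy).deriv) hs (Metric.mem_ball_self hδ)
  filter_upwards [hm.continuousAt.eventually (Metric.ball_mem_nhds _ hδ)] with r hr
  exact h2 _ hr

lemma isHolonomy_canonicalPath (hφ : IsSmoothFlow 𝓘(ℝ, FolModel n) φ)
    (hcompat : F.Compatible φ) (hι : F.IsCompleteTransversal ι) (hψ : F.IsInducedFlow φ ι ψ)
    (u : ℝ) (x : B) :
    F.IsHolonomy (fun y => φ u (ι y)) ι (canonicalPath φ ι ψ u x) x (ψ u) := by
  refine ⟨univ, univ_mem, (hψ.isSmoothFlow.contMDiff_at_time u).continuous.continuousOn,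
    fun y => canonicalPath φ ι ψ u y, ?_, fun y _ => ?_, rfl⟩
  · have := (continuous_canonicalPath hφ hι hψ).comp
      (f := fun q : B × I => ((u, q.1), q.2)) (by fun_prop)
    exact this.continuousOn
  · refine ⟨isLeafwise_canonicalPath hφ hcompat hι hψ u y, ?_, ?_⟩
    · simp [canonicalPath, canonicalCurve, hψ.isSmoothFlow.map_zero]
    · simp [canonicalPath, canonicalCurve, hφ.map_zero]

lemma isHolonomy_canonicalPath_symm (hφ : IsSmoothFlow 𝓘(ℝ, FolModel n) φ)
    (hcompat : F.Compatible φ) (hι : F.IsCompleteTransversal ι) (hψ : F.IsInducedFlow φ ι ψ)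
    (u : ℝ) (x : B) :
    F.IsHolonomy ι (fun y => φ u (ι y))
      (canonicalPath φ ι ψ u (ψ (-u) x) ∘ unitInterval.symm) x (ψ (-u)) := by
  have hc := (hψ.isSmoothFlow.contMDiff_at_time (-u)).continuous
  refine ⟨univ, univ_mem, hc.continuousOn,
    fun y => canonicalPath φ ι ψ u (ψ (-u) y) ∘ unitInterval.symm, ?_, fun y _ => ?_, rfl⟩
  · have := (continuous_canonicalPath hφ hι hψ).comp
      (f := fun q : B × I => ((u, ψ (-u) q.1), unitInterval.symm q.2)) (by fun_prop)
    exact this.continuousOn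
  · refine ⟨(isLeafwise_canonicalPath hφ hcompat hι hψ u _).comp unitInterval.continuous_symm,
      ?_, ?_⟩
    · simp [canonicalPath, canonicalCurve, hφ.map_zero, hψ.isSmoothFlow.apply_neg]
    · simp [canonicalPath, canonicalCurve, hψ.isSmoothFlow.map_zero]

lemma IsHolonomy.map_flow {T T' : Type*} [TopologicalSpace T] [TopologicalSpace T']
    (hφ : IsSmoothFlow 𝓘(ℝ, FolModel n) φ) (hcompat : F.Compatible φ)
    {j : T → V} {j' : T' → V} {γ : I → V} {a : T} {h : T → T'}
    (H : F.IsHolonomy j j' γ a h) (u : ℝ) :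
    F.IsHolonomy (fun x => φ u (j x)) (fun x => φ u (j' x)) (fun r => φ u (γ r)) a h := by
  obtain ⟨U, hU, hc, Γ, hΓ, hl, rfl⟩ := H
  refine ⟨U, hU, hc, fun x r => φ u (Γ x r), ?_, fun x hx => ?_, rfl⟩
  · exact (hφ.contMDiff_at_time u).continuous.comp_continuousOn hΓ
  · exact ⟨hcompat u _ (hl x hx).1, by simp only [(hl x hx).2.1], by simp only [(hl x hx).2.2]⟩

lemma IsHolonomy.conj_flow (hφ : IsSmoothFlow 𝓘(ℝ, FolModel n) φ)
    (hcompat : F.Compatible φ) (hι : F.IsCompleteTransversal ι) (hψ : F.IsInducedFlow φ ι ψ)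
    {γ : I → V} {b : B} {h : B → B} (H : F.IsHolonomy ι ι γ b h) (u : ℝ) :
    ∃ γ', F.IsHolonomy ι ι γ' (ψ u b) (fun y => ψ u (h (ψ (-u) y))) := by
  have h1 := isHolonomy_canonicalPath_symm hφ hcompat hι hψ u (ψ u b)
  have h2 := H.map_flow hφ hcompat u
  rw [← hψ.isSmoothFlow.neg_apply u b] at h2
  have h3 := (h1.trans h2).trans (isHolonomy_canonicalPath hφ hcompat hι hψ u _)
  exact ⟨_, h3⟩

end CodimOneFoliation

/-- The properties of the holonomy groupoid, with the action of the flow, that the convolution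
algebra depends on: `A` is an étale groupoid of germs of diffeomorphisms, stable under the flow
and commuting with it locally. -/
structure IsFlowGroupoid {B : Type*} [TopologicalSpace B] [ChartedSpace ℝ B]
    (A : Set (GermArrow B)) (ψ : ℝ → B → B) : Prop where
  isSmoothFlow : IsSmoothFlow 𝓘(ℝ, ℝ) ψ
  exists_rep : ∀ a ∈ A, ∃ h, a = GermArrow.sect h a.src
  eventually_mem : ∀ {h : B → B} {x}, GermArrow.sect h x ∈ A → ∀ᶠ y in 𝓝 x, GermArrow.sect h y ∈ A
  contMDiffAt : ∀ {h : B → B} {x}, GermArrow.sect h x ∈ A → ContMDiffAt 𝓘(ℝ, ℝ) 𝓘(ℝ, ℝ) ∞ h x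
  unit_mem : ∀ x, GermArrow.unit x ∈ A
  sect_comp_mem : ∀ {h k : B → B} {x}, GermArrow.sect k x ∈ A → GermArrow.sect h (k x) ∈ A →
    GermArrow.sect (h ∘ k) x ∈ A
  exists_inverse : ∀ {h : B → B} {x}, GermArrow.sect h x ∈ A → ∃ k, GermArrow.sect k (h x) ∈ A ∧
    (∀ᶠ y in 𝓝 x, k (h y) = y) ∧ ∀ᶠ z in 𝓝 (h x), h (k z) = z
  commute : ∀ {h : B → B} {x}, GermArrow.sect h x ∈ A →
    ∀ᶠ p : ℝ × B in 𝓝 (0, x), h (ψ p.1 p.2) = ψ p.1 (h p.2)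
  conj_mem : ∀ {h : B → B} {x}, GermArrow.sect h x ∈ A → ∀ u,
    GermArrow.sect (fun y => ψ u (h (ψ (-u) y))) (ψ u x) ∈ A

/-- In dimension one, a local left inverse of a differentiable map is a local right inverse. -/
lemma eventually_right_inverse_of_left_inverse {T T' : ℝ → ℝ} {y : ℝ}
    (hT : ContDiffAt ℝ ∞ T y) (hT' : ContDiffAt ℝ ∞ T' (T y))
    (h : ∀ᶠ z in 𝓝 y, T' (T z) = z) : ∀ᶠ z in 𝓝 (T y), T (T' z) = z := by
  have hd : deriv T' (T y) * deriv T y = 1 := by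
    have h1 : HasDerivAt (T' ∘ T) (deriv T' (T y) * deriv T y) y :=
      (hT'.differentiableAt (by simp)).hasDerivAt.comp y (hT.differentiableAt (by simp)).hasDerivAt
    have h2 : HasDerivAt (T' ∘ T) 1 y := (hasDerivAt_id y).congr_of_eventuallyEq h
    exact h1.unique h2
  have hne : mfderiv 𝓘(ℝ, ℝ) 𝓘(ℝ, ℝ) T y ≠ 0 := by
    intro h0
    have : deriv T y = 0 := by
      rw [← fderiv_apply_one_eq_deriv, ← mfderiv_eq_fderiv]
      exact congrArg (fun L : ℝ →L[ℝ] ℝ => L 1) h0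
    rw [this, mul_zero] at hd
    exact zero_ne_one hd
  obtain ⟨R, hR, hRy, -, hR2⟩ := exists_smooth_localInverse hT.contMDiffAt hne
  have hRt : Tendsto R (𝓝 (T y)) (𝓝 y) := by
    have := hR.continuousAt.tendsto
    rwa [hRy] at this
  filter_upwards [hR2, hRt.eventually h] with z h1 h2
  rw [h1] at h2
  rw [h2, h1]

namespace CodimOneFoliation

variable {n : ℕ} {V : Type*} [TopologicalSpace V] [ChartedSpace (FolModel n) V]
  {F : CodimOneFoliation n V} [IsManifold 𝓘(ℝ, FolModel n) ∞ V]
  {B : Type*} [TopologicalSpace B] [ChartedSpace ℝ B] [IsManifold 𝓘(ℝ, ℝ) ∞ B]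
  {φ : ℝ → V → V} {ι : B → V} {ψ : ℝ → B → B}

lemma contMDiffAt_transversalCoord (hι : F.IsCompleteTransversal ι)
    {e : OpenPartialHomeomorph V (FolModel n)} (he : e ∈ F.charts) {b : B} (hb : ι b ∈ e.source) :
    ContMDiffAt 𝓘(ℝ, ℝ) 𝓘(ℝ, ℝ) ∞ (fun x => (e (ι x)).2) b :=
  ContMDiffAt.comp b (g := fun v => (e v).2) (f := ι) (contMDiffAt_transverseCoord he hb)
    hι.smooth.contMDiffAt

lemma mfderiv_transversalCoord_ne_zero (hι : F.IsCompleteTransversal ι)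
    {e : OpenPartialHomeomorph V (FolModel n)} (he : e ∈ F.charts) {b : B} (hb : ι b ∈ e.source) :
    mfderiv 𝓘(ℝ, ℝ) 𝓘(ℝ, ℝ) (fun x => (e (ι x)).2) b ≠ 0 := by
  intro h0
  have h1 : (mfderiv 𝓘(ℝ, ℝ) 𝓘(ℝ, ℝ) (fun x => (e (ι x)).2) b : ℝ → ℝ) (1 : ℝ) = (0 : ℝ) :=
    congrArg (fun L : ℝ →L[ℝ] ℝ => L 1) h0
  have h2 := mfderiv_comp_model (f := ι) (g := fun v => (e v).2)
    ((contMDiffAt_transverseCoord he hb).mdifferentiableAt (by simp))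
    (hι.smooth.mdifferentiableAt (x := b) (by simp)) rfl (1 : ℝ)
  have h3 := isLeafTangent_of_chart he hb (h2.symm.trans h1)
  exact one_ne_zero (α := ℝ) (hι.transverse b _ h3)

lemma exists_transversal_inverse (hι : F.IsCompleteTransversal ι)
    {e : OpenPartialHomeomorph V (FolModel n)} (he : e ∈ F.charts) {b : B} (hb : ι b ∈ e.source) :
    ∃ ρ : ℝ → B, ContMDiffAt 𝓘(ℝ, ℝ) 𝓘(ℝ, ℝ) ∞ ρ (e (ι b)).2 ∧ ρ (e (ι b)).2 = b ∧
      (∀ᶠ x in 𝓝 b, ρ (e (ι x)).2 = x) ∧ ∀ᶠ y in 𝓝 (e (ι b)).2, (e (ι (ρ y))).2 = y :=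
  exists_smooth_localInverse (contMDiffAt_transversalCoord hι he hb)
    (mfderiv_transversalCoord_ne_zero hι he hb)

lemma IsHolonomy.exists_transport {T T' : Type*} [TopologicalSpace T] [TopologicalSpace T']
    {j : T → V} {j' : T' → V} {γ : I → V} {a : T} {h : T → T'}
    (H : F.IsHolonomy j j' γ a h) {e e' : OpenPartialHomeomorph V (FolModel n)}
    (he : e ∈ F.charts) (he' : e' ∈ F.charts) (h0 : j a ∈ e.source) (h1 : j' (h a) ∈ e'.source) :
    ∃ T₀ : ℝ → ℝ, ContDiffAt ℝ ∞ T₀ (e (j a)).2 ∧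
      ∀ᶠ x in 𝓝 a, (e' (j' (h x))).2 = T₀ (e (j x)).2 := by
  have hl := H.leafwise
  let c : C(I, V) := ⟨γ, hl.1.1⟩
  obtain ⟨T₀, hT₀, hT⟩ := CodimOneFoliation.exists_transport c hl.1 he he'
    (by change γ 0 ∈ _; rw [hl.2.1]; exact h0) (by change γ 1 ∈ _; rw [hl.2.2]; exact h1)
  refine ⟨T₀, ?_, ?_⟩
  · have : c 0 = j a := hl.2.1
    rwa [this] at hT₀
  · filter_upwards [H.eventually (fun _ => rfl) hT] with x ⟨Γ, h2, h3, h4, h5⟩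
    rw [← h4, ← h5]
    exact h2 h3

lemma IsHolonomy.contMDiffAt (hι : F.IsCompleteTransversal ι) {γ : I → V} {b : B} {h : B → B}
    (H : F.IsHolonomy ι ι γ b h) : ContMDiffAt 𝓘(ℝ, ℝ) 𝓘(ℝ, ℝ) ∞ h b := by
  obtain ⟨e, he, hb⟩ := F.cover (ι b)
  obtain ⟨e', he', hb'⟩ := F.cover (ι (h b))
  obtain ⟨T, hT, hTe⟩ := H.exists_transport he he' hb hb'
  obtain ⟨ρ, hρ, hρb, hρ1, -⟩ := exists_transversal_inverse hι he' hb'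
  have h1 : h =ᶠ[𝓝 b] fun x => ρ (T (e (ι x)).2) := by
    filter_upwards [H.continuousAt.eventually hρ1, hTe] with x h2 h3
    rw [← h3, h2]
  refine ContMDiffAt.congr_of_eventuallyEq ?_ h1
  have h4 : ContMDiffAt 𝓘(ℝ, ℝ) 𝓘(ℝ, ℝ) ∞ (fun x => T (e (ι x)).2) b :=
    ContMDiffAt.comp b hT.contMDiffAt (contMDiffAt_transversalCoord hι he hb)
  refine ContMDiffAt.comp b (f := fun x => T (e (ι x)).2) ?_ h4
  rw [← hTe.self_of_nhds]; exact hρ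

lemma IsHolonomy.exists_inverse (hι : F.IsCompleteTransversal ι) {γ : I → V} {b : B} {h : B → B}
    (H : F.IsHolonomy ι ι γ b h) : ∃ k γ', F.IsHolonomy ι ι γ' (h b) k ∧
      (∀ᶠ y in 𝓝 b, k (h y) = y) ∧ ∀ᶠ z in 𝓝 (h b), h (k z) = z := by
  obtain ⟨e, he, hb⟩ := F.cover (ι b)
  obtain ⟨e', he', hb'⟩ := F.cover (ι (h b))
  obtain ⟨T, hT, hTe⟩ := H.exists_transport he he' hb hb'
  obtain ⟨ρ, hρ, hρb, hρ1, hρ2⟩ := exists_transversal_inverse hι he hb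
  obtain ⟨ρ', hρ', hρb', hρ1', hρ2'⟩ := exists_transversal_inverse hι he' hb'
  have hl := H.leafwise
  let sy : C(I, I) := ⟨unitInterval.symm, unitInterval.continuous_symm⟩
  let c : C(I, V) := ⟨γ, hl.1.1⟩
  have hTb : T (e (ι b)).2 = (e' (ι (h b))).2 := hTe.self_of_nhds.symm
  obtain ⟨T', hT', hTe'⟩ : ∃ T' : ℝ → ℝ, ContDiffAt ℝ ∞ T' (e' (ι (h b))).2 ∧
      ∀ᶠ x in 𝓝 b, (e (ι x)).2 = T' (e' (ι (h x))).2 := by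
    have hc0 : (c.comp sy) 0 = ι (h b) := by
      change γ (unitInterval.symm 0) = _
      rw [unitInterval.symm_zero, hl.2.2]
    have hc1 : (c.comp sy) 1 = ι b := by
      change γ (unitInterval.symm 1) = _
      rw [unitInterval.symm_one, hl.2.1]
    obtain ⟨T', hT', hTe'⟩ := CodimOneFoliation.exists_transport (c.comp sy)
      (hl.1.comp unitInterval.continuous_symm) he' he (by rw [hc0]; exact hb')
      (by rw [hc1]; exact hb)
    refine ⟨T', by rwa [hc0] at hT', ?_⟩
    have h1 := (ContinuousMap.continuous_precomp (Z := V) sy).continuousAt (x := c) |>.eventually hTe'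
    filter_upwards [H.eventually (c := c) (fun _ => rfl) h1] with x ⟨Γ, h2, h3, h4, h5⟩
    have h6 := h2 (h3.comp unitInterval.continuous_symm)
    change (e (Γ (unitInterval.symm 1))).2 = T' (e' (Γ (unitInterval.symm 0))).2 at h6
    rwa [unitInterval.symm_one, unitInterval.symm_zero, h4, h5] at h6
  have hρt : Tendsto ρ (𝓝 (e (ι b)).2) (𝓝 b) := by
    have := hρ.continuousAt.tendsto
    rwa [hρb] at this
  have hTT : ∀ᶠ y in 𝓝 (e (ι b)).2, T' (T y) = y := by
    filter_upwards [hρt.eventually hTe', hρt.eventually hTe, hρ2] with y h1 h2 h3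
    rw [h3] at h1 h2
    rw [← h2, ← h1]
  have hTT' := eventually_right_inverse_of_left_inverse hT (by rw [hTb]; exact hT') hTT
  rw [hTb] at hTT'
  let k : B → B := fun z => ρ (T' (e' (ι z)).2)
  have hTb' : T' (e' (ι (h b))).2 = (e (ι b)).2 := hTe'.self_of_nhds.symm
  have hkh : ∀ᶠ y in 𝓝 b, k (h y) = y := by
    filter_upwards [hTe', hρ1] with y h1 h2
    simp only [k]
    rw [← h1, h2]
  have hs' := contMDiffAt_transversalCoord hι he' hb'
  have h4 : ContMDiffAt 𝓘(ℝ, ℝ) 𝓘(ℝ, ℝ) ∞ (fun z => T' (e' (ι z)).2) (h b) :=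
    ContMDiffAt.comp (h b) hT'.contMDiffAt hs'
  have hk : ContMDiffAt 𝓘(ℝ, ℝ) 𝓘(ℝ, ℝ) ∞ k (h b) :=
    ContMDiffAt.comp (h b) (f := fun z => T' (e' (ι z)).2) (by rw [hTb']; exact hρ) h4
  have hkb : k (h b) = b := hkh.self_of_nhds
  have hkt : Tendsto k (𝓝 (h b)) (𝓝 b) := by
    have := hk.continuousAt.tendsto
    rwa [hkb] at this
  have hT't : Tendsto (fun z => T' (e' (ι z)).2) (𝓝 (h b)) (𝓝 (e (ι b)).2) := by
    have := h4.continuousAt.tendsto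
    rwa [hTb'] at this
  have hhk : ∀ᶠ z in 𝓝 (h b), h (k z) = z := by
    have hhkt : Tendsto (fun z => h (k z)) (𝓝 (h b)) (𝓝 (h b)) := H.continuousAt.tendsto.comp hkt
    filter_upwards [hkt.eventually hTe, hT't.eventually hρ2, hs'.continuousAt.eventually hTT',
      hhkt.eventually hρ1', hρ1'] with z h1 h2 h3 h5 h6
    rw [h2, h3] at h1
    rw [← h5, h1, h6]
  refine ⟨k, γ ∘ unitInterval.symm, ?_, hkh, hhk⟩
  obtain ⟨U, hU, hc, Γ, hΓ, hlΓ, rfl⟩ := H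
  have hkc : ∀ᶠ z in 𝓝 (h b), ContinuousAt k z := by
    have hk1 : ContMDiffAt 𝓘(ℝ, ℝ) 𝓘(ℝ, ℝ) 1 k (h b) := hk.of_le (by simp)
    have := (contMDiffAt_iff_contMDiffAt_nhds (by simp)).1 hk1
    exact this.mono fun z hz => hz.continuousAt
  let W := {z | ContinuousAt k z ∧ k z ∈ U ∧ h (k z) = z}
  have hW : W ∈ 𝓝 (h b) := hkc.and ((hkt.eventually hU).and hhk)
  have hkW : ContinuousOn k W := fun z hz => hz.1.continuousWithinAt
  refine ⟨W, hW, hkW, fun z => Γ (k z) ∘ unitInterval.symm, ?_, fun z hz => ?_,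
    (by rw [hkb] : Γ (k (h b)) ∘ unitInterval.symm = Γ b ∘ unitInterval.symm)⟩
  · have : ContinuousOn (fun q : B × I => (k q.1, unitInterval.symm q.2)) (W ×ˢ univ) :=
      (hkW.comp continuousOn_fst fun q hq => hq.1).prodMk
        (unitInterval.continuous_symm.comp continuous_snd).continuousOn
    exact hΓ.comp this fun q hq => ⟨hq.1.2.1, mem_univ _⟩
  · have := hlΓ (k z) hz.2.1
    refine ⟨this.1.comp unitInterval.continuous_symm, ?_, ?_⟩
    · simp only [Function.comp, unitInterval.symm_zero, this.2.2, hz.2.2]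
    · simp only [Function.comp, unitInterval.symm_one, this.2.1]

lemma eventually_transverseCoord_flow (hφ : IsSmoothFlow 𝓘(ℝ, FolModel n) φ)
    (hcompat : F.Compatible φ) (hι : F.IsCompleteTransversal ι) (hψ : F.IsInducedFlow φ ι ψ)
    {e : OpenPartialHomeomorph V (FolModel n)} (he : e ∈ F.charts) {b : B} (hb : ι b ∈ e.source) :
    ∀ᶠ p : ℝ × B in 𝓝 (0, b), (e (φ p.1 (ι p.2))).2 = (e (ι (ψ p.1 p.2))).2 := by
  have hm : ∀ᶠ Γ : C(I, V) in 𝓝 (ContinuousMap.const I (ι b)), MapsTo Γ univ e.source :=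
    ContinuousMap.eventually_mapsTo isCompact_univ e.open_source (fun _ _ => hb)
  have hc0 : ∀ t, ContinuousMap.const I (ι b) t = canonicalPath φ ι ψ (0, b).1 (0, b).2 t := by
    intro t
    simp [canonicalPath, canonicalCurve, hφ.map_zero, hψ.isSmoothFlow.map_zero]
  filter_upwards [eventually_of_family (Γ := fun p : ℝ × B => canonicalPath φ ι ψ p.1 p.2)
    univ_mem (continuous_canonicalPath hφ hι hψ).continuousOn _ hc0 hm] with p ⟨Γ, h1, h2⟩
  have hΓ : (Γ : I → V) = canonicalPath φ ι ψ p.1 p.2 := funext h1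
  have hlw := isLeafwise_canonicalPath hφ hcompat hι hψ p.1 p.2
  rw [hΓ] at h2
  have := hlw.transverseCoord_eq he isPreconnected_univ h2 (mem_univ 0) (mem_univ 1)
  simpa [canonicalPath, canonicalCurve, hφ.map_zero, hψ.isSmoothFlow.map_zero] using this

lemma IsHolonomy.commute (hφ : IsSmoothFlow 𝓘(ℝ, FolModel n) φ)
    (hcompat : F.Compatible φ) (hι : F.IsCompleteTransversal ι) (hψ : F.IsInducedFlow φ ι ψ)
    {γ : I → V} {b : B} {h : B → B} (H : F.IsHolonomy ι ι γ b h) :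
    ∀ᶠ p : ℝ × B in 𝓝 (0, b), h (ψ p.1 p.2) = ψ p.1 (h p.2) := by
  obtain ⟨e, he, hb⟩ := F.cover (ι b)
  obtain ⟨e', he', hb'⟩ := F.cover (ι (h b))
  have hl := H.leafwise
  let c : C(I, V) := ⟨γ, hl.1.1⟩
  obtain ⟨T, hT, hTe⟩ := CodimOneFoliation.exists_transport c hl.1 he he'
    (by change γ 0 ∈ _; rw [hl.2.1]; exact hb) (by change γ 1 ∈ _; rw [hl.2.2]; exact hb')
  have hfl := hψ.isSmoothFlow
  have hψt : Tendsto (fun p : ℝ × B => ψ p.1 p.2) (𝓝 (0, b)) (𝓝 b) := by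
    have := hfl.continuous.tendsto ((0 : ℝ), b)
    simpa [hfl.map_zero] using this
  have hψt' : Tendsto (fun p : ℝ × B => ψ p.1 p.2) (𝓝 (0, h b)) (𝓝 (h b)) := by
    have := hfl.continuous.tendsto ((0 : ℝ), h b)
    simpa [hfl.map_zero] using this
  have hht : Tendsto (fun p : ℝ × B => (p.1, h p.2)) (𝓝 (0, b)) (𝓝 (0, h b)) := by
    rw [nhds_prod_eq, nhds_prod_eq]
    exact tendsto_id.prodMap H.continuousAt.tendsto
  have h1 : ∀ᶠ x in 𝓝 b, (e' (ι (h x))).2 = T (e (ι x)).2 := by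
    filter_upwards [H.eventually (c := c) (fun _ => rfl) hTe] with x ⟨Γ, h2, h3, h4, h5⟩
    rw [← h4, ← h5]; exact h2 h3
  have h2 : ∀ᶠ p : ℝ × B in 𝓝 (0, b), (e' (φ p.1 (ι (h p.2)))).2 = T (e (φ p.1 (ι p.2))).2 := by
    obtain ⟨U, hU, hc, Γ, hΓ, hlΓ, hγ⟩ := H
    have hUU : (univ ×ˢ U : Set (ℝ × B)) ∈ 𝓝 ((0 : ℝ), b) := prod_mem_nhds univ_mem hU
    have hcont : ContinuousOn (fun q : (ℝ × B) × I => φ q.1.1 (Γ q.1.2 q.2))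
        ((univ ×ˢ U : Set (ℝ × B)) ×ˢ univ) := by
      have hg : ContinuousOn (fun q : (ℝ × B) × I => Γ q.1.2 q.2)
          ((univ ×ˢ U : Set (ℝ × B)) ×ˢ univ) :=
        hΓ.comp (f := fun q : (ℝ × B) × I => (q.1.2, q.2)) (by fun_prop)
          (fun q hq => ⟨hq.1.2, mem_univ _⟩)
      exact hφ.continuous.comp_continuousOn
        ((by fun_prop : ContinuousOn (fun q : (ℝ × B) × I => q.1.1) _).prodMk hg)
    have hc0 : ∀ t, c t = φ ((0 : ℝ), b).1 (Γ ((0 : ℝ), b).2 t) := by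
      intro t
      simp only [hφ.map_zero, hγ]
      rfl
    filter_upwards [eventually_of_family (Γ := fun p : ℝ × B => fun t => φ p.1 (Γ p.2 t))
      hUU hcont c hc0 hTe, hUU] with p ⟨Γ', h3, h4⟩ hp
    have hΓ' : (Γ' : I → V) = fun t => φ p.1 (Γ p.2 t) := funext h3
    have hp' := hlΓ p.2 hp.2
    have h5 := h4 (by rw [hΓ']; exact hcompat p.1 _ hp'.1)
    rwa [h3, h3, hp'.2.1, hp'.2.2] at h5
  have h3 := eventually_transverseCoord_flow hφ hcompat hι hψ he hb
  have h4 := hht.eventually (eventually_transverseCoord_flow hφ hcompat hι hψ he' hb')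
  obtain ⟨ρ', -, -, hρ, -⟩ := exists_transversal_inverse hι he' hb'
  filter_upwards [h2, h3, h4, hψt.eventually h1, hψt.eventually (H.continuousAt.eventually hρ),
    hht.eventually (hψt'.eventually hρ)] with p a1 a2 a3 a4 a5 a6
  rw [← a5, ← a6, a4, ← a2, ← a1, a3]

lemma sect_mem_holonomyArrows {h : B → B} {x : B} :
    GermArrow.sect h x ∈ F.holonomyArrows ι ↔ ∃ γ, F.IsHolonomy ι ι γ x h := by
  constructor
  · rintro ⟨b, k, γ, H, heq⟩
    obtain ⟨rfl, hk⟩ := GermArrow.sect_eq_iff.1 heq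
    exact ⟨γ, H.congr hk⟩
  · rintro ⟨γ, H⟩
    exact ⟨x, h, γ, H, rfl⟩

theorem isFlowGroupoid_holonomyArrows (hφ : IsSmoothFlow 𝓘(ℝ, FolModel n) φ)
    (hcompat : F.Compatible φ) (hι : F.IsCompleteTransversal ι) (hψ : F.IsInducedFlow φ ι ψ) :
    IsFlowGroupoid (F.holonomyArrows ι) ψ where
  isSmoothFlow := hψ.isSmoothFlow
  exists_rep := by
    rintro a ⟨b, h, γ, -, rfl⟩
    exact ⟨h, rfl⟩
  eventually_mem := by
    intro h x hx
    obtain ⟨γ, H⟩ := sect_mem_holonomyArrows.1 hx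
    exact H.eventually_isHolonomy.mono fun y hy => sect_mem_holonomyArrows.2 hy
  contMDiffAt := by
    intro h x hx
    obtain ⟨γ, H⟩ := sect_mem_holonomyArrows.1 hx
    exact H.contMDiffAt hι
  unit_mem := fun x => sect_mem_holonomyArrows.2 ⟨fun _ => ι x, univ, univ_mem,
    continuousOn_id, fun y _ => ι y, (hι.smooth.continuous.comp continuous_fst).continuousOn,
    fun y _ => ⟨IsLeafwise.const _, rfl, rfl⟩, rfl⟩
  sect_comp_mem := by
    intro h k x hk hh
    obtain ⟨γ, H⟩ := sect_mem_holonomyArrows.1 hk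
    obtain ⟨γ', H'⟩ := sect_mem_holonomyArrows.1 hh
    exact sect_mem_holonomyArrows.2 ⟨_, H.trans H'⟩
  exists_inverse := by
    intro h x hx
    obtain ⟨γ, H⟩ := sect_mem_holonomyArrows.1 hx
    obtain ⟨k, γ', Hk, h1, h2⟩ := H.exists_inverse hι
    exact ⟨k, sect_mem_holonomyArrows.2 ⟨γ', Hk⟩, h1, h2⟩
  commute := by
    intro h x hx
    obtain ⟨γ, H⟩ := sect_mem_holonomyArrows.1 hx
    exact H.commute hφ hcompat hι hψ
  conj_mem := by
    intro h x hx u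
    obtain ⟨γ, H⟩ := sect_mem_holonomyArrows.1 hx
    exact sect_mem_holonomyArrows.2 (H.conj_flow hφ hcompat hι hψ u)

end CodimOneFoliation

section FlowDerivative

variable {B : Type*} [TopologicalSpace B] [ChartedSpace ℝ B] [IsManifold 𝓘(ℝ, ℝ) ∞ B]
  {ψ : ℝ → B → B}

/-- In dimension one, the derivative at a fixed point does not depend on the coordinate. -/
lemma hasDerivAt_conj_of_fixed {f : B → B} {b : B} {s : B → ℝ} {ρ : ℝ → B}
    (hf : MDifferentiableAt 𝓘(ℝ, ℝ) 𝓘(ℝ, ℝ) f b) (hfb : f b = b)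
    (hs : MDifferentiableAt 𝓘(ℝ, ℝ) 𝓘(ℝ, ℝ) s b)
    (hρ : MDifferentiableAt 𝓘(ℝ, ℝ) 𝓘(ℝ, ℝ) ρ (s b)) (hρb : ρ (s b) = b)
    (hsρ : ∀ᶠ y in 𝓝 (s b), s (ρ y) = y) :
    HasDerivAt (fun y => s (f (ρ y))) ((mfderiv 𝓘(ℝ, ℝ) 𝓘(ℝ, ℝ) f b : ℝ → ℝ) (1 : ℝ)) (s b) := by
  let S : ℝ →L[ℝ] ℝ := mfderiv 𝓘(ℝ, ℝ) 𝓘(ℝ, ℝ) s b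
  let R : ℝ →L[ℝ] ℝ := mfderiv 𝓘(ℝ, ℝ) 𝓘(ℝ, ℝ) ρ (s b)
  let D : ℝ →L[ℝ] ℝ := mfderiv 𝓘(ℝ, ℝ) 𝓘(ℝ, ℝ) f b
  have hSR : S (R 1) = 1 := by
    have h1 : (mfderiv 𝓘(ℝ, ℝ) 𝓘(ℝ, ℝ) (fun y => s (ρ y)) (s b) : ℝ → ℝ) (1 : ℝ) = S (R 1) :=
      mfderiv_comp_model hs hρ hρb 1
    have h2 : fderiv ℝ (fun y => s (ρ y)) (s b) 1 = 1 := by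
      have h3 : (fun y => s (ρ y)) =ᶠ[𝓝 (s b)] fun y => y := hsρ
      rw [h3.fderiv_eq]
      simp
    rw [← h1, mfderiv_eq_fderiv]
    exact h2
  have hfρ : MDifferentiableAt 𝓘(ℝ, ℝ) 𝓘(ℝ, ℝ) (fun y => f (ρ y)) (s b) :=
    MDifferentiableAt.comp (s b) (g := f) (f := ρ) (by rw [hρb]; exact hf) hρ
  have hfρb : f (ρ (s b)) = b := by rw [hρb, hfb]
  have hd : MDifferentiableAt 𝓘(ℝ, ℝ) 𝓘(ℝ, ℝ) (fun y => s (f (ρ y))) (s b) :=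
    MDifferentiableAt.comp (s b) (g := s) (f := fun y => f (ρ y)) (by rw [hfρb]; exact hs) hfρ
  have h4 : (mfderiv 𝓘(ℝ, ℝ) 𝓘(ℝ, ℝ) (fun y => s (f (ρ y))) (s b) : ℝ → ℝ) (1 : ℝ) =
      S (D (R 1)) :=
    (mfderiv_comp_model (f := fun y => f (ρ y)) hs hfρ hfρb 1).trans
      (congrArg S (mfderiv_comp_model hf hρ hρb 1))
  have h5 : S (D (R 1)) = D 1 := by
    have h6 : ∀ w : ℝ, D w = w * D 1 := fun w => by
      conv_lhs => rw [← mul_one w, ← smul_eq_mul, D.map_smul, smul_eq_mul]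
    rw [h6, mul_comm, ← smul_eq_mul, S.map_smul, hSR, smul_eq_mul, mul_one]
  have h7 := hd.differentiableAt.hasDerivAt
  rw [← fderiv_apply_one_eq_deriv, ← mfderiv_eq_fderiv] at h7
  exact (congrArg (fun d : ℝ => HasDerivAt (fun y => s (f (ρ y))) d (s b)) (h4.trans h5)).mp h7

/-- The derivative of the flow at a fixed point. -/
def flowDeriv (ψ : ℝ → B → B) (b : B) (t : ℝ) : ℝ :=
  (mfderiv 𝓘(ℝ, ℝ) 𝓘(ℝ, ℝ) (ψ t) b : ℝ → ℝ) (1 : ℝ)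

lemma mfderiv_flow_apply (b : B) (t w : ℝ) :
    (mfderiv 𝓘(ℝ, ℝ) 𝓘(ℝ, ℝ) (ψ t) b : ℝ → ℝ) w = flowDeriv ψ b t * w := by
  let D : ℝ →L[ℝ] ℝ := mfderiv 𝓘(ℝ, ℝ) 𝓘(ℝ, ℝ) (ψ t) b
  change D w = D 1 * w
  conv_lhs => rw [← mul_one w, ← smul_eq_mul, D.map_smul, smul_eq_mul]
  rw [mul_comm]

lemma contMDiffAt_of_mem_atlas {e : OpenPartialHomeomorph B ℝ}
    (he : e ∈ IsManifold.maximalAtlas 𝓘(ℝ, ℝ) ∞ B) {x : B} (hx : x ∈ e.source) :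
    ContMDiffAt 𝓘(ℝ, ℝ) 𝓘(ℝ, ℝ) ∞ e x :=
  (contMDiffOn_of_mem_maximalAtlas he).contMDiffAt (e.open_source.mem_nhds hx)

lemma contMDiffAt_symm_of_mem_atlas {e : OpenPartialHomeomorph B ℝ}
    (he : e ∈ IsManifold.maximalAtlas 𝓘(ℝ, ℝ) ∞ B) {y : ℝ} (hy : y ∈ e.target) :
    ContMDiffAt 𝓘(ℝ, ℝ) 𝓘(ℝ, ℝ) ∞ e.symm y :=
  (contMDiffOn_symm_of_mem_maximalAtlas he).contMDiffAt (e.open_target.mem_nhds hy)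

lemma IsSmoothFlow.contDiffAt_chart (hψ : IsSmoothFlow 𝓘(ℝ, ℝ) ψ) {e : OpenPartialHomeomorph B ℝ}
    (he : e ∈ IsManifold.maximalAtlas 𝓘(ℝ, ℝ) ∞ B) {t y : ℝ} (hy : y ∈ e.target)
    (ht : ψ t (e.symm y) ∈ e.source) :
    ContDiffAt ℝ ∞ (fun q : ℝ × ℝ => e (ψ q.1 (e.symm q.2))) (t, y) := by
  have h1 : ContMDiffAt 𝓘(ℝ, ℝ × ℝ) 𝓘(ℝ, ℝ) ∞ (fun q : ℝ × ℝ => e.symm q.2) (t, y) :=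
    ContMDiffAt.comp (t, y) (g := e.symm) (f := fun q : ℝ × ℝ => q.2)
      (contMDiffAt_symm_of_mem_atlas he hy) contDiff_snd.contMDiff.contMDiffAt
  have h1' : ContMDiffAt 𝓘(ℝ, ℝ × ℝ) 𝓘(ℝ, ℝ) ∞ (fun q : ℝ × ℝ => q.1) (t, y) :=
    contDiff_fst.contMDiff.contMDiffAt
  have h2 : ContMDiffAt 𝓘(ℝ, ℝ × ℝ) 𝓘(ℝ, ℝ) ∞ (fun q : ℝ × ℝ => ψ q.1 (e.symm q.2)) (t, y) :=
    ContMDiffAt.comp (t, y) (g := fun q : ℝ × B => ψ q.1 q.2)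
      (f := fun q : ℝ × ℝ => (q.1, e.symm q.2)) hψ.smooth.contMDiffAt (h1'.prodMk h1)
  exact (ContMDiffAt.comp (t, y) (g := e) (f := fun q : ℝ × ℝ => ψ q.1 (e.symm q.2))
    (contMDiffAt_of_mem_atlas he ht) h2).contDiffAt

lemma IsSmoothFlow.hasDerivAt_chart_of_fixed (hψ : IsSmoothFlow 𝓘(ℝ, ℝ) ψ) {b : B}
    (hb : b ∈ fixedPts ψ) {e : OpenPartialHomeomorph B ℝ}
    (he : e ∈ IsManifold.maximalAtlas 𝓘(ℝ, ℝ) ∞ B) (hbe : b ∈ e.source) (t : ℝ) :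
    HasDerivAt (fun y => e (ψ t (e.symm y))) (flowDeriv ψ b t) (e b) := by
  refine hasDerivAt_conj_of_fixed ((hψ.contMDiff_at_time t).mdifferentiableAt (by simp)) (hb t)
    ((contMDiffAt_of_mem_atlas he hbe).mdifferentiableAt (by simp))
    ((contMDiffAt_symm_of_mem_atlas he (e.map_source hbe)).mdifferentiableAt (by simp))
    (e.left_inv hbe) ?_
  filter_upwards [e.open_target.mem_nhds (e.map_source hbe)] with y hy
  exact e.right_inv hy

lemma flowDeriv_add (hψ : IsSmoothFlow 𝓘(ℝ, ℝ) ψ) {b : B} (hb : b ∈ fixedPts ψ) (s t : ℝ) :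
    flowDeriv ψ b (s + t) = flowDeriv ψ b s * flowDeriv ψ b t := by
  have h1 : ψ (s + t) = fun x => ψ s (ψ t x) := funext fun x => hψ.map_add s t x
  have h2 := mfderiv_comp_model (f := ψ t) (g := ψ s) (x := b) (y := b)
    ((hψ.contMDiff_at_time s).mdifferentiableAt (by simp))
    ((hψ.contMDiff_at_time t).mdifferentiableAt (by simp)) (hb t) (1 : ℝ)
  unfold flowDeriv
  rw [h1]
  exact h2.trans (mfderiv_flow_apply b s _)

lemma flowDeriv_zero (hψ : IsSmoothFlow 𝓘(ℝ, ℝ) ψ) (b : B) : flowDeriv ψ b 0 = 1 := by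
  have h1 : ψ 0 = id := funext fun x => hψ.map_zero x
  unfold flowDeriv
  rw [h1, mfderiv_id]
  rfl

lemma continuous_flowDeriv (hψ : IsSmoothFlow 𝓘(ℝ, ℝ) ψ) {b : B} (hb : b ∈ fixedPts ψ) :
    Continuous (flowDeriv ψ b) := by
  set e := chartAt ℝ b with he
  have hea : e ∈ IsManifold.maximalAtlas 𝓘(ℝ, ℝ) ∞ B := IsManifold.chart_mem_maximalAtlas b
  have hbe : b ∈ e.source := mem_chart_source ℝ b
  have hG : ∀ t, ContDiffAt ℝ ∞ (fun q : ℝ × ℝ => e (ψ q.1 (e.symm q.2))) (t, e b) := fun t =>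
    hψ.contDiffAt_chart hea (e.map_source hbe) (by rw [e.left_inv hbe, hb t]; exact hbe)
  have h1 : flowDeriv ψ b = fun t =>
      fderiv ℝ (fun q : ℝ × ℝ => e (ψ q.1 (e.symm q.2))) (t, e b) (0, 1) := by
    funext t
    have h2 : HasDerivAt (fun y : ℝ => (t, y)) ((0 : ℝ), (1 : ℝ)) (e b) :=
      (hasDerivAt_const _ _).prodMk (hasDerivAt_id _)
    have h3 := (((hG t).differentiableAt (by simp)).hasFDerivAt).comp_hasDerivAt (e b) h2
    exact (hψ.hasDerivAt_chart_of_fixed hb hea hbe t).unique h3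
  rw [h1]
  refine continuous_iff_continuousAt.2 fun t => ?_
  have h4 : ContinuousAt (fderiv ℝ (fun q : ℝ × ℝ => e (ψ q.1 (e.symm q.2)))) (t, e b) :=
    ((hG t).fderiv_right (m := 0) (by simp)).continuousAt
  have h5 : ContinuousAt (fun t : ℝ => (t, e b)) t := by fun_prop
  exact (ContinuousAt.comp (f := fun t : ℝ => (t, e b)) h4 h5).clm_apply continuousAt_const

lemma flowDeriv_pos (hψ : IsSmoothFlow 𝓘(ℝ, ℝ) ψ) {b : B} (hb : b ∈ fixedPts ψ) (t : ℝ) :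
    0 < flowDeriv ψ b t := by
  have h1 : flowDeriv ψ b t = flowDeriv ψ b (t / 2) * flowDeriv ψ b (t / 2) := by
    rw [← flowDeriv_add hψ hb, add_halves]
  have h2 : flowDeriv ψ b (t / 2) * flowDeriv ψ b (-(t / 2)) = 1 := by
    rw [← flowDeriv_add hψ hb, add_neg_cancel, flowDeriv_zero hψ]
  have h3 : flowDeriv ψ b (t / 2) ≠ 0 := left_ne_zero_of_mul_eq_one h2
  rw [h1]
  exact mul_self_pos.2 h3

lemma flowDeriv_eq_exp (hψ : IsSmoothFlow 𝓘(ℝ, ℝ) ψ) {b : B} (hb : b ∈ fixedPts ψ) (t : ℝ) :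
    flowDeriv ψ b t = Real.exp (flowExponent ψ b * t) := by
  let L : ℝ →+ ℝ :=
    { toFun := fun t => Real.log (flowDeriv ψ b t)
      map_zero' := by simp [flowDeriv_zero hψ]
      map_add' := fun s t => by
        rw [flowDeriv_add hψ hb, Real.log_mul (flowDeriv_pos hψ hb s).ne' (flowDeriv_pos hψ hb t).ne'] }
  have hL : Continuous L :=
    (continuous_flowDeriv hψ hb).log fun t => (flowDeriv_pos hψ hb t).ne'
  have h1 : L t = t * L 1 := by
    have := (L.toRealLinearMap hL).map_smul t 1
    simpa using this
  have h2 : L 1 = flowExponent ψ b := rfl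
  rw [← h2, mul_comm, ← h1]
  exact (Real.exp_log (flowDeriv_pos hψ hb t)).symm

end FlowDerivative

/-- The consequences of non-degeneracy on the transversal. -/
structure IsNonDegenerateFlowGroupoid {B : Type*} [TopologicalSpace B] [ChartedSpace ℝ B]
    (A : Set (GermArrow B)) (ψ : ℝ → B → B) : Prop extends IsFlowGroupoid A ψ where
  germ_eq_id : ∀ {h : B → B} {b}, b ∈ fixedPts ψ → GermArrow.sect h b ∈ A → h b = b →
    h =ᶠ[𝓝 b] id
  flowExponent_ne_zero : ∀ b ∈ fixedPts ψ, flowExponent ψ b ≠ 0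

namespace CodimOneFoliation

variable {n : ℕ} {V : Type*} [TopologicalSpace V] [ChartedSpace (FolModel n) V]
  {F : CodimOneFoliation n V} [IsManifold 𝓘(ℝ, FolModel n) ∞ V]
  {B : Type*} [TopologicalSpace B] [ChartedSpace ℝ B] [IsManifold 𝓘(ℝ, ℝ) ∞ B]
  {φ : ℝ → V → V} {ι : B → V} {ψ : ℝ → B → B}

/-- Holonomy between two transversals inside a foliated chart. -/
lemma isHolonomy_plaque {T T' : Type*} [TopologicalSpace T] [TopologicalSpace T']
    {e : OpenPartialHomeomorph V (FolModel n)} (he : e ∈ F.charts) {j : T → V} {j' : T' → V}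
    {h : T → T'} {a : T} (hj : ∀ᶠ x in 𝓝 a, ContinuousAt j x) (hh : ∀ᶠ x in 𝓝 a, ContinuousAt h x)
    (hj' : ∀ᶠ y in 𝓝 (h a), ContinuousAt j' y) (ha : j a ∈ e.source) (hja : j' (h a) = j a)
    (hq : ∀ᶠ x in 𝓝 a, (e (j x)).2 = (e (j' (h x))).2) :
    ∃ γ, F.IsHolonomy j j' γ a h := by
  have hca : ContinuousAt j a := hj.self_of_nhds
  have hha : ContinuousAt h a := hh.self_of_nhds
  have hcj : ContinuousAt (fun x => j' (h x)) a := ContinuousAt.comp hj'.self_of_nhds hha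
  obtain ⟨δ, hδ, hball⟩ := Metric.isOpen_iff.1 e.open_target (e (j a)) (e.map_source ha)
  have h1 : ∀ᶠ x in 𝓝 a, j x ∈ e.source := hca.eventually (e.open_source.mem_nhds ha)
  have h2 : ∀ᶠ x in 𝓝 a, j' (h x) ∈ e.source :=
    hcj.eventually (e.open_source.mem_nhds (by change j' (h a) ∈ _; rw [hja]; exact ha))
  have h3 : ∀ᶠ x in 𝓝 a, e (j x) ∈ Metric.ball (e (j a)) δ :=
    hca.eventually ((e.continuousAt ha).eventually (Metric.ball_mem_nhds _ hδ))
  have h4 : ∀ᶠ x in 𝓝 a, e (j' (h x)) ∈ Metric.ball (e (j a)) δ := by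
    refine hcj.eventually (p := fun w => e w ∈ Metric.ball (e (j a)) δ) ?_
    change ∀ᶠ w in 𝓝 (j' (h a)), e w ∈ Metric.ball (e (j a)) δ
    rw [hja]
    exact (e.continuousAt ha).eventually (Metric.ball_mem_nhds _ hδ)
  let U := {x | ContinuousAt j x ∧ ContinuousAt h x ∧ ContinuousAt j' (h x) ∧
    j x ∈ e.source ∧ j' (h x) ∈ e.source ∧ e (j x) ∈ Metric.ball (e (j a)) δ ∧
    e (j' (h x)) ∈ Metric.ball (e (j a)) δ ∧ (e (j x)).2 = (e (j' (h x))).2}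
  have hU : U ∈ 𝓝 a := hj.and (hh.and ((hha.eventually hj').and
    (h1.and (h2.and (h3.and (h4.and hq))))))
  let P : T → I → FolModel n := fun x r => (1 - (r : ℝ)) • e (j x) + (r : ℝ) • e (j' (h x))
  have hP : ∀ x ∈ U, ∀ r, P x r ∈ e.target := by
    intro x hx r
    apply hball
    exact convex_ball (e (j a)) δ hx.2.2.2.2.2.1 hx.2.2.2.2.2.2.1 (by linarith [r.2.2]) r.2.1
      (by ring)
  have hPc : ContinuousOn (fun q : T × I => P q.1 q.2) (U ×ˢ univ) := by
    have h5 : ContinuousOn (fun q : T × I => e (j q.1)) (U ×ˢ univ) := by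
      intro q hq
      have h8 : ContinuousAt (fun x => e (j x)) q.1 :=
        ContinuousAt.comp (g := e) (e.continuousAt hq.1.2.2.2.1) hq.1.1
      exact (ContinuousAt.comp (f := fun q : T × I => q.1) (x := q) h8
        continuousAt_fst).continuousWithinAt
    have h6 : ContinuousOn (fun q : T × I => e (j' (h q.1))) (U ×ˢ univ) := by
      intro q hq
      have h8 : ContinuousAt (fun x => e (j' (h x))) q.1 :=
        ContinuousAt.comp (g := e) (f := fun x => j' (h x)) (e.continuousAt hq.1.2.2.2.2.1)
          (ContinuousAt.comp (g := j') (f := h) hq.1.2.2.1 hq.1.2.1)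
      exact (ContinuousAt.comp (f := fun q : T × I => q.1) (x := q) h8
        continuousAt_fst).continuousWithinAt
    have h7 : ContinuousOn (fun q : T × I => (q.2 : ℝ)) (U ×ˢ univ) := by fun_prop
    exact ((continuousOn_const.sub h7).smul h5).add (h7.smul h6)
  have hΓc : ContinuousOn (fun q : T × I => e.symm (P q.1 q.2)) (U ×ˢ univ) :=
    e.continuousOn_symm.comp hPc fun q hq => hP q.1 hq.1 q.2
  refine ⟨fun r => e.symm (P a r), U, hU, fun x hx => hx.2.1.continuousWithinAt,
    fun x r => e.symm (P x r), hΓc, fun x hx => ⟨?_, ?_, ?_⟩, rfl⟩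
  · refine isLeafwise_of_chart he (y := (e (j x)).2) ?_ (fun r => e.map_target (hP x hx r)) ?_
    · exact hΓc.comp_continuous (f := fun r : I => (x, r)) (by fun_prop) fun r => ⟨hx, mem_univ _⟩
    · intro r
      rw [e.right_inv (hP x hx r)]
      simp only [P, Prod.snd_add, Prod.smul_snd, ← hx.2.2.2.2.2.2.2, smul_eq_mul]
      ring
  · simp [P, e.left_inv hx.2.2.2.1]
  · simp [P, e.left_inv hx.2.2.2.2.1]

lemma eventually_chartTransversal {e : OpenPartialHomeomorph V (FolModel n)} {v : V}
    (hv : v ∈ e.source) : (∀ᶠ y in 𝓝 (e v).2, ContinuousAt (chartTransversal e v) y) ∧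
      (∀ᶠ y in 𝓝 (e v).2, (e (chartTransversal e v y)).2 = y) ∧
      chartTransversal e v (e v).2 = v := by
  have h1 : ∀ᶠ y in 𝓝 (e v).2, ((e v).1, y) ∈ e.target := by
    have : ContinuousAt (fun y : ℝ => ((e v).1, y)) (e v).2 := by fun_prop
    exact this.eventually (e.open_target.mem_nhds (e.map_source hv))
  refine ⟨h1.mono fun y hy => ?_, h1.mono fun y hy => ?_, e.left_inv hv⟩
  · exact ContinuousAt.comp (g := e.symm) (f := fun y : ℝ => ((e v).1, y)) (e.continuousAt_symm hy)
      (by fun_prop)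
  · simp [chartTransversal, e.right_inv hy]

lemma leafPreserved_of_fixed (hφ : IsSmoothFlow 𝓘(ℝ, FolModel n) φ)
    (hcompat : F.Compatible φ) (hι : F.IsCompleteTransversal ι) (hψ : F.IsInducedFlow φ ι ψ)
    {b : B} (hb : b ∈ fixedPts ψ) : F.LeafPreserved φ (ι b) := by
  intro t
  have h := (isHolonomy_canonicalPath_symm hφ hcompat hι hψ t b).leafwise
  rw [hb (-t)] at h
  exact ⟨_, h⟩

lemma NonDegenerate.germ_eq_id (hnd : F.NonDegenerate φ) (hφ : IsSmoothFlow 𝓘(ℝ, FolModel n) φ)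
    (hcompat : F.Compatible φ) (hι : F.IsCompleteTransversal ι) (hψ : F.IsInducedFlow φ ι ψ)
    {b : B} (hb : b ∈ fixedPts ψ) {h : B → B} {γ : I → V} (H : F.IsHolonomy ι ι γ b h)
    (hhb : h b = b) : h =ᶠ[𝓝 b] id := by
  obtain ⟨e, he, hbe⟩ := F.cover (ι b)
  have hl := H.leafwise
  rw [hhb] at hl
  have H' := hnd.holonomy (ι b) (leafPreserved_of_fixed hφ hcompat hι hψ hb) e he hbe γ hl.1
    hl.2.1 hl.2.2
  let c : C(I, V) := ⟨γ, hl.1.1⟩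
  obtain ⟨T, hT, hTe⟩ := CodimOneFoliation.exists_transport c hl.1 he he
    (by change γ 0 ∈ _; rw [hl.2.1]; exact hbe) (by change γ 1 ∈ _; rw [hl.2.2]; exact hbe)
  have h1 : ∀ᶠ x in 𝓝 b, (e (ι (h x))).2 = T (e (ι x)).2 := by
    filter_upwards [H.eventually (c := c) (fun _ => rfl) hTe] with x ⟨Γ, h2, h3, h4, h5⟩
    rw [← h4, ← h5]; exact h2 h3
  have h2 : ∀ᶠ y in 𝓝 (e (ι b)).2, y = T y := by
    filter_upwards [H'.eventually (c := c) (fun _ => rfl) hTe,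
      (eventually_chartTransversal hbe).2.1] with y ⟨Γ, h2, h3, h4, h5⟩ h6
    have := h2 h3
    rwa [h4, h5, id, h6] at this
  obtain ⟨ρ, -, -, hρ, -⟩ := exists_transversal_inverse hι he hbe
  have hs := (contMDiffAt_transversalCoord hι he hbe).continuousAt
  have hht : Tendsto h (𝓝 b) (𝓝 b) := by
    have := H.continuousAt.tendsto
    rwa [hhb] at this
  filter_upwards [h1, hs.eventually h2, hht.eventually hρ, hρ] with x a1 a2 a3 a4
  rw [id, ← a3, a1, ← a2, a4]

lemma NonDegenerate.flowDeriv_ne_one (hnd : F.NonDegenerate φ)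
    (hφ : IsSmoothFlow 𝓘(ℝ, FolModel n) φ)
    (hcompat : F.Compatible φ) (hι : F.IsCompleteTransversal ι) (hψ : F.IsInducedFlow φ ι ψ)
    {b : B} (hb : b ∈ fixedPts ψ) : flowDeriv ψ b 1 ≠ 1 := by
  obtain ⟨e, he, hbe⟩ := F.cover (ι b)
  obtain ⟨hc1, hc2, hc3⟩ := eventually_chartTransversal hbe
  obtain ⟨ρ, hρ, hρb, hρ1, hρ2⟩ := exists_transversal_inverse hι he hbe
  have hρc : ∀ᶠ y in 𝓝 (e (ι b)).2, ContinuousAt ρ y := by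
    have hk1 : ContMDiffAt 𝓘(ℝ, ℝ) 𝓘(ℝ, ℝ) 1 ρ (e (ι b)).2 := hρ.of_le (by simp)
    exact ((contMDiffAt_iff_contMDiffAt_nhds (by simp)).1 hk1).mono fun z hz => hz.continuousAt
  have hs := contMDiffAt_transversalCoord hι he hbe
  have hsc : ∀ᶠ x in 𝓝 b, ContinuousAt (fun x => (e (ι x)).2) x := by
    filter_upwards [hι.smooth.continuous.continuousAt.eventually (e.open_source.mem_nhds hbe)]
      with x hx
    exact (contMDiffAt_transversalCoord hι he hx).continuousAt
  have hιc : ∀ x, ContinuousAt ι x := fun x => hι.smooth.continuous.continuousAt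
  obtain ⟨γ₁, H₁⟩ := isHolonomy_plaque (j := chartTransversal e (ι b)) (j' := ι) (h := ρ)
    (a := (e (ι b)).2) he hc1 hρc (Eventually.of_forall hιc) (by rw [hc3]; exact hbe)
    (by rw [hρb, hc3]) (by filter_upwards [hc2, hρ2] with y h1 h2; rw [h1, h2])
  obtain ⟨γ₃, H₃⟩ := isHolonomy_plaque (j := ι) (j' := chartTransversal e (ι b))
    (h := fun x => (e (ι x)).2) (a := b) he (Eventually.of_forall hιc) hsc hc1 hbe hc3
    (by filter_upwards [hs.continuousAt.eventually hc2] with x hx; rw [hx])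
  have H₂ := isHolonomy_canonicalPath hφ hcompat hι hψ 1 (ρ (e (ι b)).2)
  have hb1 : ψ 1 (ρ (e (ι b)).2) = b := by rw [hρb, hb 1]
  have H := ((H₁.map_flow hφ hcompat 1).trans H₂).trans (j'' := chartTransversal e (ι b))
    (h' := fun x => (e (ι x)).2) (γ' := γ₃) (by
      simp only [Function.comp]
      rw [hb1]; exact H₃)
  have hl := H.leafwise
  have hne := hnd.transverse (ι b) (leafPreserved_of_fixed hφ hcompat hι hψ hb) 1 one_ne_zero e he
    hbe _ _ (by rw [hl.2.1, hc3]) (by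
      rw [hl.2.2]
      simp only [Function.comp]
      rw [hb1, hc3]) H
  have hd := hasDerivAt_conj_of_fixed (f := ψ 1) (b := b) (s := fun x => (e (ι x)).2) (ρ := ρ)
    ((hψ.isSmoothFlow.contMDiff_at_time 1).mdifferentiableAt (by simp)) (hb 1)
    (hs.mdifferentiableAt (by simp)) (hρ.mdifferentiableAt (by simp)) hρb hρ2
  intro h1
  exact hne (hd.deriv.trans h1)

theorem NonDegenerate.isNonDegenerateFlowGroupoid (hnd : F.NonDegenerate φ)
    (hφ : IsSmoothFlow 𝓘(ℝ, FolModel n) φ)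
    (hcompat : F.Compatible φ) (hι : F.IsCompleteTransversal ι) (hψ : F.IsInducedFlow φ ι ψ) :
    IsNonDegenerateFlowGroupoid (F.holonomyArrows ι) ψ where
  toIsFlowGroupoid := isFlowGroupoid_holonomyArrows hφ hcompat hι hψ
  germ_eq_id := by
    intro h b hb hh hhb
    obtain ⟨γ, H⟩ := sect_mem_holonomyArrows.1 hh
    exact hnd.germ_eq_id hφ hcompat hι hψ hb H hhb
  flowExponent_ne_zero := by
    intro b hb h0
    apply hnd.flowDeriv_ne_one hφ hcompat hι hψ hb
    rw [flowDeriv_eq_exp hψ.isSmoothFlow hb, h0, zero_mul, Real.exp_zero]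

end CodimOneFoliation

namespace GermArrow

variable {B : Type*} [TopologicalSpace B]

@[simp] lemma src_sect (h : B → B) (x : B) : (sect h x).src = x := rfl

@[simp] lemma tgt_sect (h : B → B) (x : B) : (sect h x).tgt = h x := rfl

lemma sect_congr {h k : B → B} {x : B} (H : h =ᶠ[𝓝 x] k) : sect h x = sect k x :=
  sect_eq_iff.2 ⟨rfl, H⟩

lemma sect_rep (a : GermArrow B) : sect a.rep a.src = a := by
  cases a with
  | mk s g =>
    simp only [sect, rep]
    congr 1
    exact Quotient.out_eq g

lemma rep_sect (h : B → B) (x : B) : (sect h x).rep =ᶠ[𝓝 x] h :=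
  (sect_eq_iff.1 (sect_rep (sect h x))).2

lemma comp_sect {h k : B → B} {x : B} (hk : ContinuousAt k x) :
    (sect h (k x)).comp (sect k x) = sect (h ∘ k) x := by
  refine sect_congr ?_
  filter_upwards [rep_sect k x, hk.eventually (rep_sect h (k x))] with y h1 h2
  simp only [Function.comp]
  rw [h1, h2]

lemma comp_sect' {h k : B → B} {x y : B} (hk : ContinuousAt k x) (hy : k x = y) :
    (sect h y).comp (sect k x) = sect (h ∘ k) x := by
  subst hy; exact comp_sect hk

lemma flow_sect {ψ : ℝ → B → B} (u : ℝ) (hψ : Continuous (ψ (-u)))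
    (hu : ∀ x, ψ (-u) (ψ u x) = x) (h : B → B) (x : B) :
    (sect h x).flow ψ u = sect (fun y => ψ u (h (ψ (-u) y))) (ψ u x) := by
  refine sect_congr ?_
  have h1 : Tendsto (ψ (-u)) (𝓝 (ψ u x)) (𝓝 x) := by
    have := hψ.tendsto (ψ u x)
    rwa [hu] at this
  filter_upwards [h1.eventually (rep_sect h x)] with y hy
  rw [hy]

lemma continuous_sect (h : B → B) : Continuous (sect h) := by
  refine continuous_generateFrom_iff.2 ?_
  rintro S ⟨k, U, hU, rfl⟩
  have : sect h ⁻¹' (sect k '' U) = U ∩ {x | h =ᶠ[𝓝 x] k} := by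
    ext x
    constructor
    · rintro ⟨y, hy, hxy⟩
      obtain ⟨rfl, hk⟩ := sect_eq_iff.1 hxy
      exact ⟨hy, hk.symm⟩
    · rintro ⟨hx, hk⟩
      exact ⟨x, hx, sect_congr hk.symm⟩
  rw [this]
  exact hU.inter isOpen_setOfPred_eventually_nhds

lemma isOpen_image_sect (h : B → B) {U : Set B} (hU : IsOpen U) : IsOpen (sect h '' U) :=
  TopologicalSpace.isOpen_generateFrom_of_mem ⟨h, U, hU, rfl⟩

lemma nhds_sect (h : B → B) (x : B) : 𝓝 (sect h x) = map (sect h) (𝓝 x) := by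
  apply le_antisymm
  · intro S hS
    obtain ⟨U, hU, hUo, hxU⟩ := mem_nhds_iff.1 (mem_map.1 hS)
    exact mem_of_superset ((isOpen_image_sect h hUo).mem_nhds ⟨x, hxU, rfl⟩)
      (image_subset_iff.2 hU)
  · exact (continuous_sect h).continuousAt

lemma continuous_src : Continuous (src : GermArrow B → B) := by
  refine continuous_iff_continuousAt.2 fun a => ?_
  rw [← sect_rep a, ContinuousAt, nhds_sect, tendsto_map'_iff]
  exact tendsto_id

end GermArrow

namespace IsFlowGroupoid

variable {B : Type*} [TopologicalSpace B] [ChartedSpace ℝ B] {A : Set (GermArrow B)}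
  {ψ : ℝ → B → B} (G : IsFlowGroupoid A ψ)

include G

lemma continuousAt {h : B → B} {x : B} (hx : sect h x ∈ A) : ContinuousAt h x :=
  (G.contMDiffAt hx).continuousAt

lemma continuousAt_tgt {a : GermArrow B} (ha : a ∈ A) : ContinuousAt tgt a := by
  obtain ⟨h, hh⟩ := G.exists_rep a ha
  rw [hh] at ha ⊢
  rw [ContinuousAt, nhds_sect, tendsto_map'_iff]
  exact G.continuousAt ha

lemma isOpen : IsOpen A := by
  rw [isOpen_iff_mem_nhds]
  intro a ha
  obtain ⟨h, hh⟩ := G.exists_rep a ha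
  rw [hh] at ha ⊢
  rw [nhds_sect]
  exact G.eventually_mem ha

lemma flow_sect (u : ℝ) (h : B → B) (x : B) :
    (sect h x).flow ψ u = sect (fun y => ψ u (h (ψ (-u) y))) (ψ u x) :=
  GermArrow.flow_sect u (G.isSmoothFlow.contMDiff_at_time _).continuous
    (G.isSmoothFlow.neg_apply u) h x

lemma flow_mem {a : GermArrow B} (ha : a ∈ A) (u : ℝ) : a.flow ψ u ∈ A := by
  obtain ⟨h, hh⟩ := G.exists_rep a ha
  rw [hh] at ha ⊢
  rw [G.flow_sect]
  exact G.conj_mem ha u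

lemma src_flow (a : GermArrow B) (u : ℝ) : (a.flow ψ u).src = ψ u a.src := rfl

lemma tgt_flow (a : GermArrow B) (u : ℝ) : (a.flow ψ u).tgt = ψ u a.tgt := by
  conv_lhs => rw [← sect_rep a]
  rw [G.flow_sect, tgt_sect, G.isSmoothFlow.neg_apply]
  conv_rhs => rw [← sect_rep a]
  rfl

lemma flow_zero (a : GermArrow B) : a.flow ψ 0 = a := by
  rw [← sect_rep a, G.flow_sect, G.isSmoothFlow.map_zero]
  refine sect_congr (Eventually.of_forall fun y => ?_)
  simp [G.isSmoothFlow.map_zero]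

lemma flow_add (a : GermArrow B) (u v : ℝ) : a.flow ψ (u + v) = (a.flow ψ v).flow ψ u := by
  rw [← sect_rep a, G.flow_sect, G.flow_sect, G.flow_sect, G.isSmoothFlow.map_add]
  refine sect_congr (Eventually.of_forall fun y => ?_)
  simp only
  rw [G.isSmoothFlow.map_add, neg_add_rev, G.isSmoothFlow.map_add]

lemma flow_neg_flow (a : GermArrow B) (u : ℝ) : (a.flow ψ u).flow ψ (-u) = a := by
  rw [← G.flow_add, neg_add_cancel, G.flow_zero]

lemma flow_flow_neg (a : GermArrow B) (u : ℝ) : (a.flow ψ (-u)).flow ψ u = a := by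
  rw [← G.flow_add, add_neg_cancel, G.flow_zero]

lemma comp_mem {a b : GermArrow B} (ha : a ∈ A) (hb : b ∈ A) (hab : a.src = b.tgt) :
    a.comp b ∈ A := by
  obtain ⟨h, hh⟩ := G.exists_rep a ha
  obtain ⟨k, hk⟩ := G.exists_rep b hb
  rw [hk] at hab hb ⊢
  rw [hh, hab] at ha ⊢
  rw [tgt_sect] at ha ⊢
  rw [comp_sect (G.continuousAt hb)]
  exact G.sect_comp_mem hb ha

lemma src_comp (a b : GermArrow B) : (a.comp b).src = b.src := rfl

lemma tgt_comp {a b : GermArrow B} (hb : b ∈ A) (hab : a.src = b.tgt) :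
    (a.comp b).tgt = a.tgt := by
  obtain ⟨k, hk⟩ := G.exists_rep b hb
  rw [hk] at hab hb ⊢
  rw [← sect_rep a, hab, tgt_sect, comp_sect (G.continuousAt hb)]
  rfl

lemma comp_assoc {a b c : GermArrow B} (hb : b ∈ A) (hc : c ∈ A)
    (hab : a.src = b.tgt) (hbc : b.src = c.tgt) : (a.comp b).comp c = a.comp (b.comp c) := by
  obtain ⟨k, hk⟩ := G.exists_rep b hb
  obtain ⟨l, hl⟩ := G.exists_rep c hc
  rw [hl] at hbc hc ⊢
  rw [hk, hbc] at hb hab ⊢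
  rw [tgt_sect] at hb hab ⊢
  rw [← sect_rep a, hab, tgt_sect, comp_sect (G.continuousAt hb), comp_sect (G.continuousAt hc),
    comp_sect (G.continuousAt hc)]
  have : ContinuousAt (k ∘ l) c.src := ContinuousAt.comp (G.continuousAt hb) (G.continuousAt hc)
  exact (comp_sect (h := a.rep) this).symm

lemma unit_comp {a : GermArrow B} (ha : a ∈ A) : (unit a.tgt).comp a = a := by
  obtain ⟨k, hk⟩ := G.exists_rep a ha
  rw [hk] at ha ⊢
  exact comp_sect (G.continuousAt ha)

lemma comp_unit (a : GermArrow B) : a.comp (unit a.src) = a := by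
  conv_lhs => rw [← sect_rep a]
  exact (comp_sect (h := a.rep) (k := id) continuousAt_id).trans (sect_rep a)

lemma flow_comp {a b : GermArrow B} (hb : b ∈ A) (hab : a.src = b.tgt) (u : ℝ) :
    (a.comp b).flow ψ u = (a.flow ψ u).comp (b.flow ψ u) := by
  have hbf := G.flow_mem hb u
  obtain ⟨k, hk⟩ := G.exists_rep b hb
  rw [hk] at hab hb hbf ⊢
  rw [← sect_rep a, hab, tgt_sect, comp_sect (G.continuousAt hb), G.flow_sect, G.flow_sect]
  rw [G.flow_sect] at hbf ⊢
  have := comp_sect (h := fun y => ψ u (a.rep (ψ (-u) y))) (G.continuousAt hbf)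
  rw [G.isSmoothFlow.neg_apply] at this
  rw [this]
  refine sect_congr (Eventually.of_forall fun y => ?_)
  simp [G.isSmoothFlow.neg_apply]

lemma exists_inv {a : GermArrow B} (ha : a ∈ A) : ∃ b ∈ A, b.src = a.tgt ∧ b.tgt = a.src ∧
    b.comp a = unit a.src ∧ a.comp b = unit a.tgt := by
  obtain ⟨h, hh⟩ := G.exists_rep a ha
  rw [hh] at ha ⊢
  obtain ⟨k, hk, h1, h2⟩ := G.exists_inverse ha
  have hkh : k (h a.src) = a.src := h1.self_of_nhds
  refine ⟨sect k (h a.src), hk, rfl, hkh, ?_, ?_⟩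
  · rw [comp_sect (G.continuousAt ha)]
    exact sect_congr h1
  · rw [comp_sect' (G.continuousAt hk) hkh]
    exact sect_congr h2

end IsFlowGroupoid

/-- The inverse of an arrow of a groupoid of germs. -/
def GermArrow.inv {B : Type*} [TopologicalSpace B] (A : Set (GermArrow B)) (a : GermArrow B) :
    GermArrow B :=
  open Classical in
  if h : ∃ b ∈ A, b.src = a.tgt ∧ b.tgt = a.src ∧ b.comp a = unit a.src ∧ a.comp b = unit a.tgt
  then h.choose else a

namespace IsFlowGroupoid

variable {B : Type*} [TopologicalSpace B] [ChartedSpace ℝ B] {A : Set (GermArrow B)}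
  {ψ : ℝ → B → B} (G : IsFlowGroupoid A ψ)

include G

lemma inv_spec {a : GermArrow B} (ha : a ∈ A) : a.inv A ∈ A ∧ (a.inv A).src = a.tgt ∧
    (a.inv A).tgt = a.src ∧ (a.inv A).comp a = unit a.src ∧ a.comp (a.inv A) = unit a.tgt := by
  have h := G.exists_inv ha
  rw [GermArrow.inv, dif_pos h]
  exact h.choose_spec

lemma inv_mem {a : GermArrow B} (ha : a ∈ A) : a.inv A ∈ A := (G.inv_spec ha).1

lemma src_inv {a : GermArrow B} (ha : a ∈ A) : (a.inv A).src = a.tgt := (G.inv_spec ha).2.1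

lemma tgt_inv {a : GermArrow B} (ha : a ∈ A) : (a.inv A).tgt = a.src := (G.inv_spec ha).2.2.1

lemma inv_comp {a : GermArrow B} (ha : a ∈ A) : (a.inv A).comp a = unit a.src :=
  (G.inv_spec ha).2.2.2.1

lemma comp_inv {a : GermArrow B} (ha : a ∈ A) : a.comp (a.inv A) = unit a.tgt :=
  (G.inv_spec ha).2.2.2.2

lemma inv_comp_cancel {a b : GermArrow B} (ha : a ∈ A) (hb : b ∈ A) (hab : a.src = b.tgt) :
    (a.inv A).comp (a.comp b) = b := by
  rw [← G.comp_assoc ha hb (G.src_inv ha) hab, G.inv_comp ha, hab, G.unit_comp hb]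

lemma comp_inv_cancel {a b : GermArrow B} (ha : a ∈ A) (hb : b ∈ A) (hab : a.tgt = b.tgt) :
    a.comp ((a.inv A).comp b) = b := by
  rw [← G.comp_assoc (G.inv_mem ha) hb (G.tgt_inv ha).symm ((G.src_inv ha).trans hab),
    G.comp_inv ha, hab, G.unit_comp hb]

lemma inv_eq_of_comp {a b : GermArrow B} (ha : a ∈ A) (hb : b ∈ A) (hab : a.src = b.tgt)
    (h : a.comp b = unit b.src) : a.inv A = b := by
  rw [← G.inv_comp_cancel ha hb hab, h]
  have : b.src = (a.inv A).src := by
    rw [G.src_inv ha, ← G.tgt_comp hb hab, h]; rfl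
  rw [this, G.comp_unit]

lemma inv_inv {a : GermArrow B} (ha : a ∈ A) : (a.inv A).inv A = a := by
  apply G.inv_eq_of_comp (G.inv_mem ha) ha (G.src_inv ha) (G.inv_comp ha)

lemma flow_unit (x : B) (u : ℝ) : (unit x).flow ψ u = unit (ψ u x) := by
  unfold GermArrow.unit
  rw [G.flow_sect]
  refine sect_congr (Eventually.of_forall fun y => ?_)
  simp [G.isSmoothFlow.apply_neg]

lemma flow_inv {a : GermArrow B} (ha : a ∈ A) (u : ℝ) :
    (a.inv A).flow ψ u = (a.flow ψ u).inv A := by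
  symm
  apply G.inv_eq_of_comp (G.flow_mem ha u) (G.flow_mem (G.inv_mem ha) u)
  · rw [G.tgt_flow, G.tgt_inv ha]; rfl
  · rw [← G.flow_comp (G.inv_mem ha) (G.tgt_inv ha).symm, G.comp_inv ha, G.flow_unit,
      G.src_flow, G.src_inv ha]

/-- Arrows with a given range of a compact set are finitely many. -/
lemma finite_fiber {L : Set (GermArrow B)} (hL : IsCompact L) (hLA : L ⊆ A) (b : B) :
    {a ∈ L | a.tgt = b}.Finite := by
  refine hL.induction_on (p := fun S => {a ∈ S | a.tgt = b}.Finite) (by simp) ?_ ?_ ?_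
  · exact fun S T hST hT => hT.subset fun a ha => ⟨hST ha.1, ha.2⟩
  · intro S T hS hT
    refine (hS.union hT).subset ?_
    rintro a ⟨ha | ha, hb⟩
    · exact Or.inl ⟨ha, hb⟩
    · exact Or.inr ⟨ha, hb⟩
  · intro a ha
    have haA := hLA ha
    obtain ⟨h, hh⟩ := G.exists_rep a haA
    rw [hh] at haA ⊢
    obtain ⟨k, -, hk, -⟩ := G.exists_inverse haA
    refine ⟨sect h '' {y | k (h y) = y}, mem_nhdsWithin_of_mem_nhds ?_, ?_⟩
    · rw [nhds_sect]
      exact image_mem_map hk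
    · refine (finite_singleton (sect h (k b))).subset ?_
      rintro c ⟨⟨y, hy, rfl⟩, hb⟩
      rw [tgt_sect] at hb
      rw [mem_singleton_iff, ← hb, hy]

/-- The flow moves sections locally along the flow of the base. -/
lemma eventually_flow_sect {h : B → B} {x : B} (hx : sect h x ∈ A) (u₀ : ℝ) :
    ∀ᶠ p : ℝ × B in 𝓝 (u₀, x), (sect h p.2).flow ψ p.1 =
      sect (fun y => ψ u₀ (h (ψ (-u₀) y))) (ψ p.1 p.2) := by
  have hψ := G.isSmoothFlow
  have hψ0 : Tendsto (fun p : ℝ × B => ψ (-p.1) p.2) (𝓝 (0, x)) (𝓝 x) := by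
    have : Continuous fun p : ℝ × B => ψ (-p.1) p.2 :=
      hψ.continuous_comp (by fun_prop) (by fun_prop)
    have := this.tendsto ((0 : ℝ), x)
    simpa [hψ.map_zero] using this
  have h1 : ∀ᶠ p : ℝ × B in 𝓝 (0, x), ψ p.1 (h (ψ (-p.1) p.2)) = h p.2 := by
    have hneg : Tendsto (fun p : ℝ × B => (-p.1, p.2)) (𝓝 (0, x)) (𝓝 (0, x)) := by
      have : Continuous fun p : ℝ × B => (-p.1, p.2) := by fun_prop
      simpa using this.tendsto ((0 : ℝ), x)
    filter_upwards [hneg.eventually (G.commute hx)] with p hp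
    rw [hp, hψ.apply_neg]
  have hlim : Tendsto (fun p : ℝ × B => (p.1 - u₀, ψ (-u₀) (ψ p.1 p.2))) (𝓝 (u₀, x))
      (𝓝 (0, x)) := by
    have : Continuous fun p : ℝ × B => (p.1 - u₀, ψ (-u₀) (ψ p.1 p.2)) :=
      (by fun_prop : Continuous fun p : ℝ × B => p.1 - u₀).prodMk
        (hψ.continuous_comp continuous_const hψ.continuous)
    have := this.tendsto (u₀, x)
    simpa [hψ.neg_apply] using this
  filter_upwards [hlim.eventually (eventually_eventually_nhds.2 h1)] with p hp
  rw [G.flow_sect]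
  refine sect_congr ?_
  have h2 : Tendsto (fun y => (p.1 - u₀, ψ (-u₀) y)) (𝓝 (ψ p.1 p.2))
      (𝓝 (p.1 - u₀, ψ (-u₀) (ψ p.1 p.2))) := by
    have : Continuous fun y => (p.1 - u₀, ψ (-u₀) y) :=
      continuous_const.prodMk (hψ.contMDiff_at_time _).continuous
    exact this.tendsto _
  filter_upwards [h2.eventually hp] with y hy
  rw [← hy, ← hψ.map_add, ← hψ.map_add]
  congr 3
  · ring
  · ring

lemma continuousAt_flow {a : GermArrow B} (ha : a ∈ A) (u : ℝ) :
    ContinuousAt (fun p : ℝ × GermArrow B => p.2.flow ψ p.1) (u, a) := by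
  obtain ⟨h, hh⟩ := G.exists_rep a ha
  rw [hh] at ha ⊢
  have hcont : ContinuousAt (fun p : ℝ × B => (sect h p.2).flow ψ p.1) (u, a.src) := by
    refine ContinuousAt.congr ?_ (EventuallyEq.symm (G.eventually_flow_sect ha u))
    exact ((continuous_sect _).comp G.isSmoothFlow.continuous).continuousAt
  rw [ContinuousAt, nhds_prod_eq, nhds_sect]
  have h1 : 𝓝 u ×ˢ map (sect h) (𝓝 a.src) =
      map (fun p : ℝ × B => (p.1, sect h p.2)) (𝓝 (u, a.src)) := by
    rw [nhds_prod_eq]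
    exact (Filter.prod_map_map_eq (m₁ := id)).trans rfl
  rw [h1, tendsto_map'_iff]
  exact hcont

lemma continuousOn_comp : ContinuousOn (fun p : GermArrow B × GermArrow B => p.1.comp p.2)
    {p | p.1 ∈ A ∧ p.2 ∈ A ∧ p.1.src = p.2.tgt} := by
  rintro ⟨a, b⟩ ⟨ha, hb, hab⟩
  obtain ⟨h, hh⟩ := G.exists_rep a ha
  obtain ⟨k, hk⟩ := G.exists_rep b hb
  simp only at ha hb hab hh hk
  rw [hk] at hab hb ⊢
  rw [hh, hab] at ha ⊢
  rw [tgt_sect] at ha ⊢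
  have hkc : ∀ᶠ y in 𝓝 b.src, ContinuousAt k y :=
    (G.eventually_mem hb).mono fun y hy => G.continuousAt hy
  have h1 : ∀ᶠ p in 𝓝[{p | p.1 ∈ A ∧ p.2 ∈ A ∧ p.1.src = p.2.tgt}]
      (sect h (k b.src), sect k b.src), p.1.comp p.2 = sect (h ∘ k) p.2.src := by
    have e1 : ∀ᶠ p : GermArrow B × GermArrow B in 𝓝 (sect h (k b.src), sect k b.src),
        p.1 ∈ range (sect h) := by
      refine continuousAt_fst.eventually ?_
      change ∀ᶠ q in 𝓝 (sect h (k b.src)), q ∈ range (sect h)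
      rw [nhds_sect]
      exact range_mem_map
    have e2 : ∀ᶠ p : GermArrow B × GermArrow B in 𝓝 (sect h (k b.src), sect k b.src),
        p.2 ∈ sect k '' {y | ContinuousAt k y} := by
      refine continuousAt_snd.eventually ?_
      change ∀ᶠ q in 𝓝 (sect k b.src), q ∈ sect k '' {y | ContinuousAt k y}
      rw [nhds_sect]
      exact image_mem_map hkc
    filter_upwards [mem_nhdsWithin_of_mem_nhds e1, mem_nhdsWithin_of_mem_nhds e2,
      self_mem_nhdsWithin] with p h1 h2 h3
    obtain ⟨y, hy⟩ := h1
    obtain ⟨z, hz, hz'⟩ := h2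
    rw [← hy, ← hz']
    refine comp_sect' hz ?_
    have := h3.2.2
    rw [← hy, ← hz'] at this
    exact this.symm
  refine ContinuousWithinAt.congr_of_eventuallyEq
    (f := fun p : GermArrow B × GermArrow B => sect (h ∘ k) p.2.src) ?_ h1 ?_
  · exact ((continuous_sect _).comp (continuous_src.comp continuous_snd)).continuousWithinAt
  · exact comp_sect (G.continuousAt hb)

end IsFlowGroupoid

/-- Smooth dependence of an integral on a parameter in a manifold. -/
lemma contMDiffOn_integral {E H M : Type*} [NormedAddCommGroup E] [NormedSpace ℝ E]
    [TopologicalSpace H] [TopologicalSpace M] [ChartedSpace H M] {J : ModelWithCorners ℝ E H}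
    [J.Boundaryless] [IsManifold J ∞ M] {N : Set M} (hN : IsOpen N) {Φ : M → ℝ → ℂ} {c d : ℝ}
    (hΦ : ContMDiffOn (J.prod 𝓘(ℝ, ℝ)) 𝓘(ℝ, ℂ) ∞ (fun q : M × ℝ => Φ q.1 q.2) (N ×ˢ univ))
    (hsupp : ∀ x ∈ N, ∀ u, u ∉ Icc c d → Φ x u = 0) :
    ContMDiffOn J 𝓘(ℝ, ℂ) ∞ (fun x => ∫ u, Φ x u) N := by
  intro x hx
  refine ContMDiffAt.contMDiffWithinAt ?_
  set e := extChartAt J x with he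
  let s : Set E := e.target ∩ e.symm ⁻¹' N
  have hs : IsOpen s := (continuousOn_extChartAt_symm x).isOpen_inter_preimage
    (isOpen_extChartAt_target x) hN
  have h1 : ContMDiffOn 𝓘(ℝ, E × ℝ) (J.prod 𝓘(ℝ, ℝ)) ∞
      (fun q : E × ℝ => (e.symm q.1, q.2)) (s ×ˢ univ) := by
    refine ContMDiffOn.prodMk ?_ (contDiff_snd.contMDiff.contMDiffOn)
    exact ContMDiffOn.comp (t := e.target) (contMDiffOn_extChartAt_symm x)
      contDiff_fst.contMDiff.contMDiffOn (fun q hq => hq.1.1)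
  have h2 : ContDiffOn ℝ ∞ (fun q : E × ℝ => Φ (e.symm q.1) q.2) (s ×ˢ univ) := by
    rw [← contMDiffOn_iff_contDiffOn]
    exact ContMDiffOn.comp (g := fun q : M × ℝ => Φ q.1 q.2) hΦ h1
      fun q hq => ⟨hq.1.2, mem_univ _⟩
  have h3 := contDiffOn_convolution_right_with_param (n := ⊤) (μ := volume)
    (f := fun _ : ℝ => (1 : ℝ)) (ContinuousLinearMap.lsmul ℝ ℝ : ℝ →L[ℝ] ℂ →L[ℝ] ℂ)
    (g := fun (y : E) (u : ℝ) => Φ (e.symm y) u) (s := s) (k := Icc c d) hs isCompact_Icc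
    (fun y u hy hu => hsupp _ hy.2 u hu) (locallyIntegrable_const _) h2
  have h4 : ContDiffOn ℝ ∞ (fun y : E => ∫ u, Φ (e.symm y) u) s := by
    have h5 : ContDiffOn ℝ ∞ (fun y : E => (y, (0 : ℝ))) s := by fun_prop
    refine (h3.comp h5 fun y hy => ⟨hy, mem_univ _⟩).congr fun y hy => ?_
    simp only [Function.comp, convolution, ContinuousLinearMap.lsmul_apply, one_smul, zero_sub]
    exact (integral_neg_eq_self (fun u => Φ (e.symm y) u) volume).symm
  have hxs : e x ∈ s := ⟨mem_extChartAt_target x, by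
    rw [mem_preimage, extChartAt_to_inv]; exact hx⟩
  have h6 : ContMDiffAt J 𝓘(ℝ, ℂ) ∞ (fun z => ∫ u, Φ (e.symm (e z)) u) x :=
    ContMDiffAt.comp x (g := fun y : E => ∫ u, Φ (e.symm y) u) (f := e)
      ((h4.contDiffAt (hs.mem_nhds hxs)).contMDiffAt) (contMDiffAt_extChartAt)
  refine h6.congr_of_eventuallyEq ?_
  filter_upwards [(extChartAt_source_mem_nhds x : e.source ∈ 𝓝 x)] with z hz
  rw [e.left_inv hz]

section Support

variable {B : Type*} [TopologicalSpace B] [ChartedSpace ℝ B] {A : Set (GermArrow B)}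
  {f g : GermArrow B → ℝ → ℂ}

lemma posConv_eq_zero (hf : f ∈ posConvAlgebra A) {a : GermArrow B} (ha : a ∉ A) : f a = 0 := by
  obtain ⟨⟨K, -, hKA, h0⟩, -⟩ := hf
  funext t
  exact h0 a t fun h => ha (hKA h).1

lemma posConv_exists_bounds (hf : f ∈ posConvAlgebra A) : ∃ c d : ℝ, 0 < c ∧
    ∀ a t, t ∉ Icc c d → f a t = 0 := by
  obtain ⟨⟨K, hK, hKA, h0⟩, -⟩ := hf
  have hS : IsCompact (Prod.snd '' K) := hK.image continuous_snd
  rcases (Prod.snd '' K).eq_empty_or_nonempty with he | hne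
  · refine ⟨1, 1, one_pos, fun a t _ => h0 a t fun h => ?_⟩
    have : t ∈ Prod.snd '' K := ⟨_, h, rfl⟩
    rw [he] at this; exact this
  · obtain ⟨c, hc⟩ := hS.exists_isLeast hne
    obtain ⟨d, hd⟩ := hS.exists_isGreatest hne
    refine ⟨c, d, ?_, fun a t ht => h0 a t fun h => ht ⟨hc.2 ⟨_, h, rfl⟩, hd.2 ⟨_, h, rfl⟩⟩⟩
    obtain ⟨p, hp, hpc⟩ := hc.1
    rw [← hpc]
    exact (hKA hp).2

lemma posConv_exists_compact (hf : f ∈ posConvAlgebra A) : ∃ L, IsCompact L ∧ L ⊆ A ∧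
    ∀ a ∉ L, f a = 0 := by
  obtain ⟨⟨K, hK, hKA, h0⟩, -⟩ := hf
  refine ⟨Prod.fst '' K, hK.image continuous_fst, ?_, fun a ha => ?_⟩
  · rintro _ ⟨p, hp, rfl⟩
    exact (hKA hp).1
  · funext t
    exact h0 a t fun h => ha ⟨_, h, rfl⟩

end Support

namespace IsFlowGroupoid

variable {B : Type*} [TopologicalSpace B] [ChartedSpace ℝ B] [IsManifold 𝓘(ℝ, ℝ) ∞ B]
  {A : Set (GermArrow B)}
  {ψ : ℝ → B → B} (G : IsFlowGroupoid A ψ) {f g : GermArrow B → ℝ → ℂ}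

section smoothness

variable {E H M : Type*} [NormedAddCommGroup E] [NormedSpace ℝ E]
    [TopologicalSpace H] [TopologicalSpace M] [ChartedSpace H M] {J : ModelWithCorners ℝ E H}

include G

lemma posConv_contMDiffAt (hf : f ∈ posConvAlgebra A) {h : B → B} {X : M → B} {S : M → ℝ} {m : M}
    (hh : sect h (X m) ∈ A) (hX : ContMDiffAt J 𝓘(ℝ, ℝ) ∞ X m)
    (hS : ContMDiffAt J 𝓘(ℝ, ℝ) ∞ S m) :
    ContMDiffAt J 𝓘(ℝ, ℂ) ∞ (fun z => f (sect h (X z)) (S z)) m := by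
  obtain ⟨U, hU, hUo, hx⟩ := mem_nhds_iff.1 (G.eventually_mem hh)
  have h1 := (hf.2 h U hUo hU).contMDiffAt (x := (X m, S m))
    ((hUo.prod isOpen_univ).mem_nhds ⟨hx, mem_univ _⟩)
  exact ContMDiffAt.comp m (g := fun q : B × ℝ => f (sect h q.1) q.2)
    (f := fun z => (X z, S z)) h1 (hX.prodMk hS)

lemma posConv_flow_contMDiffAt (hf : f ∈ posConvAlgebra A) {h : B → B} {X : M → B} {U S : M → ℝ}
    {m : M} (hh : sect h (X m) ∈ A) (hX : ContMDiffAt J 𝓘(ℝ, ℝ) ∞ X m)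
    (hU : ContMDiffAt J 𝓘(ℝ, ℝ) ∞ U m) (hS : ContMDiffAt J 𝓘(ℝ, ℝ) ∞ S m) :
    ContMDiffAt J 𝓘(ℝ, ℂ) ∞ (fun z => f ((sect h (X z)).flow ψ (U z)) (S z)) m := by
  have h1 : ContMDiffAt J 𝓘(ℝ, ℝ) ∞ (fun z => ψ (U z) (X z)) m :=
    ContMDiffAt.comp m (g := fun q : ℝ × B => ψ q.1 q.2) (f := fun z => (U z, X z))
      G.isSmoothFlow.smooth.contMDiffAt (hU.prodMk hX)
  have h2 := G.posConv_contMDiffAt hf (X := fun z => ψ (U z) (X z)) (G.conj_mem hh (U m)) h1 hS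
  refine h2.congr_of_eventuallyEq ?_
  have h3 : Tendsto (fun z => (U z, X z)) (𝓝 m) (𝓝 (U m, X m)) :=
    hU.continuousAt.prodMk hX.continuousAt
  filter_upwards [h3.eventually (G.eventually_flow_sect hh (U m))] with z hz
  rw [hz]

end smoothness

include G

lemma posConv_continuousAt (hf : f ∈ posConvAlgebra A) {a : GermArrow B} (ha : a ∈ A) (t : ℝ) :
    ContinuousAt (fun p : GermArrow B × ℝ => f p.1 p.2) (a, t) := by
  obtain ⟨h, hh⟩ := G.exists_rep a ha
  rw [hh] at ha ⊢
  have h0 : ContMDiffAt (𝓘(ℝ, ℝ).prod 𝓘(ℝ, ℝ)) 𝓘(ℝ, ℂ) ∞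
      (fun p : B × ℝ => f (sect h p.1) p.2) (a.src, t) :=
    G.posConv_contMDiffAt hf (m := (a.src, t)) (X := Prod.fst) (S := Prod.snd) ha
      contMDiffAt_fst contMDiffAt_snd
  have hcont := h0.continuousAt
  rw [ContinuousAt, nhds_prod_eq, nhds_sect]
  have h1 : map (sect h) (𝓝 a.src) ×ˢ 𝓝 t =
      map (fun p : B × ℝ => (sect h p.1, p.2)) (𝓝 (a.src, t)) := by
    rw [nhds_prod_eq]
    exact (Filter.prod_map_map_eq (m₂ := id)).trans rfl
  rw [h1, tendsto_map'_iff]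
  exact hcont

lemma posConv_continuous (hf : f ∈ posConvAlgebra A) (a : GermArrow B) : Continuous (f a) := by
  by_cases ha : a ∈ A
  · refine continuous_iff_continuousAt.2 fun t => ?_
    exact ContinuousAt.comp (f := fun t : ℝ => (a, t)) (G.posConv_continuousAt hf ha t)
      (by fun_prop)
  · rw [posConv_eq_zero hf ha]; exact continuous_const

lemma posConv_flow_continuous (hf : f ∈ posConvAlgebra A) {a : GermArrow B} (ha : a ∈ A)
    {X : Type*} [TopologicalSpace X] {U S : X → ℝ} (hU : Continuous U) (hS : Continuous S) :
    Continuous fun x => f (a.flow ψ (U x)) (S x) := by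
  refine continuous_iff_continuousAt.2 fun x => ?_
  have h1 : ContinuousAt (fun x => a.flow ψ (U x)) x :=
    ContinuousAt.comp (g := fun p : ℝ × GermArrow B => p.2.flow ψ p.1) (f := fun x => (U x, a))
      (G.continuousAt_flow ha _) (hU.continuousAt.prodMk continuousAt_const)
  exact ContinuousAt.comp (g := fun p : GermArrow B × ℝ => f p.1 p.2)
    (f := fun x => (a.flow ψ (U x), S x)) (G.posConv_continuousAt hf (G.flow_mem ha _) _)
    (h1.prodMk hS.continuousAt)

lemma posConv_bounded (hf : f ∈ posConvAlgebra A) : ∃ C : ℝ, ∀ a t, ‖f a t‖ ≤ C := by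
  obtain ⟨⟨K, hK, hKA, h0⟩, -⟩ := id hf
  obtain ⟨C, hC⟩ : ∃ C : ℝ, ∀ p ∈ K, ‖f p.1 p.2‖ ≤ C := by
    refine hK.induction_on (p := fun S => ∃ C : ℝ, ∀ p ∈ S, ‖f p.1 p.2‖ ≤ C) ⟨0, by simp⟩
      (fun S T hST ⟨C, hC⟩ => ⟨C, fun p hp => hC p (hST hp)⟩) ?_ ?_
    · rintro S T ⟨C, hC⟩ ⟨D, hD⟩
      refine ⟨max C D, ?_⟩
      rintro p (hp | hp)
      · exact (hC p hp).trans (le_max_left _ _)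
      · exact (hD p hp).trans (le_max_right _ _)
    · rintro ⟨a, t⟩ hp
      have h1 := (G.posConv_continuousAt hf (hKA hp).1 t).norm
      have h2 := h1.eventually (gt_mem_nhds (lt_add_one _))
      exact ⟨_, mem_nhdsWithin_of_mem_nhds h2, ‖f a t‖ + 1, fun p hp => le_of_lt hp⟩
  refine ⟨max C 0, fun a t => ?_⟩
  by_cases h : (a, t) ∈ K
  · exact (hC _ h).trans (le_max_left _ _)
  · rw [h0 a t h, norm_zero]; exact le_max_right _ _

lemma posConv_finite_fiber (hf : f ∈ posConvAlgebra A) (b : B) :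
    {a | a.tgt = b ∧ f a ≠ 0}.Finite := by
  obtain ⟨L, hL, hLA, h0⟩ := posConv_exists_compact hf
  refine (G.finite_fiber hL hLA b).subset ?_
  rintro a ⟨hb, ha⟩
  exact ⟨by_contra fun h => ha (h0 a h), hb⟩

end IsFlowGroupoid

/-- The integral of `f Ξ` over the arrows with range `b` of the crossed product groupoid. -/
def fiberIntegral {B : Type*} [TopologicalSpace B] (A : Set (GermArrow B))
    (f Ξ : GermArrow B → ℝ → ℂ) (b : B) : ℂ :=
  ∑ᶠ (γ : GermArrow B) (_ : γ ∈ A ∧ γ.tgt = b), ∫ t : ℝ, f γ t * Ξ γ t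

section FiberIntegral

variable {B : Type*} [TopologicalSpace B] {A : Set (GermArrow B)} {f Ξ : GermArrow B → ℝ → ℂ}

lemma fiberIntegral_eq_sum {b : B} (S : Finset (GermArrow B))
    (h1 : ∀ γ ∈ S, γ ∈ A ∧ γ.tgt = b) (h2 : ∀ γ ∈ A, γ.tgt = b → f γ ≠ 0 → γ ∈ S) :
    fiberIntegral A f Ξ b = ∑ γ ∈ S, ∫ t : ℝ, f γ t * Ξ γ t := by
  refine finsum_mem_eq_sum_of_inter_support_eq (s := {γ | γ ∈ A ∧ γ.tgt = b}) _ ?_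
  ext γ
  constructor
  · rintro ⟨⟨hγ, hb⟩, hs⟩
    refine ⟨h2 γ hγ hb fun h0 => hs ?_, hs⟩
    simp [h0]
  · rintro ⟨hγ, hs⟩
    exact ⟨h1 γ hγ, hs⟩

lemma fiberIntegral_congr {f' Ξ' : GermArrow B → ℝ → ℂ} {b : B}
    (h : ∀ γ ∈ A, γ.tgt = b → ∀ t, f γ t * Ξ γ t = f' γ t * Ξ' γ t) :
    fiberIntegral A f Ξ b = fiberIntegral A f' Ξ' b := by
  refine finsum_mem_congr rfl fun γ hγ => ?_
  exact integral_congr_ae (Eventually.of_forall (h γ hγ.1 hγ.2))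

end FiberIntegral

namespace IsFlowGroupoid

variable {B : Type*} [TopologicalSpace B] [ChartedSpace ℝ B] [IsManifold 𝓘(ℝ, ℝ) ∞ B]
  {A : Set (GermArrow B)}
  {ψ : ℝ → B → B} (G : IsFlowGroupoid A ψ) {f g : GermArrow B → ℝ → ℂ}

include G

lemma convolution_eq {γ : GermArrow B} (hγ : γ ∈ A) (t : ℝ) :
    groupoidConvolution A ψ f g γ t =
      fiberIntegral A f (fun γ₁ u => g (((γ₁.inv A).comp γ).flow ψ u) (t - u)) γ.tgt := by
  refine finsum_mem_eq_of_bijOn (s := {q : GermArrow B × GermArrow B | q.1 ∈ A ∧ q.2 ∈ A ∧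
    q.1.src = q.2.tgt ∧ q.1.comp q.2 = γ}) (t := {γ₁ | γ₁ ∈ A ∧ γ₁.tgt = γ.tgt}) Prod.fst
    ⟨?_, ?_, ?_⟩ ?_
  · rintro ⟨a, b⟩ ⟨ha, hb, hab, h⟩
    refine ⟨ha, ?_⟩
    rw [← h, G.tgt_comp hb hab]
  · rintro ⟨a, b⟩ ⟨ha, hb, hab, h⟩ ⟨a', b'⟩ ⟨ha', hb', hab', h'⟩ heq
    simp only at *
    subst heq
    rw [Prod.mk.injEq]
    refine ⟨rfl, ?_⟩
    rw [← G.inv_comp_cancel ha hb hab, h, ← h', G.inv_comp_cancel ha hb' hab']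
  · rintro a ⟨ha, hat⟩
    have h1 : (a.inv A).src = γ.tgt := (G.src_inv ha).trans hat
    refine ⟨(a, (a.inv A).comp γ), ⟨ha, G.comp_mem (G.inv_mem ha) hγ h1, ?_,
      G.comp_inv_cancel ha hγ hat⟩, rfl⟩
    rw [G.tgt_comp hγ h1, G.tgt_inv ha]
  · rintro ⟨a, b⟩ ⟨ha, hb, hab, h⟩
    simp only at *
    rw [← h, G.inv_comp_cancel ha hb hab]

lemma convolution_eq_zero {γ : GermArrow B} (hγ : γ ∉ A) : groupoidConvolution A ψ f g γ = 0 := by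
  funext t
  refine (finsum_congr fun q => ?_).trans finsum_zero
  have : IsEmpty (q.1 ∈ A ∧ q.2 ∈ A ∧ q.1.src = q.2.tgt ∧ q.1.comp q.2 = γ) :=
    ⟨fun ⟨ha, hb, hab, h⟩ => hγ (h ▸ G.comp_mem ha hb hab)⟩
  exact finsum_of_isEmpty _

lemma exists_ne_zero_of_convolution_ne_zero {γ : GermArrow B} {t : ℝ}
    (h : groupoidConvolution A ψ f g γ t ≠ 0) : ∃ γ₁ ∈ A, ∃ u, γ₁.tgt = γ.tgt ∧ f γ₁ u ≠ 0 ∧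
      g (((γ₁.inv A).comp γ).flow ψ u) (t - u) ≠ 0 := by
  have hγ : γ ∈ A := by
    by_contra hγ
    exact h (by rw [G.convolution_eq_zero hγ]; rfl)
  by_contra hcon
  push Not at hcon
  apply h
  rw [G.convolution_eq hγ]
  refine (finsum_congr fun γ₁ => (finsum_congr fun hγ₁ => ?_).trans finsum_zero).trans finsum_zero
  refine (integral_congr_ae (Eventually.of_forall fun u => ?_)).trans (integral_zero _ _)
  by_cases h0 : f γ₁ u = 0
  · simp [h0]
  · simp [hcon γ₁ hγ₁.1 u hγ₁.2 h0]

/-- The arrows through which a convolution product is supported, over a point. -/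
lemma finite_convolution_fiber (hf : f ∈ posConvAlgebra A) (hg : g ∈ posConvAlgebra A) (b : B) :
    {γ ∈ A | γ.tgt = b ∧ ∃ γ₁ ∈ A, ∃ u, γ₁.tgt = b ∧ f γ₁ u ≠ 0 ∧
      g (((γ₁.inv A).comp γ).flow ψ u) ≠ 0}.Finite := by
  obtain ⟨c, d, -, hcd⟩ := posConv_exists_bounds hf
  obtain ⟨L, hL, hLA, h0⟩ := posConv_exists_compact hg
  let L' : Set (GermArrow B) := (fun p : ℝ × GermArrow B => p.2.flow ψ (-p.1)) '' (Icc c d ×ˢ L)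
  have hL' : IsCompact L' := by
    refine (isCompact_Icc.prod hL).image_of_continuousOn fun p hp => ?_
    exact (ContinuousAt.comp (g := fun p : ℝ × GermArrow B => p.2.flow ψ p.1)
      (f := fun p : ℝ × GermArrow B => (-p.1, p.2)) (G.continuousAt_flow (hLA hp.2) _)
      (by fun_prop)).continuousWithinAt
  have hL'A : L' ⊆ A := by
    rintro _ ⟨p, hp, rfl⟩
    exact G.flow_mem (hLA hp.2) _
  have hfin : (⋃ γ₁ ∈ {a | a.tgt = b ∧ f a ≠ 0},
      (fun δ => γ₁.comp δ) '' {δ ∈ L' | δ.tgt = γ₁.src}).Finite :=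
    (G.posConv_finite_fiber hf b).biUnion fun γ₁ _ => (G.finite_fiber hL' hL'A _).image _
  refine hfin.subset ?_
  rintro γ ⟨hγ, hb, γ₁, hγ₁, u, hγ₁b, hfu, hgu⟩
  have h1 : (γ₁.inv A).src = γ.tgt := (G.src_inv hγ₁).trans (hγ₁b.trans hb.symm)
  refine mem_biUnion (x := γ₁) ⟨hγ₁b, fun h => hfu (by rw [h]; rfl)⟩
    ⟨(γ₁.inv A).comp γ, ⟨⟨(u, ((γ₁.inv A).comp γ).flow ψ u), ⟨?_, ?_⟩, G.flow_neg_flow _ u⟩, ?_⟩,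
      G.comp_inv_cancel hγ₁ hγ (hγ₁b.trans hb.symm)⟩
  · by_contra h; exact hfu (hcd _ _ h)
  · by_contra h; exact hgu (h0 _ h)
  · rw [G.tgt_comp hγ h1, G.tgt_inv hγ₁]

/-- Integration against a convolution product is iterated integration. -/
lemma fiberIntegral_convolution (hf : f ∈ posConvAlgebra A) (hg : g ∈ posConvAlgebra A) {b : B}
    {Ξ : GermArrow B → ℝ → ℂ} (hΞ : ∀ γ ∈ A, γ.tgt = b → Continuous (Ξ γ)) :
    fiberIntegral A (groupoidConvolution A ψ f g) Ξ b =
      fiberIntegral A f (fun γ₁ u => fiberIntegral A g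
        (fun δ v => Ξ (γ₁.comp (δ.flow ψ (-u))) (u + v)) (ψ u γ₁.src)) b := by
  classical
  obtain ⟨c, d, -, hcd⟩ := posConv_exists_bounds hf
  obtain ⟨c', d', -, hcd'⟩ := posConv_exists_bounds hg
  let S := (G.posConv_finite_fiber hf b).toFinset
  have hfA : ∀ γ, f γ ≠ 0 → γ ∈ A := fun γ h => by_contra fun h' => h (posConv_eq_zero hf h')
  have hS1 : ∀ γ ∈ S, γ ∈ A ∧ γ.tgt = b := by
    intro γ hγ
    have := (G.posConv_finite_fiber hf b).mem_toFinset.1 hγ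
    exact ⟨hfA γ this.2, this.1⟩
  have hS2 : ∀ γ ∈ A, γ.tgt = b → f γ ≠ 0 → γ ∈ S := fun γ _ hb h =>
    (G.posConv_finite_fiber hf b).mem_toFinset.2 ⟨hb, h⟩
  let Z := (G.finite_convolution_fiber hf hg b).toFinset
  have hZ : ∀ γ, γ ∈ Z ↔ γ ∈ A ∧ γ.tgt = b ∧ ∃ γ₁ ∈ A, ∃ u, γ₁.tgt = b ∧ f γ₁ u ≠ 0 ∧
      g (((γ₁.inv A).comp γ).flow ψ u) ≠ 0 := fun γ =>
    (G.finite_convolution_fiber hf hg b).mem_toFinset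
  have hZ1 : ∀ γ ∈ Z, γ ∈ A ∧ γ.tgt = b := fun γ hγ => ⟨((hZ γ).1 hγ).1, ((hZ γ).1 hγ).2.1⟩
  have hsrc : ∀ γ₁ ∈ S, ∀ ζ ∈ Z, (γ₁.inv A).src = ζ.tgt := fun γ₁ h1 ζ h2 =>
    (G.src_inv (hS1 γ₁ h1).1).trans ((hS1 γ₁ h1).2.trans (hZ1 ζ h2).2.symm)
  have hmem : ∀ γ₁ ∈ S, ∀ ζ ∈ Z, (γ₁.inv A).comp ζ ∈ A := fun γ₁ h1 ζ h2 =>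
    G.comp_mem (G.inv_mem (hS1 γ₁ h1).1) (hZ1 ζ h2).1 (hsrc γ₁ h1 ζ h2)
  let Φ : GermArrow B → GermArrow B → ℝ → ℝ → ℂ := fun γ₁ ζ w u =>
    f γ₁ u * g (((γ₁.inv A).comp ζ).flow ψ u) (w - u) * Ξ ζ w
  have hΦc : ∀ γ₁ ∈ S, ∀ ζ ∈ Z, Continuous (Function.uncurry (Φ γ₁ ζ)) := by
    intro γ₁ h1 ζ h2
    have e1 : Continuous fun p : ℝ × ℝ => f γ₁ p.2 := (G.posConv_continuous hf γ₁).comp continuous_snd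
    have e2 : Continuous fun p : ℝ × ℝ => g (((γ₁.inv A).comp ζ).flow ψ p.2) (p.1 - p.2) :=
      G.posConv_flow_continuous hg (hmem γ₁ h1 ζ h2) continuous_snd (by fun_prop)
    have e3 : Continuous fun p : ℝ × ℝ => Ξ ζ p.1 :=
      (hΞ ζ (hZ1 ζ h2).1 (hZ1 ζ h2).2).comp continuous_fst
    exact (e1.mul e2).mul e3
  have hΦs : ∀ γ₁ ζ, HasCompactSupport (Function.uncurry (Φ γ₁ ζ)) := by
    intro γ₁ ζ
    refine HasCompactSupport.intro (K := Icc (c + c') (d + d') ×ˢ Icc c d)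
      (isCompact_Icc.prod isCompact_Icc) ?_
    rintro ⟨w, u⟩ hwu
    simp only [Function.uncurry, Φ]
    by_cases hu : u ∈ Icc c d
    · have hw : w - u ∉ Icc c' d' := fun hw => hwu ⟨⟨by linarith [hw.1, hu.1], by linarith [hw.2, hu.2]⟩, hu⟩
      rw [hcd' _ _ hw]; simp
    · rw [hcd _ _ hu]; simp
  have hΦi : ∀ γ₁ ∈ S, ∀ ζ ∈ Z, Integrable (Function.uncurry (Φ γ₁ ζ)) (volume.prod volume) :=
    fun γ₁ h1 ζ h2 => (hΦc γ₁ h1 ζ h2).integrable_of_hasCompactSupport (hΦs γ₁ ζ)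
  have hleft : fiberIntegral A (groupoidConvolution A ψ f g) Ξ b =
      ∑ ζ ∈ Z, ∑ γ₁ ∈ S, ∫ w, ∫ u, Φ γ₁ ζ w u := by
    rw [fiberIntegral_eq_sum Z hZ1]
    · refine Finset.sum_congr rfl fun ζ hζ => ?_
      rw [← integral_finsetSum]
      · refine integral_congr_ae (Eventually.of_forall fun w => ?_)
        simp only
        rw [G.convolution_eq (hZ1 ζ hζ).1, (hZ1 ζ hζ).2, fiberIntegral_eq_sum S hS1 hS2,
          Finset.sum_mul]
        refine Finset.sum_congr rfl fun γ₁ _ => ?_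
        rw [← integral_mul_const]
      · intro γ₁ hγ₁
        exact (hΦi γ₁ hγ₁ ζ hζ).integral_prod_left
    · intro γ hγ hb h0
      obtain ⟨t, ht⟩ := Function.ne_iff.1 h0
      obtain ⟨γ₁, hγ₁, u, h1, h2, h3⟩ := G.exists_ne_zero_of_convolution_ne_zero ht
      exact (hZ γ).2 ⟨hγ, hb, γ₁, hγ₁, u, h1.trans hb, h2, fun h => h3 (by rw [h]; rfl)⟩
  have hright : ∀ γ₁ ∈ S, ∀ u, f γ₁ u * fiberIntegral A g
        (fun δ v => Ξ (γ₁.comp (δ.flow ψ (-u))) (u + v)) (ψ u γ₁.src) =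
      ∑ ζ ∈ Z, ∫ w, Φ γ₁ ζ w u := by
    intro γ₁ hγ₁ u
    by_cases hfu : f γ₁ u = 0
    · simp [Φ, hfu]
    have hinj : Set.InjOn (fun ζ => ((γ₁.inv A).comp ζ).flow ψ u) Z := by
      intro ζ h1 ζ' h2 heq
      have h3 := congrArg (fun a => γ₁.comp (a.flow ψ (-u))) heq
      simp only [G.flow_neg_flow] at h3
      rwa [G.comp_inv_cancel (hS1 γ₁ hγ₁).1 (hZ1 ζ h1).1
        ((hS1 γ₁ hγ₁).2.trans (hZ1 ζ h1).2.symm), G.comp_inv_cancel (hS1 γ₁ hγ₁).1 (hZ1 ζ' h2).1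
        ((hS1 γ₁ hγ₁).2.trans (hZ1 ζ' h2).2.symm)] at h3
    rw [fiberIntegral_eq_sum (Z.image fun ζ => ((γ₁.inv A).comp ζ).flow ψ u),
      Finset.sum_image hinj, Finset.mul_sum]
    · refine Finset.sum_congr rfl fun ζ hζ => ?_
      rw [← integral_const_mul]
      rw [← integral_sub_right_eq_self (fun v => f γ₁ u * _) u]
      refine integral_congr_ae (Eventually.of_forall fun w => ?_)
      simp only [Φ]
      rw [G.flow_neg_flow, G.comp_inv_cancel (hS1 γ₁ hγ₁).1 (hZ1 ζ hζ).1
        ((hS1 γ₁ hγ₁).2.trans (hZ1 ζ hζ).2.symm), add_sub_cancel, mul_assoc]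
    · intro δ hδ
      obtain ⟨ζ, hζ, rfl⟩ := Finset.mem_image.1 hδ
      refine ⟨G.flow_mem (hmem γ₁ hγ₁ ζ hζ) u, ?_⟩
      rw [G.tgt_flow, G.tgt_comp (hZ1 ζ hζ).1 (hsrc γ₁ hγ₁ ζ hζ), G.tgt_inv (hS1 γ₁ hγ₁).1]
    · intro δ hδ hδb h0
      have hδ' := G.flow_mem hδ (-u)
      have htgt : (δ.flow ψ (-u)).tgt = γ₁.src := by
        rw [G.tgt_flow, hδb, G.isSmoothFlow.neg_apply]
      have hγ₁A := (hS1 γ₁ hγ₁).1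
      have hcancel : (γ₁.inv A).comp (γ₁.comp (δ.flow ψ (-u))) = δ.flow ψ (-u) :=
        G.inv_comp_cancel hγ₁A hδ' htgt.symm
      refine Finset.mem_image.2 ⟨γ₁.comp (δ.flow ψ (-u)), (hZ _).2 ⟨?_, ?_, γ₁, hγ₁A, u,
        (hS1 γ₁ hγ₁).2, hfu, ?_⟩, ?_⟩
      · exact G.comp_mem hγ₁A hδ' htgt.symm
      · rw [G.tgt_comp hδ' htgt.symm, (hS1 γ₁ hγ₁).2]
      · rw [hcancel, G.flow_flow_neg]; exact h0
      · rw [hcancel, G.flow_flow_neg]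
  rw [hleft, fiberIntegral_eq_sum S hS1 hS2, Finset.sum_comm]
  refine Finset.sum_congr rfl fun γ₁ hγ₁ => ?_
  rw [integral_congr_ae (Eventually.of_forall (hright γ₁ hγ₁)), integral_finsetSum]
  · refine Finset.sum_congr rfl fun ζ hζ => ?_
    exact integral_integral_swap (hΦi γ₁ hγ₁ ζ hζ)
  · intro ζ hζ
    exact (hΦi γ₁ hγ₁ ζ hζ).integral_prod_right

end IsFlowGroupoid

lemma contMDiffAt_integral {E H M : Type*} [NormedAddCommGroup E] [NormedSpace ℝ E]
    [TopologicalSpace H] [TopologicalSpace M] [ChartedSpace H M] {J : ModelWithCorners ℝ E H}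
    [J.Boundaryless] [IsManifold J ∞ M] {Φ : M → ℝ → ℂ} {c d : ℝ} {m : M}
    (hΦ : ∀ᶠ x in 𝓝 m, ∀ u, ContMDiffAt (J.prod 𝓘(ℝ, ℝ)) 𝓘(ℝ, ℂ) ∞
      (fun q : M × ℝ => Φ q.1 q.2) (x, u))
    (hsupp : ∀ x, ∀ u, u ∉ Icc c d → Φ x u = 0) :
    ContMDiffAt J 𝓘(ℝ, ℂ) ∞ (fun x => ∫ u, Φ x u) m := by
  obtain ⟨N, hN, hNo, hm⟩ := mem_nhds_iff.1 hΦ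
  refine (contMDiffOn_integral (c := c) (d := d) hNo ?_ fun x _ => hsupp x).contMDiffAt
    (hNo.mem_nhds hm)
  rintro ⟨x, u⟩ hx
  exact (hN hx.1 u).contMDiffWithinAt

lemma ContMDiffAt.mul_complex {E H M : Type*} [NormedAddCommGroup E] [NormedSpace ℝ E]
    [TopologicalSpace H] [TopologicalSpace M] [ChartedSpace H M] {J : ModelWithCorners ℝ E H}
    {p q : M → ℂ} {m : M} (hp : ContMDiffAt J 𝓘(ℝ, ℂ) ∞ p m) (hq : ContMDiffAt J 𝓘(ℝ, ℂ) ∞ q m) :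
    ContMDiffAt J 𝓘(ℝ, ℂ) ∞ (fun x => p x * q x) m :=
  ContMDiffAt.comp m (g := fun z : ℂ × ℂ => z.1 * z.2) (f := fun x => (p x, q x))
    (contDiff_fst.mul contDiff_snd : ContDiff ℝ ∞ fun z : ℂ × ℂ => z.1 * z.2).contMDiff.contMDiffAt
    (hp.prodMk_space hq)

/-- The points of a compact set where two continuous maps agree. -/
lemma IsCompact.setOf_eq_of_continuousOn {X Y : Type*} [TopologicalSpace X] [TopologicalSpace Y]
    [T2Space Y] {K : Set X} (hK : IsCompact K) {p q : X → Y} (hp : ContinuousOn p K)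
    (hq : ContinuousOn q K) : IsCompact {x ∈ K | p x = q x} := by
  have := isCompact_iff_compactSpace.1 hK
  have h1 : IsClosed {x : K | p x = q x} :=
    isClosed_eq (continuousOn_iff_continuous_domRestrict.1 hp)
      (continuousOn_iff_continuous_domRestrict.1 hq)
  have h2 := h1.isCompact.image continuous_subtype_val
  convert h2 using 1
  ext x
  constructor
  · rintro ⟨hx, h⟩
    exact ⟨⟨x, hx⟩, h, rfl⟩
  · rintro ⟨y, hy, rfl⟩
    exact ⟨y.2, hy⟩

/-- The local section of the range map through an arrow. -/
def GermArrow.tgtSect {B : Type*} [TopologicalSpace B] (A : Set (GermArrow B)) (γ : GermArrow B)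
    (b : B) : GermArrow B :=
  sect γ.rep ((γ.inv A).rep b)

namespace IsFlowGroupoid

variable {B : Type*} [TopologicalSpace B] [ChartedSpace ℝ B] [IsManifold 𝓘(ℝ, ℝ) ∞ B]
  {A : Set (GermArrow B)}
  {ψ : ℝ → B → B} (G : IsFlowGroupoid A ψ) {f g : GermArrow B → ℝ → ℂ}

include G

lemma inv_comp_rev {a b : GermArrow B} (ha : a ∈ A) (hb : b ∈ A) (hab : a.src = b.tgt) :
    (a.comp b).inv A = (b.inv A).comp (a.inv A) := by
  have hia := G.inv_mem ha
  have hib := G.inv_mem hb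
  have h1 : (b.inv A).src = (a.inv A).tgt := by rw [G.src_inv hb, G.tgt_inv ha, hab]
  have h2 : b.src = ((b.inv A).comp (a.inv A)).tgt := by
    rw [G.tgt_comp hia h1, G.tgt_inv hb]
  have h3 := G.comp_mem hib hia h1
  refine G.inv_eq_of_comp (G.comp_mem ha hb hab) h3 h2 ?_
  rw [G.comp_assoc hb h3 hab h2, G.comp_inv_cancel hb hia (by rw [G.tgt_inv ha, hab]),
    G.comp_inv ha, G.src_comp, G.src_inv ha]

lemma sect_rep_inv_mem {γ : GermArrow B} (hγ : γ ∈ A) : sect (γ.inv A).rep γ.tgt ∈ A := by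
  rw [← G.src_inv hγ, sect_rep]; exact G.inv_mem hγ

lemma rep_inv_tgt {γ : GermArrow B} (hγ : γ ∈ A) : (γ.inv A).rep γ.tgt = γ.src := by
  have h := G.tgt_inv hγ
  rw [← sect_rep (γ.inv A), G.src_inv hγ, tgt_sect] at h
  exact h

lemma eventually_rep_inv_rep {γ : GermArrow B} (hγ : γ ∈ A) :
    ∀ᶠ x in 𝓝 γ.src, (γ.inv A).rep (γ.rep x) = x := by
  have h : sect ((γ.inv A).rep ∘ γ.rep) γ.src = sect id γ.src := G.inv_comp hγ
  exact (sect_eq_iff.1 h).2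

lemma eventually_rep_rep_inv {γ : GermArrow B} (hγ : γ ∈ A) :
    ∀ᶠ b in 𝓝 γ.tgt, γ.rep ((γ.inv A).rep b) = b := by
  have h : sect (γ.rep ∘ (γ.inv A).rep) (γ.inv A).src = sect id γ.tgt := G.comp_inv hγ
  rw [G.src_inv hγ] at h
  exact (sect_eq_iff.1 h).2

lemma tgtSect_tgt {γ : GermArrow B} (hγ : γ ∈ A) : γ.tgtSect A γ.tgt = γ := by
  rw [tgtSect, G.rep_inv_tgt hγ, sect_rep]

lemma continuousAt_tgtSect {γ : GermArrow B} (hγ : γ ∈ A) :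
    ContinuousAt (γ.tgtSect A) γ.tgt :=
  (continuous_sect _).continuousAt.comp (G.continuousAt (G.sect_rep_inv_mem hγ))

lemma eventually_eq_tgtSect {γ : GermArrow B} (hγ : γ ∈ A) :
    ∀ᶠ a in 𝓝 γ, a = γ.tgtSect A a.tgt := by
  have h : 𝓝 γ = map (sect γ.rep) (𝓝 γ.src) := by rw [← nhds_sect, sect_rep]
  rw [h, eventually_map]
  filter_upwards [G.eventually_rep_inv_rep hγ] with x hx
  rw [tgtSect, tgt_sect, hx]

lemma eventually_tgtSect {γ : GermArrow B} (hγ : γ ∈ A) : ∀ᶠ b in 𝓝 γ.tgt,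
    γ.tgtSect A b ∈ A ∧ (γ.tgtSect A b).tgt = b ∧ sect (γ.inv A).rep b ∈ A ∧
      (γ.tgtSect A b).inv A = sect (γ.inv A).rep b := by
  have h1 := (G.continuousAt_tgtSect hγ).eventually
    (p := (· ∈ A)) ((G.tgtSect_tgt hγ).symm ▸ G.isOpen.mem_nhds hγ)
  filter_upwards [h1, G.eventually_rep_rep_inv hγ, (G.eventually_rep_rep_inv hγ).eventually_nhds,
    G.eventually_mem (G.sect_rep_inv_mem hγ)] with b h1 h2 h3 h4
  have h5 : (γ.tgtSect A b).tgt = b := h2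
  refine ⟨h1, h5, h4, G.inv_eq_of_comp h1 h4 rfl ?_⟩
  rw [tgtSect, comp_sect (G.continuousAt h4)]
  exact sect_congr h3

/-- Near a point, the arrows of a compact set are on finitely many disjoint local sections of the
range map. -/
lemma exists_local_fiber [T2Space B] [T2Space A] {L : Set (GermArrow B)} (hL : IsCompact L)
    (hLA : L ⊆ A) (b₀ : B) : ∃ S : Finset (GermArrow B), (∀ γ ∈ S, γ ∈ A ∧ γ.tgt = b₀) ∧
      (∀ γ ∈ L, γ.tgt = b₀ → γ ∈ S) ∧ ∀ᶠ b in 𝓝 b₀, ∀ F : GermArrow B → ℂ, (∀ a ∉ L, F a = 0) →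
        ∑ᶠ (γ : GermArrow B) (_ : γ ∈ A ∧ γ.tgt = b), F γ = ∑ γ ∈ S, F (γ.tgtSect A b) := by
  classical
  let S := (G.finite_fiber hL hLA b₀).toFinset
  have hS : ∀ γ, γ ∈ S ↔ γ ∈ L ∧ γ.tgt = b₀ := fun γ => (G.finite_fiber hL hLA b₀).mem_toFinset
  have hSA : ∀ γ ∈ S, γ ∈ A ∧ γ.tgt = b₀ := fun γ h => ⟨hLA ((hS γ).1 h).1, ((hS γ).1 h).2⟩
  refine ⟨S, hSA, fun γ h h' => (hS γ).2 ⟨h, h'⟩, ?_⟩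
  have h1 : ∀ᶠ b in 𝓝 b₀, ∀ γ ∈ S, γ.tgtSect A b ∈ A ∧ (γ.tgtSect A b).tgt = b := by
    refine (Finset.eventually_all S).2 fun γ hγ => ?_
    rw [← (hSA γ hγ).2]
    filter_upwards [G.eventually_tgtSect (hSA γ hγ).1] with b hb using ⟨hb.1, hb.2.1⟩
  have h2 : ∀ᶠ b in 𝓝 b₀, ∀ γ ∈ S, ∀ γ' ∈ S, γ ≠ γ' → γ.tgtSect A b ≠ γ'.tgtSect A b := by
    refine (Finset.eventually_all S).2 fun γ hγ => (Finset.eventually_all S).2 fun γ' hγ' => ?_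
    by_cases hne : γ = γ'
    · exact Eventually.of_forall fun b h => absurd hne h
    obtain ⟨U, U', hU, hU', hγU, hγU', hd⟩ := t2_separation
      (show (⟨γ, (hSA γ hγ).1⟩ : A) ≠ ⟨γ', (hSA γ' hγ').1⟩ from fun h => hne (congrArg (·.1) h))
    have hmap := G.isOpen.isOpenMap_subtype_val
    have e1 := G.continuousAt_tgtSect (hSA γ hγ).1
    have e2 := G.continuousAt_tgtSect (hSA γ' hγ').1
    rw [ContinuousAt, G.tgtSect_tgt (hSA γ hγ).1, (hSA γ hγ).2] at e1
    rw [ContinuousAt, G.tgtSect_tgt (hSA γ' hγ').1, (hSA γ' hγ').2] at e2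
    filter_upwards [e1.eventually ((hmap U hU).mem_nhds ⟨_, hγU, rfl⟩),
      e2.eventually ((hmap U' hU').mem_nhds ⟨_, hγU', rfl⟩)] with b hb hb' _ heq
    obtain ⟨a, ha, ha'⟩ := hb
    obtain ⟨c, hc, hc'⟩ := hb'
    have : a = c := Subtype.ext (ha'.trans (heq.trans hc'.symm))
    exact disjoint_left.1 hd ha (this ▸ hc)
  have h3 : ∀ᶠ b in 𝓝 b₀, ∀ a ∈ L, a.tgt = b → ∃ γ ∈ S, a = γ.tgtSect A b := by
    have hex : ∀ γ ∈ S, ∃ U : Set (GermArrow B), IsOpen U ∧ γ ∈ U ∧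
        ∀ a ∈ U, a = γ.tgtSect A a.tgt := by
      intro γ hγ
      obtain ⟨U, hU, hUo, hγU⟩ := mem_nhds_iff.1 (G.eventually_eq_tgtSect (hSA γ hγ).1)
      exact ⟨U, hUo, hγU, hU⟩
    choose! U hUo hγU hU using hex
    have hc : IsCompact (L \ ⋃ γ ∈ S, U γ) :=
      hL.diff (isOpen_biUnion hUo)
    have hcl : IsClosed (tgt '' (L \ ⋃ γ ∈ S, U γ)) :=
      (hc.image_of_continuousOn fun a ha =>
        (G.continuousAt_tgt (hLA ha.1)).continuousWithinAt).isClosed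
    have hb₀ : b₀ ∉ tgt '' (L \ ⋃ γ ∈ S, U γ) := by
      rintro ⟨a, ⟨haL, haU⟩, hab⟩
      have haS := (hS a).2 ⟨haL, hab⟩
      exact haU (mem_biUnion haS (hγU a haS))
    filter_upwards [hcl.isOpen_compl.mem_nhds hb₀] with b hb a ha hab
    by_contra hcon
    push Not at hcon
    refine hb ⟨a, ⟨ha, fun h => ?_⟩, hab⟩
    obtain ⟨γ, hγ, haγ⟩ := mem_iUnion₂.1 h
    exact hcon γ hγ (hab ▸ hU γ hγ a haγ)
  filter_upwards [h1, h2, h3] with b hb1 hb2 hb3 F hF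
  rw [← Finset.sum_image (s := S) (g := fun γ => γ.tgtSect A b) (f := F)
    fun γ hγ γ' hγ' h => by_contra fun hne => hb2 γ hγ γ' hγ' hne h]
  refine finsum_mem_eq_sum_of_inter_support_eq (s := {γ | γ ∈ A ∧ γ.tgt = b}) _ ?_
  ext γ
  simp only [mem_inter_iff, Finset.coe_image, mem_image, Finset.mem_coe, Function.mem_support]
  constructor
  · rintro ⟨⟨hγ, hb⟩, hs⟩
    obtain ⟨γ', h, h'⟩ := hb3 γ (by_contra fun h => hs (hF γ h)) hb
    exact ⟨⟨γ', h, h'.symm⟩, hs⟩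
  · rintro ⟨⟨γ', h, rfl⟩, hs⟩
    exact ⟨hb1 γ' h, hs⟩

lemma fiberIntegral_local [T2Space B] [T2Space A] (hf : f ∈ posConvAlgebra A) (b₀ : B) :
    ∃ S : Finset (GermArrow B), (∀ γ ∈ S, γ ∈ A ∧ γ.tgt = b₀) ∧
      ∀ᶠ b in 𝓝 b₀, ∀ Ξ : GermArrow B → ℝ → ℂ, fiberIntegral A f Ξ b =
        ∑ γ ∈ S, ∫ t, f (γ.tgtSect A b) t * Ξ (γ.tgtSect A b) t := by
  obtain ⟨L, hL, hLA, h0⟩ := posConv_exists_compact hf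
  obtain ⟨S, hS, -, h⟩ := G.exists_local_fiber hL hLA b₀
  refine ⟨S, hS, ?_⟩
  filter_upwards [h] with b hb Ξ
  exact hb (fun γ => ∫ t, f γ t * Ξ γ t) fun a ha => by simp [h0 a ha]

lemma contMDiff_fiberIntegral_flow [T2Space B] [T2Space A] (hf : f ∈ posConvAlgebra A) {Ψ : B × B → ℂ}
    (hΨ : ContMDiff (𝓘(ℝ, ℝ).prod 𝓘(ℝ, ℝ)) 𝓘(ℝ, ℂ) ∞ Ψ) :
    ContMDiff 𝓘(ℝ, ℝ) 𝓘(ℝ, ℂ) ∞ (fun b => fiberIntegral A f (fun γ t => Ψ (b, ψ t γ.src)) b) := by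
  intro b₀
  obtain ⟨S, hS, h⟩ := G.fiberIntegral_local hf b₀
  obtain ⟨c, d, -, hcd⟩ := posConv_exists_bounds hf
  have h1 : ContMDiffAt 𝓘(ℝ, ℝ) 𝓘(ℝ, ℂ) ∞ (fun b => ∑ γ ∈ S, ∫ t, f (γ.tgtSect A b) t *
      Ψ (b, ψ t (γ.tgtSect A b).src)) b₀ := by
    refine contMDiffAt_finsetSum fun γ hγ => ?_
    obtain ⟨hγA, rfl⟩ := hS γ hγ
    refine contMDiffAt_integral (c := c) (d := d) ?_ fun x u hu => by simp [hcd _ _ hu]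
    filter_upwards [G.eventually_tgtSect hγA] with b hb u
    have hX : ContMDiffAt (𝓘(ℝ, ℝ).prod 𝓘(ℝ, ℝ)) 𝓘(ℝ, ℝ) ∞
        (fun q : B × ℝ => (γ.inv A).rep q.1) (b, u) :=
      ContMDiffAt.comp (b, u) (g := (γ.inv A).rep) (f := Prod.fst) (G.contMDiffAt hb.2.2.1)
        contMDiffAt_fst
    refine ContMDiffAt.mul_complex (G.posConv_contMDiffAt hf (X := fun q : B × ℝ => (γ.inv A).rep q.1)
      (S := Prod.snd) (m := (b, u)) hb.1 hX contMDiffAt_snd) ?_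
    refine ContMDiffAt.comp (b, u) (g := Ψ)
      (f := fun q : B × ℝ => (q.1, ψ q.2 ((γ.inv A).rep q.1))) hΨ.contMDiffAt
      (contMDiffAt_fst.prodMk ?_)
    exact ContMDiffAt.comp (b, u) (g := fun q : ℝ × B => ψ q.1 q.2)
      (f := fun q : B × ℝ => (q.2, (γ.inv A).rep q.1))
      G.isSmoothFlow.smooth.contMDiffAt (contMDiffAt_snd.prodMk hX)
  refine h1.congr_of_eventuallyEq ?_
  filter_upwards [h] with b hb
  exact hb (fun γ t => Ψ (b, ψ t γ.src))

lemma contMDiff_kernelAction [T2Space B] [T2Space A] (hf : f ∈ posConvAlgebra A) {ξ : B → ℂ}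
    (hξ : ContMDiff 𝓘(ℝ, ℝ) 𝓘(ℝ, ℂ) ∞ ξ) :
    ContMDiff 𝓘(ℝ, ℝ) 𝓘(ℝ, ℂ) ∞ (kernelAction A ψ f ξ) :=
  G.contMDiff_fiberIntegral_flow hf (Ψ := fun q => ξ q.2) (hξ.comp contMDiff_snd)

lemma convolution_mem [T2Space B] [T2Space A] (hf : f ∈ posConvAlgebra A)
    (hg : g ∈ posConvAlgebra A) : groupoidConvolution A ψ f g ∈ posConvAlgebra A := by
  obtain ⟨c, d, -, hcd⟩ := posConv_exists_bounds hf
  constructor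
  · obtain ⟨⟨K, hK, hKA, hK0⟩, -⟩ := id hf
    obtain ⟨⟨K', hK', hKA', hK0'⟩, -⟩ := id hg
    let P : Set ((GermArrow B × ℝ) × (GermArrow B × ℝ)) :=
      {x ∈ K ×ˢ K' | x.1.1.src = (x.2.1.flow ψ (-x.1.2)).tgt}
    have hflow : ContinuousOn (fun x : (GermArrow B × ℝ) × (GermArrow B × ℝ) =>
        x.2.1.flow ψ (-x.1.2)) (K ×ˢ K') := fun x hx =>
      (ContinuousAt.comp (g := fun p : ℝ × GermArrow B => p.2.flow ψ p.1)
        (f := fun x : (GermArrow B × ℝ) × (GermArrow B × ℝ) => (-x.1.2, x.2.1))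
        (G.continuousAt_flow (hKA' hx.2).1 _) (by fun_prop)).continuousWithinAt
    have hmem : ∀ x ∈ K ×ˢ K', x.2.1.flow ψ (-x.1.2) ∈ A := fun x hx =>
      G.flow_mem (hKA' hx.2).1 _
    have hP : IsCompact P := by
      refine (hK.prod hK').setOf_eq_of_continuousOn
        (continuous_src.comp (continuous_fst.comp continuous_fst)).continuousOn fun x hx => ?_
      exact ContinuousAt.comp_continuousWithinAt (g := tgt) (G.continuousAt_tgt (hmem x hx))
        (hflow x hx)
    refine ⟨(fun x : (GermArrow B × ℝ) × (GermArrow B × ℝ) =>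
      (x.1.1.comp (x.2.1.flow ψ (-x.1.2)), x.1.2 + x.2.2)) '' P, ?_, ?_, ?_⟩
    · refine hP.image_of_continuousOn (ContinuousOn.prodMk ?_ (by fun_prop))
      refine ContinuousOn.comp (t := {p : GermArrow B × GermArrow B | p.1 ∈ A ∧ p.2 ∈ A ∧
        p.1.src = p.2.tgt}) (g := fun p : GermArrow B × GermArrow B => p.1.comp p.2)
        (f := fun x : (GermArrow B × ℝ) × (GermArrow B × ℝ) =>
          (x.1.1, x.2.1.flow ψ (-x.1.2))) G.continuousOn_comp ?_ ?_
      · exact (continuous_fst.comp continuous_fst).continuousOn.prodMk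
          (hflow.mono fun x hx => hx.1)
      · rintro x ⟨hx, hx'⟩
        exact ⟨(hKA hx.1).1, hmem x hx, hx'⟩
    · rintro _ ⟨x, ⟨hx, hx'⟩, rfl⟩
      exact ⟨G.comp_mem (hKA hx.1).1 (hmem x hx) hx',
        add_pos (show (0 : ℝ) < _ from (hKA hx.1).2) (show (0 : ℝ) < _ from (hKA' hx.2).2)⟩
    · intro γ t hγt
      by_contra h0
      have hγ : γ ∈ A := by
        by_contra hγ
        exact h0 (by rw [G.convolution_eq_zero hγ]; rfl)
      obtain ⟨γ₁, hγ₁, u, h1, h2, h3⟩ := G.exists_ne_zero_of_convolution_ne_zero h0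
      refine hγt ⟨((γ₁, u), (((γ₁.inv A).comp γ).flow ψ u, t - u)), ⟨⟨?_, ?_⟩, ?_⟩, ?_⟩
      · exact by_contra fun h => h2 (hK0 _ _ h)
      · exact by_contra fun h => h3 (hK0' _ _ h)
      · simp only
        rw [G.flow_neg_flow, G.tgt_comp hγ ((G.src_inv hγ₁).trans h1), G.tgt_inv hγ₁]
      · simp only
        rw [G.flow_neg_flow, G.comp_inv_cancel hγ₁ hγ h1, add_sub_cancel]
  · intro h U hU hUA
    rintro ⟨x₀, t₀⟩ ⟨hx₀, -⟩
    refine ContMDiffAt.contMDiffWithinAt ?_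
    have hh := hUA x₀ hx₀
    have hhx := G.continuousAt hh
    obtain ⟨S, hS, hloc⟩ := G.fiberIntegral_local hf (h x₀)
    have hfst : Tendsto (Prod.fst : B × ℝ → B) (𝓝 (x₀, t₀)) (𝓝 x₀) := continuousAt_fst
    have hev : ∀ γ ∈ S, ∀ᶠ x in 𝓝 x₀, sect h x ∈ A ∧ (γ.tgtSect A (h x) ∈ A ∧
        (γ.tgtSect A (h x)).tgt = h x ∧
        sect (γ.inv A).rep (h x) ∈ A ∧ (γ.tgtSect A (h x)).inv A = sect (γ.inv A).rep (h x)) := by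
      intro γ hγ
      have e1 := G.eventually_tgtSect (hS γ hγ).1
      rw [(hS γ hγ).2] at e1
      exact (G.eventually_mem hh).and (hhx.eventually e1)
    have h1 : ContMDiffAt (𝓘(ℝ, ℝ).prod 𝓘(ℝ, ℝ)) 𝓘(ℝ, ℂ) ∞ (fun q : B × ℝ => ∑ γ ∈ S, ∫ u,
        f (sect γ.rep ((γ.inv A).rep (h q.1))) u *
          g ((sect ((γ.inv A).rep ∘ h) q.1).flow ψ u) (q.2 - u)) (x₀, t₀) := by
      refine contMDiffAt_finsetSum fun γ hγ => ?_
      refine contMDiffAt_integral (c := c) (d := d) ?_ fun x u hu => by simp [hcd _ _ hu]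
      filter_upwards [hfst.eventually (hev γ hγ)] with p hp u
      obtain ⟨hp0, hp1, -, hp2, -⟩ := hp
      have hfst' : ContMDiffAt ((𝓘(ℝ, ℝ).prod 𝓘(ℝ, ℝ)).prod 𝓘(ℝ, ℝ)) 𝓘(ℝ, ℝ) ∞
          (fun q : (B × ℝ) × ℝ => q.1.1) (p, u) :=
        ContMDiffAt.comp (p, u) (g := Prod.fst) (f := Prod.fst) contMDiffAt_fst contMDiffAt_fst
      have hX : ContMDiffAt ((𝓘(ℝ, ℝ).prod 𝓘(ℝ, ℝ)).prod 𝓘(ℝ, ℝ)) 𝓘(ℝ, ℝ) ∞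
          (fun q : (B × ℝ) × ℝ => (γ.inv A).rep (h q.1.1)) (p, u) :=
        ContMDiffAt.comp (p, u) (g := (γ.inv A).rep) (f := fun q : (B × ℝ) × ℝ => h q.1.1)
          (G.contMDiffAt hp2) (ContMDiffAt.comp (p, u) (g := h)
          (f := fun q : (B × ℝ) × ℝ => q.1.1) (G.contMDiffAt hp0) hfst')
      refine ContMDiffAt.mul_complex (G.posConv_contMDiffAt hf (m := (p, u))
        (X := fun q : (B × ℝ) × ℝ => (γ.inv A).rep (h q.1.1)) (S := Prod.snd)
        hp1 hX contMDiffAt_snd) ?_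
      refine G.posConv_flow_contMDiffAt hg (m := (p, u)) (X := fun q : (B × ℝ) × ℝ => q.1.1)
        (U := Prod.snd) (S := fun q : (B × ℝ) × ℝ => q.1.2 - q.2) ?_ hfst' contMDiffAt_snd ?_
      · exact G.sect_comp_mem hp0 hp2
      · exact (ContMDiffAt.comp (p, u) (g := Prod.snd) (f := Prod.fst) contMDiffAt_snd
          contMDiffAt_fst).sub contMDiffAt_snd
    refine h1.congr_of_eventuallyEq ?_
    have hall : ∀ᶠ x in 𝓝 x₀, ∀ γ ∈ S, sect h x ∈ A ∧ (γ.tgtSect A (h x) ∈ A ∧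
        (γ.tgtSect A (h x)).tgt = h x ∧
        sect (γ.inv A).rep (h x) ∈ A ∧ (γ.tgtSect A (h x)).inv A = sect (γ.inv A).rep (h x)) :=
      (Finset.eventually_all S).2 hev
    filter_upwards [hfst.eventually hall, hfst.eventually (hhx.eventually hloc),
      hfst.eventually (G.eventually_mem hh)] with p hp1 hp2 hp3
    rw [G.convolution_eq hp3, tgt_sect, hp2]
    refine Finset.sum_congr rfl fun γ hγ => ?_
    obtain ⟨-, -, -, -, hinv⟩ := hp1 γ hγ
    refine integral_congr_ae (Eventually.of_forall fun u => ?_)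
    simp only
    rw [hinv, comp_sect (G.continuousAt hp3)]
    rfl

end IsFlowGroupoid

namespace IsFlowGroupoid

variable {B : Type*} [TopologicalSpace B] [ChartedSpace ℝ B] [IsManifold 𝓘(ℝ, ℝ) ∞ B]
  {A : Set (GermArrow B)}
  {ψ : ℝ → B → B} (G : IsFlowGroupoid A ψ) {f f' g g' h : GermArrow B → ℝ → ℂ}

include G

lemma posConv_integrable_mul (hf : f ∈ posConvAlgebra A) (γ : GermArrow B) {k : ℝ → ℂ}
    (hk : Continuous k) : Integrable (fun t => f γ t * k t) := by
  obtain ⟨c, d, -, hcd⟩ := posConv_exists_bounds hf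
  refine ((G.posConv_continuous hf γ).mul hk).integrable_of_hasCompactSupport ?_
  refine HasCompactSupport.intro (K := Icc c d) isCompact_Icc fun t ht => ?_
  simp [hcd _ _ ht]

lemma exists_finset_fiber (hf : f ∈ posConvAlgebra A) (hg : g ∈ posConvAlgebra A) (b : B) :
    ∃ S : Finset (GermArrow B), (∀ γ ∈ S, γ ∈ A ∧ γ.tgt = b) ∧
      (∀ γ ∈ A, γ.tgt = b → f γ ≠ 0 → γ ∈ S) ∧ ∀ γ ∈ A, γ.tgt = b → g γ ≠ 0 → γ ∈ S := by
  classical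
  have h1 := G.posConv_finite_fiber hf b
  have h2 := G.posConv_finite_fiber hg b
  refine ⟨h1.toFinset ∪ h2.toFinset, ?_, ?_, ?_⟩
  · intro γ hγ
    rw [Finset.mem_union, h1.mem_toFinset, h2.mem_toFinset] at hγ
    rcases hγ with hγ | hγ
    · exact ⟨by_contra fun h => hγ.2 (posConv_eq_zero hf h), hγ.1⟩
    · exact ⟨by_contra fun h => hγ.2 (posConv_eq_zero hg h), hγ.1⟩
  · exact fun γ _ hb h0 => Finset.mem_union_left _ (h1.mem_toFinset.2 ⟨hb, h0⟩)
  · exact fun γ _ hb h0 => Finset.mem_union_right _ (h2.mem_toFinset.2 ⟨hb, h0⟩)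

lemma fiberIntegral_add_left (hf : f ∈ posConvAlgebra A) (hf' : f' ∈ posConvAlgebra A) {b : B}
    {Ξ : GermArrow B → ℝ → ℂ} (hΞ : ∀ γ ∈ A, γ.tgt = b → Continuous (Ξ γ)) :
    fiberIntegral A (f + f') Ξ b = fiberIntegral A f Ξ b + fiberIntegral A f' Ξ b := by
  obtain ⟨S, hS, h1, h2⟩ := G.exists_finset_fiber hf hf' b
  rw [fiberIntegral_eq_sum S hS h1, fiberIntegral_eq_sum S hS h2, ← Finset.sum_add_distrib,
    fiberIntegral_eq_sum S hS]
  · refine Finset.sum_congr rfl fun γ hγ => ?_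
    rw [← integral_add (G.posConv_integrable_mul hf γ (hΞ γ (hS γ hγ).1 (hS γ hγ).2))
      (G.posConv_integrable_mul hf' γ (hΞ γ (hS γ hγ).1 (hS γ hγ).2))]
    exact integral_congr_ae (Eventually.of_forall fun t => add_mul _ _ _)
  · intro γ hγ hb h0
    by_contra hγS
    have e1 : f γ = 0 := by_contra fun h => hγS (h1 γ hγ hb h)
    have e2 : f' γ = 0 := by_contra fun h => hγS (h2 γ hγ hb h)
    exact h0 (by simp [e1, e2])

lemma fiberIntegral_smul_left (hf : f ∈ posConvAlgebra A) (c : ℂ) {b : B}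
    {Ξ : GermArrow B → ℝ → ℂ} :
    fiberIntegral A (c • f) Ξ b = c * fiberIntegral A f Ξ b := by
  obtain ⟨S, hS, h1, -⟩ := G.exists_finset_fiber hf hf b
  rw [fiberIntegral_eq_sum S hS h1, fiberIntegral_eq_sum S hS, Finset.mul_sum]
  · refine Finset.sum_congr rfl fun γ hγ => ?_
    rw [← integral_const_mul]
    exact integral_congr_ae (Eventually.of_forall fun t => by simp [mul_assoc])
  · exact fun γ hγ hb h0 => h1 γ hγ hb fun h => h0 (by simp [h])

lemma fiberIntegral_add_right (hf : f ∈ posConvAlgebra A) {b : B}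
    {Ξ Ξ' : GermArrow B → ℝ → ℂ} (hΞ : ∀ γ ∈ A, γ.tgt = b → Continuous (Ξ γ))
    (hΞ' : ∀ γ ∈ A, γ.tgt = b → Continuous (Ξ' γ)) :
    fiberIntegral A f (Ξ + Ξ') b = fiberIntegral A f Ξ b + fiberIntegral A f Ξ' b := by
  obtain ⟨S, hS, h1, -⟩ := G.exists_finset_fiber hf hf b
  rw [fiberIntegral_eq_sum S hS h1, fiberIntegral_eq_sum S hS h1, fiberIntegral_eq_sum S hS h1,
    ← Finset.sum_add_distrib]
  refine Finset.sum_congr rfl fun γ hγ => ?_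
  rw [← integral_add (G.posConv_integrable_mul hf γ (hΞ γ (hS γ hγ).1 (hS γ hγ).2))
    (G.posConv_integrable_mul hf γ (hΞ' γ (hS γ hγ).1 (hS γ hγ).2))]
  exact integral_congr_ae (Eventually.of_forall fun t => mul_add _ _ _)

lemma fiberIntegral_smul_right (hf : f ∈ posConvAlgebra A) (c : ℂ) {b : B}
    {Ξ : GermArrow B → ℝ → ℂ} :
    fiberIntegral A f (c • Ξ) b = c * fiberIntegral A f Ξ b := by
  obtain ⟨S, hS, h1, -⟩ := G.exists_finset_fiber hf hf b
  rw [fiberIntegral_eq_sum S hS h1, fiberIntegral_eq_sum S hS h1, Finset.mul_sum]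
  refine Finset.sum_congr rfl fun γ hγ => ?_
  rw [← integral_const_mul]
  exact integral_congr_ae (Eventually.of_forall fun t => by simp; ring)

lemma exists_fiberIntegral_bound [T2Space B] [CompactSpace B] [T2Space A]
    (hf : f ∈ posConvAlgebra A) : ∃ C : ℝ, ∀ (b : B) (Ξ : GermArrow B → ℝ → ℂ) (M : ℝ),
      (∀ γ t, ‖Ξ γ t‖ ≤ M) → ‖fiberIntegral A f Ξ b‖ ≤ C * M := by
  obtain ⟨c, d, -, hcd⟩ := posConv_exists_bounds hf
  obtain ⟨C, hC⟩ := G.posConv_bounded hf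
  have hterm : ∀ γ (k : ℝ → ℂ) M, (∀ t, ‖k t‖ ≤ M) →
      ‖∫ t, f γ t * k t‖ ≤ C * M * volume.real (Icc c d) := by
    intro γ k M hk
    have h1 : ∫ t, f γ t * k t = ∫ t in Icc c d, f γ t * k t :=
      (setIntegral_eq_integral_of_forall_compl_eq_zero fun t ht => by simp [hcd _ _ ht]).symm
    rw [h1]
    refine norm_setIntegral_le_of_norm_le_const (by simp) fun t _ => ?_
    rw [norm_mul]
    exact mul_le_mul (hC _ _) (hk t) (norm_nonneg _) ((norm_nonneg _).trans (hC γ t))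
  have hN : ∃ N : ℕ, ∀ b ∈ (univ : Set B), ∀ (Ξ : GermArrow B → ℝ → ℂ) (M : ℝ),
      (∀ γ t, ‖Ξ γ t‖ ≤ M) → ‖fiberIntegral A f Ξ b‖ ≤ N * (C * M * volume.real (Icc c d)) := by
    refine isCompact_univ.induction_on (p := fun s : Set B => ∃ N : ℕ, ∀ b ∈ s,
      ∀ (Ξ : GermArrow B → ℝ → ℂ) (M : ℝ),
      (∀ γ t, ‖Ξ γ t‖ ≤ M) → ‖fiberIntegral A f Ξ b‖ ≤ N * (C * M * volume.real (Icc c d)))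
      ⟨0, by simp⟩ (fun s t hst ⟨N, hN⟩ => ⟨N, fun b hb => hN b (hst hb)⟩) ?_ ?_
    · rintro s t ⟨N, hN⟩ ⟨N', hN'⟩
      refine ⟨max N N', fun b hb Ξ M hΞ => ?_⟩
      have h0 : 0 ≤ C * M * volume.real (Icc c d) :=
        (norm_nonneg _).trans (hterm (unit b) (Ξ (unit b)) M (hΞ _))
      rcases hb with hb | hb
      · exact (hN b hb Ξ M hΞ).trans (mul_le_mul_of_nonneg_right (by simp) h0)
      · exact (hN' b hb Ξ M hΞ).trans (mul_le_mul_of_nonneg_right (by simp) h0)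
    · intro b₀ _
      obtain ⟨S, -, h⟩ := G.fiberIntegral_local hf b₀
      refine ⟨_, mem_nhdsWithin_of_mem_nhds h, S.card, fun b hb Ξ M hΞ => ?_⟩
      rw [show fiberIntegral A f Ξ b = _ from hb Ξ, ← nsmul_eq_mul, ← Finset.sum_const]
      exact (norm_sum_le _ _).trans (Finset.sum_le_sum fun γ _ => hterm _ _ _ (hΞ _))
  obtain ⟨N, hN⟩ := hN
  exact ⟨N * C * volume.real (Icc c d), fun b Ξ M hΞ => (hN b (mem_univ _) Ξ M hΞ).trans_eq
    (by ring)⟩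

lemma convolution_integrand_continuous (hg : g ∈ posConvAlgebra A) {γ : GermArrow B} (hγ : γ ∈ A)
    (t : ℝ) : ∀ γ₁ ∈ A, γ₁.tgt = γ.tgt →
      Continuous fun u => g (((γ₁.inv A).comp γ).flow ψ u) (t - u) := fun γ₁ hγ₁ hb =>
  G.posConv_flow_continuous hg (G.comp_mem (G.inv_mem hγ₁) hγ ((G.src_inv hγ₁).trans hb))
    continuous_id (by fun_prop)

lemma convolution_ext {k : GermArrow B → ℝ → ℂ} (h0 : ∀ γ ∉ A, k γ = 0)
    (h : ∀ γ ∈ A, ∀ t, fiberIntegral A f (fun γ₁ u => g (((γ₁.inv A).comp γ).flow ψ u) (t - u))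
      γ.tgt = k γ t) : groupoidConvolution A ψ f g = k := by
  funext γ t
  by_cases hγ : γ ∈ A
  · rw [G.convolution_eq hγ, h γ hγ]
  · rw [G.convolution_eq_zero hγ, h0 γ hγ]

lemma convolution_add_left (hf : f ∈ posConvAlgebra A) (hf' : f' ∈ posConvAlgebra A)
    (hg : g ∈ posConvAlgebra A) : groupoidConvolution A ψ (f + f') g =
      groupoidConvolution A ψ f g + groupoidConvolution A ψ f' g := by
  refine G.convolution_ext (fun γ hγ => ?_) fun γ hγ t => ?_
  · rw [Pi.add_apply, G.convolution_eq_zero hγ, G.convolution_eq_zero hγ, add_zero]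
  · rw [Pi.add_apply, Pi.add_apply, G.convolution_eq hγ, G.convolution_eq hγ,
      G.fiberIntegral_add_left hf hf' (G.convolution_integrand_continuous hg hγ t)]

lemma convolution_smul_left (hf : f ∈ posConvAlgebra A) (c : ℂ) :
    groupoidConvolution A ψ (c • f) g = c • groupoidConvolution A ψ f g := by
  refine G.convolution_ext (fun γ hγ => ?_) fun γ hγ t => ?_
  · rw [Pi.smul_apply, G.convolution_eq_zero hγ, smul_zero]
  · rw [Pi.smul_apply, Pi.smul_apply, G.convolution_eq hγ, G.fiberIntegral_smul_left hf,
      smul_eq_mul]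

lemma convolution_add_right (hf : f ∈ posConvAlgebra A) (hg : g ∈ posConvAlgebra A)
    (hg' : g' ∈ posConvAlgebra A) : groupoidConvolution A ψ f (g + g') =
      groupoidConvolution A ψ f g + groupoidConvolution A ψ f g' := by
  refine G.convolution_ext (fun γ hγ => ?_) fun γ hγ t => ?_
  · rw [Pi.add_apply, G.convolution_eq_zero hγ, G.convolution_eq_zero hγ, add_zero]
  · rw [Pi.add_apply, Pi.add_apply, G.convolution_eq hγ, G.convolution_eq hγ]
    exact G.fiberIntegral_add_right hf (G.convolution_integrand_continuous hg hγ t)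
      (G.convolution_integrand_continuous hg' hγ t)

lemma convolution_smul_right (hf : f ∈ posConvAlgebra A) (c : ℂ) :
    groupoidConvolution A ψ f (c • g) = c • groupoidConvolution A ψ f g := by
  refine G.convolution_ext (fun γ hγ => ?_) fun γ hγ t => ?_
  · rw [Pi.smul_apply, G.convolution_eq_zero hγ, smul_zero]
  · rw [Pi.smul_apply, Pi.smul_apply, G.convolution_eq hγ]
    exact G.fiberIntegral_smul_right hf c

lemma convolution_assoc (hf : f ∈ posConvAlgebra A) (hg : g ∈ posConvAlgebra A)
    (hh : h ∈ posConvAlgebra A) :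
    groupoidConvolution A ψ (groupoidConvolution A ψ f g) h =
      groupoidConvolution A ψ f (groupoidConvolution A ψ g h) := by
  refine G.convolution_ext (fun γ hγ => G.convolution_eq_zero hγ) fun γ hγ t => ?_
  rw [G.fiberIntegral_convolution hf hg (G.convolution_integrand_continuous hh hγ t),
    G.convolution_eq hγ]
  refine fiberIntegral_congr fun γ₁ hγ₁ hb u => ?_
  have h1 : (γ₁.inv A).src = γ.tgt := (G.src_inv hγ₁).trans hb
  have h2 := G.comp_mem (G.inv_mem hγ₁) hγ h1
  have h3 : ψ u γ₁.src = (((γ₁.inv A).comp γ).flow ψ u).tgt := by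
    rw [G.tgt_flow, G.tgt_comp hγ h1, G.tgt_inv hγ₁]
  rw [G.convolution_eq (G.flow_mem h2 u), ← h3]
  congr 1
  refine fiberIntegral_congr fun δ hδ hδb v => ?_
  have h4 : γ₁.src = (δ.flow ψ (-u)).tgt := by
    rw [G.tgt_flow, hδb, G.isSmoothFlow.neg_apply]
  have h5 := G.flow_mem hδ (-u)
  rw [G.inv_comp_rev hγ₁ h5 h4, G.comp_assoc (G.inv_mem hγ₁) hγ
    (by rw [G.src_inv h5, G.tgt_inv hγ₁, h4]) h1, add_comm u v, G.flow_add,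
    G.flow_comp h2 (by rw [G.src_inv h5, G.tgt_comp hγ h1, G.tgt_inv hγ₁, h4]),
    G.flow_inv h5, G.flow_flow_neg, sub_sub, add_comm v u]

lemma kernelAction_convolution (hf : f ∈ posConvAlgebra A) (hg : g ∈ posConvAlgebra A) {ξ : B → ℂ}
    (hξ : Continuous ξ) : kernelAction A ψ (groupoidConvolution A ψ f g) ξ =
      kernelAction A ψ f (kernelAction A ψ g ξ) := by
  funext b
  refine (G.fiberIntegral_convolution hf hg (Ξ := fun γ t => ξ (ψ t γ.src)) fun γ _ _ =>
    hξ.comp (G.isSmoothFlow.contMDiff_orbit _).continuous).trans ?_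
  refine fiberIntegral_congr fun γ₁ hγ₁ hb u => ?_
  congr 1
  refine fiberIntegral_congr fun δ hδ hδb v => ?_
  rw [G.src_comp, G.src_flow, ← G.isSmoothFlow.map_add, add_neg_cancel_comm]

/-- The convolution algebra of a Hausdorff groupoid. -/
def convMul [T2Space B] [T2Space A] :
    posConvAlgebra A →ₗ[ℂ] posConvAlgebra A →ₗ[ℂ] posConvAlgebra A :=
  LinearMap.mk₂ ℂ (fun f g => ⟨groupoidConvolution A ψ f g, G.convolution_mem f.2 g.2⟩)
    (fun f f' g => Subtype.ext (G.convolution_add_left f.2 f'.2 g.2))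
    (fun c f g => Subtype.ext (G.convolution_smul_left f.2 c))
    (fun f g g' => Subtype.ext (G.convolution_add_right f.2 g.2 g'.2))
    (fun c f g => Subtype.ext (G.convolution_smul_right f.2 c))

lemma continuous_comp_flow {ξ : B → ℂ} (hξ : ContMDiff 𝓘(ℝ, ℝ) 𝓘(ℝ, ℂ) ∞ ξ) (x : B) :
    Continuous fun t => ξ (ψ t x) :=
  hξ.continuous.comp (G.isSmoothFlow.contMDiff_orbit x).continuous

/-- The representation of the convolution algebra on the smooth functions. -/
def kernelRep [T2Space B] [T2Space A] :
    posConvAlgebra A →ₗ[ℂ] Module.End ℂ (smoothFun 𝓘(ℝ, ℝ) B) :=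
  LinearMap.mk₂ ℂ (fun (f : posConvAlgebra A) (ξ : smoothFun 𝓘(ℝ, ℝ) B) =>
      (⟨kernelAction A ψ f ξ, G.contMDiff_kernelAction f.2 ξ.2⟩ : smoothFun 𝓘(ℝ, ℝ) B))
    (fun f f' ξ => Subtype.ext (funext fun b => G.fiberIntegral_add_left f.2 f'.2
      fun γ _ _ => G.continuous_comp_flow ξ.2 _))
    (fun c f ξ => Subtype.ext (funext fun b => G.fiberIntegral_smul_left f.2 c))
    (fun f ξ ξ' => Subtype.ext (funext fun b => G.fiberIntegral_add_right f.2
      (fun γ _ _ => G.continuous_comp_flow ξ.2 _) fun γ _ _ => G.continuous_comp_flow ξ'.2 _))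
    (fun c f ξ => Subtype.ext (funext fun b => G.fiberIntegral_smul_right f.2 c))

end IsFlowGroupoid

/-- The speed of the flow `ψ` in the chart `e`, at the point with coordinate `y`. -/
def chartSpeed {B : Type*} [TopologicalSpace B] (e : OpenPartialHomeomorph B ℝ) (ψ : ℝ → B → B)
    (y : ℝ) : ℝ :=
  deriv (fun t => e (ψ t (e.symm y))) 0

/-- The orbits that are not reduced to a fixed point. -/
def properOrbits {X : Type*} (ψ : ℝ → X → X) : Set (Set X) :=
  {O | ∃ x ∉ fixedPts ψ, O = flowOrbit ψ x}

namespace IsSmoothFlow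

variable {B : Type*} [TopologicalSpace B] [ChartedSpace ℝ B] [IsManifold 𝓘(ℝ, ℝ) ∞ B]
  {ψ : ℝ → B → B} (hψ : IsSmoothFlow 𝓘(ℝ, ℝ) ψ) {e : OpenPartialHomeomorph B ℝ}

include hψ

lemma contDiffAt_orbit_chart (he : e ∈ IsManifold.maximalAtlas 𝓘(ℝ, ℝ) ∞ B) {x : B} {t : ℝ}
    (ht : ψ t x ∈ e.source) : ContDiffAt ℝ ∞ (fun s => e (ψ s x)) t := by
  rw [← contMDiffAt_iff_contDiffAt]
  exact ContMDiffAt.comp t (g := e) (f := fun s => ψ s x) (contMDiffAt_of_mem_atlas he ht)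
    (hψ.contMDiff_orbit x).contMDiffAt

lemma hasDerivAt_orbit_chart (he : e ∈ IsManifold.maximalAtlas 𝓘(ℝ, ℝ) ∞ B) {x : B} {t : ℝ}
    (ht : ψ t x ∈ e.source) :
    HasDerivAt (fun s => e (ψ s x)) (chartSpeed e ψ (e (ψ t x))) t := by
  have h1 : HasDerivAt (fun s => e (ψ s (ψ t x))) (chartSpeed e ψ (e (ψ t x))) 0 := by
    unfold chartSpeed
    rw [e.left_inv ht]
    refine DifferentiableAt.hasDerivAt ?_
    exact (hψ.contDiffAt_orbit_chart he (x := ψ t x) (t := 0)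
      (by rwa [hψ.map_zero])).differentiableAt (by simp)
  have h2 : HasDerivAt (fun s : ℝ => s - t) 1 t := (hasDerivAt_id t).sub_const t
  have h3 := HasDerivAt.scomp t (g₁ := fun s => e (ψ s (ψ t x))) (h := fun s : ℝ => s - t)
    (by rw [sub_self]; exact h1) h2
  rw [one_smul] at h3
  refine h3.congr_of_eventuallyEq (Eventually.of_forall fun s => ?_)
  simp only [Function.comp, ← hψ.map_add, sub_add_cancel]

lemma contDiffAt_chartSpeed (he : e ∈ IsManifold.maximalAtlas 𝓘(ℝ, ℝ) ∞ B) {y : ℝ}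
    (hy : y ∈ e.target) : ContDiffAt ℝ ∞ (chartSpeed e ψ) y := by
  have h1 := hψ.contDiffAt_chart he (t := 0) hy (by rw [hψ.map_zero]; exact e.map_target hy)
  have h2 : ContDiffAt ℝ ∞ (Function.uncurry fun (y t : ℝ) => e (ψ t (e.symm y))) (y, 0) :=
    ContDiffAt.comp (y, (0 : ℝ)) (g := fun q : ℝ × ℝ => e (ψ q.1 (e.symm q.2)))
      (f := fun q : ℝ × ℝ => (q.2, q.1)) h1 (by fun_prop)
  have h3 : ContDiffAt ℝ ∞ (fun y => fderiv ℝ (fun t => e (ψ t (e.symm y))) 0) y :=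
    ContDiffAt.fderiv h2 contDiffAt_const (by simp)
  have h4 : ContDiffAt ℝ ∞ (fun y => fderiv ℝ (fun t => e (ψ t (e.symm y))) 0 1) y :=
    h3.clm_apply contDiffAt_const
  exact h4

lemma mem_fixedPts_of_chartSpeed_eq_zero (he : e ∈ IsManifold.maximalAtlas 𝓘(ℝ, ℝ) ∞ B) {x : B}
    (hx : x ∈ e.source) (h0 : chartSpeed e ψ (e x) = 0) : x ∈ fixedPts ψ := by
  have hd : ∀ e' ∈ IsManifold.maximalAtlas 𝓘(ℝ, ℝ) ∞ B, ∀ s, ψ s x ∈ e'.source →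
      HasDerivAt (fun s => e' (ψ s x)) 0 s := by
    intro e' he' s hs
    have h1 : HasDerivAt (fun u => e (ψ u x)) 0 0 := by
      have := hψ.hasDerivAt_orbit_chart he (x := x) (t := 0) (by rwa [hψ.map_zero])
      rwa [hψ.map_zero, h0] at this
    have h2 : ContDiffAt ℝ ∞ (fun y => e' (ψ s (e.symm y))) (e x) := by
      rw [← contMDiffAt_iff_contDiffAt]
      have hx' : e.symm (e x) = x := e.left_inv hx
      refine ContMDiffAt.comp (e x) (g := e') (f := fun y => ψ s (e.symm y))
        (contMDiffAt_of_mem_atlas he' (by rwa [hx'])) ?_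
      exact ContMDiffAt.comp (e x) (g := ψ s) (f := e.symm) (hψ.contMDiff_at_time s).contMDiffAt
        (contMDiffAt_symm_of_mem_atlas he (e.map_source hx))
    have h2' : HasDerivAt (fun y => e' (ψ s (e.symm y)))
        (deriv (fun y => e' (ψ s (e.symm y))) (e x)) (e (ψ 0 x)) := by
      rw [hψ.map_zero]
      exact (h2.differentiableAt (by simp)).hasDerivAt
    have h3 : HasDerivAt (fun u => e' (ψ s (e.symm (e (ψ u x))))) 0 0 := by
      have := HasDerivAt.scomp (0 : ℝ) (g₁ := fun y => e' (ψ s (e.symm y)))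
        (h := fun u => e (ψ u x)) h2' h1
      rwa [zero_smul] at this
    have h4 : (fun u => e' (ψ (s + u) x)) =ᶠ[𝓝 0] fun u => e' (ψ s (e.symm (e (ψ u x)))) := by
      have hc : ContinuousAt (fun u => ψ u x) 0 := (hψ.contMDiff_orbit x).continuous.continuousAt
      simp only [ContinuousAt, hψ.map_zero] at hc
      have : ∀ᶠ u in 𝓝 (0 : ℝ), ψ u x ∈ e.source := hc.eventually (e.open_source.mem_nhds hx)
      filter_upwards [this] with u hu
      rw [e.left_inv hu, hψ.map_add]
    have h5 := h3.congr_of_eventuallyEq h4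
    have h6 := HasDerivAt.scomp s (g₁ := fun u => e' (ψ (s + u) x)) (h := fun v : ℝ => v - s)
      (by rw [sub_self]; exact h5) ((hasDerivAt_id s).sub_const s)
    rw [smul_zero] at h6
    refine h6.congr_of_eventuallyEq (Eventually.of_forall fun v => ?_)
    simp
  have hloc : IsLocallyConstant fun s => ψ s x := by
    rw [IsLocallyConstant.iff_eventually_eq]
    intro s
    set e' := chartAt ℝ (ψ s x) with he'
    have hc : Continuous fun u => ψ u x := (hψ.contMDiff_orbit x).continuous
    have hmem : ∀ᶠ u in 𝓝 s, ψ u x ∈ e'.source := hc.continuousAt.eventually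
      (e'.open_source.mem_nhds (mem_chart_source ℝ _))
    obtain ⟨ε, hε, hball⟩ := Metric.eventually_nhds_iff_ball.1 hmem
    filter_upwards [Metric.ball_mem_nhds s hε] with u hu
    have hconst : e' (ψ u x) = e' (ψ s x) := by
      refine (convex_ball s ε).is_const_of_fderivWithin_eq_zero (𝕜 := ℝ)
        (f := fun u => e' (ψ u x)) ?_ ?_ hu (Metric.mem_ball_self hε)
      · intro v hv
        exact (hd e' (IsManifold.chart_mem_maximalAtlas _) v
          (hball v hv)).differentiableAt.differentiableWithinAt
      · intro v hv
        rw [fderivWithin_of_isOpen Metric.isOpen_ball hv]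
        have := (hd e' (IsManifold.chart_mem_maximalAtlas _) v (hball v hv)).hasFDerivAt.fderiv
        rw [this]; ext; simp
    exact e'.injOn (hball u hu) (hball s (Metric.mem_ball_self hε)) hconst
  intro t
  rw [hloc.apply_eq_of_isPreconnected isPreconnected_univ (mem_univ t) (mem_univ (0 : ℝ)),
    hψ.map_zero]

/-- Near a point that is not fixed, the points are labelled by the time at which the flow reaches
them. -/
lemma exists_flowTime {x : B} (hx : x ∉ fixedPts ψ) : ∃ τ : B → ℝ,
    ContMDiffAt 𝓘(ℝ, ℝ) 𝓘(ℝ, ℝ) ∞ τ x ∧ τ x = 0 ∧ (∀ᶠ z in 𝓝 x, ψ (τ z) x = z) ∧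
      ∀ᶠ s in 𝓝 0, τ (ψ s x) = s := by
  set e := chartAt ℝ x with he
  have hea : e ∈ IsManifold.maximalAtlas 𝓘(ℝ, ℝ) ∞ B := IsManifold.chart_mem_maximalAtlas x
  have hxe : x ∈ e.source := mem_chart_source ℝ x
  have h0 : ψ 0 x = x := hψ.map_zero x
  have hT : ContDiffAt ℝ ∞ (fun s => e (ψ s x)) 0 := hψ.contDiffAt_orbit_chart hea (by rwa [h0])
  have hne : mfderiv 𝓘(ℝ, ℝ) 𝓘(ℝ, ℝ) (fun s => e (ψ s x)) 0 ≠ 0 := by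
    intro hz
    refine hx (hψ.mem_fixedPts_of_chartSpeed_eq_zero hea hxe ?_)
    rw [chartSpeed, e.left_inv hxe, ← fderiv_apply_one_eq_deriv, ← mfderiv_eq_fderiv]
    exact congrArg (fun L : ℝ →L[ℝ] ℝ => L 1) hz
  obtain ⟨ρ, hρ, hρ0, h1, h2⟩ := exists_smooth_localInverse hT.contMDiffAt hne
  rw [h0] at hρ hρ0 h2
  have hc : ContinuousAt e x := e.continuousAt hxe
  have hρc : ContinuousAt (fun z => ρ (e z)) x :=
    ContinuousAt.comp (g := ρ) hρ.continuousAt hc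
  refine ⟨fun z => ρ (e z), ContMDiffAt.comp x (g := ρ) hρ (contMDiffAt_of_mem_atlas hea hxe), hρ0,
    ?_, h1⟩
  have hm : ∀ᶠ z in 𝓝 x, ψ (ρ (e z)) x ∈ e.source := by
    have : ContinuousAt (fun z => ψ (ρ (e z)) x) x :=
      ContinuousAt.comp (g := fun s => ψ s x) (f := fun z => ρ (e z))
        (hψ.contMDiff_orbit x).continuous.continuousAt hρc
    exact this.eventually (by simp only [hρ0, h0]; exact e.open_source.mem_nhds hxe)
  filter_upwards [hc.eventually h2, hm, e.open_source.mem_nhds hxe] with z hz hz' hz''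
  exact e.injOn hz' hz'' hz

lemma not_mem_fixedPts_flow {x : B} (hx : x ∉ fixedPts ψ) (t : ℝ) : ψ t x ∉ fixedPts ψ := by
  intro h
  apply hx
  have h1 := h (-t)
  rw [hψ.neg_apply] at h1
  rwa [← h1] at h

lemma mem_flowOrbit_self (x : B) : x ∈ flowOrbit ψ x := ⟨0, hψ.map_zero x⟩

lemma flowOrbit_eq {x y : B} (h : y ∈ flowOrbit ψ x) : flowOrbit ψ y = flowOrbit ψ x := by
  obtain ⟨t, rfl⟩ := h
  ext z
  constructor
  · rintro ⟨s, rfl⟩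
    exact ⟨s + t, hψ.map_add s t x⟩
  · rintro ⟨s, rfl⟩
    exact ⟨s - t, by simp only [← hψ.map_add, sub_add_cancel]⟩

lemma not_mem_fixedPts_of_mem_orbit {O : Set B} (hO : O ∈ properOrbits ψ) {x : B} (hx : x ∈ O) :
    x ∉ fixedPts ψ := by
  obtain ⟨y, hy, rfl⟩ := hO
  obtain ⟨t, rfl⟩ := hx
  exact hψ.not_mem_fixedPts_flow hy t

lemma eq_flowOrbit_of_mem {O : Set B} (hO : O ∈ properOrbits ψ) {x : B} (hx : x ∈ O) :
    O = flowOrbit ψ x := by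
  obtain ⟨y, hy, rfl⟩ := hO
  exact (hψ.flowOrbit_eq hx).symm

lemma flow_mem_orbit_iff {O : Set B} (hO : O ∈ properOrbits ψ) {x : B} (t : ℝ) :
    ψ t x ∈ O ↔ x ∈ O := by
  constructor
  · intro h
    rw [hψ.eq_flowOrbit_of_mem hO h]
    exact ⟨-t, hψ.neg_apply t x⟩
  · intro h
    rw [hψ.eq_flowOrbit_of_mem hO h]
    exact ⟨t, rfl⟩

lemma flowOrbit_mem_nhds {x : B} (hx : x ∉ fixedPts ψ) : flowOrbit ψ x ∈ 𝓝 x := by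
  obtain ⟨τ, -, -, h, -⟩ := hψ.exists_flowTime hx
  filter_upwards [h] with z hz
  exact ⟨_, hz⟩

lemma isOpen_orbit {O : Set B} (hO : O ∈ properOrbits ψ) : IsOpen O := by
  rw [isOpen_iff_mem_nhds]
  intro x hx
  rw [hψ.eq_flowOrbit_of_mem hO hx]
  exact hψ.flowOrbit_mem_nhds (hψ.not_mem_fixedPts_of_mem_orbit hO hx)

lemma isClosed_fixedPts [T2Space B] : IsClosed (fixedPts ψ) := by
  have : fixedPts ψ = ⋂ t, {x | ψ t x = x} := by ext; simp [fixedPts]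
  rw [this]
  exact isClosed_iInter fun t => isClosed_eq (hψ.contMDiff_at_time t).continuous continuous_id

lemma eventually_flow_ne {x : B} (hx : x ∉ fixedPts ψ) : ∀ᶠ s in 𝓝[≠] (0 : ℝ), ψ s x ≠ x := by
  obtain ⟨τ, -, h0, -, h⟩ := hψ.exists_flowTime hx
  rw [eventually_nhdsWithin_iff]
  filter_upwards [h] with s hs hs0 heq
  rw [heq, h0] at hs
  exact hs0 hs.symm

lemma mem_fixedPts_of_eventually {x : B} (h : ∀ᶠ s in 𝓝 (0 : ℝ), ψ s x = x) : x ∈ fixedPts ψ := by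
  by_contra hx
  obtain ⟨s, hs, hs'⟩ := ((hψ.eventually_flow_ne hx).and (h.filter_mono nhdsWithin_le_nhds)).exists
  exact hs hs'

/-- The times at which a point that is not fixed returns to itself. -/
lemma free_or_periodic {x : B} (hx : x ∉ fixedPts ψ) : (∀ t, t ≠ 0 → ψ t x ≠ x) ∨
    ∃ p, 0 < p ∧ ∀ t, ψ t x = x ↔ ∃ k : ℤ, t = k * p := by
  let P : AddSubgroup ℝ :=
    { carrier := {t | ψ t x = x}
      add_mem' := fun {s t} hs ht => by
        change ψ (s + t) x = x
        rw [hψ.map_add, show ψ t x = x from ht, show ψ s x = x from hs]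
      zero_mem' := hψ.map_zero x
      neg_mem' := fun {t} ht => by
        change ψ (-t) x = x
        conv_lhs => rw [← show ψ t x = x from ht]
        exact hψ.neg_apply t x }
  have hP : ∀ t, ψ t x = x ↔ t ∈ P := fun t => Iff.rfl
  have h := eventually_nhdsWithin_iff.1 (hψ.eventually_flow_ne hx)
  obtain ⟨ε, hε, hball⟩ := Metric.eventually_nhds_iff_ball.1 h
  have hd : Disjoint (P : Set ℝ) (Ioo 0 ε) := by
    rw [disjoint_left]
    intro s hs hs'
    refine hball s ?_ hs'.1.ne' hs
    rw [Metric.mem_ball, dist_zero_right, Real.norm_eq_abs, abs_of_pos hs'.1]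
    exact hs'.2
  obtain ⟨b, hb⟩ := AddSubgroup.cyclic_of_isolated_zero hε hd
  have hmem : ∀ t, ψ t x = x ↔ ∃ k : ℤ, t = k * b := by
    intro t
    rw [hP, hb, AddSubgroup.mem_closure_singleton]
    simp [eq_comm]
  rcases eq_or_ne b 0 with rfl | hb0
  · left
    intro t ht h
    obtain ⟨k, hk⟩ := (hmem t).1 h
    exact ht (by simpa using hk)
  · right
    refine ⟨|b|, abs_pos.2 hb0, fun t => (hmem t).trans ?_⟩
    rcases abs_choice b with h | h <;> rw [h]
    constructor
    · rintro ⟨k, hk⟩; exact ⟨-k, by rw [hk]; push_cast; ring⟩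
    · rintro ⟨k, hk⟩; exact ⟨-k, by rw [hk]; push_cast; ring⟩

lemma isPreconnected_subset_orbit [T2Space B] {S : Set B} (hS : IsPreconnected S)
    (hfix : ∀ x ∈ S, x ∉ fixedPts ψ) {x : B} (hx : x ∈ S) : S ⊆ flowOrbit ψ x := by
  have h1 : IsOpen (flowOrbit ψ x) := hψ.isOpen_orbit ⟨x, hfix x hx, rfl⟩
  have h2 : IsOpen (⋃ y ∈ S \ flowOrbit ψ x, flowOrbit ψ y) :=
    isOpen_biUnion fun y hy => hψ.isOpen_orbit ⟨y, hfix y hy.1, rfl⟩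
  refine hS.subset_left_of_subset_union h1 h2 ?_ ?_ ⟨x, hx, hψ.mem_flowOrbit_self x⟩
  · rw [disjoint_left]
    rintro z hz hz'
    obtain ⟨y, hy, hzy⟩ := mem_iUnion₂.1 hz'
    apply hy.2
    rw [← hψ.flowOrbit_eq hz, hψ.flowOrbit_eq hzy]
    exact hψ.mem_flowOrbit_self y
  · intro z hz
    by_cases hz' : z ∈ flowOrbit ψ x
    · exact Or.inl hz'
    · exact Or.inr (mem_biUnion ⟨hz, hz'⟩ (hψ.mem_flowOrbit_self z))

/-- Near a hyperbolic fixed point, the time one map has no other fixed point. -/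
lemma eventually_ne_of_flowExponent_ne_zero {b : B} (hb : b ∈ fixedPts ψ)
    (hκ : flowExponent ψ b ≠ 0) : ∀ᶠ z in 𝓝[≠] b, z ∉ fixedPts ψ := by
  set e := chartAt ℝ b with he
  have hea : e ∈ IsManifold.maximalAtlas 𝓘(ℝ, ℝ) ∞ B := IsManifold.chart_mem_maximalAtlas b
  have hbe : b ∈ e.source := mem_chart_source ℝ b
  have h1 := (hψ.hasDerivAt_chart_of_fixed hb hea hbe 1).sub (hasDerivAt_id (e b))
  have h2 : flowDeriv ψ b 1 - 1 ≠ 0 := by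
    rw [flowDeriv_eq_exp hψ hb, mul_one, sub_ne_zero]
    simpa using hκ
  have h3 := h1.eventually_ne (c := 0) h2
  rw [eventually_nhdsWithin_iff] at h3 ⊢
  filter_upwards [(e.continuousAt hbe).eventually h3, e.open_source.mem_nhds hbe] with z hz hze hne hf
  refine hz (fun h => hne (e.injOn hze hbe h)) ?_
  simp [e.left_inv hze, hf 1]

lemma finite_fixedPts [T2Space B] [CompactSpace B]
    (hκ : ∀ b ∈ fixedPts ψ, flowExponent ψ b ≠ 0) : (fixedPts ψ).Finite := by
  have h := isCompact_univ.induction_on (p := fun s : Set B => (s ∩ fixedPts ψ).Finite) (by simp)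
    (fun s t hst ht => ht.subset (inter_subset_inter_left _ hst))
    (fun s t hs ht => by rw [union_inter_distrib_right]; exact hs.union ht) ?_
  · rwa [univ_inter] at h
  · intro b _
    by_cases hb : b ∈ fixedPts ψ
    · have h1 := hψ.eventually_ne_of_flowExponent_ne_zero hb (hκ b hb)
      rw [eventually_nhdsWithin_iff] at h1
      refine ⟨_, mem_nhdsWithin_of_mem_nhds h1, (finite_singleton b).subset ?_⟩
      rintro z ⟨hz, hzf⟩
      by_contra hne
      exact hz hne hzf
    · refine ⟨_, mem_nhdsWithin_of_mem_nhds (hψ.isClosed_fixedPts.isOpen_compl.mem_nhds hb), ?_⟩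
      rw [compl_inter_self]; exact finite_empty

lemma finite_properOrbits [T2Space B] [CompactSpace B]
    (hκ : ∀ b ∈ fixedPts ψ, flowExponent ψ b ≠ 0) : (properOrbits ψ).Finite := by
  have h := isCompact_univ.induction_on
    (p := fun s : Set B => {O ∈ properOrbits ψ | (O ∩ s).Nonempty}.Finite) (by simp)
    (fun s t hst ht => ht.subset fun O hO => ⟨hO.1, hO.2.mono (inter_subset_inter_right _ hst)⟩)
    (fun s t hs ht => (hs.union ht).subset fun O hO => ?_) ?_
  · refine h.subset fun O hO => ⟨hO, ?_⟩
    obtain ⟨x, -, rfl⟩ := hO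
    exact ⟨x, hψ.mem_flowOrbit_self x, mem_univ _⟩
  · obtain ⟨x, hx, hxs | hxt⟩ := hO.2
    · exact Or.inl ⟨hO.1, x, hx, hxs⟩
    · exact Or.inr ⟨hO.1, x, hx, hxt⟩
  · have hone : ∀ S : Set B, (∃ x, S ⊆ flowOrbit ψ x) →
        {O ∈ properOrbits ψ | (O ∩ S).Nonempty}.Finite := by
      rintro S ⟨x, hx⟩
      refine (finite_singleton (flowOrbit ψ x)).subset ?_
      rintro O ⟨hO, z, hz, hzS⟩
      rw [mem_singleton_iff, hψ.eq_flowOrbit_of_mem hO hz, hψ.flowOrbit_eq (hx hzS)]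
    intro b _
    by_cases hb : b ∈ fixedPts ψ
    · set e := chartAt ℝ b with he
      have hbe : b ∈ e.source := mem_chart_source ℝ b
      have h1 := hψ.eventually_ne_of_flowExponent_ne_zero hb (hκ b hb)
      rw [eventually_nhdsWithin_iff] at h1
      have hc : ContinuousAt e.symm (e b) := e.continuousAt_symm (e.map_source hbe)
      have h2 : ∀ᶠ y in 𝓝 (e b), y ∈ e.target ∧ (e.symm y ≠ b → e.symm y ∉ fixedPts ψ) := by
        rw [ContinuousAt, e.left_inv hbe] at hc
        filter_upwards [e.open_target.mem_nhds (e.map_source hbe), hc.eventually h1] with y hy hy'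
        exact ⟨hy, hy'⟩
      obtain ⟨ε, hε, hball⟩ := Metric.eventually_nhds_iff_ball.1 h2
      have hside : ∀ J : Set ℝ, IsPreconnected J → J ⊆ Metric.ball (e b) ε → e b ∉ J →
          {O ∈ properOrbits ψ | (O ∩ e.symm '' J).Nonempty}.Finite := by
        intro J hJ hJb hbJ
        rcases J.eq_empty_or_nonempty with rfl | ⟨y, hy⟩
        · simp
        refine hone _ ⟨e.symm y, hψ.isPreconnected_subset_orbit
          (hJ.image _ fun z hz => ?_) ?_ ⟨y, hy, rfl⟩⟩
        · exact (e.continuousAt_symm (hball z (hJb hz)).1).continuousWithinAt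
        · rintro _ ⟨z, hz, rfl⟩
          refine (hball z (hJb hz)).2 fun heq => hbJ ?_
          rw [← heq, e.right_inv (hball z (hJb hz)).1]
          exact hz
      have hl := hside (Ioo (e b - ε) (e b)) isPreconnected_Ioo
        (by rw [Real.ball_eq_Ioo]; exact Ioo_subset_Ioo_right (by linarith)) (by simp)
      have hr := hside (Ioo (e b) (e b + ε)) isPreconnected_Ioo
        (by rw [Real.ball_eq_Ioo]; exact Ioo_subset_Ioo_left (by linarith)) (by simp)
      refine ⟨e.source ∩ e ⁻¹' Metric.ball (e b) ε, mem_nhdsWithin_of_mem_nhds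
        (inter_mem (e.open_source.mem_nhds hbe) ((e.continuousAt hbe).preimage_mem_nhds
          (Metric.ball_mem_nhds _ hε))), (hl.union hr).subset ?_⟩
      rintro O ⟨hO, z, hzO, hze, hzb⟩
      rw [mem_preimage, Real.ball_eq_Ioo] at hzb
      have hne : e z ≠ e b := fun h => hψ.not_mem_fixedPts_of_mem_orbit hO hzO
        ((e.injOn hze hbe h).symm ▸ hb)
      rcases lt_or_gt_of_ne hne with hlt | hgt
      · exact Or.inl ⟨hO, z, hzO, e z, ⟨hzb.1, hlt⟩, e.left_inv hze⟩
      · exact Or.inr ⟨hO, z, hzO, e z, ⟨hgt, hzb.2⟩, e.left_inv hze⟩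
    · exact ⟨_, mem_nhdsWithin_of_mem_nhds (hψ.flowOrbit_mem_nhds hb), hone _ ⟨b, subset_rfl⟩⟩

lemma periodicOrbits_subset : periodicOrbits ψ ⊆ properOrbits ψ := by
  rintro O ⟨x, p, ⟨hp, hpx, hq⟩, rfl⟩
  exact ⟨x, fun h => hq (p / 2) (by linarith) (by linarith) (h _), rfl⟩

lemma infiniteOrbits_subset : infiniteOrbits ψ ⊆ properOrbits ψ := by
  rintro O ⟨x, hx, rfl⟩
  exact ⟨x, fun h => hx 1 one_ne_zero (h 1), rfl⟩

/-- The return times to the points of a periodic orbit. -/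
lemma flow_eq_self_iff {O : Set B} (hO : O ∈ periodicOrbits ψ) {x : B} (hx : x ∈ O) (t : ℝ) :
    0 < orbitPeriod ψ O ∧ (ψ t x = x ↔ ∃ k : ℤ, t = k * orbitPeriod ψ O) := by
  have hO' := hψ.periodicOrbits_subset hO
  obtain ⟨y, p, ⟨hp, hpy, hq⟩, hOy⟩ := hO
  have hyO : y ∈ O := hOy ▸ hψ.mem_flowOrbit_self y
  have hall : ∀ z ∈ O, ∀ t, ψ t z = z ↔ ∃ k : ℤ, t = k * p := by
    have hy : ∀ t, ψ t y = y ↔ ∃ k : ℤ, t = k * p := by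
      rcases hψ.free_or_periodic (hψ.not_mem_fixedPts_of_mem_orbit hO' hyO) with h | ⟨q, hq0, h⟩
      · exact absurd hpy (h p hp.ne')
      · have hqp : ¬ q < p := fun hlt => hq q hq0 hlt ((h q).2 ⟨1, by simp⟩)
        obtain ⟨k, hk⟩ := (h p).1 hpy
        have hk1 : k = 1 := by
          have h1 : 0 < k := by
            by_contra hneg
            have : (k : ℝ) ≤ 0 := by exact_mod_cast not_lt.1 hneg
            nlinarith
          have h2 : (k : ℝ) ≤ 1 := by
            by_contra hneg
            push Not at hneg
            nlinarith
          have : k ≤ 1 := by exact_mod_cast h2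
          omega
        rw [hk1, Int.cast_one, one_mul] at hk
        rwa [hk]
    intro z hz t
    rw [hOy] at hz
    obtain ⟨s, rfl⟩ := hz
    rw [← hy t, ← hψ.map_add, add_comm, hψ.map_add]
    exact ⟨fun h => by rw [← hψ.neg_apply s (ψ t y), h, hψ.neg_apply], fun h => by rw [h]⟩
  have hper : orbitPeriod ψ O = p := by
    refine IsLeast.csInf_eq ⟨⟨hp, fun z hz => (hall z hz p).2 ⟨1, by simp⟩⟩, ?_⟩
    rintro q ⟨hq0, hqO⟩
    exact not_lt.1 fun hlt => hq q hq0 hlt (hqO y hyO)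
  rw [hper]
  exact ⟨hp, hall x hx t⟩

lemma flow_eq_self_iff_of_infinite {O : Set B} (hO : O ∈ infiniteOrbits ψ) {x : B} (hx : x ∈ O)
    (t : ℝ) : ψ t x = x ↔ t = 0 := by
  obtain ⟨y, hy, rfl⟩ := hO
  obtain ⟨s, rfl⟩ := hx
  refine ⟨fun h => by_contra fun ht => hy t ht ?_, fun h => by rw [h, hψ.map_zero]⟩
  rw [← hψ.neg_apply s (ψ t y), ← hψ.map_add s t, add_comm, hψ.map_add]
  exact (congrArg (ψ (-s)) h).trans (hψ.neg_apply s y)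

lemma properOrbits_eq : properOrbits ψ = periodicOrbits ψ ∪ infiniteOrbits ψ := by
  refine Subset.antisymm ?_ (union_subset hψ.periodicOrbits_subset hψ.infiniteOrbits_subset)
  rintro O ⟨x, hx, rfl⟩
  rcases hψ.free_or_periodic hx with h | ⟨p, hp, h⟩
  · exact Or.inr ⟨x, h, rfl⟩
  · refine Or.inl ⟨x, p, ⟨hp, (h p).2 ⟨1, by simp⟩, fun q hq hqp hqx => ?_⟩, rfl⟩
    obtain ⟨k, rfl⟩ := (h q).1 hqx
    have h1 : (0 : ℝ) < k := by
      by_contra hneg; push Not at hneg; nlinarith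
    have h2 : (k : ℝ) < 1 := by
      by_contra hneg; push Not at hneg; nlinarith
    have h3 : 0 < k := by exact_mod_cast h1
    have h4 : k < 1 := by exact_mod_cast h2
    omega

lemma disjoint_periodicOrbits_infiniteOrbits : Disjoint (periodicOrbits ψ) (infiniteOrbits ψ) := by
  rw [disjoint_left]
  intro O hO hO'
  obtain ⟨x, -, rfl⟩ := hψ.infiniteOrbits_subset hO'
  have hx := hψ.mem_flowOrbit_self x
  obtain ⟨hp, h⟩ := hψ.flow_eq_self_iff hO hx (orbitPeriod ψ (flowOrbit ψ x))
  have := h.2 ⟨1, by simp⟩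
  rw [hψ.flow_eq_self_iff_of_infinite hO' hx] at this
  exact hp.ne' this

end IsSmoothFlow

namespace IsFlowGroupoid

variable {B : Type*} [TopologicalSpace B] [ChartedSpace ℝ B] [IsManifold 𝓘(ℝ, ℝ) ∞ B]
  {A : Set (GermArrow B)} {ψ : ℝ → B → B} (G : IsFlowGroupoid A ψ)

include G

lemma tgt_mem_fixedPts {a : GermArrow B} (ha : a ∈ A) (h : a.src ∈ fixedPts ψ) :
    a.tgt ∈ fixedPts ψ := by
  refine G.isSmoothFlow.mem_fixedPts_of_eventually ?_
  obtain ⟨k, hk⟩ := G.exists_rep a ha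
  rw [hk] at ha ⊢
  have h1 : ∀ᶠ u in 𝓝 (0 : ℝ), k (ψ u a.src) = ψ u (k a.src) :=
    (show ContinuousAt (fun u : ℝ => (u, a.src)) 0 by fun_prop).eventually (G.commute ha)
  filter_upwards [h1] with u hu
  rw [h u] at hu
  exact hu.symm

lemma src_mem_fixedPts_iff {a : GermArrow B} (ha : a ∈ A) :
    a.src ∈ fixedPts ψ ↔ a.tgt ∈ fixedPts ψ := by
  refine ⟨G.tgt_mem_fixedPts ha, fun h => ?_⟩
  rw [← G.src_inv ha] at h
  rw [← G.tgt_inv ha]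
  exact G.tgt_mem_fixedPts (G.inv_mem ha) h

/-- An arrow from a point that is not fixed to itself is a unit. -/
lemma eq_unit_of_not_mem_fixedPts {a : GermArrow B} (ha : a ∈ A) (h : a.tgt = a.src)
    (hf : a.src ∉ fixedPts ψ) : a = unit a.src := by
  obtain ⟨k, hk⟩ := G.exists_rep a ha
  have hka : sect k a.src ∈ A := hk ▸ ha
  have hkx : k a.src = a.src := by rw [hk] at h; exact h
  conv_lhs => rw [hk]
  refine sect_congr ?_
  obtain ⟨τ, hτ, hτ0, h1, -⟩ := G.isSmoothFlow.exists_flowTime hf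
  have h2 : Tendsto (fun z => (τ z, a.src)) (𝓝 a.src) (𝓝 (0, a.src)) := by
    have := hτ.continuousAt.tendsto
    rw [hτ0] at this
    exact this.prodMk_nhds tendsto_const_nhds
  filter_upwards [h1, h2.eventually (G.commute hka)] with z hz hz'
  simp only [hz, hkx] at hz'
  exact hz'

end IsFlowGroupoid

namespace IsNonDegenerateFlowGroupoid

variable {B : Type*} [TopologicalSpace B] [ChartedSpace ℝ B] [IsManifold 𝓘(ℝ, ℝ) ∞ B]
  {A : Set (GermArrow B)} {ψ : ℝ → B → B} (G : IsNonDegenerateFlowGroupoid A ψ)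

include G

lemma eq_unit {a : GermArrow B} (ha : a ∈ A) (h : a.tgt = a.src) : a = unit a.src := by
  by_cases hf : a.src ∈ fixedPts ψ
  · obtain ⟨k, hk⟩ := G.exists_rep a ha
    conv_lhs => rw [hk]
    exact sect_congr (G.germ_eq_id hf (hk ▸ ha) (by rw [hk] at h; exact h))
  · exact G.toIsFlowGroupoid.eq_unit_of_not_mem_fixedPts ha h hf

lemma eq_of_src_tgt {a b : GermArrow B} (ha : a ∈ A) (hb : b ∈ A) (hs : a.src = b.src)
    (ht : a.tgt = b.tgt) : a = b := by
  have G' := G.toIsFlowGroupoid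
  have h1 : (b.inv A).src = a.tgt := (G'.src_inv hb).trans ht.symm
  have h2 : (b.inv A).comp a = unit a.src := by
    refine G.eq_unit (a := (b.inv A).comp a) (G'.comp_mem (G'.inv_mem hb) ha h1) ?_
    rw [G'.tgt_comp ha h1, G'.tgt_inv hb]
    exact hs.symm
  rw [← G'.comp_inv_cancel hb ha ht.symm, h2, hs, G'.comp_unit]

theorem t2Space [T2Space B] : T2Space A := by
  refine ⟨fun a b hab => ?_⟩
  have G' := G.toIsFlowGroupoid
  have hne : (a.1.src, a.1.tgt) ≠ (b.1.src, b.1.tgt) := by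
    intro h
    rw [Prod.mk.injEq] at h
    exact hab (Subtype.ext (G.eq_of_src_tgt a.2 b.2 h.1 h.2))
  have hc : Continuous fun a : A => (a.1.src, a.1.tgt) := by
    refine (continuous_src.comp continuous_subtype_val).prodMk ?_
    refine continuous_iff_continuousAt.2 fun a => ?_
    exact ContinuousAt.comp (g := tgt) (G'.continuousAt_tgt a.2) continuous_subtype_val.continuousAt
  obtain ⟨U, W, hU, hW, h1, h2, h3⟩ := t2_separation hne
  exact ⟨_, _, hU.preimage hc, hW.preimage hc, h1, h2, h3.preimage _⟩

end IsNonDegenerateFlowGroupoid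

lemma hasSum_integral_translates {h : ℝ → ℂ} (hh : Integrable h) {p : ℝ} (hp : 0 < p) :
    HasSum (fun k : ℤ => ∫ u in Ico 0 p, h (u + k * p)) (∫ u, h u) := by
  have h1 := hasSum_integral_iUnion (μ := volume) (f := h)
    (s := fun n : ℤ => Ico (n • p) ((n + 1) • p)) (fun n => measurableSet_Ico)
    (pairwise_disjoint_Ico_zsmul p) hh.integrableOn
  rw [iUnion_Ico_zsmul hp, setIntegral_univ] at h1
  have h2 : ∀ k : ℤ, ∫ u in Ico 0 p, h (u + k * p) =
      ∫ u in Ico (k • p) ((k + 1) • p), h u := fun k => by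
    rw [← (measurePreserving_add_right volume ((k : ℝ) * p)).setIntegral_preimage_emb
      (measurableEmbedding_addRight _) h (Ico (k • p) ((k + 1) • p)), Set.preimage_add_const_Ico,
      show k • p - k * p = 0 by simp, show (k + 1) • p - k * p = p by simp [add_mul]]
  rw [funext h2]
  exact h1

/-- The sum of `F` over the times at which the flow maps `x` to `y`. -/
def orbitSum {B : Type*} (ψ : ℝ → B → B) (F : ℝ → ℂ) (x y : B) : ℂ :=
  ∑ᶠ (t : ℝ) (_ : ψ t x = y), F t

/-- The parameters of an orbit. -/
def flowDomain {B : Type*} (ψ : ℝ → B → B) (O : Set B) : Set ℝ :=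
  open Classical in if O ∈ periodicOrbits ψ then Ico 0 (orbitPeriod ψ O) else univ

lemma measurableSet_flowDomain {B : Type*} (ψ : ℝ → B → B) (O : Set B) :
    MeasurableSet (flowDomain ψ O) := by
  unfold flowDomain
  split_ifs
  · exact measurableSet_Ico
  · exact MeasurableSet.univ

lemma orbitSum_eq_zero {B : Type*} {ψ : ℝ → B → B} {F : ℝ → ℂ} {x y : B}
    (h : ∀ t, F t ≠ 0 → ψ t x ≠ y) : orbitSum ψ F x y = 0 := by
  refine (finsum_congr fun t => (finsum_congr fun ht => ?_).trans finsum_zero).trans finsum_zero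
  exact by_contra fun h0 => h t h0 ht

namespace IsSmoothFlow

variable {B : Type*} [TopologicalSpace B] [ChartedSpace ℝ B] [IsManifold 𝓘(ℝ, ℝ) ∞ B]
  {ψ : ℝ → B → B} (hψ : IsSmoothFlow 𝓘(ℝ, ℝ) ψ) {e : OpenPartialHomeomorph B ℝ}

include hψ

lemma flow_eq_self_iff_of_mem_orbit {x y : B} (h : y ∈ flowOrbit ψ x) (t : ℝ) :
    ψ t y = y ↔ ψ t x = x := by
  obtain ⟨s, rfl⟩ := h
  simp only
  rw [← hψ.map_add, add_comm, hψ.map_add]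
  exact ⟨fun h => by rw [← hψ.neg_apply s (ψ t x), h, hψ.neg_apply], fun h => by rw [h]⟩

lemma exists_finset_returnTimes {x : B} (hx : x ∉ fixedPts ψ) (C : ℝ) : ∃ R : Finset ℝ,
    (∀ r ∈ R, ψ r x = x) ∧ ∀ r, ψ r x = x → |r| ≤ C → r ∈ R := by
  classical
  rcases hψ.free_or_periodic hx with h | ⟨p, hp, h⟩
  · refine ⟨{0}, by simp [hψ.map_zero], fun r hr _ => ?_⟩
    rw [Finset.mem_singleton]
    exact by_contra fun h0 => h r h0 hr
  · refine ⟨(Finset.Icc (-⌈C / p⌉) ⌈C / p⌉).image fun k : ℤ => (k : ℝ) * p, ?_, ?_⟩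
    · intro r hr
      obtain ⟨k, -, rfl⟩ := Finset.mem_image.1 hr
      exact (h _).2 ⟨k, rfl⟩
    · intro r hr hC
      obtain ⟨k, rfl⟩ := (h r).1 hr
      refine Finset.mem_image.2 ⟨k, ?_, rfl⟩
      rw [abs_mul, abs_of_pos hp, ← le_div_iff₀ hp] at hC
      have h1 : |k| ≤ ⌈C / p⌉ := by
        have : ((|k| : ℤ) : ℝ) ≤ (⌈C / p⌉ : ℝ) := by
          push_cast
          exact hC.trans (Int.le_ceil _)
        exact_mod_cast this
      exact Finset.mem_Icc.2 (abs_le.1 h1)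

lemma orbitSum_eq_sum {F : ℝ → ℂ} {x y : B} {θ : ℝ} (hθ : ψ θ x = y) (R : Finset ℝ)
    (h1 : ∀ r ∈ R, ψ r x = x) (h2 : ∀ r, ψ r x = x → F (θ + r) ≠ 0 → r ∈ R) :
    orbitSum ψ F x y = ∑ r ∈ R, F (θ + r) := by
  classical
  have h3 : ∑ r ∈ R, F (θ + r) = ∑ t ∈ R.image (θ + ·), F t :=
    (Finset.sum_image fun r _ r' _ h => add_left_cancel h).symm
  rw [h3]
  refine finsum_mem_eq_sum_of_inter_support_eq (s := {t | ψ t x = y}) _ ?_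
  ext t
  simp only [mem_inter_iff, mem_ofPred_eq, Finset.coe_image, mem_image, Finset.mem_coe,
    Function.mem_support]
  constructor
  · rintro ⟨ht, h0⟩
    refine ⟨⟨t - θ, h2 _ ?_ (by rwa [add_sub_cancel]), by ring⟩, h0⟩
    rw [sub_eq_neg_add, hψ.map_add, ht, ← hθ, hψ.neg_apply]
  · rintro ⟨⟨r, hr, rfl⟩, h0⟩
    refine ⟨?_, h0⟩
    rw [hψ.map_add, h1 r hr, hθ]

lemma eventually_orbitSum_eq_zero [T2Space B] {M : Type*} [TopologicalSpace M]
    {X Y : M → B} {m : M} (hX : ContinuousAt X m) (hY : ContinuousAt Y m)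
    (hXY : ∀ t, ψ t (X m) ≠ Y m) (c d : ℝ) : ∀ᶠ z in 𝓝 m, ∀ F : ℝ → ℂ,
      (∀ t, t ∉ Icc c d → F t = 0) → orbitSum ψ F (X z) (Y z) = 0 := by
  have h1 : ∀ᶠ z in 𝓝 m, ∀ t ∈ Icc c d, ψ t (X z) ≠ Y z := by
    refine isCompact_Icc.eventually_forall_of_forall_eventually fun t _ => ?_
    have h2 : ContinuousAt (fun q : M × ℝ => ψ q.2 (X q.1)) (m, t) :=
      ContinuousAt.comp (g := fun q : ℝ × B => ψ q.1 q.2) (f := fun q : M × ℝ => (q.2, X q.1))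
        hψ.continuous.continuousAt (continuousAt_snd.prodMk
        (ContinuousAt.comp (g := X) hX continuousAt_fst))
    have h3 : ContinuousAt (fun q : M × ℝ => Y q.1) (m, t) :=
      ContinuousAt.comp (g := Y) hY continuousAt_fst
    have h4 : ∀ᶠ p : B × B in 𝓝 (ψ t (X m), Y m), p.1 ≠ p.2 :=
      (isOpen_ne_fun continuous_fst continuous_snd).mem_nhds (hXY t)
    exact (h2.prodMk h3).eventually h4
  filter_upwards [h1] with z hz F hF
  refine orbitSum_eq_zero fun t h0 => hz t ?_
  exact by_contra fun h => h0 (hF t h)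

lemma contMDiffAt_orbitSum [T2Space B] {E H M : Type*} [NormedAddCommGroup E] [NormedSpace ℝ E]
    [TopologicalSpace H] [TopologicalSpace M] [ChartedSpace H M] {J : ModelWithCorners ℝ E H}
    {F : M → ℝ → ℂ} {X Y : M → B} {m : M} {c d : ℝ}
    (hF : ∀ t, ContMDiffAt (J.prod 𝓘(ℝ, ℝ)) 𝓘(ℝ, ℂ) ∞ (fun q : M × ℝ => F q.1 q.2) (m, t))
    (hsupp : ∀ z t, t ∉ Icc c d → F z t = 0)
    (hX : ContMDiffAt J 𝓘(ℝ, ℝ) ∞ X m) (hY : ContMDiffAt J 𝓘(ℝ, ℝ) ∞ Y m)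
    (hXY : X m ∉ fixedPts ψ ∨ Y m ∉ fixedPts ψ) :
    ContMDiffAt J 𝓘(ℝ, ℂ) ∞ (fun z => orbitSum ψ (F z) (X z) (Y z)) m := by
  have hflow : ∀ t, ContMDiffAt J 𝓘(ℝ, ℝ) ∞ (fun z => ψ t (X z)) m := fun t =>
    ContMDiffAt.comp m (g := ψ t) (hψ.contMDiff_at_time t).contMDiffAt hX
  by_cases hcase : ∃ t, ψ t (X m) = Y m
  · obtain ⟨t₀, ht₀⟩ := hcase
    have hXm : X m ∉ fixedPts ψ := by
      rcases hXY with h | h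
      · exact h
      · intro h'
        rw [h' t₀] at ht₀
        exact h (ht₀ ▸ h')
    have hYm : Y m ∉ fixedPts ψ := ht₀ ▸ hψ.not_mem_fixedPts_flow hXm t₀
    obtain ⟨τ, hτ, hτ0, hτ1, -⟩ := hψ.exists_flowTime hYm
    let θ : M → ℝ := fun z => t₀ + (τ (Y z) - τ (ψ t₀ (X z)))
    have hθ : ContMDiffAt J 𝓘(ℝ, ℝ) ∞ θ m := by
      refine contMDiffAt_const.add (ContMDiffAt.sub (ContMDiffAt.comp m (g := τ) hτ hY) ?_)
      exact ContMDiffAt.comp m (g := τ) (f := fun z => ψ t₀ (X z)) (by rw [ht₀]; exact hτ)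
        (hflow t₀)
    have hθm : θ m = t₀ := by simp [θ, ht₀, hτ0]
    obtain ⟨R, hR1, hR2⟩ := hψ.exists_finset_returnTimes hXm (|c| + |d| + |t₀| + 1)
    have h1 : ContMDiffAt J 𝓘(ℝ, ℂ) ∞ (fun z => ∑ r ∈ R, F z (θ z + r)) m := by
      refine contMDiffAt_finsetSum fun r _ => ?_
      exact ContMDiffAt.comp m (g := fun q : M × ℝ => F q.1 q.2) (f := fun z => (z, θ z + r))
        (hF _) (contMDiffAt_id.prodMk (hθ.add contMDiffAt_const))
    refine h1.congr_of_eventuallyEq ?_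
    have e1 : ∀ᶠ z in 𝓝 m, ψ (τ (Y z)) (Y m) = Y z := hY.continuousAt.eventually hτ1
    have e2 : ∀ᶠ z in 𝓝 m, ψ (τ (ψ t₀ (X z))) (Y m) = ψ t₀ (X z) := by
      have := (hflow t₀).continuousAt
      rw [ContinuousAt, ht₀] at this
      exact this.eventually hτ1
    have e3 : ∀ᶠ z in 𝓝 m, |θ z - t₀| < 1 := by
      have := hθ.continuousAt.tendsto.sub_const t₀
      rw [hθm, sub_self] at this
      have h := this.abs
      rw [abs_zero] at h
      exact h.eventually (gt_mem_nhds one_pos)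
    have e4 : ∀ᶠ z in 𝓝 m, X z ∈ flowOrbit ψ (X m) :=
      hX.continuousAt.eventually (hψ.flowOrbit_mem_nhds hXm)
    filter_upwards [e1, e2, e3, e4] with z h1 h2 h3 h4
    refine hψ.orbitSum_eq_sum ?_ R (fun r hr => (hψ.flow_eq_self_iff_of_mem_orbit h4 r).2
      (hR1 r hr)) fun r hr h0 => hR2 r ((hψ.flow_eq_self_iff_of_mem_orbit h4 r).1 hr) ?_
    · have h5 : ψ (-τ (ψ t₀ (X z))) (ψ t₀ (X z)) = Y m :=
        (congrArg (ψ (-τ (ψ t₀ (X z)))) h2).symm.trans (hψ.neg_apply _ _)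
      simp only [θ]
      rw [add_comm, hψ.map_add, sub_eq_add_neg, hψ.map_add, h5, h1]
    · have h6 : θ z + r ∈ Icc c d := by_contra fun h => h0 (hsupp z _ h)
      have h7 := abs_lt.1 h3
      rw [abs_le]
      have := neg_abs_le c
      have := le_abs_self d
      have := neg_abs_le t₀
      have := le_abs_self t₀
      have := abs_nonneg c
      have := abs_nonneg d
      constructor <;> linarith [h6.1, h6.2]
  · push Not at hcase
    refine (contMDiffAt_const (c := (0 : ℂ))).congr_of_eventuallyEq ?_
    filter_upwards [hψ.eventually_orbitSum_eq_zero hX.continuousAt hY.continuousAt hcase c d]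
      with z hz using hz _ (hsupp z)

lemma exists_mem_flowDomain {O : Set B} (hO : O ∈ properOrbits ψ) {x₀ z : B} (hx₀ : x₀ ∈ O)
    (hz : z ∈ O) : ∃ u ∈ flowDomain ψ O, ψ u x₀ = z := by
  rw [hψ.eq_flowOrbit_of_mem hO hx₀] at hz
  obtain ⟨t, rfl⟩ := hz
  unfold flowDomain
  split_ifs with h
  · have hp := (hψ.flow_eq_self_iff h hx₀ 0).1
    obtain ⟨k, hk, -⟩ := existsUnique_add_zsmul_mem_Ico hp t 0
    rw [zero_add] at hk
    refine ⟨_, hk, ?_⟩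
    simp only
    rw [hψ.map_add, (hψ.flow_eq_self_iff h hx₀ _).2.2 ⟨k, by simp⟩]
  · exact ⟨t, mem_univ _, rfl⟩

lemma injOn_flowDomain {O : Set B} (hO : O ∈ properOrbits ψ) {x₀ : B} (hx₀ : x₀ ∈ O) :
    InjOn (fun u => ψ u x₀) (flowDomain ψ O) := by
  intro u hu v hv huv
  have h1 : ψ (u - v) x₀ = x₀ := by
    rw [sub_eq_neg_add, hψ.map_add, show ψ u x₀ = ψ v x₀ from huv, hψ.neg_apply]
  unfold flowDomain at hu hv
  split_ifs at hu hv with h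
  · obtain ⟨hp, h2⟩ := hψ.flow_eq_self_iff h hx₀ (u - v)
    obtain ⟨k, hk⟩ := h2.1 h1
    have h3 : |(k : ℝ) * orbitPeriod ψ O| < orbitPeriod ψ O := by
      rw [← hk, abs_lt]; constructor <;> linarith [hu.1, hu.2, hv.1, hv.2]
    rw [abs_mul, abs_of_pos hp, mul_lt_iff_lt_one_left hp] at h3
    have h4 : |k| < 1 := by exact_mod_cast h3
    rw [Int.abs_lt_one_iff.1 h4] at hk
    simpa [sub_eq_zero] using hk
  · have hinf : O ∈ infiniteOrbits ψ := by
      rw [hψ.properOrbits_eq] at hO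
      exact hO.resolve_left h
    exact sub_eq_zero.1 ((hψ.flow_eq_self_iff_of_infinite hinf hx₀ _).1 h1)

/-- An integral along the flow as an integral over the orbit. -/
lemma integral_mul_flow {O : Set B} (hO : O ∈ properOrbits ψ) {x₀ x : B} (hx₀ : x₀ ∈ O)
    (hx : x ∈ O) {F : ℝ → ℂ} {c d : ℝ} (hF : Continuous F) (hsupp : ∀ t, t ∉ Icc c d → F t = 0)
    {ξ : B → ℂ} (hξ : Continuous ξ) : ∫ t, F t * ξ (ψ t x) =
      ∫ u in flowDomain ψ O, orbitSum ψ F x (ψ u x₀) * ξ (ψ u x₀) := by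
  have hx' := hx
  rw [hψ.eq_flowOrbit_of_mem hO hx₀] at hx'
  obtain ⟨a, rfl⟩ := hx'
  have h1 : ∫ t, F t * ξ (ψ t (ψ a x₀)) = ∫ t, F (t - a) * ξ (ψ t x₀) := by
    rw [← integral_add_right_eq_self (fun t => F (t - a) * ξ (ψ t x₀)) a]
    simp only [add_sub_cancel_right, hψ.map_add]
  simp only at h1 hx ⊢
  rw [h1]
  have hθ : ∀ u, ψ (u - a) (ψ a x₀) = ψ u x₀ := fun u => by rw [← hψ.map_add, sub_add_cancel]
  have hint : Integrable fun t => F (t - a) * ξ (ψ t x₀) := by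
    refine Continuous.integrable_of_hasCompactSupport ?_ ?_
    · exact (hF.comp (by fun_prop)).mul (hξ.comp (hψ.contMDiff_orbit x₀).continuous)
    · refine HasCompactSupport.intro (K := Icc (c + a) (d + a)) isCompact_Icc fun t ht => ?_
      rw [hsupp (t - a) fun h => ht ⟨by linarith [h.1], by linarith [h.2]⟩, zero_mul]
  unfold flowDomain
  split_ifs with h
  · set p := orbitPeriod ψ O with hpdef
    have hp : 0 < p := (hψ.flow_eq_self_iff h hx₀ 0).1
    have hret : ∀ z ∈ O, ∀ t, ψ t z = z ↔ ∃ k : ℤ, t = k * p := fun z hz t =>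
      (hψ.flow_eq_self_iff h hz t).2
    let N : ℤ := ⌈(|c| + |d| + |a| + p) / p⌉
    have hN : ∀ (k : ℤ) (u : ℝ), u ∈ Ico 0 p → F (u - a + k * p) ≠ 0 → k ∈ Finset.Icc (-N) N := by
      intro k u hu h0
      have h6 : u - a + k * p ∈ Icc c d := by_contra fun h => h0 (hsupp _ h)
      have h7 : |(k : ℝ) * p| ≤ |c| + |d| + |a| + p := by
        rw [abs_le]
        have := neg_abs_le c
        have := le_abs_self d
        have := neg_abs_le a
        have := le_abs_self a
        have := abs_nonneg c
        have := abs_nonneg d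
        constructor <;> linarith [h6.1, h6.2, hu.1, hu.2]
      rw [abs_mul, abs_of_pos hp, ← le_div_iff₀ hp] at h7
      have h8 : |k| ≤ N := by
        have : ((|k| : ℤ) : ℝ) ≤ (N : ℝ) := by
          push_cast
          exact h7.trans (Int.le_ceil _)
        exact_mod_cast this
      exact Finset.mem_Icc.2 (abs_le.1 h8)
    have h2 := hasSum_integral_translates hint hp
    have h3 : ∀ k ∉ Finset.Icc (-N) N,
        ∫ u in Ico 0 p, F (u + k * p - a) * ξ (ψ (u + k * p) x₀) = 0 := by
      intro k hk
      refine setIntegral_eq_zero_of_forall_eq_zero fun u hu => ?_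
      have : F (u + k * p - a) = 0 := by
        by_contra h0
        exact hk (hN k u hu (by rwa [show u - a + k * p = u + k * p - a by ring]))
      rw [this, zero_mul]
    rw [h2.unique (hasSum_sum_of_ne_finset_zero h3), ← integral_finsetSum]
    · refine setIntegral_congr_fun measurableSet_Ico fun u hu => ?_
      have h4 : ∀ k : ℤ, ψ (u + k * p) x₀ = ψ u x₀ := fun k => by
        rw [hψ.map_add, (hret x₀ hx₀ _).2 ⟨k, rfl⟩]
      have h5 : orbitSum ψ F (ψ a x₀) (ψ u x₀) =
          ∑ k ∈ Finset.Icc (-N) N, F (u - a + k * p) := by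
        classical
        rw [hψ.orbitSum_eq_sum (hθ u) ((Finset.Icc (-N) N).image fun k : ℤ => (k : ℝ) * p),
          Finset.sum_image]
        · intro k _ k' _ hkk
          exact_mod_cast mul_right_cancel₀ hp.ne' hkk
        · intro r hr
          obtain ⟨k, -, rfl⟩ := Finset.mem_image.1 hr
          exact (hret _ hx _).2 ⟨k, rfl⟩
        · intro r hr h0
          obtain ⟨k, rfl⟩ := (hret _ hx _).1 hr
          exact Finset.mem_image.2 ⟨k, hN k u hu h0, rfl⟩
      rw [h5, Finset.sum_mul]
      refine Finset.sum_congr rfl fun k _ => ?_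
      rw [h4, show u + k * p - a = u - a + k * p by ring]
    · intro k _
      exact (hint.comp_add_right (k * p)).integrableOn
  · have hinf : O ∈ infiniteOrbits ψ := by
      have hO' := hO
      rw [hψ.properOrbits_eq] at hO'
      exact hO'.resolve_left h
    rw [setIntegral_univ]
    refine integral_congr_ae (Eventually.of_forall fun u => ?_)
    simp only
    rw [hψ.orbitSum_eq_sum (hθ u) {0}]
    · simp
    · simp [hψ.map_zero]
    · intro r hr _
      exact Finset.mem_singleton.2 ((hψ.flow_eq_self_iff_of_infinite hinf hx r).1 hr)

/-- The time along an orbit, in a chart. -/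
lemma setIntegral_flowDomain_chart {O : Set B} (hO : O ∈ properOrbits ψ) {x₀ : B} (hx₀ : x₀ ∈ O)
    (he : e ∈ IsManifold.maximalAtlas 𝓘(ℝ, ℝ) ∞ B) (G : B → ℂ) (hG : ∀ b ∉ e.source, G b = 0) :
    ∫ u in flowDomain ψ O, G (ψ u x₀) =
      ∫ y in e.target ∩ e.symm ⁻¹' O, |chartSpeed e ψ y|⁻¹ • G (e.symm y) := by
  let s : Set ℝ := flowDomain ψ O ∩ {u | ψ u x₀ ∈ e.source}
  have hc : Continuous fun u => ψ u x₀ := (hψ.contMDiff_orbit x₀).continuous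
  have hs : MeasurableSet s :=
    (measurableSet_flowDomain ψ O).inter (e.open_source.preimage hc).measurableSet
  have hzero : ∀ u ∈ flowDomain ψ O \ s, G (ψ u x₀) = 0 := fun u hu =>
    hG _ fun h => hu.2 ⟨hu.1, h⟩
  have h1 : ∫ u in flowDomain ψ O, G (ψ u x₀) = ∫ u in s, G (ψ u x₀) :=
    setIntegral_eq_of_subset_of_forall_sdiff_eq_zero (f := fun u => G (ψ u x₀))
      (measurableSet_flowDomain ψ O) inter_subset_left hzero
  have himg : (fun u => e (ψ u x₀)) '' s = e.target ∩ e.symm ⁻¹' O := by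
    ext y
    constructor
    · rintro ⟨u, hu, rfl⟩
      refine ⟨e.map_source hu.2, ?_⟩
      rw [mem_preimage, e.left_inv hu.2, hψ.flow_mem_orbit_iff hO]
      exact hx₀
    · rintro ⟨hy, hyO⟩
      obtain ⟨u, hu, hux⟩ := hψ.exists_mem_flowDomain hO hx₀ hyO
      refine ⟨u, ⟨hu, ?_⟩, ?_⟩
      · rw [mem_ofPred_eq, hux]; exact e.map_target hy
      · simp only [hux]; exact e.right_inv hy
  have hinj : InjOn (fun u => e (ψ u x₀)) s := fun u hu v hv huv =>
    hψ.injOn_flowDomain hO hx₀ hu.1 hv.1 (e.injOn hu.2 hv.2 huv)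
  rw [h1, ← himg, integral_image_eq_integral_abs_deriv_smul hs
    (fun u hu => (hψ.hasDerivAt_orbit_chart he hu.2).hasDerivWithinAt) hinj]
  refine setIntegral_congr_fun hs fun u hu => ?_
  have hne : chartSpeed e ψ (e (ψ u x₀)) ≠ 0 := fun h =>
    hψ.not_mem_fixedPts_of_mem_orbit hO ((hψ.flow_mem_orbit_iff hO u).2 hx₀)
      (hψ.mem_fixedPts_of_chartSpeed_eq_zero he hu.2 h)
  rw [e.left_inv hu.2, smul_smul, mul_inv_cancel₀ (abs_ne_zero.2 hne), one_smul]

lemma integral_mul_flow_chart [T2Space B] {x : B} (hx : x ∉ fixedPts ψ)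
    (he : e ∈ IsManifold.maximalAtlas 𝓘(ℝ, ℝ) ∞ B) {F : ℝ → ℂ} {c d : ℝ} (hF : Continuous F)
    (hsupp : ∀ t, t ∉ Icc c d → F t = 0) {ξ : B → ℂ} (hξ : Continuous ξ)
    (h0 : ∀ b ∉ e.source, ξ b = 0) : ∫ t, F t * ξ (ψ t x) =
      ∫ y in e.target, |chartSpeed e ψ y|⁻¹ • (orbitSum ψ F x (e.symm y) * ξ (e.symm y)) := by
  have hO : flowOrbit ψ x ∈ properOrbits ψ := ⟨x, hx, rfl⟩
  have hx' := hψ.mem_flowOrbit_self x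
  rw [hψ.integral_mul_flow hO hx' hx' hF hsupp hξ, hψ.setIntegral_flowDomain_chart hO hx' he
    (fun b => orbitSum ψ F x b * ξ b) fun b hb => by rw [h0 b hb, mul_zero]]
  refine (setIntegral_eq_of_subset_of_forall_sdiff_eq_zero e.open_target.measurableSet
    inter_subset_left fun y hy => ?_).symm
  rw [orbitSum_eq_zero, zero_mul, smul_zero]
  exact fun t _ h => hy.2 ⟨hy.1, t, h⟩

end IsSmoothFlow

section Bump

variable {B : Type*} [TopologicalSpace B] [ChartedSpace ℝ B] [IsManifold 𝓘(ℝ, ℝ) ∞ B]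
  [CompactSpace B] [T2Space B]

lemma exists_smooth_bump {x : B} {N : Set B} (hN : N ∈ 𝓝 x) : ∃ β : B → ℝ,
    ContMDiff 𝓘(ℝ, ℝ) 𝓘(ℝ, ℝ) ∞ β ∧ (∀ᶠ z in 𝓝 x, β z = 1) ∧ tsupport β ⊆ N ∧
      ∀ z, β z ∈ Icc 0 1 := by
  obtain ⟨t, ht, htc, htN⟩ := exists_mem_nhds_isClosed_subset hN
  obtain ⟨f, h1, h2, h3⟩ := exists_contMDiffMap_one_nhds_of_subset_interior (n := ⊤) 𝓘(ℝ, ℝ)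
    (isClosed_singleton (x := x)) (singleton_subset_iff.2 (mem_interior_iff_mem_nhds.2 ht))
  refine ⟨f, f.contMDiff, by rwa [nhdsSet_singleton] at h1, ?_, h3⟩
  refine (closure_minimal (fun z hz => ?_) htc).trans htN
  by_contra h
  exact hz (h2 z h)

lemma contMDiff_ofReal {E H M : Type*} [NormedAddCommGroup E] [NormedSpace ℝ E]
    [TopologicalSpace H] [TopologicalSpace M] [ChartedSpace H M] {J : ModelWithCorners ℝ E H}
    {f : M → ℝ} (hf : ContMDiff J 𝓘(ℝ, ℝ) ∞ f) : ContMDiff J 𝓘(ℝ, ℂ) ∞ fun x => (f x : ℂ) :=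
  Complex.ofRealCLM.contDiff.contMDiff.comp hf

lemma exists_finite_partition (U : B → Set B) (hU : ∀ b, U b ∈ 𝓝 b) :
    ∃ (s : Finset B) (ζ : B → B → ℂ), (∀ i, ContMDiff 𝓘(ℝ, ℝ) 𝓘(ℝ, ℂ) ∞ (ζ i)) ∧
      (∀ i, tsupport (ζ i) ⊆ U i) ∧ ∀ x, ∑ i ∈ s, ζ i x = 1 := by
  classical
  obtain ⟨f, hf⟩ := SmoothPartitionOfUnity.exists_isSubordinate (ι := B) 𝓘(ℝ, ℝ)
    (isClosed_univ (X := B)) (fun b => interior (U b)) (fun b => isOpen_interior) fun x _ =>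
      mem_iUnion.2 ⟨x, mem_interior_iff_mem_nhds.2 (hU x)⟩
  have hfin := f.locallyFinite.finite_nonempty_of_compact
  refine ⟨hfin.toFinset, fun i x => (f i x : ℂ), fun i => contMDiff_ofReal (f i).contMDiff,
    fun i => ?_, fun x => ?_⟩
  · refine Subset.trans ?_ ((hf i).trans interior_subset)
    refine closure_mono fun x hx => ?_
    simp only [Function.mem_support, ne_eq, Complex.ofReal_eq_zero] at hx
    exact hx
  · rw [← Complex.ofReal_sum, ← finsum_eq_sum_of_support_subset, f.sum_eq_one (mem_univ x),
      Complex.ofReal_one]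
    intro i hi
    rw [Finset.mem_coe, hfin.mem_toFinset]
    exact ⟨x, hi⟩

end Bump

section Density

variable {B : Type*} [TopologicalSpace B] [ChartedSpace ℝ B] [IsManifold 𝓘(ℝ, ℝ) ∞ B]
  [MeasurableSpace B] [BorelSpace B] {μ : Measure B} (hμ : IsSmoothDensity μ)

include hμ

/-- The density in a chart, and integrals computed in the chart. -/
lemma IsSmoothDensity.exists_chart {e : OpenPartialHomeomorph B ℝ}
    (he : e ∈ IsManifold.maximalAtlas 𝓘(ℝ, ℝ) ∞ B) : ∃ ρ : ℝ → ℝ, ContDiffOn ℝ ∞ ρ e.target ∧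
      (∀ x ∈ e.target, 0 < ρ x) ∧
      (∀ G : B → ℂ, ContinuousOn G e.source → (∀ b ∉ e.source, G b = 0) →
        ∫ b, G b ∂μ = ∫ y in e.target, ρ y • G (e.symm y)) ∧
      ∀ S : Set ℝ, MeasurableSet S → μ (e.source ∩ e ⁻¹' S) =
        ∫⁻ y in S ∩ e.target, ENNReal.ofReal (ρ y) := by
  obtain ⟨ρ, hρ, hpos, hmap⟩ := hμ e he
  have hem : AEMeasurable e (μ.restrict e.source) :=
    e.continuousOn.aemeasurable e.open_source.measurableSet
  have hρm : AEMeasurable ρ (volume.restrict e.target) :=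
    hρ.continuousOn.aemeasurable e.open_target.measurableSet
  refine ⟨ρ, hρ, hpos, fun G hG h0 => ?_, fun S hS => ?_⟩
  · have h1 : ∫ b, G b ∂μ = ∫ b in e.source, G (e.symm (e b)) ∂μ := by
      rw [← setIntegral_eq_integral_of_forall_compl_eq_zero h0]
      exact setIntegral_congr_fun e.open_source.measurableSet fun b hb => by rw [e.left_inv hb]
    have hmeas : AEStronglyMeasurable (fun y => G (e.symm y)) ((μ.restrict e.source).map e) := by
      rw [hmap]
      refine AEStronglyMeasurable.mono_ac (withDensity_absolutelyContinuous _ _) ?_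
      exact (hG.comp e.continuousOn_symm fun y hy => e.map_target hy).aestronglyMeasurable
        e.open_target.measurableSet
    rw [h1, ← integral_map hem hmeas, hmap, integral_withDensity_eq_integral_toReal_smul₀
      hρm.ennreal_ofReal (Eventually.of_forall fun y => ENNReal.ofReal_lt_top)]
    refine setIntegral_congr_fun e.open_target.measurableSet fun y hy => ?_
    rw [ENNReal.toReal_ofReal (hpos y hy).le]
  · have h1 := Measure.map_apply_of_aemeasurable hem hS
    rw [hmap, withDensity_apply _ hS, Measure.restrict_restrict hS] at h1
    rw [h1]
    exact (Measure.restrict_apply' e.open_source.measurableSet).symm ▸ by rw [inter_comm]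

lemma IsSmoothDensity.exists_nhds_lt (b : B) {ε : ENNReal} (hε : ε ≠ 0) :
    ∃ N ∈ 𝓝 b, μ N < ε := by
  obtain ⟨ρ, hρ, hpos, -, hS⟩ := hμ.exists_chart (IsManifold.chart_mem_maximalAtlas b)
  set e := chartAt ℝ b
  have hb : b ∈ e.source := mem_chart_source ℝ b
  have hy := e.map_source hb
  have hc : ContinuousAt ρ (e b) := hρ.continuousOn.continuousAt (e.open_target.mem_nhds hy)
  obtain ⟨r, hr, hball⟩ := Metric.eventually_nhds_iff_ball.1
    (hc.eventually (gt_mem_nhds (lt_add_one (ρ (e b)))))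
  have hlim : Tendsto (fun r : ℝ => ENNReal.ofReal (ρ (e b) + 1) * ENNReal.ofReal (2 * r))
      (𝓝[>] 0) (𝓝 0) := by
    have h1 : Tendsto (fun r : ℝ => ENNReal.ofReal (2 * r)) (𝓝[>] 0) (𝓝 0) := by
      have := (ENNReal.continuous_ofReal.comp (continuous_const_mul (2 : ℝ))).tendsto 0
      simp only [Function.comp, mul_zero, ENNReal.ofReal_zero] at this
      exact this.mono_left nhdsWithin_le_nhds
    have h2 := ENNReal.Tendsto.const_mul (a := ENNReal.ofReal (ρ (e b) + 1)) h1
      (Or.inr ENNReal.ofReal_ne_top)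
    rwa [mul_zero] at h2
  obtain ⟨r', hr', hr'0, hr'r⟩ := ((hlim.eventually (gt_mem_nhds (pos_iff_ne_zero.2 hε))).and
    (Ioo_mem_nhdsGT hr)).exists
  refine ⟨e.source ∩ e ⁻¹' Metric.ball (e b) r', inter_mem (e.open_source.mem_nhds hb)
    ((e.continuousAt hb).preimage_mem_nhds (Metric.ball_mem_nhds _ hr'0)), ?_⟩
  rw [hS _ Metric.isOpen_ball.measurableSet]
  refine lt_of_le_of_lt ?_ hr'
  calc ∫⁻ y in Metric.ball (e b) r' ∩ e.target, ENNReal.ofReal (ρ y)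
      ≤ ∫⁻ y in Metric.ball (e b) r', ENNReal.ofReal (ρ y) :=
        lintegral_mono_set inter_subset_left
    _ ≤ ∫⁻ y in Metric.ball (e b) r', ENNReal.ofReal (ρ (e b) + 1) := by
        refine setLIntegral_mono' Metric.isOpen_ball.measurableSet fun y hy => ?_
        exact ENNReal.ofReal_le_ofReal (hball y (Metric.ball_subset_ball hr'r.le hy)).le
    _ = _ := by rw [setLIntegral_const, Real.volume_ball]

lemma IsSmoothDensity.isFiniteMeasure [CompactSpace B] : IsFiniteMeasure μ := by
  refine ⟨isCompact_univ.measure_lt_top_of_nhdsWithin fun b _ => ?_⟩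
  obtain ⟨N, hN, hlt⟩ := hμ.exists_nhds_lt b one_ne_zero
  exact ⟨N, mem_nhdsWithin_of_mem_nhds hN, hlt.trans ENNReal.one_lt_top⟩

lemma IsSmoothDensity.isOpenPosMeasure : μ.IsOpenPosMeasure := by
  refine ⟨fun U hU ⟨b, hbU⟩ h0 => ?_⟩
  obtain ⟨ρ, hρ, hpos, -, hS⟩ := hμ.exists_chart (IsManifold.chart_mem_maximalAtlas b)
  set e := chartAt ℝ b
  have hb : b ∈ e.source := mem_chart_source ℝ b
  have hopen : IsOpen (e.target ∩ e.symm ⁻¹' U) := e.isOpen_inter_preimage_symm hU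
  have h1 : μ (e.source ∩ e ⁻¹' (e.target ∩ e.symm ⁻¹' U)) = 0 := by
    refine measure_mono_null ?_ h0
    rintro z ⟨hz, -, hzU⟩
    rwa [mem_preimage, e.left_inv hz] at hzU
  rw [hS _ hopen.measurableSet, lintegral_eq_zero_iff' ?_, EventuallyEq,
    ae_restrict_iff' (hopen.inter e.open_target).measurableSet] at h1
  · have h2 : volume ((e.target ∩ e.symm ⁻¹' U) ∩ e.target) = 0 := by
      have h1' := ae_iff.1 h1
      refine measure_mono_null ?_ h1'
      intro y hy hcon
      have := hcon hy
      simp only [Pi.zero_apply, ENNReal.ofReal_eq_zero] at this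
      exact absurd (hpos y hy.2) (not_lt.2 this)
    refine ((hopen.inter e.open_target).measure_pos volume ⟨e b, ⟨e.map_source hb, ?_⟩,
      e.map_source hb⟩).ne' h2
    rw [mem_preimage, e.left_inv hb]; exact hbU
  · exact ((hρ.continuousOn.mono inter_subset_right).aemeasurable
      (hopen.inter e.open_target).measurableSet).ennreal_ofReal

/-- Integrals along the flow in terms of a smooth density. -/
lemma IsSmoothDensity.exists_flowWeight [CompactSpace B] [T2Space B] {ψ : ℝ → B → B}
    (hψ : IsSmoothFlow 𝓘(ℝ, ℝ) ψ) : ∃ w : B → ℂ,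
      (∀ b ∉ fixedPts ψ, ContMDiffAt 𝓘(ℝ, ℝ) 𝓘(ℝ, ℂ) ∞ w b) ∧
      ∀ x ∉ fixedPts ψ, ∀ (F : ℝ → ℂ) (c d : ℝ), ContDiff ℝ ∞ F → (∀ t, t ∉ Icc c d → F t = 0) →
        ∀ ξ : B → ℂ, Continuous ξ →
          Integrable (fun y => orbitSum ψ F x y * w y * ξ y) μ ∧
          ∫ t, F t * ξ (ψ t x) = ∫ y, orbitSum ψ F x y * w y * ξ y ∂μ := by
  have := hμ.isFiniteMeasure
  obtain ⟨s, ζ, hζ, hζU, hζ1⟩ := exists_finite_partition (fun b : B => (chartAt ℝ b).source)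
    fun b => (chartAt ℝ b).open_source.mem_nhds (mem_chart_source ℝ b)
  have hat : ∀ i : B, chartAt ℝ i ∈ IsManifold.maximalAtlas 𝓘(ℝ, ℝ) ∞ B := fun i =>
    IsManifold.chart_mem_maximalAtlas i
  choose ρ hρ hpos hint _ using fun i : B => hμ.exists_chart (hat i)
  let w : B → B → ℂ := fun i b => ζ i b *
    ((ρ i (chartAt ℝ i b) * |chartSpeed (chartAt ℝ i) ψ (chartAt ℝ i b)|)⁻¹ : ℝ)
  have hsp : ∀ i b, b ∉ fixedPts ψ → b ∈ (chartAt ℝ i).source →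
      chartSpeed (chartAt ℝ i) ψ (chartAt ℝ i b) ≠ 0 := fun i b hb hbi h =>
    hb (hψ.mem_fixedPts_of_chartSpeed_eq_zero (hat i) hbi h)
  have hw : ∀ i, ∀ b ∉ fixedPts ψ, ContMDiffAt 𝓘(ℝ, ℝ) 𝓘(ℝ, ℂ) ∞ (w i) b := by
    intro i b hb
    by_cases hbs : b ∈ tsupport (ζ i)
    · have hbi := hζU i hbs
      refine ContMDiffAt.mul_complex (hζ i).contMDiffAt ?_
      have hy := (chartAt ℝ i).map_source hbi
      have h1 : ContDiffAt ℝ ∞ (fun y => (((ρ i y * |chartSpeed (chartAt ℝ i) ψ y|)⁻¹ : ℝ) : ℂ))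
          (chartAt ℝ i b) := by
        refine Complex.ofRealCLM.contDiff.contDiffAt.comp _ (ContDiffAt.inv ?_ ?_)
        · refine ((hρ i).contDiffAt ((chartAt ℝ i).open_target.mem_nhds hy)).mul ?_
          exact (contDiffAt_abs (hsp i b hb hbi)).comp _ (hψ.contDiffAt_chartSpeed (hat i) hy)
        · exact mul_ne_zero (hpos i _ hy).ne' (abs_ne_zero.2 (hsp i b hb hbi))
      exact ContMDiffAt.comp b (g := fun y =>
        (((ρ i y * |chartSpeed (chartAt ℝ i) ψ y|)⁻¹ : ℝ) : ℂ)) h1.contMDiffAt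
        (contMDiffAt_of_mem_atlas (hat i) hbi)
    · refine (contMDiffAt_const (c := (0 : ℂ))).congr_of_eventuallyEq ?_
      filter_upwards [notMem_tsupport_iff_eventuallyEq.1 hbs] with z hz
      simp [w, hz]
  refine ⟨fun b => ∑ i ∈ s, w i b, fun b hb => contMDiffAt_finsetSum fun i _ => hw i b hb, ?_⟩
  intro x hx F c d hF hsupp ξ hξ
  have hcont : ∀ i, Continuous fun y => orbitSum ψ F x y * w i y * ξ y := by
    intro i
    refine continuous_iff_continuousAt.2 fun y => ?_
    by_cases hy : y ∈ fixedPts ψ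
    · have h1 := hψ.eventually_orbitSum_eq_zero (X := fun _ : B => x) (Y := id) (m := y)
        continuousAt_const continuousAt_id (fun t h => hψ.not_mem_fixedPts_flow hx t
          (by rw [h]; exact hy)) c d
      refine (continuousAt_const (y := (0 : ℂ))).congr ?_
      filter_upwards [h1] with z hz
      have := hz F hsupp
      simp only [id] at this
      rw [this, zero_mul, zero_mul]
    · have h1 : ContMDiffAt 𝓘(ℝ, ℝ) 𝓘(ℝ, ℂ) ∞ (fun z => orbitSum ψ F x z) y :=
        hψ.contMDiffAt_orbitSum (F := fun _ => F) (X := fun _ => x) (Y := id) (c := c) (d := d)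
          (fun t => hF.contMDiff.contMDiffAt.comp _ contMDiffAt_snd) (fun _ => hsupp)
          contMDiffAt_const contMDiffAt_id (Or.inl hx)
      exact (h1.continuousAt.mul (hw i y hy).continuousAt).mul hξ.continuousAt
  have hi : ∀ i, Integrable (fun y => orbitSum ψ F x y * w i y * ξ y) μ := fun i =>
    (hcont i).integrable_of_hasCompactSupport (HasCompactSupport.of_compactSpace _)
  have hsum : ∀ y, orbitSum ψ F x y * (∑ i ∈ s, w i y) * ξ y =
      ∑ i ∈ s, orbitSum ψ F x y * w i y * ξ y := fun y => by
    rw [Finset.mul_sum, Finset.sum_mul]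
  simp only [hsum]
  refine ⟨integrable_finsetSum _ fun i _ => hi i, ?_⟩
  rw [integral_finsetSum _ fun i _ => hi i]
  have horb : Continuous fun t => ψ t x := (hψ.contMDiff_orbit x).continuous
  have hζc : ∀ i, Continuous (ζ i) := fun i => (hζ i).continuous
  have h1 : ∫ t, F t * ξ (ψ t x) = ∑ i ∈ s, ∫ t, F t * (ζ i (ψ t x) * ξ (ψ t x)) := by
    rw [← integral_finsetSum]
    · refine integral_congr_ae (Eventually.of_forall fun t => ?_)
      simp only
      rw [← Finset.mul_sum, ← Finset.sum_mul, hζ1, one_mul]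
    · intro i _
      refine Continuous.integrable_of_hasCompactSupport ?_ ?_
      · exact hF.continuous.mul (((hζc i).comp horb).mul (hξ.comp horb))
      · exact HasCompactSupport.intro (K := Icc c d) isCompact_Icc fun t ht => by
          rw [hsupp t ht, zero_mul]
  rw [h1]
  refine Finset.sum_congr rfl fun i _ => ?_
  have hζ0 : ∀ b ∉ (chartAt ℝ i).source, ζ i b = 0 := fun b hb =>
    image_eq_zero_of_notMem_tsupport fun h => hb (hζU i h)
  rw [hψ.integral_mul_flow_chart hx (hat i) hF.continuous hsupp
    (ξ := fun b => ζ i b * ξ b) ((hζc i).mul hξ) (fun b hb => by rw [hζ0 b hb, zero_mul]),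
    hint i _ (hcont i).continuousOn fun b hb => by simp [w, hζ0 b hb]]
  refine setIntegral_congr_fun (chartAt ℝ i).open_target.measurableSet fun y hy => ?_
  simp only [w, (chartAt ℝ i).right_inv hy, Complex.real_smul]
  have : (ρ i y : ℂ) ≠ 0 := by exact_mod_cast (hpos i y hy).ne'
  push_cast
  field_simp

end Density

/-- The kernel of `f` in terms of the time along the flow. -/
def arrowKernel {B : Type*} [TopologicalSpace B] (A : Set (GermArrow B)) (ψ : ℝ → B → B)
    (f : GermArrow B → ℝ → ℂ) (b b' : B) : ℂ :=
  ∑ᶠ (γ : GermArrow B) (_ : γ ∈ A ∧ γ.tgt = b), orbitSum ψ (f γ) γ.src b'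

namespace IsFlowGroupoid

variable {B : Type*} [TopologicalSpace B] [ChartedSpace ℝ B] [IsManifold 𝓘(ℝ, ℝ) ∞ B]
  {A : Set (GermArrow B)}
  {ψ : ℝ → B → B} (G : IsFlowGroupoid A ψ) {f : GermArrow B → ℝ → ℂ}

include G

lemma posConv_contDiff (hf : f ∈ posConvAlgebra A) (γ : GermArrow B) : ContDiff ℝ ∞ (f γ) := by
  by_cases hγ : γ ∈ A
  · rw [← contMDiff_iff_contDiff]
    intro t
    have h := G.posConv_contMDiffAt hf (J := 𝓘(ℝ, ℝ)) (h := γ.rep) (X := fun _ : ℝ => γ.src)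
      (S := id) (m := t) (by rwa [sect_rep]) contMDiffAt_const contMDiffAt_id
    simp only [sect_rep] at h
    exact h
  · rw [posConv_eq_zero hf hγ]; exact contDiff_const

omit [ChartedSpace ℝ B] [IsManifold 𝓘(ℝ, ℝ) ∞ B] G in
lemma arrowKernel_eq_sum {b : B} (S : Finset (GermArrow B)) (h1 : ∀ γ ∈ S, γ ∈ A ∧ γ.tgt = b)
    (h2 : ∀ γ ∈ A, γ.tgt = b → f γ ≠ 0 → γ ∈ S) (b' : B) :
    arrowKernel A ψ f b b' = ∑ γ ∈ S, orbitSum ψ (f γ) γ.src b' := by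
  refine finsum_mem_eq_sum_of_inter_support_eq (s := {γ | γ ∈ A ∧ γ.tgt = b}) _ ?_
  ext γ
  constructor
  · rintro ⟨⟨hγ, hb⟩, hs⟩
    refine ⟨h2 γ hγ hb fun h0 => hs ?_, hs⟩
    exact orbitSum_eq_zero fun t ht => absurd (by rw [h0]; rfl) ht
  · rintro ⟨hγ, hs⟩
    exact ⟨h1 γ hγ, hs⟩

lemma exists_arrowKernel_local [T2Space B] [T2Space A] (hf : f ∈ posConvAlgebra A) (b₀ : B) :
    ∃ S : Finset (GermArrow B), (∀ γ ∈ S, γ ∈ A ∧ γ.tgt = b₀) ∧ ∀ᶠ b in 𝓝 b₀, ∀ b',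
      arrowKernel A ψ f b b' =
        ∑ γ ∈ S, orbitSum ψ (f (γ.tgtSect A b)) ((γ.inv A).rep b) b' := by
  obtain ⟨L, hL, hLA, h0⟩ := posConv_exists_compact hf
  obtain ⟨S, hS, -, h⟩ := G.exists_local_fiber hL hLA b₀
  refine ⟨S, hS, ?_⟩
  filter_upwards [h] with b hb b'
  exact hb (fun γ => orbitSum ψ (f γ) γ.src b') fun a ha =>
    orbitSum_eq_zero fun t ht => absurd (by rw [h0 a ha]; rfl) ht

lemma contMDiffAt_rep_inv {γ : GermArrow B} (hγ : γ ∈ A) :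
    ContMDiffAt 𝓘(ℝ, ℝ) 𝓘(ℝ, ℝ) ∞ (γ.inv A).rep γ.tgt :=
  G.contMDiffAt (G.sect_rep_inv_mem hγ)

lemma contMDiffAt_arrowKernel [T2Space B] [T2Space A] (hf : f ∈ posConvAlgebra A) {b b' : B}
    (hb : b ∉ fixedPts ψ ∨ b' ∉ fixedPts ψ) :
    ContMDiffAt (𝓘(ℝ, ℝ).prod 𝓘(ℝ, ℝ)) 𝓘(ℝ, ℂ) ∞
      (fun q : B × B => arrowKernel A ψ f q.1 q.2) (b, b') := by
  obtain ⟨S, hS, hloc⟩ := G.exists_arrowKernel_local hf b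
  obtain ⟨c, d, -, hcd⟩ := posConv_exists_bounds hf
  have hfst : Tendsto (Prod.fst : B × B → B) (𝓝 (b, b')) (𝓝 b) := continuousAt_fst
  have h1 : ContMDiffAt (𝓘(ℝ, ℝ).prod 𝓘(ℝ, ℝ)) 𝓘(ℝ, ℂ) ∞ (fun q : B × B =>
      ∑ γ ∈ S, orbitSum ψ (f (γ.tgtSect A q.1)) ((γ.inv A).rep q.1) q.2) (b, b') := by
    refine contMDiffAt_finsetSum fun γ hγ => ?_
    obtain ⟨hγA, rfl⟩ := hS γ hγ
    have hX : ContMDiffAt (𝓘(ℝ, ℝ).prod 𝓘(ℝ, ℝ)) 𝓘(ℝ, ℝ) ∞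
        (fun q : B × B => (γ.inv A).rep q.1) (γ.tgt, b') :=
      ContMDiffAt.comp (γ.tgt, b') (g := (γ.inv A).rep) (f := Prod.fst)
        (G.contMDiffAt_rep_inv hγA) contMDiffAt_fst
    refine G.isSmoothFlow.contMDiffAt_orbitSum (c := c) (d := d) (fun t => ?_)
      (fun q t ht => hcd _ _ ht) hX contMDiffAt_snd ?_
    · refine G.posConv_contMDiffAt hf (m := ((γ.tgt, b'), t))
        (X := fun q : (B × B) × ℝ => (γ.inv A).rep q.1.1) (S := Prod.snd) ?_ ?_ contMDiffAt_snd
      · simp only [G.rep_inv_tgt hγA, sect_rep]; exact hγA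
      · exact ContMDiffAt.comp ((γ.tgt, b'), t) (g := fun q : B × B => (γ.inv A).rep q.1)
          (f := Prod.fst) hX contMDiffAt_fst
    · simp only [G.rep_inv_tgt hγA, G.src_mem_fixedPts_iff hγA]
      exact hb
  refine h1.congr_of_eventuallyEq ?_
  filter_upwards [hfst.eventually hloc] with q hq using hq _

lemma orbitSum_eq_zero_of_fixedPts {F : ℝ → ℂ} {x y : B}
    (h : x ∈ fixedPts ψ ∧ y ∉ fixedPts ψ ∨ x ∉ fixedPts ψ ∧ y ∈ fixedPts ψ) :
    orbitSum ψ F x y = 0 := by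
  refine orbitSum_eq_zero fun t _ ht => ?_
  rcases h with ⟨h1, h2⟩ | ⟨h1, h2⟩
  · rw [h1 t] at ht
    exact h2 (ht ▸ h1)
  · exact G.isSmoothFlow.not_mem_fixedPts_flow h1 t (ht ▸ h2)

/-- The kernel vanishes near the pairs formed by a fixed point and a point that is not fixed. -/
lemma eventually_arrowKernel_eq_zero [T2Space B] [T2Space A] (hf : f ∈ posConvAlgebra A) {b b' : B}
    (h : b ∈ fixedPts ψ ∧ b' ∉ fixedPts ψ ∨ b ∉ fixedPts ψ ∧ b' ∈ fixedPts ψ) :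
    ∀ᶠ q : B × B in 𝓝 (b, b'), arrowKernel A ψ f q.1 q.2 = 0 := by
  obtain ⟨S, hS, hloc⟩ := G.exists_arrowKernel_local hf b
  obtain ⟨c, d, -, hcd⟩ := posConv_exists_bounds hf
  have hfst : Tendsto (Prod.fst : B × B → B) (𝓝 (b, b')) (𝓝 b) := continuousAt_fst
  have h1 : ∀ᶠ q : B × B in 𝓝 (b, b'), ∀ γ ∈ S,
      orbitSum ψ (f (γ.tgtSect A q.1)) ((γ.inv A).rep q.1) q.2 = 0 := by
    refine (Finset.eventually_all S).2 fun γ hγ => ?_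
    obtain ⟨hγA, rfl⟩ := hS γ hγ
    have h2 := G.isSmoothFlow.eventually_orbitSum_eq_zero (m := (γ.tgt, b'))
      (X := fun q : B × B => (γ.inv A).rep q.1) (Y := Prod.snd)
      (ContinuousAt.comp (g := (γ.inv A).rep) (f := Prod.fst)
        (G.contMDiffAt_rep_inv hγA).continuousAt continuousAt_fst) continuousAt_snd
      (fun t ht => ?_) c d
    · filter_upwards [h2] with q hq using hq _ (hcd _)
    · simp only [G.rep_inv_tgt hγA] at ht
      rw [← G.src_mem_fixedPts_iff hγA] at h
      rcases h with ⟨h1, h2⟩ | ⟨h1, h2⟩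
      · rw [h1 t] at ht
        exact h2 (ht ▸ h1)
      · exact G.isSmoothFlow.not_mem_fixedPts_flow h1 t (ht ▸ h2)
  filter_upwards [hfst.eventually hloc, h1] with q hq1 hq2
  rw [hq1]
  exact Finset.sum_eq_zero hq2

/-- The distributional kernel is smooth away from the pairs of fixed points. -/
lemma isSmoothKernelOn_distKernel [T2Space B] [CompactSpace B] [T2Space A] [MeasurableSpace B]
    [BorelSpace B] {μ : Measure B} (hμ : IsSmoothDensity μ) (hf : f ∈ posConvAlgebra A) :
    IsSmoothKernelOn μ (distKernel A ψ μ f) (fixedPts ψ ×ˢ fixedPts ψ)ᶜ := by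
  obtain ⟨w, hw, hwint⟩ := hμ.exists_flowWeight G.isSmoothFlow
  obtain ⟨c, d, -, hcd⟩ := posConv_exists_bounds hf
  refine ⟨fun q => arrowKernel A ψ f q.1 q.2 * w q.2, ?_, fun Ψ hΨ hW => ?_⟩
  · rintro ⟨b, b'⟩ hb
    refine ContMDiffAt.contMDiffWithinAt ?_
    by_cases hb' : b' ∈ fixedPts ψ
    · have hbf : b ∉ fixedPts ψ := fun h => hb ⟨h, hb'⟩
      refine (contMDiffAt_const (c := (0 : ℂ))).congr_of_eventuallyEq ?_
      filter_upwards [G.eventually_arrowKernel_eq_zero hf (Or.inr ⟨hbf, hb'⟩)] with q hq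
      rw [hq, zero_mul]
    · exact (G.contMDiffAt_arrowKernel hf (Or.inr hb')).mul_complex
        (ContMDiffAt.comp (b, b') (g := w) (f := Prod.snd) (hw b' hb') contMDiffAt_snd)
  · have hΨ0 : ∀ b ∈ fixedPts ψ, ∀ b' ∈ fixedPts ψ, Ψ (b, b') = 0 := fun b hb b' hb' =>
      image_eq_zero_of_notMem_tsupport fun h => hW h ⟨hb, hb'⟩
    have hΨ' : ContMDiff (𝓘(ℝ, ℝ).prod 𝓘(ℝ, ℝ)) 𝓘(ℝ, ℂ) ∞ Ψ := hΨ
    have hΨc : Continuous Ψ := hΨ'.continuous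
    refine integral_congr_ae (Eventually.of_forall fun b => ?_)
    change fiberIntegral A f (fun γ t => Ψ (b, ψ t γ.src)) b = _
    obtain ⟨S, hS, h1, -⟩ := G.exists_finset_fiber hf hf b
    rw [fiberIntegral_eq_sum S hS h1]
    simp only [arrowKernel_eq_sum S hS h1]
    by_cases hb : b ∈ fixedPts ψ
    · rw [Finset.sum_eq_zero, integral_eq_zero_of_ae]
      · refine Eventually.of_forall fun b' => ?_
        by_cases hb' : b' ∈ fixedPts ψ
        · simp [hΨ0 b hb b' hb']
        · simp only [Pi.zero_apply]
          rw [Finset.sum_eq_zero, zero_mul, zero_mul]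
          intro γ hγ
          refine G.orbitSum_eq_zero_of_fixedPts (Or.inl ⟨?_, hb'⟩)
          rw [G.src_mem_fixedPts_iff (hS γ hγ).1, (hS γ hγ).2]
          exact hb
      · intro γ hγ
        have hs : γ.src ∈ fixedPts ψ := by
          rw [G.src_mem_fixedPts_iff (hS γ hγ).1, (hS γ hγ).2]
          exact hb
        refine integral_eq_zero_of_ae (Eventually.of_forall fun t => ?_)
        simp only [Pi.zero_apply]
        rw [hs t, hΨ0 b hb _ hs, mul_zero]
    · have h2 : ∀ γ ∈ S, _ := fun γ hγ => hwint γ.src (by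
        rw [G.src_mem_fixedPts_iff (hS γ hγ).1, (hS γ hγ).2]; exact hb) (f γ) c d
        (G.posConv_contDiff hf γ) (hcd γ) (fun b' => Ψ (b, b')) (by fun_prop)
      rw [Finset.sum_congr rfl fun γ hγ => (h2 γ hγ).2,
        ← integral_finsetSum _ fun γ hγ => (h2 γ hγ).1]
      refine integral_congr_ae (Eventually.of_forall fun b' => ?_)
      simp only [Finset.sum_mul]

/-- The function supported by the units, where it depends on the time only. -/
lemma unitFunction_mem [CompactSpace B] [T2Space A] {g : ℝ → ℂ} (hg : ContDiff ℝ ∞ g) {c d : ℝ}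
    (hc : 0 < c) (hcd : ∀ t, t ∉ Icc c d → g t = 0) :
    (open Classical in fun (a : GermArrow B) t => if a = GermArrow.unit a.src then g t else 0) ∈
      posConvAlgebra A := by
  classical
  constructor
  · refine ⟨(GermArrow.unit '' univ) ×ˢ Icc c d,
      (isCompact_univ.image (continuous_sect id)).prod isCompact_Icc, ?_, ?_⟩
    · rintro ⟨_, t⟩ ⟨⟨b, -, rfl⟩, ht⟩
      exact ⟨G.unit_mem b, hc.trans_le ht.1⟩
    · intro a t hat
      simp only
      split_ifs with h
      · exact hcd t fun ht => hat ⟨⟨a.src, mem_univ _, h.symm⟩, ht⟩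
      · rfl
  · intro h U hU hUA
    rintro ⟨x, t⟩ ⟨hx, -⟩
    refine ContMDiffAt.contMDiffWithinAt ?_
    have hfst : Tendsto (Prod.fst : B × ℝ → B) (𝓝 (x, t)) (𝓝 x) := continuousAt_fst
    by_cases hxu : sect h x = GermArrow.unit x
    · have h1 : ∀ᶠ z in 𝓝 x, sect h z = GermArrow.unit z := by
        filter_upwards [(sect_eq_iff.1 hxu).2.eventually_nhds] with z hz using sect_congr hz
      refine (hg.contMDiff.contMDiffAt.comp (x, t) contMDiffAt_snd).congr_of_eventuallyEq ?_
      filter_upwards [hfst.eventually h1] with q hq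
      exact if_pos hq
    · have h1 : ∀ᶠ z in 𝓝 x, sect h z ≠ GermArrow.unit z := by
        obtain ⟨N, N', hN, hN', hxN, hxN', hd⟩ := t2_separation (show (⟨sect h x, hUA x hx⟩ : A) ≠
          ⟨GermArrow.unit x, G.unit_mem x⟩ from fun h => hxu (congrArg (·.1) h))
        have hmap := G.isOpen.isOpenMap_subtype_val
        filter_upwards [(continuous_sect h).continuousAt.eventually
          ((hmap N hN).mem_nhds ⟨_, hxN, rfl⟩), (continuous_sect id).continuousAt.eventually
          ((hmap N' hN').mem_nhds ⟨_, hxN', rfl⟩)] with z hz hz' heq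
        obtain ⟨a, ha, ha'⟩ := hz
        obtain ⟨a', ha₁, ha₁'⟩ := hz'
        have : a = a' := Subtype.ext (ha'.trans (heq.trans ha₁'.symm))
        exact disjoint_left.1 hd ha (this ▸ ha₁)
      refine (contMDiffAt_const (c := (0 : ℂ))).congr_of_eventuallyEq ?_
      filter_upwards [hfst.eventually h1] with q hq
      exact if_neg hq

/-- The kernel may be singular on the diagonal at the fixed points. -/
lemma exists_not_isSmoothKernelOn [T2Space B] [CompactSpace B] [T2Space A] [MeasurableSpace B]
    [BorelSpace B] {μ : Measure B} (hμ : IsSmoothDensity μ) {b : B} (hb : b ∈ fixedPts ψ) :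
    ∃ f ∈ posConvAlgebra A, ¬ ∃ W ∈ 𝓝 (b, b), IsOpen W ∧
      IsSmoothKernelOn μ (distKernel A ψ μ f) W := by
  classical
  have := hμ.isFiniteMeasure
  have := hμ.isOpenPosMeasure
  let B₀ : ContDiffBump (3 / 2 : ℝ) := ⟨1 / 4, 1 / 2, by norm_num, by norm_num⟩
  let g : ℝ → ℂ := fun t => (B₀.normed volume t : ℂ)
  have hg : ContDiff ℝ ∞ g := Complex.ofRealCLM.contDiff.comp B₀.contDiff_normed
  have hgs : ∀ t, t ∉ Icc (1 : ℝ) 2 → g t = 0 := fun t ht => by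
    have : t ∉ Function.support (B₀.normed volume) := by
      rw [B₀.support_normed_eq, Real.ball_eq_Ioo]
      intro h
      have h1 : B₀.rOut = 1 / 2 := rfl
      rw [h1] at h
      exact ht ⟨by linarith [h.1], by linarith [h.2]⟩
    simp only [g, Function.notMem_support.1 this, Complex.ofReal_zero]
  have hg1 : ∫ t, g t = 1 := by
    simp only [g]
    rw [integral_complex_ofReal, B₀.integral_normed, Complex.ofReal_one]
  refine ⟨_, G.unitFunction_mem hg one_pos hgs, ?_⟩
  rintro ⟨W, hW, hWo, κ, hκ, hk⟩
  have hκc : ContinuousAt κ (b, b) := (hκ.continuousOn).continuousAt hW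
  set M := ‖κ (b, b)‖ + 1 with hM
  have hM0 : 0 < M := by positivity
  have hbd : ∀ᶠ q in 𝓝 (b, b), ‖κ q‖ ≤ M ∧ q ∈ W :=
    ((hκc.norm.eventually (gt_mem_nhds (lt_add_one _))).mono fun q h => le_of_lt h).and hW
  obtain ⟨Q₁, hQ₁, Q₂, hQ₂, hQ⟩ := mem_nhds_prod_iff.1 hbd
  obtain ⟨N, hN, hμN⟩ := hμ.exists_nhds_lt b (ε := ENNReal.ofReal (1 / M))
    (by simpa using hM0)
  obtain ⟨β, hβ, hβ1, hβN, hβ01⟩ := exists_smooth_bump (inter_mem hN hQ₂)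
  have htube : ∀ᶠ z in 𝓝 b, ∀ t ∈ Icc (1 : ℝ) 2, β (ψ t z) = 1 := by
    refine isCompact_Icc.eventually_forall_of_forall_eventually fun t _ => ?_
    have h1 : Tendsto (fun q : B × ℝ => ψ q.2 q.1) (𝓝 (b, t)) (𝓝 b) := by
      have h2 := (G.isSmoothFlow.continuous_comp (X := B × ℝ) continuous_snd
        continuous_fst).tendsto (b, t)
      simpa only [hb t] using h2
    exact h1.eventually hβ1
  obtain ⟨α, hα, hα1, hαN, hα01⟩ := exists_smooth_bump (inter_mem hQ₁ htube)
  let Ψ : B × B → ℂ := fun q => (α q.1 : ℂ) * (β q.2 : ℂ)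
  have hΨ : ContMDiff (𝓘(ℝ, ℝ).prod 𝓘(ℝ, ℝ)) 𝓘(ℝ, ℂ) ∞ Ψ := fun q =>
    ContMDiffAt.mul_complex (((contMDiff_ofReal hα).comp contMDiff_fst) q)
      (((contMDiff_ofReal hβ).comp contMDiff_snd) q)
  have hΨs : tsupport Ψ ⊆ W := by
    refine (closure_minimal (t := tsupport α ×ˢ tsupport β) ?_
      ((isClosed_tsupport α).prod (isClosed_tsupport β))).trans fun q hq =>
        (hQ ⟨(hαN hq.1).1, (hβN hq.2).2⟩).2
    intro q hq
    refine ⟨subset_tsupport _ fun h => hq ?_, subset_tsupport _ fun h => hq ?_⟩ <;> simp [Ψ, h]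
  have key := hk Ψ hΨ hΨs
  have hL : distKernel A ψ μ (fun a t => if a = GermArrow.unit a.src then g t else 0) Ψ =
      ∫ b, (α b : ℂ) ∂μ := by
    refine integral_congr_ae (Eventually.of_forall fun z => ?_)
    change fiberIntegral A _ (fun γ t => Ψ (z, ψ t γ.src)) z = _
    rw [fiberIntegral_eq_sum {GermArrow.unit z} (by
      intro γ hγ
      rw [Finset.mem_singleton.1 hγ]
      exact ⟨G.unit_mem z, rfl⟩) (by
      intro γ hγ hz h0
      by_cases h : γ = GermArrow.unit γ.src
      · rw [Finset.mem_singleton, ← hz, h]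
        rfl
      · exact absurd (funext fun t => if_neg h) h0), Finset.sum_singleton]
    by_cases hz : α z = 0
    · simp [Ψ, hz]
    · have hz' := (hαN (subset_tsupport _ hz)).2
      have h1 : ∀ t, (if GermArrow.unit z = GermArrow.unit (GermArrow.unit z).src then g t else 0) *
          Ψ (z, ψ t (GermArrow.unit z).src) = g t * (α z : ℂ) := by
        intro t
        rw [if_pos (show GermArrow.unit z = GermArrow.unit (GermArrow.unit z).src from rfl)]
        by_cases ht : t ∈ Icc (1 : ℝ) 2
        · have h2 : β (ψ t z) = 1 := hz' t ht
          simp only [Ψ, GermArrow.unit, src_sect, h2, Complex.ofReal_one, mul_one]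
        · rw [hgs t ht, zero_mul, zero_mul]
      simp only [h1]
      rw [integral_mul_const, hg1, one_mul]
  have hαc : Continuous α := hα.continuous
  have hαint : Integrable α μ := hαc.integrable_of_hasCompactSupport (.of_compactSpace _)
  have hpos : 0 < ∫ b, α b ∂μ :=
    hαc.integral_pos_of_hasCompactSupport_nonneg_nonzero (.of_compactSpace _)
      (fun z => (hα01 z).1) (x := b) (by rw [hα1.self_of_nhds]; exact one_ne_zero)
  have hin : ∀ z, ‖∫ b', κ (z, b') * Ψ (z, b') ∂μ‖ ≤ α z * (M * μ.real (tsupport β)) := by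
    intro z
    have h1 := norm_integral_le_of_norm_le (μ := μ) (f := fun b' => κ (z, b') * Ψ (z, b'))
      (g := (tsupport β).indicator fun _ => M * α z)
      ((integrable_const _).indicator (isClosed_tsupport β).measurableSet)
      (Eventually.of_forall fun b' => ?_)
    · rw [integral_indicator_const _ (isClosed_tsupport β).measurableSet, smul_eq_mul] at h1
      linarith
    · by_cases hb' : b' ∈ tsupport β
      · rw [indicator_of_mem hb', norm_mul]
        by_cases hz : α z = 0
        · simp [Ψ, hz]
        · have h2 : ‖Ψ (z, b')‖ ≤ α z := by
            simp only [Ψ, norm_mul, Complex.norm_real, Real.norm_eq_abs,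
              abs_of_nonneg (hα01 z).1, abs_of_nonneg (hβ01 b').1]
            exact mul_le_of_le_one_right (hα01 z).1 (hβ01 b').2
          exact mul_le_mul (hQ (⟨(hαN (subset_tsupport _ hz)).1, (hβN hb').2⟩ :
            (z, b') ∈ Q₁ ×ˢ Q₂)).1 h2 (norm_nonneg _) hM0.le
      · rw [indicator_of_notMem hb']
        simp [Ψ, image_eq_zero_of_notMem_tsupport hb']
  have hout := norm_integral_le_of_norm_le (hαint.mul_const (M * μ.real (tsupport β)))
    (Eventually.of_forall hin)
  rw [← key, hL, integral_complex_ofReal, Complex.norm_real, integral_mul_const,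
    Real.norm_of_nonneg hpos.le] at hout
  have hlt : μ.real (tsupport β) < 1 / M := by
    refine ENNReal.toReal_lt_of_lt_ofReal ?_
    exact (measure_mono fun z hz => (hβN hz).1).trans_lt hμN
  have h1 : M * μ.real (tsupport β) < 1 := by
    rw [lt_div_iff₀ hM0] at hlt; linarith
  nlinarith

end IsFlowGroupoid

lemma integral_mul_mollifier (G : ℝ → ℂ) (χ : ℝ → ℝ) {ε : ℝ} (hε : 0 < ε) (x : ℝ) :
    ∫ y, G y * ((ε⁻¹ * χ ((y - x) / ε) : ℝ) : ℂ) = ∫ z, G (x + ε * z) * (χ z : ℂ) := by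
  rw [← integral_add_left_eq_self _ x]
  have h := Measure.integral_comp_mul_left
    (fun y => G (x + y) * ((ε⁻¹ * χ ((x + y - x) / ε) : ℝ) : ℂ)) ε
  rw [abs_of_pos (inv_pos.2 hε), eq_comm, inv_smul_eq_iff₀ hε.ne'] at h
  rw [h, ← integral_smul]
  refine integral_congr_ae (Eventually.of_forall fun z => ?_)
  simp only [Complex.real_smul, Complex.ofReal_mul, Complex.ofReal_inv]
  rw [show (x + ε * z - x) / ε = z by field_simp; ring]
  have : (ε : ℂ) ≠ 0 := by exact_mod_cast hε.ne'
  field_simp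

lemma HasCompactSupport.exists_pos_bound {χ : ℝ → ℝ} (hχ : HasCompactSupport χ) :
    ∃ R > 0, ∀ z, R < |z| → χ z = 0 := by
  obtain ⟨R, hR, h⟩ := hχ.isCompact.isBounded.subset_closedBall_lt 0 0
  refine ⟨R, hR, fun z hz => image_eq_zero_of_notMem_tsupport fun h' => ?_⟩
  have := mem_closedBall_zero_iff.1 (h h')
  rw [Real.norm_eq_abs] at this
  linarith

lemma eventually_pos_mul_lt (R : ℝ) {δ : ℝ} (hδ : 0 < δ) :
    ∀ᶠ ε : ℝ in 𝓝[>] 0, 0 < ε ∧ ε * R < δ := by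
  refine eventually_mem_nhdsWithin.and (mem_nhdsWithin_of_mem_nhds ?_)
  have : Tendsto (fun ε : ℝ => ε * R) (𝓝 0) (𝓝 (0 * R)) :=
    (by fun_prop : Continuous fun ε : ℝ => ε * R).tendsto 0
  exact this.eventually (gt_mem_nhds (by simpa using hδ))

/-- Convergence of the mollified restriction to the diagonal of a continuous function. -/
lemma tendsto_integral_mollifier {U C : Set ℝ} (hU : IsOpen U) (hC : IsCompact C) (hCU : C ⊆ U)
    {H : ℝ × ℝ → ℂ} (hH : ContinuousOn H (U ×ˢ U)) (h0 : ∀ x ∈ U, x ∉ C → ∀ y ∈ U, H (x, y) = 0)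
    {χ : ℝ → ℝ} (hχ : Continuous χ) (hχc : HasCompactSupport χ) (hχ1 : ∫ z, χ z = 1) :
    Tendsto (fun ε : ℝ => ∫ x in U, ∫ y in U, H (x, y) * ((ε⁻¹ * χ ((y - x) / ε) : ℝ) : ℂ))
      (𝓝[>] 0) (𝓝 (∫ x in U, H (x, x))) := by
  classical
  obtain ⟨R, hR, hχR⟩ := hχc.exists_pos_bound
  obtain ⟨δ, hδ, hδU⟩ := hC.exists_cthickening_subset_open hU hCU
  have hCδ : IsCompact (Metric.cthickening δ C) := hC.cthickening
  have hCC : C ⊆ Metric.cthickening δ C := Metric.self_subset_cthickening C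
  obtain ⟨M, hM⟩ := (hCδ.prod hCδ).exists_bound_of_continuousOn
    (hH.mono (prod_mono hδU hδU))
  set H' : ℝ × ℝ → ℂ := (U ×ˢ U).indicator H with hH'
  have hUU : IsOpen (U ×ˢ U) := hU.prod hU
  have hH'eq : ∀ x y, x ∈ U → y ∈ U → H' (x, y) = H (x, y) := fun x y hx hy =>
    indicator_of_mem (s := U ×ˢ U) (⟨hx, hy⟩ : (x, y) ∈ U ×ˢ U) H
  have hmeas : Measurable H' := by
    rw [hH', ← piecewise_eq_indicator]
    exact hH.measurable_piecewise continuousOn_const hUU.measurableSet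
  have hχi : Integrable (fun z => (χ z : ℂ)) := (hχ.integrable_of_hasCompactSupport hχc).ofReal
  let Φ : ℝ → ℝ × ℝ → ℂ := fun ε q => H' (q.1, q.1 + ε * q.2) * (χ q.2 : ℂ)
  let bound : ℝ × ℝ → ℝ := fun q => C.indicator (fun _ => M) q.1 * |χ q.2|
  have hbi : Integrable bound (volume.prod volume) :=
    ((integrable_indicator_iff hC.measurableSet).2 (integrableOn_const hC.measure_ne_top)).mul_prod
      (hχ.integrable_of_hasCompactSupport hχc).abs
  have hΦm : ∀ ε, AEStronglyMeasurable (Φ ε) (volume.prod volume) := fun ε =>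
    ((hmeas.comp (by fun_prop)).mul (by fun_prop)).aestronglyMeasurable
  have hΦb : ∀ ε ≥ 0, ε * R < δ → ∀ q, ‖Φ ε q‖ ≤ bound q := by
    intro ε hε hεR q
    by_cases hz : R < |q.2|
    · simp [Φ, bound, hχR _ hz]
    by_cases hx : q.1 ∈ C
    · simp only [Φ, bound, norm_mul, Complex.norm_real, Real.norm_eq_abs, indicator_of_mem hx]
      refine mul_le_mul_of_nonneg_right ?_ (abs_nonneg _)
      have hy : q.1 + ε * q.2 ∈ Metric.cthickening δ C := by
        refine Metric.mem_cthickening_of_dist_le _ q.1 δ C hx ?_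
        rw [Real.dist_eq, add_sub_cancel_left, abs_mul, abs_of_nonneg hε]
        exact (mul_le_mul_of_nonneg_left (not_lt.1 hz) hε).trans hεR.le
      rw [hH'eq _ _ (hCU hx) (hδU hy)]
      exact hM _ ⟨hCC hx, hy⟩
    · have : H' (q.1, q.1 + ε * q.2) = 0 := by
        rw [hH']
        exact indicator_apply_eq_zero.2 fun h => h0 _ h.1 hx _ h.2
      simp only [Φ, bound, this, indicator_of_notMem hx, zero_mul, norm_zero, le_refl]
  have hsmall := eventually_pos_mul_lt R hδ
  have hlim : Tendsto (fun ε => ∫ q, Φ ε q ∂(volume.prod volume)) (𝓝[>] 0)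
      (𝓝 (∫ q, Φ 0 q ∂(volume.prod volume))) := by
    refine tendsto_integral_filter_of_dominated_convergence bound
      (Eventually.of_forall hΦm) ?_ hbi (Eventually.of_forall fun q => ?_)
    · filter_upwards [hsmall] with ε hε using Eventually.of_forall (hΦb ε hε.1.le hε.2)
    · refine Tendsto.mul ?_ tendsto_const_nhds
      have ht : Tendsto (fun ε : ℝ => (q.1, q.1 + ε * q.2)) (𝓝[>] 0) (𝓝 (q.1, q.1 + 0 * q.2)) :=
        ((by fun_prop : Continuous fun ε : ℝ => (q.1, q.1 + ε * q.2)).tendsto 0).mono_left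
          nhdsWithin_le_nhds
      by_cases hx : q.1 ∈ U
      · have hmem : (q.1, q.1 + 0 * q.2) ∈ U ×ˢ U := ⟨hx, by simpa using hx⟩
        have hc : ContinuousAt H' (q.1, q.1 + 0 * q.2) := by
          refine (hH.continuousAt (hUU.mem_nhds hmem)).congr ?_
          filter_upwards [hUU.mem_nhds hmem] with z hz using (indicator_of_mem hz H).symm
        exact hc.tendsto.comp ht
      · have : ∀ y, H' (q.1, y) = 0 := fun y => indicator_of_notMem (fun h => hx h.1) _
        simp only [this]
        exact tendsto_const_nhds
  have hiter : ∀ ε ≥ 0, ε * R < δ → ∫ q, Φ ε q ∂(volume.prod volume) =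
      ∫ x, ∫ z, H' (x, x + ε * z) * (χ z : ℂ) := fun ε hε hεR =>
    integral_prod _ (hbi.mono' (hΦm ε) (Eventually.of_forall (hΦb ε hε hεR)))
  rw [hiter 0 le_rfl (by simpa using hδ)] at hlim
  have hend : ∫ x, ∫ z, H' (x, x + 0 * z) * (χ z : ℂ) = ∫ x in U, H (x, x) := by
    rw [← integral_indicator hU.measurableSet]
    refine integral_congr_ae (Eventually.of_forall fun x => ?_)
    simp only [zero_mul, add_zero]
    rw [integral_const_mul, integral_complex_ofReal, hχ1, Complex.ofReal_one, mul_one]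
    by_cases hx : x ∈ U
    · rw [indicator_of_mem hx, hH'eq _ _ hx hx]
    · rw [indicator_of_notMem hx, hH', indicator_of_notMem fun h => hx h.1]
  rw [hend] at hlim
  refine hlim.congr' ?_
  filter_upwards [hsmall] with ε hε
  rw [hiter ε hε.1.le hε.2, ← integral_indicator hU.measurableSet]
  refine integral_congr_ae (Eventually.of_forall fun x => ?_)
  simp only
  rw [← integral_mul_mollifier (fun y => H' (x, y)) χ hε.1 x]
  by_cases hx : x ∈ U
  · rw [indicator_of_mem hx, ← integral_indicator hU.measurableSet]
    refine integral_congr_ae (Eventually.of_forall fun y => ?_)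
    simp only
    by_cases hy : y ∈ U
    · rw [indicator_of_mem hy, hH'eq _ _ hx hy]
    · rw [indicator_of_notMem hy, hH', indicator_of_notMem fun h => hy h.2, zero_mul]
  · rw [indicator_of_notMem hx]
    have : ∀ y, H' (x, y) = 0 := fun y => indicator_of_notMem (fun h => hx h.1) _
    simp [this]

section

variable {B : Type*} [TopologicalSpace B] [ChartedSpace ℝ B] {e : OpenPartialHomeomorph B ℝ}

lemma chartMollifier_symm (χ : ℝ → ℝ) (ε x : ℝ) {y : ℝ} (hy : y ∈ e.target) :
    chartMollifier e χ ε x (e.symm y) = ((ε⁻¹ * χ ((y - x) / ε) : ℝ) : ℂ) := by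
  rw [chartMollifier, if_pos (e.map_target hy), e.right_inv hy]

lemma chartMollifier_eq_zero (χ : ℝ → ℝ) (ε x : ℝ) {b : B} (hb : b ∉ e.source) :
    chartMollifier e χ ε x b = 0 := if_neg hb

lemma exists_smooth_mollifier : ∃ χ : ℝ → ℝ, ContDiff ℝ ∞ χ ∧ HasCompactSupport χ ∧
    ∫ x, χ x = 1 := by
  let B₀ : ContDiffBump (0 : ℝ) := ⟨1, 2, by norm_num, by norm_num⟩
  exact ⟨B₀.normed volume, B₀.contDiff_normed, B₀.hasCompactSupport_normed, B₀.integral_normed⟩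

variable [IsManifold 𝓘(ℝ, ℝ) ∞ B] [CompactSpace B] [T2Space B]

lemma eventually_chartMollifier_eq_zero {K W : Set B} (hK : IsCompact K) (hKe : K ⊆ e.source)
    (hW : IsOpen W) (hKW : K ⊆ W) {χ : ℝ → ℝ} (hχc : HasCompactSupport χ) :
    ∃ K' : Set B, IsCompact K' ∧ K' ⊆ e.source ∩ W ∧
      ∀ᶠ ε : ℝ in 𝓝[>] 0, ∀ b ∈ K, ∀ b' ∉ K', chartMollifier e χ ε (e b) b' = 0 := by
  obtain ⟨R, hR, hχR⟩ := hχc.exists_pos_bound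
  have hC : IsCompact (e '' K) := hK.image_of_continuousOn (e.continuousOn.mono hKe)
  obtain ⟨δ, hδ, hδW⟩ := hC.exists_cthickening_subset_open (e.isOpen_inter_preimage_symm hW) (by
    rintro _ ⟨b, hb, rfl⟩
    exact ⟨e.map_source (hKe hb), by rw [mem_preimage, e.left_inv (hKe hb)]; exact hKW hb⟩)
  have hδU := hδW.trans inter_subset_left
  refine ⟨e.symm '' Metric.cthickening δ (e '' K), hC.cthickening.image_of_continuousOn
    (e.symm.continuousOn.mono hδU), ?_, ?_⟩
  · rintro _ ⟨y, hy, rfl⟩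
    exact ⟨e.map_target (hδU hy), (hδW hy).2⟩
  have hsmall := eventually_pos_mul_lt R hδ
  filter_upwards [hsmall] with ε hε b hb b' hb'
  by_cases hs : b' ∈ e.source
  · rw [chartMollifier, if_pos hs, hχR, mul_zero, Complex.ofReal_zero]
    by_contra! hle
    rw [abs_div, abs_of_pos hε.1, div_le_iff₀ hε.1] at hle
    refine hb' ⟨e b', Metric.mem_cthickening_of_dist_le _ (e b) δ _ ⟨b, hb, rfl⟩ ?_,
      e.left_inv hs⟩
    rw [Real.dist_eq]
    linarith
  · exact if_neg hs

lemma contMDiffAt_chartMollifier (he : e ∈ IsManifold.maximalAtlas 𝓘(ℝ, ℝ) ∞ B) {χ : ℝ → ℝ}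
    (hχ : ContDiff ℝ ∞ χ) (ε : ℝ) {b b' : B} (hb : b ∈ e.source) (hb' : b' ∈ e.source) :
    ContMDiffAt (𝓘(ℝ, ℝ).prod 𝓘(ℝ, ℝ)) 𝓘(ℝ, ℂ) ∞
      (fun q : B × B => chartMollifier e χ ε (e q.1) q.2) (b, b') := by
  have h1 : ContMDiffAt (𝓘(ℝ, ℝ).prod 𝓘(ℝ, ℝ)) 𝓘(ℝ, ℝ) ∞ (fun q : B × B => e q.1) (b, b') :=
    ContMDiffAt.comp (b, b') (g := e) (f := Prod.fst) (contMDiffAt_of_mem_atlas he hb)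
      contMDiffAt_fst
  have h2 : ContMDiffAt (𝓘(ℝ, ℝ).prod 𝓘(ℝ, ℝ)) 𝓘(ℝ, ℝ) ∞ (fun q : B × B => e q.2) (b, b') :=
    ContMDiffAt.comp (b, b') (g := e) (f := Prod.snd) (contMDiffAt_of_mem_atlas he hb')
      contMDiffAt_snd
  have hF : ContDiff ℝ ∞ (fun p : ℝ × ℝ => ((ε⁻¹ * χ ((p.2 - p.1) / ε) : ℝ) : ℂ)) := by
    refine Complex.ofRealCLM.contDiff.comp (contDiff_const.mul (hχ.comp ?_))
    exact (contDiff_snd.sub contDiff_fst).div_const ε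
  have h3 := ContMDiffAt.comp (b, b') (hF.contMDiff (e b, e b')) (h1.prodMk_space h2)
  refine h3.congr_of_eventuallyEq ?_
  have hsnd : Tendsto (Prod.snd : B × B → B) (𝓝 (b, b')) (𝓝 b') := continuousAt_snd
  filter_upwards [hsnd.eventually (e.open_source.mem_nhds hb')] with q hq
  exact if_pos hq

lemma eventually_contMDiff_mul_chartMollifier (he : e ∈ IsManifold.maximalAtlas 𝓘(ℝ, ℝ) ∞ B)
    {η : B → ℂ} (hη : ContMDiff 𝓘(ℝ, ℝ) 𝓘(ℝ, ℂ) ∞ η) (hηe : tsupport η ⊆ e.source) {χ : ℝ → ℝ}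
    (hχ : ContDiff ℝ ∞ χ) (hχc : HasCompactSupport χ) :
    ∀ᶠ ε : ℝ in 𝓝[>] 0, ContMDiff (𝓘(ℝ, ℝ).prod 𝓘(ℝ, ℝ)) 𝓘(ℝ, ℂ) ∞
      (fun q : B × B => η q.1 * chartMollifier e χ ε (e q.1) q.2) := by
  obtain ⟨K', hK', hK'e, hev⟩ := eventually_chartMollifier_eq_zero
    (isClosed_tsupport η).isCompact hηe isOpen_univ (subset_univ _) hχc
  filter_upwards [hev] with ε hε
  rintro ⟨b, b'⟩
  have hfst : Tendsto (Prod.fst : B × B → B) (𝓝 (b, b')) (𝓝 b) := continuousAt_fst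
  have hsnd : Tendsto (Prod.snd : B × B → B) (𝓝 (b, b')) (𝓝 b') := continuousAt_snd
  by_cases hb : b ∈ tsupport η
  · by_cases hb' : b' ∈ K'
    · exact (ContMDiffAt.comp (b, b') (g := η) (f := Prod.fst) (hη b)
        contMDiffAt_fst).mul_complex
        (contMDiffAt_chartMollifier he hχ ε (hηe hb) (hK'e hb').1)
    · refine (contMDiffAt_const (c := (0 : ℂ))).congr_of_eventuallyEq ?_
      filter_upwards [hsnd.eventually (hK'.isClosed.isOpen_compl.mem_nhds hb')] with q hq
      by_cases hq1 : q.1 ∈ tsupport η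
      · rw [hε _ hq1 _ hq, mul_zero]
      · rw [image_eq_zero_of_notMem_tsupport hq1, zero_mul]
  · refine (contMDiffAt_const (c := (0 : ℂ))).congr_of_eventuallyEq ?_
    filter_upwards [hfst.eventually ((isClosed_tsupport η).isOpen_compl.mem_nhds hb)] with q hq
    rw [image_eq_zero_of_notMem_tsupport hq, zero_mul]

lemma eventually_contMDiff_chartMollifier (he : e ∈ IsManifold.maximalAtlas 𝓘(ℝ, ℝ) ∞ B)
    {η : B → ℂ} (hη : ContMDiff 𝓘(ℝ, ℝ) 𝓘(ℝ, ℂ) ∞ η) (hηe : tsupport η ⊆ e.source) {χ : ℝ → ℝ}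
    (hχ : ContDiff ℝ ∞ χ) (hχc : HasCompactSupport χ) :
    ∀ᶠ ε : ℝ in 𝓝[>] 0, ∀ b, η b ≠ 0 →
      ContMDiff 𝓘(ℝ, ℝ) 𝓘(ℝ, ℂ) ∞ (chartMollifier e χ ε (e b)) := by
  filter_upwards [eventually_contMDiff_mul_chartMollifier he hη hηe hχ hχc] with ε hε b hb
  have h1 : ContMDiff 𝓘(ℝ, ℝ) 𝓘(ℝ, ℂ) ∞ fun b' =>
      (η b)⁻¹ * (η b * chartMollifier e χ ε (e b) b') := fun b' =>
    contMDiffAt_const.mul_complex (ContMDiffAt.comp b' (g := fun q : B × B =>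
      η q.1 * chartMollifier e χ ε (e q.1) q.2) (f := fun b' => (b, b')) (hε (b, b'))
      (contMDiffAt_const.prodMk contMDiffAt_id))
  exact h1.congr fun b' => by field_simp

/-- The integral of the restriction to the diagonal is unique. -/
lemma IsDiagonalRestriction.hasDiagonalTrace_iff {P : (B → ℂ) → (B → ℂ)}
    {T : smoothFun 𝓘(ℝ, ℝ) B →ₗ[ℂ] ℂ} (hT : IsDiagonalRestriction P T) (τ : ℂ) :
    HasDiagonalTrace P τ ↔ τ = T ⟨fun _ => 1, contMDiff_const⟩ := by
  refine ⟨?_, fun h => ⟨T, hT, h.symm⟩⟩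
  rintro ⟨T', hT', rfl⟩
  obtain ⟨s, ζ, hζ, hζs, hζ1⟩ := exists_finite_partition (B := B)
    (fun b => (chartAt ℝ b).source) fun b => (chartAt ℝ b).open_source.mem_nhds
      (mem_chart_source ℝ b)
  obtain ⟨χ, hχ, hχc, hχ1⟩ := exists_smooth_mollifier
  have h1 : (⟨fun _ => 1, contMDiff_const⟩ : smoothFun 𝓘(ℝ, ℝ) B) =
      ∑ i ∈ s, (⟨ζ i, hζ i⟩ : smoothFun 𝓘(ℝ, ℝ) B) := by
    ext x
    simp only [AddSubmonoidClass.coe_finsetSum, Finset.sum_apply]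
    exact (hζ1 x).symm
  rw [h1, map_sum, map_sum]
  refine Finset.sum_congr rfl fun i _ => ?_
  have he : chartAt ℝ i ∈ IsManifold.maximalAtlas 𝓘(ℝ, ℝ) ∞ B :=
    IsManifold.chart_mem_maximalAtlas i
  exact tendsto_nhds_unique (hT' _ he ⟨ζ i, hζ i⟩ (hζs i) χ hχ hχc hχ1)
    (hT _ he ⟨ζ i, hζ i⟩ (hζs i) χ hχ hχc hχ1)

lemma IsDiagonalRestriction.congr {P Q : (B → ℂ) → (B → ℂ)} {T : smoothFun 𝓘(ℝ, ℝ) B →ₗ[ℂ] ℂ}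
    (hT : IsDiagonalRestriction P T)
    (h : ∀ ξ, ContMDiff 𝓘(ℝ, ℝ) 𝓘(ℝ, ℂ) ∞ ξ → Q ξ = P ξ) : IsDiagonalRestriction Q T := by
  intro e he η hη χ hχ hχc hχ1
  refine (hT e he η hη χ hχ hχc hχ1).congr' ?_
  filter_upwards [eventually_contMDiff_chartMollifier he η.2 hη hχ hχc] with ε hε
  refine setIntegral_congr_fun e.open_target.measurableSet fun x hx => ?_
  by_cases h0 : (η : B → ℂ) (e.symm x) = 0
  · simp only [h0, zero_mul]
  · have := hε _ h0
    rw [e.right_inv hx] at this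
    simp only [h _ this]

lemma continuousOn_mul_chart {e : OpenPartialHomeomorph B ℝ} {U : Set ℝ} (hU : U ⊆ e.target)
    {η : B → ℂ} (hη : Continuous η) : ContinuousOn (fun q : ℝ × ℝ => η (e.symm q.1)) (U ×ˢ U) :=
  hη.comp_continuousOn (e.symm.continuousOn.comp continuousOn_fst fun q hq => hU hq.1)

variable [MeasurableSpace B] [BorelSpace B] {μ : Measure B}

/-- The distribution `η ↦ ∫ η(b) κ(b, b) dμ(b)`. -/
def diagonalIntegral (hμ : IsSmoothDensity μ) {κ : B × B → ℂ} (hκ : Continuous κ) :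
    smoothFun 𝓘(ℝ, ℝ) B →ₗ[ℂ] ℂ :=
  have hi : ∀ η : smoothFun 𝓘(ℝ, ℝ) B, Integrable (fun b => (η : B → ℂ) b * κ (b, b)) μ := fun η =>
    have := hμ.isFiniteMeasure
    have hη : ContMDiff 𝓘(ℝ, ℝ) 𝓘(ℝ, ℂ) ∞ (η : B → ℂ) := η.2
    have hηc := hη.continuous
    (by fun_prop : Continuous fun b => (η : B → ℂ) b * κ (b, b)).integrable_of_hasCompactSupport
      (.of_compactSpace _)
  { toFun := fun η => ∫ b, (η : B → ℂ) b * κ (b, b) ∂μ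
    map_add' := fun η η' => by
      rw [← integral_add (hi η) (hi η')]
      refine integral_congr_ae (Eventually.of_forall fun b => ?_)
      simp [add_mul]
    map_smul' := fun c η => by
      simp only [RingHom.id_apply, smul_eq_mul]
      rw [← integral_const_mul]
      refine integral_congr_ae (Eventually.of_forall fun b => ?_)
      simp [mul_assoc] }

lemma isDiagonalRestriction_integralOperator (hμ : IsSmoothDensity μ) {κ : B × B → ℂ}
    (hκ : Continuous κ) :
    IsDiagonalRestriction (integralOperator μ κ) (diagonalIntegral hμ hκ) := by
  intro e he η hη χ hχ hχc hχ1
  obtain ⟨ρ, hρ, -, hint, -⟩ := hμ.exists_chart he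
  have hη' : ContMDiff 𝓘(ℝ, ℝ) 𝓘(ℝ, ℂ) ∞ (η : B → ℂ) := η.2
  have hηc := hη'.continuous
  have hsym : ContinuousOn e.symm e.target := e.symm.continuousOn
  have hK : IsCompact (tsupport (η : B → ℂ)) := (isClosed_tsupport _).isCompact
  let C := e '' tsupport (η : B → ℂ)
  have hC : IsCompact C := hK.image_of_continuousOn (e.continuousOn.mono hη)
  have hCt : C ⊆ e.target := by rintro _ ⟨b, hb, rfl⟩; exact e.map_source (hη hb)
  let H : ℝ × ℝ → ℂ := fun q => (η : B → ℂ) (e.symm q.1) *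
    (ρ q.2 • κ (e.symm q.1, e.symm q.2))
  have hH : ContinuousOn H (e.target ×ˢ e.target) := by
    refine ContinuousOn.mul (continuousOn_mul_chart subset_rfl hηc)
      (ContinuousOn.smul (hρ.continuousOn.comp continuousOn_snd fun q hq => hq.2) ?_)
    exact hκ.comp_continuousOn
      ((hsym.comp continuousOn_fst fun q hq => hq.1).prodMk
        (hsym.comp continuousOn_snd fun q hq => hq.2))
  have key := tendsto_integral_mollifier e.open_target hC hCt hH
    (fun x hx hxC y _ => by
      have h0 : (η : B → ℂ) (e.symm x) = 0 := image_eq_zero_of_notMem_tsupport fun h =>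
        hxC ⟨_, h, e.right_inv hx⟩
      simp only [H, h0, zero_mul]) hχ.continuous hχc hχ1
  have hlim : ∫ x in e.target, H (x, x) = diagonalIntegral hμ hκ η := by
    change _ = ∫ b, (η : B → ℂ) b * κ (b, b) ∂μ
    rw [hint (fun b => (η : B → ℂ) b * κ (b, b)) (by fun_prop) fun b hb => by
      have h0 : (η : B → ℂ) b = 0 := image_eq_zero_of_notMem_tsupport fun h => hb (hη h)
      simp only [h0, zero_mul]]
    refine setIntegral_congr_fun e.open_target.measurableSet fun x hx => ?_
    simp only [H, Complex.real_smul]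
    ring
  rw [hlim] at key
  refine key.congr fun ε => ?_
  refine setIntegral_congr_fun e.open_target.measurableSet fun x hx => ?_
  simp only [integralOperator]
  rw [hint]
  · rw [← integral_const_mul]
    refine setIntegral_congr_fun e.open_target.measurableSet fun y hy => ?_
    simp only [H, chartMollifier_symm χ ε x hy, Complex.real_smul]
    ring
  · refine ContinuousOn.mul (by fun_prop) ?_
    have h1 : ContinuousOn (fun b => ((ε⁻¹ * χ ((e b - x) / ε) : ℝ) : ℂ)) e.source := by
      have := hχ.continuous
      have h2 : Continuous fun y : ℝ => ((ε⁻¹ * χ ((y - x) / ε) : ℝ) : ℂ) := by fun_prop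
      exact h2.comp_continuousOn e.continuousOn
    exact h1.congr fun b hb => if_pos hb
  · intro b hb
    rw [chartMollifier_eq_zero χ ε x hb, mul_zero]

end

namespace IsSmoothFlow

variable {B : Type*} [TopologicalSpace B] [ChartedSpace ℝ B] [IsManifold 𝓘(ℝ, ℝ) ∞ B]
  {ψ : ℝ → B → B} (hψ : IsSmoothFlow 𝓘(ℝ, ℝ) ψ)

include hψ

lemma eq_of_mem_properOrbits {O O' : Set B} (hO : O ∈ properOrbits ψ) (hO' : O' ∈ properOrbits ψ)
    {x : B} (hx : x ∈ O) (hx' : x ∈ O') : O = O' :=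
  (hψ.eq_flowOrbit_of_mem hO hx).trans (hψ.eq_flowOrbit_of_mem hO' hx').symm

lemma flowOrbit_mem_properOrbits {x : B} (hx : x ∉ fixedPts ψ) :
    flowOrbit ψ x ∈ properOrbits ψ := ⟨x, hx, rfl⟩

lemma exists_bound_flowDomain {O : Set B} (hO : O ∈ properOrbits ψ) {x₀ : B} (hx₀ : x₀ ∈ O)
    {Q : Set B} (hQ : IsCompact Q) (hQF : ∀ b ∈ Q, b ∉ fixedPts ψ) :
    ∃ R : ℝ, ∀ u ∈ flowDomain ψ O, ψ u x₀ ∈ Q → |u| ≤ R := by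
  by_cases hper : O ∈ periodicOrbits ψ
  · refine ⟨orbitPeriod ψ O, fun u hu _ => ?_⟩
    rw [flowDomain, if_pos hper] at hu
    rw [abs_of_nonneg hu.1]
    exact hu.2.le
  have hinf : O ∈ infiniteOrbits ψ := by
    rw [hψ.properOrbits_eq] at hO
    exact hO.resolve_left hper
  refine hQ.induction_on (p := fun S => ∃ R : ℝ, ∀ u ∈ flowDomain ψ O, ψ u x₀ ∈ S → |u| ≤ R)
    ⟨0, fun u _ h => h.elim⟩ (fun S S' hSS ⟨R, hR⟩ => ⟨R, fun u hu h => hR u hu (hSS h)⟩)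
    (fun S S' ⟨R, hR⟩ ⟨R', hR'⟩ => ⟨max R R', fun u hu h => h.elim
      (fun h => (hR u hu h).trans (le_max_left _ _))
      fun h => (hR' u hu h).trans (le_max_right _ _)⟩) fun z hz => ?_
  by_cases hzO : z ∈ O
  · obtain ⟨v, -, hv⟩ := hψ.exists_mem_flowDomain hO hx₀ hzO
    have hback : ∀ s u : ℝ, ψ s x₀ = ψ u x₀ → ψ (u - s) x₀ = x₀ := fun s u h => by
      rw [sub_eq_neg_add, hψ.map_add, ← h, hψ.neg_apply]
    obtain ⟨τ, hτ, hτ0, hτz, -⟩ := hψ.exists_flowTime (hQF z hz)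
    have h1 : ∀ᶠ z' in 𝓝 z, |τ z'| < 1 := by
      have := hτ.continuousAt.abs.tendsto
      rw [hτ0, abs_zero] at this
      exact this.eventually (gt_mem_nhds one_pos)
    refine ⟨_, mem_nhdsWithin_of_mem_nhds (hτz.and h1), |v| + 1, fun u _ hu => ?_⟩
    obtain ⟨h2, h3⟩ := hu
    rw [← hv, ← hψ.map_add] at h2
    have h4 := hback _ _ h2
    have h5 := (hψ.flow_eq_self_iff_of_infinite hinf hx₀ _).1 h4
    have h6 : u = τ (ψ u x₀) + v := by linarith
    calc |u| = |τ (ψ u x₀) + v| := by rw [← h6]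
      _ ≤ |τ (ψ u x₀)| + |v| := abs_add_le _ _
      _ ≤ |v| + 1 := by linarith
  · refine ⟨_, mem_nhdsWithin_of_mem_nhds (hψ.flowOrbit_mem_nhds (hQF z hz)), 0, fun u _ hu => ?_⟩
    have h1 : ψ u x₀ ∈ O := (hψ.flow_mem_orbit_iff hO u).2 hx₀
    have h2 := hψ.eq_of_mem_properOrbits hO (hψ.flowOrbit_mem_properOrbits (hQF z hz)) h1 hu
    exact absurd (h2 ▸ hψ.mem_flowOrbit_self z) hzO

lemma continuous_comp_orbit {G : B → ℂ} (hG : ∀ b ∉ fixedPts ψ, ContinuousAt G b) {x₀ : B}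
    (hx₀ : x₀ ∉ fixedPts ψ) : Continuous fun u => G (ψ u x₀) :=
  continuous_iff_continuousAt.2 fun u => ContinuousAt.comp (g := G) (f := fun u => ψ u x₀)
    (hG _ (hψ.not_mem_fixedPts_flow hx₀ u)) (hψ.contMDiff_orbit x₀).continuous.continuousAt

lemma integrableOn_flowDomain {O : Set B} (hO : O ∈ properOrbits ψ) {x₀ : B} (hx₀ : x₀ ∈ O)
    {Q : Set B} (hQ : IsCompact Q) (hQF : ∀ b ∈ Q, b ∉ fixedPts ψ) {G : B → ℂ}
    (hG : ∀ b ∉ fixedPts ψ, ContinuousAt G b) (h0 : ∀ b ∉ fixedPts ψ, b ∉ Q → G b = 0) :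
    IntegrableOn (fun u => G (ψ u x₀)) (flowDomain ψ O) := by
  obtain ⟨R, hR⟩ := hψ.exists_bound_flowDomain hO hx₀ hQ hQF
  have hx := hψ.not_mem_fixedPts_of_mem_orbit hO hx₀
  refine IntegrableOn.of_forall_sdiff_eq_zero (s := Icc (-R) R)
    (hψ.continuous_comp_orbit hG hx).continuousOn.integrableOn_Icc
    (measurableSet_flowDomain ψ O) fun u hu => h0 _ (hψ.not_mem_fixedPts_flow hx u) fun h => ?_
  exact hu.2 (abs_le.1 (hR u hu.1 h))

lemma exists_finset_hitTimes {x : B} (hx : x ∉ fixedPts ψ) (y : B) (C : ℝ) : ∃ T : Finset ℝ,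
    ∀ t, t ∈ T ↔ ψ t x = y ∧ |t| ≤ C := by
  classical
  by_cases hy : ∃ θ, ψ θ x = y
  · obtain ⟨θ, hθ⟩ := hy
    obtain ⟨R, -, hR⟩ := hψ.exists_finset_returnTimes hx (C + |θ|)
    refine ⟨(R.image (θ + ·)).filter fun t => ψ t x = y ∧ |t| ≤ C, fun t => ?_⟩
    rw [Finset.mem_filter, and_iff_right_iff_imp]
    rintro ⟨h1, h2⟩
    refine Finset.mem_image.2 ⟨t - θ, hR _ ?_ ?_, by ring⟩
    · rw [show t - θ = -θ + t by ring, hψ.map_add, h1, ← hθ, hψ.neg_apply]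
    · exact (abs_sub _ _).trans (by linarith)
  · exact ⟨∅, fun t => ⟨fun h => by simp at h, fun h => (hy ⟨t, h.1⟩).elim⟩⟩

lemma orbitSum_eq_sum_hitTimes {F : ℝ → ℂ} {x y : B} (T : Finset ℝ) (h1 : ∀ t ∈ T, ψ t x = y)
    (h2 : ∀ t, ψ t x = y → F t ≠ 0 → t ∈ T) : orbitSum ψ F x y = ∑ t ∈ T, F t := by
  refine finsum_mem_eq_sum_of_inter_support_eq (s := {t | ψ t x = y}) _ ?_
  ext t
  exact ⟨fun h => ⟨h2 t h.1 h.2, h.2⟩, fun h => ⟨h1 t h.1, h.2⟩⟩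

end IsSmoothFlow

namespace IsFlowGroupoid

variable {B : Type*} [TopologicalSpace B] [ChartedSpace ℝ B] [IsManifold 𝓘(ℝ, ℝ) ∞ B]
  {A : Set (GermArrow B)}
  {ψ : ℝ → B → B} (G : IsFlowGroupoid A ψ) {f g : GermArrow B → ℝ → ℂ}

include G

lemma continuousAt_arrowKernel [T2Space B] [T2Space A] (hf : f ∈ posConvAlgebra A) {b b' : B}
    (hb : b ∉ fixedPts ψ ∨ b' ∉ fixedPts ψ) :
    ContinuousAt (fun q : B × B => arrowKernel A ψ f q.1 q.2) (b, b') :=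
  (G.contMDiffAt_arrowKernel hf hb).continuousAt

lemma continuousAt_arrowKernel_left [T2Space B] [T2Space A] (hf : f ∈ posConvAlgebra A) {b b' : B}
    (hb : b ∉ fixedPts ψ ∨ b' ∉ fixedPts ψ) : ContinuousAt (fun z => arrowKernel A ψ f z b') b :=
  ContinuousAt.comp (g := fun q : B × B => arrowKernel A ψ f q.1 q.2) (f := fun z => (z, b'))
    (G.continuousAt_arrowKernel hf hb) (by fun_prop)

lemma continuousAt_arrowKernel_diag [T2Space B] [T2Space A] (hf : f ∈ posConvAlgebra A) {b : B}
    (hb : b ∉ fixedPts ψ) : ContinuousAt (fun z => arrowKernel A ψ f z z) b :=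
  ContinuousAt.comp (g := fun q : B × B => arrowKernel A ψ f q.1 q.2) (f := fun z => (z, z))
    (G.continuousAt_arrowKernel hf (Or.inl hb)) (by fun_prop)

/-- The action of `f` at a point that is not fixed, as a sum of integrals over the orbits. -/
lemma kernelAction_eq_sum_orbits [T2Space B] [T2Space A] (hf : f ∈ posConvAlgebra A)
    (hfin : (properOrbits ψ).Finite) {base : Set B → B} (hbase : ∀ O ∈ properOrbits ψ, base O ∈ O)
    {b : B} (hb : b ∉ fixedPts ψ) {ξ : B → ℂ} (hξ : Continuous ξ) :
    kernelAction A ψ f ξ b = ∑ O ∈ hfin.toFinset, ∫ u in flowDomain ψ O,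
      arrowKernel A ψ f b (ψ u (base O)) * ξ (ψ u (base O)) := by
  obtain ⟨S, hS, hS', -⟩ := G.exists_finset_fiber hf hf b
  obtain ⟨c, d, -, hcd⟩ := posConv_exists_bounds hf
  change fiberIntegral A f (fun γ t => ξ (ψ t γ.src)) b = _
  rw [fiberIntegral_eq_sum S hS hS']
  have hsrc : ∀ γ ∈ S, γ.src ∉ fixedPts ψ := fun γ hγ h => by
    rw [G.src_mem_fixedPts_iff (hS γ hγ).1, (hS γ hγ).2] at h
    exact hb h
  have hψ := G.isSmoothFlow
  have hint : ∀ γ ∈ S, ∀ O ∈ properOrbits ψ, IntegrableOn (fun u =>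
      orbitSum ψ (f γ) γ.src (ψ u (base O)) * ξ (ψ u (base O))) (flowDomain ψ O) := by
    intro γ hγ O hO
    refine hψ.integrableOn_flowDomain hO (hbase O hO) (Q := (fun t => ψ t γ.src) '' Icc c d)
      (G := fun z => orbitSum ψ (f γ) γ.src z * ξ z)
      (isCompact_Icc.image (hψ.contMDiff_orbit _).continuous) ?_ ?_ ?_
    · rintro _ ⟨t, -, rfl⟩
      exact hψ.not_mem_fixedPts_flow (hsrc γ hγ) t
    · intro z hz
      refine ContinuousAt.mul ?_ hξ.continuousAt
      refine (hψ.contMDiffAt_orbitSum (J := 𝓘(ℝ, ℝ)) (F := fun _ => f γ) (X := fun _ => γ.src)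
        (Y := id) (c := c) (d := d) (fun t => ?_) (fun _ => hcd γ) contMDiffAt_const contMDiffAt_id
        (Or.inr hz)).continuousAt
      exact ContMDiffAt.comp (z, t) (g := f γ) (f := Prod.snd)
        (G.posConv_contDiff hf γ).contMDiff.contMDiffAt contMDiffAt_snd
    · intro z _ hz
      rw [orbitSum_eq_zero, zero_mul]
      intro t ht hz'
      exact hz ⟨t, by_contra fun h => ht (hcd γ t h), hz'⟩
  have h1 : ∀ γ ∈ S, ∫ t, f γ t * ξ (ψ t γ.src) = ∑ O ∈ hfin.toFinset, ∫ u in flowDomain ψ O,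
      orbitSum ψ (f γ) γ.src (ψ u (base O)) * ξ (ψ u (base O)) := by
    intro γ hγ
    have hO := hψ.flowOrbit_mem_properOrbits (hsrc γ hγ)
    rw [Finset.sum_eq_single (flowOrbit ψ γ.src)]
    · exact hψ.integral_mul_flow hO (hbase _ hO) (hψ.mem_flowOrbit_self _)
        (G.posConv_continuous hf γ) (hcd γ) hξ
    · intro O' hO' hne
      rw [Set.Finite.mem_toFinset] at hO'
      refine integral_eq_zero_of_ae (Eventually.of_forall fun u => ?_)
      simp only [Pi.zero_apply]
      rw [orbitSum_eq_zero, zero_mul]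
      intro t _ ht
      refine hne (hψ.eq_of_mem_properOrbits hO' hO (x := ψ u (base O')) ?_ ⟨t, ht⟩)
      exact (hψ.flow_mem_orbit_iff hO' u).2 (hbase _ hO')
    · intro h
      exact absurd (hfin.mem_toFinset.2 hO) h
  rw [Finset.sum_congr rfl h1, Finset.sum_comm]
  refine Finset.sum_congr rfl fun O hO => ?_
  rw [← integral_finsetSum _ fun γ hγ => hint γ hγ O (hfin.mem_toFinset.1 hO)]
  refine integral_congr_ae (Eventually.of_forall fun u => ?_)
  simp only
  rw [arrowKernel_eq_sum S hS hS', Finset.sum_mul]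

/-- The kernel of a convolution product. -/
lemma arrowKernel_convolution (hf : f ∈ posConvAlgebra A) (hg : g ∈ posConvAlgebra A) {b b' : B}
    (hb : b ∉ fixedPts ψ) : arrowKernel A ψ (groupoidConvolution A ψ f g) b b' =
      kernelAction A ψ f (fun z => arrowKernel A ψ g z b') b := by
  classical
  have hψ := G.isSmoothFlow
  obtain ⟨S₁, hS₁, hS₁', -⟩ := G.exists_finset_fiber hf hf b
  have hfinS := G.finite_convolution_fiber hf hg b
  set S := hfinS.toFinset with hSdef
  have hS : ∀ γ ∈ S, γ ∈ A ∧ γ.tgt = b := fun γ hγ => by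
    obtain ⟨h1, h2, -⟩ := hfinS.mem_toFinset.1 hγ
    exact ⟨h1, h2⟩
  obtain ⟨c, d, hc, hcd⟩ := posConv_exists_bounds hf
  obtain ⟨c', d', hc', hcd'⟩ := posConv_exists_bounds hg
  have hsrc : ∀ γ ∈ A, γ.tgt = b → γ.src ∉ fixedPts ψ := fun γ hγ h1 h => by
    rw [G.src_mem_fixedPts_iff hγ, h1] at h
    exact hb h
  have hT : ∀ γ, ∃ T : Finset ℝ, γ ∈ A → γ.tgt = b →
      ∀ t, t ∈ T ↔ ψ t γ.src = b' ∧ |t| ≤ d + d' := by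
    intro γ
    by_cases h : γ ∈ A ∧ γ.tgt = b
    · obtain ⟨T, hT⟩ := hψ.exists_finset_hitTimes (hsrc γ h.1 h.2) b' (d + d')
      exact ⟨T, fun _ _ => hT⟩
    · exact ⟨∅, fun h1 h2 => (h ⟨h1, h2⟩).elim⟩
  choose T hT using hT
  have hbound : ∀ {γ₁ δ : GermArrow B} {u v : ℝ}, f γ₁ u ≠ 0 → g δ v ≠ 0 → |u + v| ≤ d + d' := by
    intro γ₁ δ u v h1 h2
    have h3 : u ∈ Icc c d := by_contra fun h => h1 (hcd _ _ h)
    have h4 : v ∈ Icc c' d' := by_contra fun h => h2 (hcd' _ _ h)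
    rw [abs_of_nonneg (by linarith [h3.1, h4.1])]
    linarith [h3.2, h4.2]
  have hL : arrowKernel A ψ (groupoidConvolution A ψ f g) b b' =
      ∑ γ ∈ S, ∑ t ∈ T γ, groupoidConvolution A ψ f g γ t := by
    rw [arrowKernel_eq_sum S hS]
    · refine Finset.sum_congr rfl fun γ hγ => ?_
      have hTγ := hT γ (hS γ hγ).1 (hS γ hγ).2
      refine hψ.orbitSum_eq_sum_hitTimes _ (fun t ht => ((hTγ t).1 ht).1) fun t ht h0 => ?_
      obtain ⟨γ₁, -, u, -, h1, h2⟩ := G.exists_ne_zero_of_convolution_ne_zero h0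
      refine (hTγ t).2 ⟨ht, ?_⟩
      have := hbound h1 h2
      rwa [add_sub_cancel] at this
    · intro γ hγ hγb h0
      obtain ⟨t, ht⟩ := Function.ne_iff.1 h0
      obtain ⟨γ₁, hγ₁, u, h3, h1, h2⟩ := G.exists_ne_zero_of_convolution_ne_zero ht
      exact hfinS.mem_toFinset.2 ⟨hγ, hγb, γ₁, hγ₁, u, h3.trans hγb, h1,
        fun h => h2 (by rw [h]; rfl)⟩
  rw [hL]
  change _ = fiberIntegral A f (fun γ t => arrowKernel A ψ g (ψ t γ.src) b') b
  rw [fiberIntegral_eq_sum S₁ hS₁ hS₁']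
  have hconv : ∀ γ ∈ S, ∀ t, groupoidConvolution A ψ f g γ t =
      ∑ γ₁ ∈ S₁, ∫ u, f γ₁ u * g (((γ₁.inv A).comp γ).flow ψ u) (t - u) := by
    intro γ hγ t
    obtain ⟨h1, rfl⟩ := hS γ hγ
    rw [G.convolution_eq h1, fiberIntegral_eq_sum S₁ hS₁ hS₁']
  have hint : ∀ γ ∈ S, ∀ t, ∀ γ₁ ∈ S₁, Integrable fun u =>
      f γ₁ u * g (((γ₁.inv A).comp γ).flow ψ u) (t - u) := fun γ hγ t γ₁ hγ₁ =>
    G.posConv_integrable_mul hf γ₁ (G.convolution_integrand_continuous hg (hS γ hγ).1 t γ₁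
      (hS₁ γ₁ hγ₁).1 ((hS₁ γ₁ hγ₁).2.trans (hS γ hγ).2.symm))
  have h1 : ∑ γ ∈ S, ∑ t ∈ T γ, groupoidConvolution A ψ f g γ t = ∑ γ₁ ∈ S₁, ∑ γ ∈ S,
      ∑ t ∈ T γ, ∫ u, f γ₁ u * g (((γ₁.inv A).comp γ).flow ψ u) (t - u) := by
    rw [Finset.sum_comm]
    refine Finset.sum_congr rfl fun γ hγ => ?_
    rw [Finset.sum_comm]
    exact Finset.sum_congr rfl fun t _ => hconv γ hγ t
  rw [h1]
  refine Finset.sum_congr rfl fun γ₁ hγ₁ => ?_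
  obtain ⟨hγ₁A, hγ₁b⟩ := hS₁ γ₁ hγ₁
  rw [Finset.sum_congr rfl fun γ hγ => (integral_finsetSum (T γ) fun t _ =>
    hint γ hγ t γ₁ hγ₁).symm, ← integral_finsetSum S fun γ hγ =>
    integrable_finsetSum (T γ) fun t _ => hint γ hγ t γ₁ hγ₁]
  refine integral_congr_ae (Eventually.of_forall fun u => ?_)
  simp only
  by_cases hfu : f γ₁ u = 0
  · simp [hfu]
  simp only [← Finset.mul_sum]
  congr 1
  have hcompmem : ∀ γ ∈ S, (γ₁.inv A).comp γ ∈ A := fun γ hγ =>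
    G.comp_mem (G.inv_mem hγ₁A) (hS γ hγ).1 ((G.src_inv hγ₁A).trans
      (hγ₁b.trans (hS γ hγ).2.symm))
  have hinj : InjOn (fun γ => ((γ₁.inv A).comp γ).flow ψ u) S := by
    intro γ hγ γ' hγ' h
    have h2 : (γ₁.inv A).comp γ = (γ₁.inv A).comp γ' := by
      rw [← G.flow_neg_flow ((γ₁.inv A).comp γ) u, ← G.flow_neg_flow ((γ₁.inv A).comp γ') u]
      exact congrArg (GermArrow.flow ψ (-u)) h
    rw [← G.comp_inv_cancel hγ₁A (hS γ hγ).1 (hγ₁b.trans (hS γ hγ).2.symm), h2,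
      G.comp_inv_cancel hγ₁A (hS γ' hγ').1 (hγ₁b.trans (hS γ' hγ').2.symm)]
  rw [arrowKernel_eq_sum (S.image fun γ => ((γ₁.inv A).comp γ).flow ψ u), Finset.sum_image hinj]
  · refine Finset.sum_congr rfl fun γ hγ => ?_
    have hTγ := hT γ (hS γ hγ).1 (hS γ hγ).2
    rw [hψ.orbitSum_eq_sum_hitTimes ((T γ).image fun t => t - u),
      Finset.sum_image fun t _ t' _ h => by simpa using h]
    · intro v hv
      obtain ⟨t, ht, rfl⟩ := Finset.mem_image.1 hv
      rw [G.src_flow, src_comp G, ← hψ.map_add, sub_add_cancel]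
      exact ((hTγ t).1 ht).1
    · intro v hv hgv
      refine Finset.mem_image.2 ⟨u + v, (hTγ _).2 ⟨?_, hbound hfu hgv⟩, by ring⟩
      rwa [G.src_flow, src_comp G, ← hψ.map_add, add_comm v u] at hv
  · intro δ hδ
    obtain ⟨γ, hγ, rfl⟩ := Finset.mem_image.1 hδ
    refine ⟨G.flow_mem (hcompmem γ hγ) u, ?_⟩
    rw [G.tgt_flow, G.tgt_comp (hS γ hγ).1 ((G.src_inv hγ₁A).trans
      (hγ₁b.trans (hS γ hγ).2.symm)), G.tgt_inv hγ₁A]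
  · intro δ hδ hδt hgδ
    have hm := G.flow_mem hδ (-u)
    have ht : γ₁.src = (δ.flow ψ (-u)).tgt := by rw [G.tgt_flow, hδt, hψ.neg_apply]
    refine Finset.mem_image.2 ⟨γ₁.comp (δ.flow ψ (-u)), hfinS.mem_toFinset.2
      ⟨G.comp_mem hγ₁A hm ht, (G.tgt_comp hm ht).trans hγ₁b, γ₁, hγ₁A, u, hγ₁b, hfu, ?_⟩, ?_⟩
    · rwa [G.inv_comp_cancel hγ₁A hm ht, G.flow_flow_neg]
    · rw [G.inv_comp_cancel hγ₁A hm ht, G.flow_flow_neg]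

end IsFlowGroupoid

namespace IsSmoothFlow

variable {B : Type*} [TopologicalSpace B] [ChartedSpace ℝ B] [IsManifold 𝓘(ℝ, ℝ) ∞ B]
  {ψ : ℝ → B → B} (hψ : IsSmoothFlow 𝓘(ℝ, ℝ) ψ) {e : OpenPartialHomeomorph B ℝ}

include hψ

/-- Near a fixed point with non-zero exponent, the displacement by the flow is at least
proportional to the distance to the fixed point. -/
lemma exists_displacement_bound {b : B} (hb : b ∈ fixedPts ψ) (hκ : flowExponent ψ b ≠ 0)
    (he : e ∈ IsManifold.maximalAtlas 𝓘(ℝ, ℝ) ∞ B) (hbe : b ∈ e.source) {c d : ℝ} (hc : 0 < c) :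
    ∃ c₀ > 0, ∀ᶠ x in 𝓝 (e b), ∀ t ∈ Icc c d,
      c₀ * |x - e b| ≤ |e (ψ t (e.symm x)) - x| := by
  obtain ⟨m, hm, hmt⟩ := (isCompact_Icc (a := c) (b := d)).exists_forall_le'
    (f := fun t => |Real.exp (flowExponent ψ b * t) - 1|) (a := 0) (by fun_prop) (by
      intro t ht
      rw [abs_pos, sub_ne_zero, Ne, Real.exp_eq_one_iff]
      exact mul_ne_zero hκ (hc.trans_le ht.1).ne')
  refine ⟨m / 2, half_pos hm, ?_⟩
  refine isCompact_Icc.eventually_forall_of_forall_eventually fun t ht => ?_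
  set x₀ := e b
  let F : ℝ × ℝ → ℝ := fun q => e (ψ q.1 (e.symm q.2))
  have hfix : ∀ s, F (s, x₀) = x₀ := fun s => by simp only [F, x₀, e.left_inv hbe, hb s]
  have hF : ContDiffAt ℝ ∞ F (t, x₀) := hψ.contDiffAt_chart he (e.map_source hbe)
    (by rw [e.left_inv hbe, hb t]; exact hbe)
  have hS := hF.hasStrictFDerivAt (by simp)
  set L := fderiv ℝ F (t, x₀)
  have hL : L (0, 1) = Real.exp (flowExponent ψ b * t) := by
    have h1 : HasDerivAt (fun y => F (t, y)) (L (0, 1)) x₀ :=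
      hS.hasFDerivAt.comp_hasDerivAt x₀ ((hasDerivAt_const x₀ t).prodMk (hasDerivAt_id x₀))
    rw [← flowDeriv_eq_exp hψ hb]
    exact h1.unique (hψ.hasDerivAt_chart_of_fixed hb he hbe t)
  have h1 := hS.isLittleO.def (half_pos hm)
  have h2 : Tendsto (fun q : ℝ × ℝ => (((q.2, q.1), (q.2, x₀)) : (ℝ × ℝ) × (ℝ × ℝ)))
      (𝓝 (x₀, t)) (𝓝 ((t, x₀), (t, x₀))) :=
    (by fun_prop : Continuous fun q : ℝ × ℝ =>
      (((q.2, q.1), (q.2, x₀)) : (ℝ × ℝ) × (ℝ × ℝ))).tendsto (x₀, t)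
  filter_upwards [h2.eventually h1] with q hq
  have h3 : ((q.2, q.1) : ℝ × ℝ) - (q.2, x₀) = (q.1 - x₀) • ((0, 1) : ℝ × ℝ) := by
    ext <;> simp
  rw [h3, map_smul, hL, hfix, norm_smul, Real.norm_eq_abs, Real.norm_eq_abs, smul_eq_mul,
    show ‖((0, 1) : ℝ × ℝ)‖ = 1 by simp [Prod.norm_def], mul_one] at hq
  have h4 := hmt t ht
  set k := Real.exp (flowExponent ψ b * t)
  change m / 2 * |q.1 - x₀| ≤ |F (q.2, q.1) - q.1|
  have h5 : |(k - 1) * (q.1 - x₀)| ≤ |F (q.2, q.1) - q.1| +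
      |F (q.2, q.1) - x₀ - (q.1 - x₀) * k| := by
    rw [show (k - 1) * (q.1 - x₀) = (F (q.2, q.1) - q.1) -
      (F (q.2, q.1) - x₀ - (q.1 - x₀) * k) by ring]
    exact abs_sub _ _
  rw [abs_mul] at h5
  nlinarith [abs_nonneg (q.1 - x₀), mul_le_mul_of_nonneg_right h4 (abs_nonneg (q.1 - x₀))]

lemma eventually_eq_of_flow_eq {b : B} (hb : b ∈ fixedPts ψ) (hκ : flowExponent ψ b ≠ 0)
    {c d : ℝ} (hc : 0 < c) : ∀ᶠ z in 𝓝 b, ∀ t ∈ Icc c d, ψ t z = z → z = b := by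
  obtain ⟨c₀, hc₀, h⟩ := hψ.exists_displacement_bound (d := d) hb hκ
    (IsManifold.chart_mem_maximalAtlas b) (mem_chart_source ℝ b) hc
  have hs := (chartAt ℝ b).open_source.mem_nhds (mem_chart_source ℝ b)
  filter_upwards [hs, ((chartAt ℝ b).continuousAt (mem_chart_source ℝ b)).eventually h]
    with z hz hzt t ht hψz
  have h1 := hzt t ht
  rw [(chartAt ℝ b).left_inv hz, hψz, sub_self, abs_zero] at h1
  have h2 : |chartAt ℝ b z - chartAt ℝ b b| = 0 :=
    le_antisymm (by nlinarith [abs_nonneg (chartAt ℝ b z - chartAt ℝ b b)]) (abs_nonneg _)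
  exact (chartAt ℝ b).injOn hz (mem_chart_source ℝ b) (sub_eq_zero.1 (abs_eq_zero.1 h2))

end IsSmoothFlow

lemma exists_isCompact_compl_of_eventually {X : Type*} [TopologicalSpace X] [CompactSpace X]
    {F : Set X} {P : X → Prop} (h : ∀ b ∈ F, ∀ᶠ z in 𝓝[≠] b, P z) :
    ∃ Q : Set X, IsCompact Q ∧ (∀ b ∈ Q, b ∉ F) ∧ ∀ b ∉ F, b ∉ Q → P b := by
  refine ⟨(interior {b | b ∈ F ∨ P b})ᶜ, isOpen_interior.isClosed_compl.isCompact, ?_, ?_⟩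
  · intro b hb hbF
    refine hb (mem_interior_iff_mem_nhds.2 ?_)
    filter_upwards [eventually_nhdsWithin_iff.1 (h b hbF)] with z hz
    by_cases hzb : z = b
    · exact Or.inl (hzb ▸ hbF)
    · exact Or.inr (hz hzb)
  · intro b hb hbQ
    exact (interior_subset (not_not.1 hbQ)).resolve_left hb

lemma exists_of_arrowKernel_ne_zero {B : Type*} [TopologicalSpace B] {A : Set (GermArrow B)}
    {ψ : ℝ → B → B} {f : GermArrow B → ℝ → ℂ} {b b' : B} (h : arrowKernel A ψ f b b' ≠ 0) :
    ∃ γ ∈ A, γ.tgt = b ∧ ∃ t, f γ t ≠ 0 ∧ ψ t γ.src = b' := by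
  by_contra! hcon
  refine h (finsum_mem_eq_zero_of_forall_eq_zero (s := {γ | γ ∈ A ∧ γ.tgt = b}) fun γ hγ => ?_)
  exact orbitSum_eq_zero fun t ht => hcon γ hγ.1 hγ.2 t ht

lemma posConv_exists_isCompact {B : Type*} [TopologicalSpace B] [ChartedSpace ℝ B]
    {A : Set (GermArrow B)} {f : GermArrow B → ℝ → ℂ} (hf : f ∈ posConvAlgebra A) :
    ∃ K : Set (GermArrow B × ℝ), IsCompact K ∧ K ⊆ A ×ˢ Ioi 0 ∧
      ∀ a t, f a t ≠ 0 → (a, t) ∈ K := by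
  obtain ⟨⟨K, hK, hKA, h0⟩, -⟩ := hf
  exact ⟨K, hK, hKA, fun a t h => by_contra fun h' => h (h0 a t h')⟩

namespace IsFlowGroupoid

variable {B : Type*} [TopologicalSpace B] [ChartedSpace ℝ B] [IsManifold 𝓘(ℝ, ℝ) ∞ B]
  {A : Set (GermArrow B)} {ψ : ℝ → B → B} (G : IsFlowGroupoid A ψ)

include G

lemma isCompact_compositions [T2Space B] {K K' : Set (GermArrow B × ℝ)} (hK : IsCompact K)
    (hK' : IsCompact K') (hKA : K ⊆ A ×ˢ Ioi 0) (hKA' : K' ⊆ A ×ˢ Ioi 0) :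
    IsCompact ((fun r : (GermArrow B × ℝ) × (GermArrow B × ℝ) =>
      (r.1.1.comp (r.2.1.flow ψ (-r.1.2)), r.1.2 + r.2.2)) ''
      {r ∈ K ×ˢ K' | r.1.1.src = ψ (-r.1.2) r.2.1.tgt}) := by
  have hψ := G.isSmoothFlow
  have htgt : ContinuousOn (fun r : (GermArrow B × ℝ) × (GermArrow B × ℝ) => r.2.1.tgt)
      (K ×ˢ K') := fun r hr => (ContinuousAt.comp (x := r) (g := GermArrow.tgt)
        (f := fun r : (GermArrow B × ℝ) × (GermArrow B × ℝ) => r.2.1)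
        (G.continuousAt_tgt (hKA' hr.2).1) (by fun_prop)).continuousWithinAt
  have hsrc : Continuous fun r : (GermArrow B × ℝ) × (GermArrow B × ℝ) => r.1.1.src :=
    continuous_src.comp (by fun_prop)
  have hD := (hK.prod hK').setOf_eq_of_continuousOn hsrc.continuousOn
    (hψ.continuous.comp_continuousOn ((by fun_prop : Continuous fun r : (GermArrow B × ℝ) ×
      (GermArrow B × ℝ) => -r.1.2).continuousOn.prodMk htgt))
  refine hD.image_of_continuousOn (ContinuousOn.prodMk ?_ (by fun_prop))
  have hfl : ContinuousOn (fun r : (GermArrow B × ℝ) × (GermArrow B × ℝ) =>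
      r.2.1.flow ψ (-r.1.2)) (K ×ˢ K') := fun r hr =>
    (ContinuousAt.comp (x := r) (g := fun p : ℝ × GermArrow B => p.2.flow ψ p.1)
      (f := fun r : (GermArrow B × ℝ) × (GermArrow B × ℝ) => (-r.1.2, r.2.1))
      (G.continuousAt_flow (hKA' hr.2).1 _) (by fun_prop)).continuousWithinAt
  refine G.continuousOn_comp.comp ((by fun_prop : Continuous fun r : (GermArrow B × ℝ) ×
    (GermArrow B × ℝ) => r.1.1).continuousOn.prodMk (hfl.mono fun r hr => hr.1)) ?_
  intro r hr
  refine ⟨(hKA hr.1.1).1, G.flow_mem (hKA' hr.1.2).1 _, ?_⟩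
  rw [G.tgt_flow]
  exact hr.2

end IsFlowGroupoid

namespace IsNonDegenerateFlowGroupoid

variable {B : Type*} [TopologicalSpace B] [ChartedSpace ℝ B] [IsManifold 𝓘(ℝ, ℝ) ∞ B]
  {A : Set (GermArrow B)} {ψ : ℝ → B → B} (G : IsNonDegenerateFlowGroupoid A ψ)
  {f g : GermArrow B → ℝ → ℂ}

include G

/-- In a compact set, no arrow followed by the flow returns to a point that is close to, but
different from, a fixed point. -/
lemma eventually_flow_src_ne [T2Space B] {K : Set (GermArrow B × ℝ)} (hK : IsCompact K)
    (hKA : K ⊆ A ×ˢ Ioi 0) {b₀ : B} (hb₀ : b₀ ∈ fixedPts ψ) :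
    ∀ᶠ b in 𝓝[≠] b₀, ∀ p ∈ K, p.1.tgt = b → ψ p.2 p.1.src ≠ b := by
  have hψ := G.isSmoothFlow
  have key : {q : (GermArrow B × ℝ) × B | q.1.1.tgt = q.2 → ψ q.1.2 q.1.1.src ≠ q.2} ∈
      𝓝ˢ K ×ˢ 𝓝[≠] b₀ := by
    refine hK.mem_nhdsSet_prod_of_forall fun p hp => ?_
    obtain ⟨hα, hw⟩ := hKA hp
    have hw' : 0 < p.2 := hw
    have h1 : Tendsto (fun q : (GermArrow B × ℝ) × B => q.1) (𝓝 p ×ˢ 𝓝[≠] b₀) (𝓝 p) :=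
      tendsto_fst
    have h2 : Tendsto (fun q : (GermArrow B × ℝ) × B => q.2) (𝓝 p ×ˢ 𝓝[≠] b₀) (𝓝[≠] b₀) :=
      tendsto_snd
    have h2' := h2.mono_right nhdsWithin_le_nhds
    have h3 : Tendsto (fun q : (GermArrow B × ℝ) × B => q.1.1.tgt) (𝓝 p ×ˢ 𝓝[≠] b₀)
        (𝓝 p.1.tgt) := (G.continuousAt_tgt hα).tendsto.comp (continuousAt_fst.tendsto.comp h1)
    have h4 : Tendsto (fun q : (GermArrow B × ℝ) × B => ψ q.1.2 q.1.1.src) (𝓝 p ×ˢ 𝓝[≠] b₀)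
        (𝓝 (ψ p.2 p.1.src)) := ((hψ.continuous_comp (X := GermArrow B × ℝ) continuous_snd
          (continuous_src.comp continuous_fst)).tendsto p).comp h1
    by_cases h5 : p.1.tgt = b₀
    · by_cases h6 : ψ p.2 p.1.src = b₀
      · have h7 : p.1.src ∈ fixedPts ψ := by
          rw [G.src_mem_fixedPts_iff hα, h5]
          exact hb₀
        rw [h7 p.2] at h6
        have h8 := G.eq_unit hα (h5.trans h6.symm)
        rw [h6] at h8
        have h9 : ∀ᶠ a in 𝓝 p.1, a.tgt = a.src := by
          rw [h8, GermArrow.unit, nhds_sect, eventually_map]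
          exact Eventually.of_forall fun z => rfl
        have h10 : ∀ᶠ s in 𝓝 p.2, s ∈ Icc (p.2 / 2) (p.2 + 1) :=
          Icc_mem_nhds (by linarith) (by linarith)
        filter_upwards [(continuousAt_fst.tendsto.comp h1).eventually h9,
          (continuousAt_snd.tendsto.comp h1).eventually h10, h2.eventually
          (eventually_mem_nhdsWithin.and (mem_nhdsWithin_of_mem_nhds (hψ.eventually_eq_of_flow_eq
            (c := p.2 / 2) (d := p.2 + 1) hb₀ (G.flowExponent_ne_zero b₀ hb₀) (half_pos hw'))))]
          with q hq1 hq2 hq3 hq4 hq5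
        simp only [Function.comp_apply] at hq1 hq2
        rw [← hq1, hq4] at hq5
        exact hq3.1 (hq3.2 _ hq2 hq5)
      · filter_upwards [(h4.prodMk_nhds h2').eventually
          (isClosed_diagonal.isOpen_compl.mem_nhds h6)] with q hq _ using hq
    · filter_upwards [(h3.prodMk_nhds h2').eventually
          (isClosed_diagonal.isOpen_compl.mem_nhds h5)] with q hq h using absurd h hq
  obtain ⟨u, hu, v, hv, huv⟩ := mem_prod_iff.1 key
  filter_upwards [hv] with b hb p hp
  exact huv (⟨subset_of_mem_nhdsSet hu hp, hb⟩ : (p, b) ∈ u ×ˢ v)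

lemma exists_isCompact_arrowKernel_diag [T2Space B] [CompactSpace B] (hf : f ∈ posConvAlgebra A) :
    ∃ Q : Set B, IsCompact Q ∧ (∀ b ∈ Q, b ∉ fixedPts ψ) ∧
      ∀ b ∉ fixedPts ψ, b ∉ Q → arrowKernel A ψ f b b = 0 := by
  obtain ⟨K, hK, hKA, h0⟩ := posConv_exists_isCompact hf
  refine exists_isCompact_compl_of_eventually fun b₀ hb₀ => ?_
  filter_upwards [G.eventually_flow_src_ne hK hKA hb₀] with b hb
  by_contra hne
  obtain ⟨γ, -, hγ, t, ht, hts⟩ := exists_of_arrowKernel_ne_zero hne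
  exact hb _ (h0 γ t ht) hγ hts

lemma exists_isCompact_arrowKernel_mul [T2Space B] [CompactSpace B] (hf : f ∈ posConvAlgebra A)
    (hg : g ∈ posConvAlgebra A) : ∃ Q : Set B, IsCompact Q ∧ (∀ b ∈ Q, b ∉ fixedPts ψ) ∧
      ∀ b ∉ fixedPts ψ, b ∉ Q → ∀ b', arrowKernel A ψ f b b' * arrowKernel A ψ g b' b = 0 := by
  have hψ := G.isSmoothFlow
  obtain ⟨K, hK, hKA, h0⟩ := posConv_exists_isCompact hf
  obtain ⟨K', hK', hKA', h0'⟩ := posConv_exists_isCompact hg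
  refine exists_isCompact_compl_of_eventually fun b₀ hb₀ => ?_
  filter_upwards [G.eventually_flow_src_ne (G.isCompact_compositions hK hK' hKA hKA') (by
    rintro _ ⟨r, ⟨hr, hr'⟩, rfl⟩
    exact ⟨G.comp_mem (hKA hr.1).1 (G.flow_mem (hKA' hr.2).1 _) (by rw [G.tgt_flow]; exact hr'),
      add_pos (mem_Ioi.1 (hKA hr.1).2) (mem_Ioi.1 (hKA' hr.2).2)⟩) hb₀] with b hb b'
  by_contra hne
  obtain ⟨γ, hγA, hγ, t, ht, hts⟩ := exists_of_arrowKernel_ne_zero (left_ne_zero_of_mul hne)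
  obtain ⟨δ, hδA, hδ, s, hs, hss⟩ := exists_of_arrowKernel_ne_zero (right_ne_zero_of_mul hne)
  have h1 : γ.src = ψ (-t) δ.tgt := by rw [hδ, ← hts, hψ.neg_apply]
  have h2 : γ.src = (δ.flow ψ (-t)).tgt := by rw [G.tgt_flow, h1]
  refine hb _ ⟨((γ, t), (δ, s)), ⟨⟨h0 γ t ht, h0' δ s hs⟩, h1⟩, rfl⟩ ?_ ?_
  · exact (G.tgt_comp (G.flow_mem hδA _) h2).trans hγ
  · simp only
    rw [G.src_comp, G.src_flow, ← hψ.map_add, show t + s + -t = s by ring, hss]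

end IsNonDegenerateFlowGroupoid

/-- The contribution of a fixed point to the trace. -/
def fixedContribution {B : Type*} [TopologicalSpace B] [ChartedSpace ℝ B] (ψ : ℝ → B → B)
    (f : GermArrow B → ℝ → ℂ) (b : B) : ℂ :=
  ∫ t in Ioi (0 : ℝ), f (GermArrow.unit b) t /
    ((|1 - Real.exp (flowExponent ψ b * t)| : ℝ) : ℂ)

lemma integral_comp_mul_left_eq {χ : ℝ → ℝ} (hχ1 : ∫ z, χ z = 1) (a : ℝ) :
    ∫ z, (χ (a * z) : ℂ) = (|a|⁻¹ : ℝ) := by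
  rw [integral_complex_ofReal, Measure.integral_comp_mul_left, hχ1, smul_eq_mul, mul_one, abs_inv]

namespace IsFlowGroupoid

variable {B : Type*} [TopologicalSpace B] [ChartedSpace ℝ B] [IsManifold 𝓘(ℝ, ℝ) ∞ B]
  {A : Set (GermArrow B)} {ψ : ℝ → B → B} (G : IsFlowGroupoid A ψ)
  {f : GermArrow B → ℝ → ℂ} {e : OpenPartialHomeomorph B ℝ} {η : B → ℂ} {χ : ℝ → ℝ}

include G

lemma integrableOn_mollified [T2Space B] [CompactSpace B] [T2Space A] (hf : f ∈ posConvAlgebra A)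
    (he : e ∈ IsManifold.maximalAtlas 𝓘(ℝ, ℝ) ∞ B) (hη : ContMDiff 𝓘(ℝ, ℝ) 𝓘(ℝ, ℂ) ∞ η)
    (hηe : tsupport η ⊆ e.source) (hχ : ContDiff ℝ ∞ χ) (hχc : HasCompactSupport χ) :
    ∀ᶠ ε : ℝ in 𝓝[>] 0, IntegrableOn (fun x => η (e.symm x) *
      kernelAction A ψ f (chartMollifier e χ ε x) (e.symm x)) e.target := by
  filter_upwards [eventually_contMDiff_mul_chartMollifier he hη hηe hχ hχc] with ε hε
  have h1 := (G.contMDiff_fiberIntegral_flow hf hε).continuous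
  have hC : IsCompact (e '' tsupport η) :=
    (isClosed_tsupport η).isCompact.image_of_continuousOn (e.continuousOn.mono hηe)
  have hCt : e '' tsupport η ⊆ e.target := by
    rintro _ ⟨b, hb, rfl⟩
    exact e.map_source (hηe hb)
  have h2 : ContinuousOn (fun x => fiberIntegral A f (fun γ t =>
      η (e.symm x) * chartMollifier e χ ε (e (e.symm x)) (ψ t γ.src)) (e.symm x)) e.target :=
    h1.comp_continuousOn e.symm.continuousOn
  refine IntegrableOn.of_forall_sdiff_eq_zero (s := e '' tsupport η) ?_
    e.open_target.measurableSet ?_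
  · refine IntegrableOn.congr_fun ((h2.mono hCt).integrableOn_compact hC) (fun x hx => ?_)
      hC.measurableSet
    rw [e.right_inv (hCt hx)]
    exact G.fiberIntegral_smul_right hf (η (e.symm x))
      (Ξ := fun γ t => chartMollifier e χ ε x (ψ t γ.src))
  · rintro x ⟨hx, hxC⟩
    rw [image_eq_zero_of_notMem_tsupport (f := η) fun h => hxC ⟨_, h, e.right_inv hx⟩, zero_mul]

/-- The restriction of the kernel to the diagonal, inside an orbit. -/
lemma tendsto_mollified_of_subset_orbit [T2Space B] [CompactSpace B] [T2Space A]
    (hf : f ∈ posConvAlgebra A) (hfin : (properOrbits ψ).Finite) {base : Set B → B}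
    (hbase : ∀ O ∈ properOrbits ψ, base O ∈ O) (he : e ∈ IsManifold.maximalAtlas 𝓘(ℝ, ℝ) ∞ B)
    {O : Set B} (hO : O ∈ properOrbits ψ) (hη : ContMDiff 𝓘(ℝ, ℝ) 𝓘(ℝ, ℂ) ∞ η)
    (hηe : tsupport η ⊆ e.source) (hηO : tsupport η ⊆ O) (hχ : ContDiff ℝ ∞ χ)
    (hχc : HasCompactSupport χ) (hχ1 : ∫ z, χ z = 1) :
    Tendsto (fun ε : ℝ => ∫ x in e.target, η (e.symm x) *
      kernelAction A ψ f (chartMollifier e χ ε x) (e.symm x)) (𝓝[>] 0)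
      (𝓝 (∫ u in flowDomain ψ O, η (ψ u (base O)) *
        arrowKernel A ψ f (ψ u (base O)) (ψ u (base O)))) := by
  have hψ := G.isSmoothFlow
  have hOo := hψ.isOpen_orbit hO
  have hOF : ∀ b ∈ O, b ∉ fixedPts ψ := fun b hb => hψ.not_mem_fixedPts_of_mem_orbit hO hb
  have hK : IsCompact (tsupport η) := (isClosed_tsupport η).isCompact
  set U := e.target ∩ e.symm ⁻¹' O with hU
  have hUo : IsOpen U := e.isOpen_inter_preimage_symm hOo
  have hUt : U ⊆ e.target := inter_subset_left
  have hC : IsCompact (e '' tsupport η) := hK.image_of_continuousOn (e.continuousOn.mono hηe)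
  have hCU : e '' tsupport η ⊆ U := by
    rintro _ ⟨b, hb, rfl⟩
    exact ⟨e.map_source (hηe hb), by rw [mem_preimage, e.left_inv (hηe hb)]; exact hηO hb⟩
  have hη0 : ∀ x ∈ e.target, x ∉ e '' tsupport η → η (e.symm x) = 0 := fun x hx hxC =>
    image_eq_zero_of_notMem_tsupport fun h => hxC ⟨_, h, e.right_inv hx⟩
  let H : ℝ × ℝ → ℂ := fun q => η (e.symm q.1) *
    (|chartSpeed e ψ q.2|⁻¹ • arrowKernel A ψ f (e.symm q.1) (e.symm q.2))
  have hsym : ContinuousOn e.symm U := e.symm.continuousOn.mono hUt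
  have hH : ContinuousOn H (U ×ˢ U) := by
    refine (continuousOn_mul_chart hUt hη.continuous).mul (ContinuousOn.fun_smul ?_ ?_)
    · intro q hq
      refine ContinuousAt.continuousWithinAt (ContinuousAt.inv₀ ?_ ?_)
      · exact ContinuousAt.abs (ContinuousAt.comp (g := chartSpeed e ψ) (f := Prod.snd)
          (hψ.contDiffAt_chartSpeed he (hUt hq.2)).continuousAt continuousAt_snd)
      · rw [abs_ne_zero]
        intro h0
        refine hOF _ hq.2.2 (hψ.mem_fixedPts_of_chartSpeed_eq_zero he (e.map_target hq.2.1) ?_)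
        rwa [e.right_inv hq.2.1]
    · intro q hq
      exact ContinuousAt.comp_continuousWithinAt
        (g := fun q : B × B => arrowKernel A ψ f q.1 q.2)
        (f := fun q : ℝ × ℝ => (e.symm q.1, e.symm q.2))
        (G.continuousAt_arrowKernel hf (Or.inl (hOF _ hq.1.2)))
        (((hsym.comp continuousOn_fst fun q hq => hq.1).prodMk
          (hsym.comp continuousOn_snd fun q hq => hq.2)) q hq)
  have key := tendsto_integral_mollifier hUo hC hCU hH (fun x hx hxC y _ => by
    simp only [H, hη0 x hx.1 hxC, zero_mul]) hχ.continuous hχc hχ1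
  have hlim : ∫ x in U, H (x, x) = ∫ u in flowDomain ψ O, η (ψ u (base O)) *
      arrowKernel A ψ f (ψ u (base O)) (ψ u (base O)) := by
    rw [hψ.setIntegral_flowDomain_chart hO (hbase O hO) he
      (fun z => η z * arrowKernel A ψ f z z) fun b hb => by
        rw [image_eq_zero_of_notMem_tsupport fun h => hb (hηe h), zero_mul]]
    refine setIntegral_congr_fun hUo.measurableSet fun x hx => ?_
    simp only [H, Complex.real_smul]
    ring
  rw [hlim] at key
  refine key.congr' ?_
  obtain ⟨K', hK', hK'e, hev⟩ := eventually_chartMollifier_eq_zero hK hηe hOo hηO hχc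
  filter_upwards [hev, eventually_contMDiff_chartMollifier he hη hηe hχ hχc] with ε hε hεs
  rw [setIntegral_eq_of_subset_of_forall_sdiff_eq_zero e.open_target.measurableSet hUt
    fun x hx => by rw [hη0 x hx.1 fun h => hx.2 (hCU h), zero_mul]]
  refine setIntegral_congr_fun hUo.measurableSet fun x hx => ?_
  by_cases h0 : η (e.symm x) = 0
  · simp only [H, h0, zero_mul, integral_zero]
  have hxs := hεs _ h0
  have hxz := hε _ (subset_tsupport _ h0)
  rw [e.right_inv hx.1] at hxs hxz
  rw [G.kernelAction_eq_sum_orbits hf hfin hbase (hOF _ hx.2) hxs.continuous,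
    Finset.sum_eq_single_of_mem O (hfin.mem_toFinset.2 hO),
    hψ.setIntegral_flowDomain_chart hO (hbase O hO) he
      (fun z => arrowKernel A ψ f (e.symm x) z * chartMollifier e χ ε x z) fun b hb => by
        rw [chartMollifier_eq_zero χ ε x hb, mul_zero], ← integral_const_mul]
  · refine setIntegral_congr_fun hUo.measurableSet fun y hy => ?_
    simp only [H, chartMollifier_symm χ ε x hy.1, Complex.real_smul]
    ring
  · intro O' hO' hne
    rw [hfin.mem_toFinset] at hO'
    refine integral_eq_zero_of_ae (Eventually.of_forall fun u => ?_)
    simp only [Pi.zero_apply]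
    rw [hxz, mul_zero]
    intro h
    exact hne (hψ.eq_of_mem_properOrbits hO' hO
      ((hψ.flow_mem_orbit_iff hO' u).2 (hbase O' hO')) (hK'e h).2)

end IsFlowGroupoid

namespace IsNonDegenerateFlowGroupoid

variable {B : Type*} [TopologicalSpace B] [ChartedSpace ℝ B] [IsManifold 𝓘(ℝ, ℝ) ∞ B]
  {A : Set (GermArrow B)} {ψ : ℝ → B → B} (G : IsNonDegenerateFlowGroupoid A ψ)
  {f : GermArrow B → ℝ → ℂ} {e : OpenPartialHomeomorph B ℝ}

include G

/-- Near a fixed point, only the unit arrows contribute to the restriction to the diagonal. -/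
lemma exists_kernelAction_eq_unit [T2Space B] [CompactSpace B] (hf : f ∈ posConvAlgebra A)
    {b₀ : B} (hb₀ : b₀ ∈ fixedPts ψ) : ∃ N : Set B, IsOpen N ∧ b₀ ∈ N ∧ ∀ᶠ b in 𝓝 b₀,
      ∀ ξ : B → ℂ, (∀ z ∉ N, ξ z = 0) →
        kernelAction A ψ f ξ b = ∫ t, f (GermArrow.unit b) t * ξ (ψ t b) := by
  classical
  have hψ := G.isSmoothFlow
  have hT2 : T2Space A := G.t2Space
  obtain ⟨c, d, -, hcd⟩ := posConv_exists_bounds hf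
  obtain ⟨L, hL, hLA, h0⟩ := posConv_exists_compact hf
  have hLu : IsCompact (L ∪ {GermArrow.unit b₀}) := hL.union isCompact_singleton
  obtain ⟨S, hS, hLS, hloc⟩ := G.exists_local_fiber hLu
    (union_subset hLA (singleton_subset_iff.2 (G.unit_mem b₀))) b₀
  have huS : GermArrow.unit b₀ ∈ S := hLS _ (Or.inr rfl) rfl
  have hsep : ∀ γ, ∃ N N' : Set B, γ ∈ S → γ ≠ GermArrow.unit b₀ →
      IsOpen N ∧ IsOpen N' ∧ b₀ ∈ N ∧ γ.src ∈ N' ∧ Disjoint N N' := by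
    intro γ
    by_cases h : γ ∈ S ∧ γ ≠ GermArrow.unit b₀
    · obtain ⟨hγA, hγb⟩ := hS γ h.1
      have hne : b₀ ≠ γ.src := fun hb => h.2 (by
        rw [hb]
        exact G.eq_unit hγA (hγb.trans hb))
      obtain ⟨N, N', h1⟩ := t2_separation hne
      exact ⟨N, N', fun _ _ => h1⟩
    · exact ⟨∅, ∅, fun h1 h2 => (h ⟨h1, h2⟩).elim⟩
  choose N N' hN using hsep
  refine ⟨⋂ γ ∈ S.erase (GermArrow.unit b₀), N γ, isOpen_biInter_finset fun γ hγ =>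
    (hN γ (Finset.mem_of_mem_erase hγ) (Finset.ne_of_mem_erase hγ)).1,
    mem_iInter₂.2 fun γ hγ =>
      (hN γ (Finset.mem_of_mem_erase hγ) (Finset.ne_of_mem_erase hγ)).2.2.1, ?_⟩
  have hfar : ∀ᶠ b in 𝓝 b₀, ∀ γ ∈ S.erase (GermArrow.unit b₀), ∀ t ∈ Icc c d,
      ψ t ((γ.inv A).rep b) ∈ N' γ := by
    refine (Finset.eventually_all _).2 fun γ hγ => ?_
    obtain ⟨-, h2, -, h4, -⟩ := hN γ (Finset.mem_of_mem_erase hγ) (Finset.ne_of_mem_erase hγ)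
    obtain ⟨hγA, hγb⟩ := hS γ (Finset.mem_of_mem_erase hγ)
    have hsrc : γ.src ∈ fixedPts ψ := by
      rw [G.src_mem_fixedPts_iff hγA, hγb]
      exact hb₀
    refine isCompact_Icc.eventually_forall_of_forall_eventually fun t _ => ?_
    have h5 : ContinuousAt (γ.inv A).rep b₀ := hγb ▸ (G.contMDiffAt_rep_inv hγA).continuousAt
    have h7 : Tendsto (fun q : B × ℝ => (q.2, (γ.inv A).rep q.1)) (𝓝 (b₀, t))
        (𝓝 (t, (γ.inv A).rep b₀)) := Tendsto.prodMk_nhds continuousAt_snd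
      (h5.tendsto.comp (continuousAt_fst (p := (b₀, t))))
    have h6 : Tendsto (fun q : B × ℝ => ψ q.2 ((γ.inv A).rep q.1)) (𝓝 (b₀, t))
        (𝓝 (ψ t ((γ.inv A).rep b₀))) :=
      (hψ.continuous.tendsto (t, (γ.inv A).rep b₀)).comp h7
    rw [← hγb, G.rep_inv_tgt hγA, hsrc t] at h6
    rw [← hγb]
    exact h6.eventually (h2.mem_nhds h4)
  have hunit : ∀ᶠ b in 𝓝 b₀, GermArrow.unit b = (GermArrow.unit b₀).tgtSect A b :=
    (continuous_sect id).continuousAt.eventually (G.eventually_eq_tgtSect (G.unit_mem b₀))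
  filter_upwards [hloc, hfar, hunit] with b hb hbf hbu ξ hξ
  change fiberIntegral A f (fun γ t => ξ (ψ t γ.src)) b = _
  refine (hb (fun γ => ∫ t, f γ t * ξ (ψ t γ.src)) fun a ha => ?_).trans ?_
  · rw [h0 a fun h => ha (Or.inl h)]
    simp
  · rw [Finset.sum_eq_single_of_mem _ huS, ← hbu]
    · rfl
    · intro γ hγ hne
      refine integral_eq_zero_of_ae (Eventually.of_forall fun t => ?_)
      have hγ' := Finset.mem_erase.2 ⟨hne, hγ⟩
      by_cases ht : t ∈ Icc c d
      · change _ * ξ (ψ t ((γ.inv A).rep b)) = 0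
        rw [hξ, mul_zero]
        intro h
        exact disjoint_left.1 (hN γ hγ hne).2.2.2.2 (mem_iInter₂.1 h γ hγ') (hbf γ hγ' t ht)
      · simp only [hcd _ t ht, zero_mul, Pi.zero_apply]

/-- The restriction of the kernel to the diagonal, near a fixed point. -/
lemma exists_tendsto_mollified_of_fixed [T2Space B] [CompactSpace B] (hf : f ∈ posConvAlgebra A)
    {b₀ : B} (hb₀ : b₀ ∈ fixedPts ψ) (he : e ∈ IsManifold.maximalAtlas 𝓘(ℝ, ℝ) ∞ B)
    (hbe : b₀ ∈ e.source) : ∃ N ∈ 𝓝 b₀, ∀ (η : B → ℂ) (χ : ℝ → ℝ),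
      ContMDiff 𝓘(ℝ, ℝ) 𝓘(ℝ, ℂ) ∞ η → tsupport η ⊆ e.source → tsupport η ⊆ N →
      ContDiff ℝ ∞ χ → HasCompactSupport χ → ∫ z, χ z = 1 →
      Tendsto (fun ε : ℝ => ∫ x in e.target, η (e.symm x) *
        kernelAction A ψ f (chartMollifier e χ ε x) (e.symm x)) (𝓝[>] 0)
        (𝓝 (η b₀ * fixedContribution ψ f b₀)) := by
  classical
  have hψ := G.isSmoothFlow
  have hκ := G.flowExponent_ne_zero b₀ hb₀
  obtain ⟨c, d, hc, hcd⟩ := posConv_exists_bounds hf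
  obtain ⟨W, hW, hbW, hWev⟩ := G.exists_kernelAction_eq_unit hf hb₀
  obtain ⟨c₀, hc₀, hdisp⟩ := hψ.exists_displacement_bound (c := c) (d := d) hb₀ hκ he hbe hc
  obtain ⟨Mf, hMf⟩ := G.posConv_bounded hf
  have hstay : ∀ᶠ b in 𝓝 b₀, ∀ t ∈ Icc c d, ψ t b ∈ e.source := by
    refine isCompact_Icc.eventually_forall_of_forall_eventually fun t _ => ?_
    have h1 := (hψ.continuous_comp (X := B × ℝ) continuous_snd continuous_fst).tendsto (b₀, t)
    simp only [hb₀ t] at h1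
    exact h1.eventually (e.open_source.mem_nhds hbe)
  have hWn : ∀ᶠ b in 𝓝 b₀, b ∈ W := hW.mem_nhds hbW
  refine ⟨_, (hWev.and (hWn.and
    (((e.continuousAt hbe).eventually hdisp).and hstay))), ?_⟩
  intro η χ hη hηe hηN hχ hχc hχ1
  obtain ⟨R, hR, hχR⟩ := hχc.exists_pos_bound
  obtain ⟨Mη, hMη⟩ := (isCompact_univ (X := B)).exists_bound_of_continuousOn
    hη.continuous.continuousOn
  obtain ⟨Mχ, hMχ⟩ := hχc.exists_bound_of_continuous hχ.continuous
  have hM0 : 0 ≤ Mη * (Mχ * Mf) := mul_nonneg ((norm_nonneg _).trans (hMη b₀ trivial))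
    (mul_nonneg ((norm_nonneg _).trans (hMχ 0)) ((norm_nonneg _).trans (hMf (GermArrow.unit b₀) 0)))
  set x₀ := e b₀ with hx₀
  have hx₀t : x₀ ∈ e.target := e.map_source hbe
  let g : ℝ → B × ℝ → ℂ := fun ε q => η q.1 * chartMollifier e χ ε (e q.1) (ψ q.2 q.1) *
    f (GermArrow.unit q.1) q.2
  let Φ : ℝ → ℝ × ℝ → ℂ := fun ε q =>
    e.target.indicator (fun x => (ε : ℂ) * g ε (e.symm x, q.2)) (x₀ + ε * q.1)
  let Φ₀ : ℝ × ℝ → ℂ := fun q => η b₀ *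
    χ ((Real.exp (flowExponent ψ b₀ * q.2) - 1) * q.1) * f (GermArrow.unit b₀) q.2
  let bound : ℝ × ℝ → ℝ := (Icc (-(R / c₀)) (R / c₀) ×ˢ Icc c d).indicator
    fun _ => Mη * (Mχ * Mf)
  have hbi : Integrable bound (volume.prod volume) := by
    rw [integrable_indicator_iff (measurableSet_Icc.prod measurableSet_Icc)]
    exact integrableOn_const (isCompact_Icc.prod isCompact_Icc).measure_ne_top
  have hfc : Continuous fun q : B × ℝ => f (GermArrow.unit q.1) q.2 :=
    continuous_iff_continuousAt.2 fun q => ContinuousAt.comp (x := q)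
      (g := fun p : GermArrow B × ℝ => f p.1 p.2) (f := fun q : B × ℝ => (GermArrow.unit q.1, q.2))
      (G.posConv_continuousAt hf (G.unit_mem q.1) q.2)
      (((continuous_sect id).comp continuous_fst).prodMk continuous_snd).continuousAt
  -- the value of the integrand
  have hΦval : ∀ ε > 0, ∀ q : ℝ × ℝ, x₀ + ε * q.1 ∈ e.target →
      ψ q.2 (e.symm (x₀ + ε * q.1)) ∈ e.source → Φ ε q = η (e.symm (x₀ + ε * q.1)) *
        χ ((e (ψ q.2 (e.symm (x₀ + ε * q.1))) - (x₀ + ε * q.1)) / ε) *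
          f (GermArrow.unit (e.symm (x₀ + ε * q.1))) q.2 := by
    intro ε hε q h1 h2
    simp only [Φ, indicator_of_mem h1, g, e.right_inv h1, chartMollifier, if_pos h2]
    have : (ε : ℂ) ≠ 0 := by exact_mod_cast hε.ne'
    push_cast
    field_simp
  have hΦb : ∀ ε > 0, ∀ q, ‖Φ ε q‖ ≤ bound q := by
    intro ε hε q
    have hb0 : 0 ≤ bound q := indicator_nonneg (fun _ _ => hM0) q
    by_cases h0 : Φ ε q = 0
    · rwa [h0, norm_zero]
    have h1 : x₀ + ε * q.1 ∈ e.target := by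
      by_contra h
      exact h0 (indicator_of_notMem h _)
    set b := e.symm (x₀ + ε * q.1) with hb
    have hηb : η b ≠ 0 := fun h => h0 (by simp only [Φ, indicator_of_mem h1, g, ← hb, h]; simp)
    have ht : q.2 ∈ Icc c d := by
      by_contra h
      exact h0 (by simp only [Φ, indicator_of_mem h1, g, hcd _ _ h]; simp)
    obtain ⟨-, -, h2, h3⟩ := hηN (subset_tsupport _ hηb)
    have h4 := hΦval ε hε q h1 (h3 _ ht)
    have h5 := h2 q.2 ht
    rw [e.right_inv h1, add_sub_cancel_left, abs_mul, abs_of_pos hε] at h5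
    have hz : |q.1| ≤ R / c₀ := by
      by_contra! hz
      refine h0 ?_
      rw [h4, hχR]
      · simp
      · rw [div_lt_iff₀ hc₀] at hz
        rw [abs_div, abs_of_pos hε, lt_div_iff₀ hε]
        refine lt_of_lt_of_le ?_ h5
        nlinarith
    have hmem : q ∈ Icc (-(R / c₀)) (R / c₀) ×ˢ Icc c d := ⟨abs_le.1 hz, ht⟩
    simp only [bound, indicator_of_mem hmem]
    rw [h4, mul_assoc, norm_mul, norm_mul, Complex.norm_real]
    exact mul_le_mul (hMη _ trivial) (mul_le_mul (hMχ _) (hMf _ _) (norm_nonneg _)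
      ((norm_nonneg _).trans (hMχ 0))) (by positivity) ((norm_nonneg _).trans (hMη b₀ trivial))
  have hΦlim : ∀ q, Tendsto (fun ε => Φ ε q) (𝓝[>] 0) (𝓝 (Φ₀ q)) := by
    intro q
    have h1 : Tendsto (fun ε : ℝ => x₀ + ε * q.1) (𝓝[>] 0) (𝓝 x₀) := by
      have : Tendsto (fun ε : ℝ => x₀ + ε * q.1) (𝓝 0) (𝓝 (x₀ + 0 * q.1)) :=
        (by fun_prop : Continuous fun ε : ℝ => x₀ + ε * q.1).tendsto 0
      rw [zero_mul, add_zero] at this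
      exact this.mono_left nhdsWithin_le_nhds
    have h2 : Tendsto (fun ε : ℝ => e.symm (x₀ + ε * q.1)) (𝓝[>] 0) (𝓝 b₀) := by
      have := (e.symm.continuousAt hx₀t).tendsto.comp h1
      rwa [hx₀, e.left_inv hbe] at this
    have h3 : Tendsto (fun ε : ℝ => ψ q.2 (e.symm (x₀ + ε * q.1))) (𝓝[>] 0) (𝓝 b₀) := by
      have := ((hψ.contMDiff_at_time q.2).continuous.tendsto b₀).comp h2
      rwa [hb₀ q.2] at this
    have h4 : Tendsto (fun ε : ℝ => (e (ψ q.2 (e.symm (x₀ + ε * q.1))) - (x₀ + ε * q.1)) / ε)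
        (𝓝[>] 0) (𝓝 ((Real.exp (flowExponent ψ b₀ * q.2) - 1) * q.1)) := by
      have hd := hψ.hasDerivAt_chart_of_fixed hb₀ he hbe q.2
      rw [flowDeriv_eq_exp hψ hb₀] at hd
      have hin : HasDerivAt (fun ε : ℝ => x₀ + ε * q.1) q.1 0 := by
        simpa using ((hasDerivAt_id (0 : ℝ)).mul_const q.1).const_add x₀
      have hd' : HasDerivAt (fun y => e (ψ q.2 (e.symm y)))
          (Real.exp (flowExponent ψ b₀ * q.2)) ((fun ε : ℝ => x₀ + ε * q.1) 0) := by
        simpa using hd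
      have h5 := ((hd'.comp (0 : ℝ) hin).sub hin).tendsto_slope_zero_right
      simp only [Function.comp_apply, Pi.sub_apply, zero_add, zero_mul, add_zero, smul_eq_mul] at h5
      rw [hx₀, e.left_inv hbe, hb₀ q.2, sub_self] at h5
      rw [sub_mul, one_mul]
      refine h5.congr fun ε => ?_
      rw [sub_zero, div_eq_inv_mul]
    have h5 : Tendsto (fun ε : ℝ => η (e.symm (x₀ + ε * q.1)) *
        χ ((e (ψ q.2 (e.symm (x₀ + ε * q.1))) - (x₀ + ε * q.1)) / ε) *
          f (GermArrow.unit (e.symm (x₀ + ε * q.1))) q.2) (𝓝[>] 0) (𝓝 (Φ₀ q)) := by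
      refine (((hη.continuous.tendsto b₀).comp h2).mul
        ((Complex.continuous_ofReal.tendsto _).comp ((hχ.continuous.tendsto _).comp h4))).mul ?_
      exact (hfc.tendsto (b₀, q.2)).comp (h2.prodMk_nhds tendsto_const_nhds)
    refine h5.congr' ?_
    filter_upwards [eventually_mem_nhdsWithin, h1.eventually (e.open_target.mem_nhds hx₀t),
      h3.eventually (e.open_source.mem_nhds hbe)] with ε hε h6 h7 using (hΦval ε hε q h6 h7).symm
  have hsm := eventually_contMDiff_mul_chartMollifier he hη hηe hχ hχc
  have hΦm : ∀ᶠ ε : ℝ in 𝓝[>] 0, AEStronglyMeasurable (Φ ε) (volume.prod volume) := by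
    filter_upwards [hsm] with ε hε
    have hg : Continuous (g ε) := (hε.continuous.comp (continuous_fst.prodMk
      (hψ.continuous_comp continuous_snd continuous_fst))).mul hfc
    have h1 : Measurable ((e.target ×ˢ (univ : Set ℝ)).indicator
        fun q : ℝ × ℝ => (ε : ℂ) * g ε (e.symm q.1, q.2)) := by
      rw [← piecewise_eq_indicator]
      refine ContinuousOn.measurable_piecewise ?_ continuousOn_const
        (e.open_target.prod isOpen_univ).measurableSet
      exact continuousOn_const.mul (hg.comp_continuousOn
        ((e.symm.continuousOn.comp continuousOn_fst fun q hq => hq.1).prodMk continuousOn_snd))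
    have h2 : Measurable fun q : ℝ × ℝ => ((x₀ + ε * q.1, q.2) : ℝ × ℝ) := by fun_prop
    have h3 := (h1.comp h2).aestronglyMeasurable (μ := volume.prod volume)
    refine h3.congr (Eventually.of_forall fun q => ?_)
    by_cases hq : x₀ + ε * q.1 ∈ e.target
    · simp only [Φ, Function.comp_apply, indicator_of_mem hq]
      exact indicator_of_mem (s := e.target ×ˢ (univ : Set ℝ)) ⟨hq, trivial⟩ _
    · simp only [Φ, Function.comp_apply, indicator_of_notMem hq]
      exact indicator_of_notMem (s := e.target ×ˢ (univ : Set ℝ)) (fun h => hq h.1) _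
  have hpos : ∀ᶠ ε : ℝ in 𝓝[>] 0, 0 < ε := eventually_mem_nhdsWithin
  have hlim := tendsto_integral_filter_of_dominated_convergence bound hΦm
    (hpos.mono fun ε hε => Eventually.of_forall (hΦb ε hε)) hbi (Eventually.of_forall hΦlim)
  have hΦ₀i : Integrable Φ₀ (volume.prod volume) := by
    refine hbi.mono' ?_ (Eventually.of_forall fun q => ?_)
    · have h1 : Continuous fun t => f (GermArrow.unit b₀) t := G.posConv_continuous hf _
      have h2 := hχ.continuous
      have h3 : Continuous Φ₀ := by fun_prop
      exact h3.aestronglyMeasurable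
    · exact le_of_tendsto (hΦlim q).norm (hpos.mono fun ε hε => hΦb ε hε q)
  have hΦ₀ : ∫ q, Φ₀ q ∂(volume.prod volume) = η b₀ * fixedContribution ψ f b₀ := by
    rw [integral_prod_symm _ hΦ₀i, fixedContribution, ← integral_const_mul,
      ← setIntegral_eq_integral_of_forall_compl_eq_zero (s := Ioi (0 : ℝ))]
    · refine setIntegral_congr_fun measurableSet_Ioi fun t ht => ?_
      simp only [Φ₀]
      rw [integral_mul_const, integral_const_mul, integral_comp_mul_left_eq hχ1, abs_sub_comm]
      push_cast
      ring
    · intro t ht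
      have : f (GermArrow.unit b₀) t = 0 := hcd _ _ fun h => ht (hc.trans_le h.1)
      simp only [Φ₀, this, mul_zero, integral_zero]
  rw [hΦ₀] at hlim
  refine hlim.congr' ?_
  obtain ⟨K', hK', hK'e, hev⟩ := eventually_chartMollifier_eq_zero
    (isClosed_tsupport η).isCompact hηe hW (fun b hb => (hηN hb).2.1) hχc
  filter_upwards [hpos, hΦm, hev] with ε hε hm hmol
  rw [integral_prod _ (hbi.mono' hm (Eventually.of_forall (hΦb ε hε))),
    ← integral_indicator e.open_target.measurableSet]
  set h : ℝ → ℂ := e.target.indicator fun x => η (e.symm x) *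
    kernelAction A ψ f (chartMollifier e χ ε x) (e.symm x) with hh
  have hval : ∀ z, ∫ t, Φ ε (z, t) = ε • h (x₀ + ε * z) := by
    intro z
    simp only [Φ, hh]
    by_cases hz : x₀ + ε * z ∈ e.target
    · simp only [indicator_of_mem hz, g]
      rw [integral_const_mul, Complex.real_smul]
      congr 1
      by_cases h0 : η (e.symm (x₀ + ε * z)) = 0
      · simp [h0]
      have h1 := hηN (subset_tsupport _ h0)
      rw [h1.1 _ fun y hy => ?_, ← integral_const_mul]
      · refine integral_congr_ae (Eventually.of_forall fun t => ?_)
        simp only [e.right_inv hz]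
        ring
      · have h2 := hmol _ (subset_tsupport _ h0) y fun h => hy (hK'e h).2
        rwa [e.right_inv hz] at h2
    · simp only [indicator_of_notMem hz, integral_zero, smul_zero]
  simp only [hval]
  rw [integral_smul]
  have h1 := Measure.integral_comp_mul_left (fun y => h (x₀ + y)) ε
  rw [h1, integral_add_left_eq_self h x₀, abs_of_pos (inv_pos.2 hε), smul_smul,
    mul_inv_cancel₀ hε.ne', one_smul]

end IsNonDegenerateFlowGroupoid

/-- The integral of the restriction of the kernel to the diagonal over the orbits that are not
reduced to a point. -/
def orbitTrace {B : Type*} [TopologicalSpace B] (A : Set (GermArrow B)) (ψ : ℝ → B → B)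
    (hfin : (properOrbits ψ).Finite) (base : Set B → B) (f : GermArrow B → ℝ → ℂ) (η : B → ℂ) : ℂ :=
  ∑ O ∈ hfin.toFinset, ∫ u in flowDomain ψ O, η (ψ u (base O)) *
    arrowKernel A ψ f (ψ u (base O)) (ψ u (base O))

/-- The contribution of the fixed points. -/
def fixedTrace {B : Type*} [TopologicalSpace B] [ChartedSpace ℝ B] (ψ : ℝ → B → B)
    (hfix : (fixedPts ψ).Finite) (f : GermArrow B → ℝ → ℂ) (η : B → ℂ) : ℂ :=
  ∑ b ∈ hfix.toFinset, η b * fixedContribution ψ f b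

namespace IsNonDegenerateFlowGroupoid

variable {B : Type*} [TopologicalSpace B] [ChartedSpace ℝ B] [IsManifold 𝓘(ℝ, ℝ) ∞ B]
  [T2Space B] [CompactSpace B]
  {A : Set (GermArrow B)} {ψ : ℝ → B → B} (G : IsNonDegenerateFlowGroupoid A ψ)
  {f g : GermArrow B → ℝ → ℂ} (hfin : (properOrbits ψ).Finite) (hfix : (fixedPts ψ).Finite)
  {base : Set B → B} (hbase : ∀ O ∈ properOrbits ψ, base O ∈ O)

include G hbase

lemma integrableOn_mul_arrowKernel_diag (hf : f ∈ posConvAlgebra A) {η : B → ℂ} (hη : Continuous η)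
    {O : Set B} (hO : O ∈ properOrbits ψ) :
    IntegrableOn (fun u => η (ψ u (base O)) * arrowKernel A ψ f (ψ u (base O)) (ψ u (base O)))
      (flowDomain ψ O) := by
  have hT2 : T2Space A := G.t2Space
  obtain ⟨Q, hQ, hQF, h0⟩ := G.exists_isCompact_arrowKernel_diag hf
  exact G.isSmoothFlow.integrableOn_flowDomain hO (hbase O hO) hQ hQF
    (G := fun b => η b * arrowKernel A ψ f b b)
    (fun b hb => hη.continuousAt.mul (G.continuousAt_arrowKernel_diag hf hb))
    fun b hb hbQ => by rw [h0 b hb hbQ, mul_zero]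

omit hbase in
lemma arrowKernel_add (hf : f ∈ posConvAlgebra A) (hg : g ∈ posConvAlgebra A) {b : B}
    (hb : b ∉ fixedPts ψ) (b' : B) :
    arrowKernel A ψ (f + g) b b' = arrowKernel A ψ f b b' + arrowKernel A ψ g b b' := by
  obtain ⟨S, hS, hSf, hSg⟩ := G.exists_finset_fiber hf hg b
  rw [IsFlowGroupoid.arrowKernel_eq_sum S hS hSf, IsFlowGroupoid.arrowKernel_eq_sum S hS hSg,
    IsFlowGroupoid.arrowKernel_eq_sum S hS,
    ← Finset.sum_add_distrib]
  · refine Finset.sum_congr rfl fun γ hγ => ?_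
    obtain ⟨c, d, -, hcd⟩ := posConv_exists_bounds hf
    obtain ⟨c', d', -, hcd'⟩ := posConv_exists_bounds hg
    have hs : γ.src ∉ fixedPts ψ := by
      rw [G.src_mem_fixedPts_iff (hS γ hγ).1, (hS γ hγ).2]
      exact hb
    obtain ⟨T, hT⟩ := G.isSmoothFlow.exists_finset_hitTimes hs b' (max (max |c| |d|) (max |c'| |d'|))
    have h1 : ∀ t ∈ T, ψ t γ.src = b' := fun t ht => ((hT t).1 ht).1
    have hf' : ∀ t, ψ t γ.src = b' → f γ t ≠ 0 → t ∈ T := fun t ht h => by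
      have h2 : t ∈ Icc c d := by_contra fun h' => h (hcd γ t h')
      exact (hT t).2 ⟨ht, (abs_le_max_abs_abs h2.1 h2.2).trans (le_max_left _ _)⟩
    have hg' : ∀ t, ψ t γ.src = b' → g γ t ≠ 0 → t ∈ T := fun t ht h => by
      have h2 : t ∈ Icc c' d' := by_contra fun h' => h (hcd' γ t h')
      exact (hT t).2 ⟨ht, (abs_le_max_abs_abs h2.1 h2.2).trans (le_max_right _ _)⟩
    rw [G.isSmoothFlow.orbitSum_eq_sum_hitTimes T h1 hf',
      G.isSmoothFlow.orbitSum_eq_sum_hitTimes T h1 hg',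
      G.isSmoothFlow.orbitSum_eq_sum_hitTimes T h1, ← Finset.sum_add_distrib]
    · rfl
    · intro t ht h
      by_cases h2 : f γ t = 0
      · exact hg' t ht fun h3 => h (by simp [h2, h3])
      · exact hf' t ht h2
  · intro γ hγ hb h
    by_cases h2 : f γ = 0
    · exact hSg γ hγ hb fun h3 => h (by simp [h2, h3])
    · exact hSf γ hγ hb h2

omit hbase G in
lemma arrowKernel_smul (c : ℂ) (b b' : B) :
    arrowKernel A ψ (c • f) b b' = c * arrowKernel A ψ f b b' := by
  simp only [arrowKernel, orbitSum, Pi.smul_apply, smul_eq_mul]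
  have h : ∀ γ : GermArrow B, (∑ᶠ (t : ℝ) (_ : ψ t γ.src = b'), c * f γ t) =
      c * ∑ᶠ (t : ℝ) (_ : ψ t γ.src = b'), f γ t := fun γ => by
    simp only [← smul_eq_mul]
    rw [smul_finsum]
    exact finsum_congr fun t => (smul_finsum _ _).symm
  simp only [h]
  simp only [← smul_eq_mul]
  rw [smul_finsum]
  exact finsum_congr fun t => (smul_finsum _ _).symm

lemma orbitTrace_add_left (hf : f ∈ posConvAlgebra A) (hg : g ∈ posConvAlgebra A) {η : B → ℂ}
    (hη : Continuous η) : orbitTrace A ψ hfin base (f + g) η =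
      orbitTrace A ψ hfin base f η + orbitTrace A ψ hfin base g η := by
  rw [orbitTrace, orbitTrace, orbitTrace, ← Finset.sum_add_distrib]
  refine Finset.sum_congr rfl fun O hO => ?_
  rw [hfin.mem_toFinset] at hO
  rw [← integral_add (G.integrableOn_mul_arrowKernel_diag hbase hf hη hO)
    (G.integrableOn_mul_arrowKernel_diag hbase hg hη hO)]
  refine integral_congr_ae (Eventually.of_forall fun u => ?_)
  simp only
  rw [G.arrowKernel_add hf hg (G.isSmoothFlow.not_mem_fixedPts_flow
    (G.isSmoothFlow.not_mem_fixedPts_of_mem_orbit hO (hbase O hO)) u), mul_add]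

omit hbase G in
lemma orbitTrace_smul_left (c : ℂ) (η : B → ℂ) :
    orbitTrace A ψ hfin base (c • f) η = c * orbitTrace A ψ hfin base f η := by
  simp only [orbitTrace, arrowKernel_smul, Finset.mul_sum, ← integral_const_mul, mul_left_comm]

omit hbase in
lemma integrableOn_fixedContribution (hf : f ∈ posConvAlgebra A) {b : B} (hb : b ∈ fixedPts ψ) :
    IntegrableOn (fun t : ℝ => f (GermArrow.unit b) t /
      ((|1 - Real.exp (flowExponent ψ b * t)| : ℝ) : ℂ)) (Ioi 0) := by
  obtain ⟨c, d, hc, hcd⟩ := posConv_exists_bounds hf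
  refine IntegrableOn.of_forall_sdiff_eq_zero (s := Icc c d) ?_ measurableSet_Ioi
    fun t ht => by rw [hcd _ _ ht.2, zero_div]
  refine ContinuousOn.integrableOn_Icc (ContinuousOn.div
    (G.posConv_continuous hf _).continuousOn (by fun_prop) fun t ht => ?_)
  rw [Complex.ofReal_ne_zero, abs_ne_zero, sub_ne_zero, ne_comm, Ne, Real.exp_eq_one_iff]
  exact mul_ne_zero (G.flowExponent_ne_zero b hb) (hc.trans_le ht.1).ne'

omit hbase in
lemma fixedTrace_add_left (hf : f ∈ posConvAlgebra A) (hg : g ∈ posConvAlgebra A) (η : B → ℂ) :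
    fixedTrace ψ hfix (f + g) η = fixedTrace ψ hfix f η + fixedTrace ψ hfix g η := by
  rw [fixedTrace, fixedTrace, fixedTrace, ← Finset.sum_add_distrib]
  refine Finset.sum_congr rfl fun b hb => ?_
  rw [hfix.mem_toFinset] at hb
  rw [← mul_add, fixedContribution, fixedContribution, fixedContribution, ← integral_add
    (G.integrableOn_fixedContribution hf hb) (G.integrableOn_fixedContribution hg hb)]
  simp only [Pi.add_apply, add_div]

omit hbase G in
lemma fixedTrace_smul_left (c : ℂ) (η : B → ℂ) :
    fixedTrace ψ hfix (c • f) η = c * fixedTrace ψ hfix f η := by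
  simp only [fixedTrace, fixedContribution, Finset.mul_sum]
  refine Finset.sum_congr rfl fun b _ => ?_
  simp only [Pi.smul_apply, smul_eq_mul, mul_div_assoc]
  rw [integral_const_mul, mul_left_comm]

lemma tendsto_mollified_orbit (hf : f ∈ posConvAlgebra A) {e : OpenPartialHomeomorph B ℝ}
    (he : e ∈ IsManifold.maximalAtlas 𝓘(ℝ, ℝ) ∞ B) {O : Set B} (hO : O ∈ properOrbits ψ)
    {η : B → ℂ} {χ : ℝ → ℝ} (hη : ContMDiff 𝓘(ℝ, ℝ) 𝓘(ℝ, ℂ) ∞ η)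
    (hηe : tsupport η ⊆ e.source) (hηO : tsupport η ⊆ O) (hχ : ContDiff ℝ ∞ χ)
    (hχc : HasCompactSupport χ) (hχ1 : ∫ z, χ z = 1) :
    Tendsto (fun ε : ℝ => ∫ x in e.target, η (e.symm x) *
      kernelAction A ψ f (chartMollifier e χ ε x) (e.symm x)) (𝓝[>] 0)
      (𝓝 (orbitTrace A ψ hfin base f η + fixedTrace ψ hfix f η)) := by
  have hψ := G.isSmoothFlow
  have hT2 : T2Space A := G.t2Space
  have h0 : ∀ b ∉ O, η b = 0 := fun b hb => image_eq_zero_of_notMem_tsupport fun h => hb (hηO h)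
  have h1 := G.tendsto_mollified_of_subset_orbit hf hfin hbase he hO hη hηe hηO hχ hχc hχ1
  have h2 : orbitTrace A ψ hfin base f η + fixedTrace ψ hfix f η =
      ∫ u in flowDomain ψ O, η (ψ u (base O)) *
        arrowKernel A ψ f (ψ u (base O)) (ψ u (base O)) := by
    rw [orbitTrace, fixedTrace, Finset.sum_eq_single_of_mem O (hfin.mem_toFinset.2 hO),
      Finset.sum_eq_zero, add_zero]
    · intro b hb
      rw [h0 b fun h => hψ.not_mem_fixedPts_of_mem_orbit hO h (hfix.mem_toFinset.1 hb), zero_mul]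
    · intro O' hO' hne
      rw [hfin.mem_toFinset] at hO'
      refine integral_eq_zero_of_ae (Eventually.of_forall fun u => ?_)
      simp only [Pi.zero_apply]
      rw [h0 _ fun h => hne (hψ.eq_of_mem_properOrbits hO' hO
        ((hψ.flow_mem_orbit_iff hO' u).2 (hbase O' hO')) h), zero_mul]
  rwa [h2]

lemma exists_tendsto_mollified_fixed (hf : f ∈ posConvAlgebra A) {e : OpenPartialHomeomorph B ℝ}
    (he : e ∈ IsManifold.maximalAtlas 𝓘(ℝ, ℝ) ∞ B) {b : B} (hb : b ∈ fixedPts ψ)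
    (hbe : b ∈ e.source) : ∃ N ∈ 𝓝 b, ∀ (η : B → ℂ) (χ : ℝ → ℝ),
      ContMDiff 𝓘(ℝ, ℝ) 𝓘(ℝ, ℂ) ∞ η → tsupport η ⊆ e.source → tsupport η ⊆ N →
      ContDiff ℝ ∞ χ → HasCompactSupport χ → ∫ z, χ z = 1 →
      Tendsto (fun ε : ℝ => ∫ x in e.target, η (e.symm x) *
        kernelAction A ψ f (chartMollifier e χ ε x) (e.symm x)) (𝓝[>] 0)
        (𝓝 (orbitTrace A ψ hfin base f η + fixedTrace ψ hfix f η)) := by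
  have hψ := G.isSmoothFlow
  obtain ⟨Q, hQ, hQF, hQ0⟩ := G.exists_isCompact_arrowKernel_diag hf
  obtain ⟨N, hN, h1⟩ := G.exists_tendsto_mollified_of_fixed hf hb he hbe
  have h2 := eventually_nhdsWithin_iff.1
    (hψ.eventually_ne_of_flowExponent_ne_zero hb (G.flowExponent_ne_zero b hb))
  refine ⟨N ∩ (Qᶜ ∩ {z | z ∈ ({b} : Set B)ᶜ → z ∉ fixedPts ψ}), inter_mem hN (inter_mem
    (hQ.isClosed.isOpen_compl.mem_nhds fun h => hQF b h hb) h2), ?_⟩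
  intro η χ hη hηe hηN hχ hχc hχ1
  have h3 : orbitTrace A ψ hfin base f η + fixedTrace ψ hfix f η =
      η b * fixedContribution ψ f b := by
    rw [orbitTrace, fixedTrace, Finset.sum_eq_zero, zero_add,
      Finset.sum_eq_single_of_mem b (hfix.mem_toFinset.2 hb)]
    · intro z hz hzb
      rw [image_eq_zero_of_notMem_tsupport (f := η) fun h =>
        (hηN h).2.2 hzb (hfix.mem_toFinset.1 hz), zero_mul]
    · intro O hO
      rw [hfin.mem_toFinset] at hO
      refine integral_eq_zero_of_ae (Eventually.of_forall fun u => ?_)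
      simp only [Pi.zero_apply]
      by_cases h7 : ψ u (base O) ∈ tsupport η
      · rw [hQ0 _ (hψ.not_mem_fixedPts_flow
          (hψ.not_mem_fixedPts_of_mem_orbit hO (hbase O hO)) u) (hηN h7).2.1, mul_zero]
      · rw [image_eq_zero_of_notMem_tsupport h7, zero_mul]
  rw [h3]
  exact h1 η χ hη hηe (fun z hz => (hηN hz).1) hχ hχc hχ1

/-- The restriction of the kernel to the diagonal. -/
def diagonalRestriction (hf : f ∈ posConvAlgebra A) : smoothFun 𝓘(ℝ, ℝ) B →ₗ[ℂ] ℂ where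
  toFun := fun η => orbitTrace A ψ hfin base f η + fixedTrace ψ hfix f η
  map_add' := fun η η' => by
    have hcont : ∀ η : smoothFun 𝓘(ℝ, ℝ) B, Continuous (η : B → ℂ) := fun η =>
      (show ContMDiff 𝓘(ℝ, ℝ) 𝓘(ℝ, ℂ) ∞ (η : B → ℂ) from η.2).continuous
    have h1 : orbitTrace A ψ hfin base f (η + η' : smoothFun 𝓘(ℝ, ℝ) B) =
        orbitTrace A ψ hfin base f η + orbitTrace A ψ hfin base f η' := by
      rw [orbitTrace, orbitTrace, orbitTrace, ← Finset.sum_add_distrib]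
      refine Finset.sum_congr rfl fun O hO => ?_
      rw [hfin.mem_toFinset] at hO
      rw [← integral_add (G.integrableOn_mul_arrowKernel_diag hbase hf (hcont η) hO)
        (G.integrableOn_mul_arrowKernel_diag hbase hf (hcont η') hO)]
      refine integral_congr_ae (Eventually.of_forall fun u => ?_)
      simp [add_mul]
    have h2 : fixedTrace ψ hfix f (η + η' : smoothFun 𝓘(ℝ, ℝ) B) =
        fixedTrace ψ hfix f η + fixedTrace ψ hfix f η' := by
      simp [fixedTrace, ← Finset.sum_add_distrib, add_mul]
    rw [h1, h2]
    ring
  map_smul' := fun c η => by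
    simp only [orbitTrace, fixedTrace, RingHom.id_apply, smul_eq_mul, mul_add,
      Finset.mul_sum, ← integral_const_mul]
    simp [mul_assoc]

theorem isDiagonalRestriction_kernelAction (hf : f ∈ posConvAlgebra A) :
    IsDiagonalRestriction (kernelAction A ψ f) (G.diagonalRestriction hfin hfix hbase hf) := by
  classical
  have hψ := G.isSmoothFlow
  have hT2 : T2Space A := G.t2Space
  intro e he η hη χ hχ hχc hχ1
  have hηs : ContMDiff 𝓘(ℝ, ℝ) 𝓘(ℝ, ℂ) ∞ (η : B → ℂ) := η.2
  have hU : ∀ b, ∃ U ∈ 𝓝 b, ∀ ζ : B → ℂ, ContMDiff 𝓘(ℝ, ℝ) 𝓘(ℝ, ℂ) ∞ ζ →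
      tsupport ζ ⊆ U → tsupport ζ ⊆ tsupport (η : B → ℂ) →
      Tendsto (fun ε : ℝ => ∫ x in e.target, ζ (e.symm x) *
        kernelAction A ψ f (chartMollifier e χ ε x) (e.symm x)) (𝓝[>] 0)
        (𝓝 (orbitTrace A ψ hfin base f ζ + fixedTrace ψ hfix f ζ)) := by
    intro b
    by_cases hb : b ∈ fixedPts ψ
    · by_cases hbe : b ∈ e.source
      · obtain ⟨N, hN, h⟩ := G.exists_tendsto_mollified_fixed hfin hfix hbase hf he hb hbe
        exact ⟨N, hN, fun ζ h1 h2 h3 => h ζ χ h1 (h3.trans hη) h2 hχ hχc hχ1⟩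
      · refine ⟨(tsupport (η : B → ℂ))ᶜ, (isClosed_tsupport _).isOpen_compl.mem_nhds
          fun h => hbe (hη h), fun ζ h1 h2 h3 => ?_⟩
        have h4 : ∀ z, ζ z = 0 := fun z =>
          image_eq_zero_of_notMem_tsupport fun h => h2 h (h3 h)
        simp only [orbitTrace, fixedTrace, h4, zero_mul, integral_zero, Finset.sum_const_zero,
          add_zero]
        exact tendsto_const_nhds
    · exact ⟨flowOrbit ψ b, hψ.flowOrbit_mem_nhds hb, fun ζ h1 h2 h3 =>
        G.tendsto_mollified_orbit hfin hfix hbase hf he (hψ.flowOrbit_mem_properOrbits hb) h1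
          (h3.trans hη) h2 hχ hχc hχ1⟩
  choose U hUn hU using hU
  obtain ⟨s, ζ, hζ, hζs, hζ1⟩ := exists_finite_partition U hUn
  have hprod : ∀ i, ContMDiff 𝓘(ℝ, ℝ) 𝓘(ℝ, ℂ) ∞ fun b => ζ i b * (η : B → ℂ) b := fun i b =>
    (hζ i b).mul_complex (hηs b)
  have hs1 : ∀ i, tsupport (fun b => ζ i b * (η : B → ℂ) b) ⊆ tsupport (η : B → ℂ) := fun i =>
    tsupport_mul_subset_right
  have hsum : η = ∑ i ∈ s, (⟨fun b => ζ i b * (η : B → ℂ) b, hprod i⟩ : smoothFun 𝓘(ℝ, ℝ) B) := by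
    ext b
    simp only [AddSubmonoidClass.coe_finsetSum, Finset.sum_apply]
    rw [← Finset.sum_mul, hζ1, one_mul]
  have htot : Tendsto (fun ε : ℝ => ∑ i ∈ s, ∫ x in e.target,
      (ζ i (e.symm x) * (η : B → ℂ) (e.symm x)) *
        kernelAction A ψ f (chartMollifier e χ ε x) (e.symm x)) (𝓝[>] 0) (𝓝 (∑ i ∈ s,
      (orbitTrace A ψ hfin base f (fun b => ζ i b * (η : B → ℂ) b) +
        fixedTrace ψ hfix f (fun b => ζ i b * (η : B → ℂ) b)))) :=
    tendsto_finsetSum s fun i _ => hU i (fun b => ζ i b * (η : B → ℂ) b) (hprod i)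
      (tsupport_mul_subset_left.trans (hζs i)) (hs1 i)
  have hT : G.diagonalRestriction hfin hfix hbase hf η = ∑ i ∈ s,
      (orbitTrace A ψ hfin base f (fun b => ζ i b * (η : B → ℂ) b) +
        fixedTrace ψ hfix f (fun b => ζ i b * (η : B → ℂ) b)) := by
    conv_lhs => rw [hsum]
    rw [map_sum]
    exact Finset.sum_congr rfl fun i _ => rfl
  rw [hT]
  refine htot.congr' ?_
  have hint : ∀ i, ∀ᶠ ε : ℝ in 𝓝[>] 0, IntegrableOn (fun x =>
      (ζ i (e.symm x) * (η : B → ℂ) (e.symm x)) *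
        kernelAction A ψ f (chartMollifier e χ ε x) (e.symm x)) e.target := fun i =>
    G.integrableOn_mollified (η := fun b => ζ i b * (η : B → ℂ) b) hf he (hprod i)
      ((hs1 i).trans hη) hχ hχc
  filter_upwards [(Finset.eventually_all s).2 fun i _ => hint i] with ε hε
  rw [← integral_finsetSum _ hε]
  refine integral_congr_ae (Eventually.of_forall fun x => ?_)
  simp only
  rw [← Finset.sum_mul, ← Finset.sum_mul, hζ1, one_mul]

end IsNonDegenerateFlowGroupoid

lemma integral_mul_sub_comm (p q : ℝ → ℂ) (t : ℝ) :
    ∫ u, p u * q (t - u) = ∫ u, q u * p (t - u) := by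
  rw [← integral_sub_left_eq_self _ volume t]
  refine integral_congr_ae (Eventually.of_forall fun u => ?_)
  simp only [sub_sub_cancel]
  ring

lemma continuous_integral_mul_sub {p q : ℝ → ℂ} (hp : Continuous p) (hq : Continuous q) {c d : ℝ}
    (hpc : ∀ t, t ∉ Icc c d → p t = 0) : Continuous fun t => ∫ u, p u * q (t - u) := by
  have h1 : (fun t => ∫ u, p u * q (t - u)) = fun t => ∫ u in Icc c d, p u * q (t - u) := by
    funext t
    rw [setIntegral_eq_integral_of_forall_compl_eq_zero fun u hu => by rw [hpc u hu, zero_mul]]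
  rw [h1]
  exact continuous_parametric_integral_of_continuous
    (by simp only [Function.uncurry_def]; fun_prop) isCompact_Icc

namespace IsNonDegenerateFlowGroupoid

variable {B : Type*} [TopologicalSpace B] [ChartedSpace ℝ B] [IsManifold 𝓘(ℝ, ℝ) ∞ B]
  {A : Set (GermArrow B)} {ψ : ℝ → B → B} (G : IsNonDegenerateFlowGroupoid A ψ)
  {f g : GermArrow B → ℝ → ℂ}

include G

lemma flow_eq_self {γ : GermArrow B} (hγ : γ ∈ A) (h : γ.tgt ∈ fixedPts ψ) (u : ℝ) :
    γ.flow ψ u = γ := by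
  refine G.eq_of_src_tgt (G.flow_mem hγ u) hγ ?_ ?_
  · exact ((G.src_mem_fixedPts_iff hγ).2 h) u
  · rw [G.tgt_flow]
    exact h u

/-- The exponents at the source and at the range of an arrow are equal. -/
lemma flowExponent_src {γ : GermArrow B} (hγ : γ ∈ A) (h : γ.tgt ∈ fixedPts ψ) :
    flowExponent ψ γ.src = flowExponent ψ γ.tgt := by
  have hψ := G.isSmoothFlow
  have hs := (G.src_mem_fixedPts_iff hγ).2 h
  have hmem : sect γ.rep γ.src ∈ A := by rwa [sect_rep]
  have hd := (G.contMDiffAt hmem).mdifferentiableAt (by simp)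
  have hdψ : ∀ b, MDifferentiableAt 𝓘(ℝ, ℝ) 𝓘(ℝ, ℝ) (ψ 1) b := fun b =>
    (hψ.contMDiff_at_time 1 b).mdifferentiableAt (by simp)
  have htgt : γ.rep γ.src = γ.tgt := congrArg GermArrow.tgt (sect_rep γ)
  have h1 : (fun y => ψ 1 (γ.rep (ψ (-1) y))) =ᶠ[𝓝 γ.src] γ.rep := by
    have h2 := G.flow_eq_self hγ h 1
    have h3 := G.flow_sect 1 γ.rep γ.src
    rw [sect_rep, h2, hs 1] at h3
    exact (sect_eq_iff.1 (h3.symm.trans (sect_rep γ).symm)).2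
  have h2 : (fun y => γ.rep (ψ 1 y)) =ᶠ[𝓝 γ.src] fun y => ψ 1 (γ.rep y) := by
    have h3 := (hψ.contMDiff_at_time 1).continuous.tendsto γ.src
    rw [hs 1] at h3
    filter_upwards [h3.eventually h1] with y hy
    rw [hψ.neg_apply] at hy
    exact hy.symm
  set D : ℝ → ℝ := (mfderiv 𝓘(ℝ, ℝ) 𝓘(ℝ, ℝ) γ.rep γ.src : ℝ → ℝ) with hD
  have hlin : ∀ w : ℝ, D w = w * D 1 := fun w => by
    let L : ℝ →L[ℝ] ℝ := mfderiv 𝓘(ℝ, ℝ) 𝓘(ℝ, ℝ) γ.rep γ.src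
    change L w = w * L 1
    rw [← smul_eq_mul, ← map_smul, smul_eq_mul, mul_one]
  have e1 := mfderiv_comp_model (hd : MDifferentiableAt 𝓘(ℝ, ℝ) 𝓘(ℝ, ℝ) γ.rep γ.src)
    (hdψ γ.src) (hs 1) (1 : ℝ)
  have e2 := mfderiv_comp_model (hdψ γ.tgt) hd htgt (1 : ℝ)
  rw [h2.mfderiv_eq] at e1
  have e3 : D (flowDeriv ψ γ.src 1 * 1) = flowDeriv ψ γ.tgt 1 * D 1 :=
    (congrArg D (mfderiv_flow_apply γ.src 1 1)).symm.trans
      ((e1.symm.trans e2).trans (mfderiv_flow_apply γ.tgt 1 (D 1)))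
  rw [mul_one, hlin] at e3
  have hne : D 1 ≠ 0 := by
    intro h0
    obtain ⟨k, hk, hkh, -⟩ := G.exists_inverse hmem
    have hdk := (G.contMDiffAt hk).mdifferentiableAt (by simp)
    have e4 := mfderiv_comp_model (hdk : MDifferentiableAt 𝓘(ℝ, ℝ) 𝓘(ℝ, ℝ) k (γ.rep γ.src))
      hd rfl (1 : ℝ)
    have e5 : (fun y => k (γ.rep y)) =ᶠ[𝓝 γ.src] id := hkh
    rw [e5.mfderiv_eq, mfderiv_id, ← hD, h0] at e4
    have e6 : (1 : ℝ) = 0 := e4.trans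
      (map_zero (mfderiv 𝓘(ℝ, ℝ) 𝓘(ℝ, ℝ) k (γ.rep γ.src) : ℝ →L[ℝ] ℝ))
    exact one_ne_zero e6
  have e7 := mul_right_cancel₀ hne e3
  rw [flowDeriv_eq_exp hψ hs, flowDeriv_eq_exp hψ h, mul_one, mul_one] at e7
  exact Real.exp_injective e7

lemma integrableOn_div_exponent {b : B} (hb : b ∈ fixedPts ψ) {p : ℝ → ℂ} (hp : Continuous p)
    {c d : ℝ} (hc : 0 < c) (hcd : ∀ t, t ∉ Icc c d → p t = 0) :
    IntegrableOn (fun t : ℝ => p t / ((|1 - Real.exp (flowExponent ψ b * t)| : ℝ) : ℂ))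
      (Ioi 0) := by
  refine IntegrableOn.of_forall_sdiff_eq_zero (s := Icc c d) ?_ measurableSet_Ioi
    fun t ht => by rw [hcd _ ht.2, zero_div]
  refine ContinuousOn.integrableOn_Icc (ContinuousOn.div hp.continuousOn (by fun_prop)
    fun t ht => ?_)
  rw [Complex.ofReal_ne_zero, abs_ne_zero, sub_ne_zero, ne_comm, Ne, Real.exp_eq_one_iff]
  exact mul_ne_zero (G.flowExponent_ne_zero b hb) (hc.trans_le ht.1).ne'

lemma fixedContribution_convolution [T2Space B] (hf : f ∈ posConvAlgebra A)
    (hg : g ∈ posConvAlgebra A) {b : B} (hb : b ∈ fixedPts ψ) (S : Finset (GermArrow B))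
    (hS : ∀ γ ∈ S, γ ∈ A ∧ γ.tgt = b) (hS' : ∀ γ ∈ A, γ.tgt = b → f γ ≠ 0 → γ ∈ S) :
    fixedContribution ψ (groupoidConvolution A ψ f g) b = ∑ γ ∈ S, ∫ t in Ioi (0 : ℝ),
      (∫ u, f γ u * g (γ.inv A) (t - u)) /
        ((|1 - Real.exp (flowExponent ψ γ.tgt * t)| : ℝ) : ℂ) := by
  obtain ⟨c, d, hc, hcd⟩ := posConv_exists_bounds hf
  obtain ⟨c', d', hc', hcd'⟩ := posConv_exists_bounds hg
  have hint : ∀ γ ∈ S, IntegrableOn (fun t : ℝ => (∫ u, f γ u * g (γ.inv A) (t - u)) /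
      ((|1 - Real.exp (flowExponent ψ γ.tgt * t)| : ℝ) : ℂ)) (Ioi 0) := by
    intro γ hγ
    rw [(hS γ hγ).2]
    refine G.integrableOn_div_exponent hb (continuous_integral_mul_sub (G.posConv_continuous hf _)
      (G.posConv_continuous hg _) (hcd γ)) (add_pos hc hc') (d := d + d') fun t ht => ?_
    refine integral_eq_zero_of_ae (Eventually.of_forall fun u => ?_)
    simp only [Pi.zero_apply]
    by_cases h1 : u ∈ Icc c d
    · rw [hcd' _ _ fun h2 => ht ⟨by linarith [h1.1, h2.1], by linarith [h1.2, h2.2]⟩, mul_zero]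
    · rw [hcd _ _ h1, zero_mul]
  rw [← integral_finsetSum _ hint, fixedContribution]
  refine integral_congr_ae (Eventually.of_forall fun t => ?_)
  simp only
  rw [G.convolution_eq (G.unit_mem b), show (GermArrow.unit b).tgt = b from rfl,
    fiberIntegral_eq_sum S hS hS', Finset.sum_div]
  refine Finset.sum_congr rfl fun γ hγ => ?_
  obtain ⟨hγA, hγb⟩ := hS γ hγ
  have h1 : ∀ u, ((γ.inv A).comp (GermArrow.unit b)).flow ψ u = γ.inv A := by
    intro u
    have h2 : (γ.inv A).comp (GermArrow.unit b) = γ.inv A := by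
      rw [← hγb, ← G.src_inv hγA, G.comp_unit]
    rw [h2, G.flow_eq_self (G.inv_mem hγA)]
    rw [G.tgt_inv hγA, G.src_mem_fixedPts_iff hγA, hγb]
    exact hb
  simp only [h1, hγb]

/-- The contributions of the fixed points define a trace. -/
lemma fixedTrace_convolution_comm [T2Space B] (hfix : (fixedPts ψ).Finite)
    (hf : f ∈ posConvAlgebra A) (hg : g ∈ posConvAlgebra A) :
    fixedTrace ψ hfix (groupoidConvolution A ψ f g) (fun _ => 1) =
      fixedTrace ψ hfix (groupoidConvolution A ψ g f) (fun _ => 1) := by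
  classical
  have hfinite : ∀ {f g : GermArrow B → ℝ → ℂ}, f ∈ posConvAlgebra A → g ∈ posConvAlgebra A →
      {γ | γ ∈ A ∧ γ.tgt ∈ fixedPts ψ ∧ (f γ ≠ 0 ∨ g (γ.inv A) ≠ 0)}.Finite := by
    intro f g hf hg
    have h1 : (⋃ b ∈ fixedPts ψ, {a : GermArrow B | a.tgt = b ∧ f a ≠ 0}).Finite :=
      hfix.biUnion fun b _ => G.posConv_finite_fiber hf b
    have h2 : (⋃ b ∈ fixedPts ψ, {a : GermArrow B | a.tgt = b ∧ g a ≠ 0}).Finite :=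
      hfix.biUnion fun b _ => G.posConv_finite_fiber hg b
    refine (h1.union (h2.image (GermArrow.inv A))).subset ?_
    rintro γ ⟨hγ, ht, h | h⟩
    · exact Or.inl (mem_iUnion₂.2 ⟨_, ht, rfl, h⟩)
    · refine Or.inr ⟨γ.inv A, mem_iUnion₂.2 ⟨_, ?_, rfl, h⟩, G.inv_inv hγ⟩
      rw [G.tgt_inv hγ, G.src_mem_fixedPts_iff hγ]
      exact ht
  have key : ∀ {f g : GermArrow B → ℝ → ℂ} (hf : f ∈ posConvAlgebra A)
      (hg : g ∈ posConvAlgebra A), fixedTrace ψ hfix (groupoidConvolution A ψ f g) (fun _ => 1) =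
      ∑ γ ∈ (hfinite hf hg).toFinset, ∫ t in Ioi (0 : ℝ), (∫ u, f γ u * g (γ.inv A) (t - u)) /
        ((|1 - Real.exp (flowExponent ψ γ.tgt * t)| : ℝ) : ℂ) := by
    intro f g hf hg
    rw [fixedTrace, ← Finset.sum_fiberwise_of_maps_to (t := hfix.toFinset) (g := GermArrow.tgt)
      fun γ hγ => hfix.mem_toFinset.2 ((hfinite hf hg).mem_toFinset.1 hγ).2.1]
    refine Finset.sum_congr rfl fun b hb => ?_
    rw [hfix.mem_toFinset] at hb
    rw [one_mul, G.fixedContribution_convolution hf hg hb]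
    · intro γ hγ
      obtain ⟨h1, h2⟩ := Finset.mem_filter.1 hγ
      exact ⟨((hfinite hf hg).mem_toFinset.1 h1).1, h2⟩
    · intro γ hγ hγb h0
      exact Finset.mem_filter.2 ⟨(hfinite hf hg).mem_toFinset.2 ⟨hγ, by rwa [hγb], Or.inl h0⟩, hγb⟩
  rw [key hf hg, key hg hf]
  refine Finset.sum_nbij' (GermArrow.inv A) (GermArrow.inv A) ?_ ?_ ?_ ?_ ?_
  · intro γ hγ
    obtain ⟨h1, h2, h3⟩ := (hfinite hf hg).mem_toFinset.1 hγ
    refine (hfinite hg hf).mem_toFinset.2 ⟨G.inv_mem h1, ?_, ?_⟩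
    · rw [G.tgt_inv h1, G.src_mem_fixedPts_iff h1]
      exact h2
    · rw [G.inv_inv h1]
      exact h3.symm
  · intro γ hγ
    obtain ⟨h1, h2, h3⟩ := (hfinite hg hf).mem_toFinset.1 hγ
    refine (hfinite hf hg).mem_toFinset.2 ⟨G.inv_mem h1, ?_, ?_⟩
    · rw [G.tgt_inv h1, G.src_mem_fixedPts_iff h1]
      exact h2
    · rw [G.inv_inv h1]
      exact h3.symm
  · exact fun γ hγ => G.inv_inv ((hfinite hf hg).mem_toFinset.1 hγ).1
  · exact fun γ hγ => G.inv_inv ((hfinite hg hf).mem_toFinset.1 hγ).1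
  · intro γ hγ
    obtain ⟨h1, h2, h3⟩ := (hfinite hf hg).mem_toFinset.1 hγ
    rw [G.inv_inv h1, G.tgt_inv h1, G.flowExponent_src h1 h2]
    simp only [integral_mul_sub_comm (f γ)]

variable [T2Space B] [CompactSpace B] (hfin : (properOrbits ψ).Finite)
  {base : Set B → B} (hbase : ∀ O ∈ properOrbits ψ, base O ∈ O)

include hbase

lemma integrable_arrowKernel_mul (hf : f ∈ posConvAlgebra A) (hg : g ∈ posConvAlgebra A)
    {O O' : Set B} (hO : O ∈ properOrbits ψ) (hO' : O' ∈ properOrbits ψ) :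
    Integrable (fun q : ℝ × ℝ => arrowKernel A ψ f (ψ q.1 (base O)) (ψ q.2 (base O')) *
      arrowKernel A ψ g (ψ q.2 (base O')) (ψ q.1 (base O)))
      ((volume.restrict (flowDomain ψ O)).prod (volume.restrict (flowDomain ψ O'))) := by
  have hψ := G.isSmoothFlow
  have hT2 : T2Space A := G.t2Space
  obtain ⟨Q, hQ, hQF, hQ0⟩ := G.exists_isCompact_arrowKernel_mul hf hg
  obtain ⟨Q', hQ', hQF', hQ0'⟩ := G.exists_isCompact_arrowKernel_mul hg hf
  obtain ⟨R, hR⟩ := hψ.exists_bound_flowDomain hO (hbase O hO) hQ hQF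
  obtain ⟨R', hR'⟩ := hψ.exists_bound_flowDomain hO' (hbase O' hO') hQ' hQF'
  have hx : ∀ u, ψ u (base O) ∉ fixedPts ψ := hψ.not_mem_fixedPts_flow
    (hψ.not_mem_fixedPts_of_mem_orbit hO (hbase O hO))
  have hx' : ∀ u, ψ u (base O') ∉ fixedPts ψ := hψ.not_mem_fixedPts_flow
    (hψ.not_mem_fixedPts_of_mem_orbit hO' (hbase O' hO'))
  have h1 : Continuous fun q : ℝ × ℝ => ψ q.1 (base O) :=
    hψ.continuous_comp continuous_fst continuous_const
  have h2 : Continuous fun q : ℝ × ℝ => ψ q.2 (base O') :=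
    hψ.continuous_comp continuous_snd continuous_const
  have hc : Continuous fun q : ℝ × ℝ => arrowKernel A ψ f (ψ q.1 (base O)) (ψ q.2 (base O')) *
      arrowKernel A ψ g (ψ q.2 (base O')) (ψ q.1 (base O)) := by
    refine continuous_iff_continuousAt.2 fun q => ContinuousAt.mul ?_ ?_
    · exact ContinuousAt.comp (x := q) (g := fun p : B × B => arrowKernel A ψ f p.1 p.2)
        (f := fun q : ℝ × ℝ => (ψ q.1 (base O), ψ q.2 (base O')))
        (G.continuousAt_arrowKernel hf (Or.inl (hx _))) (h1.prodMk h2).continuousAt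
    · exact ContinuousAt.comp (x := q) (g := fun p : B × B => arrowKernel A ψ g p.1 p.2)
        (f := fun q : ℝ × ℝ => (ψ q.2 (base O'), ψ q.1 (base O)))
        (G.continuousAt_arrowKernel hg (Or.inl (hx' _))) (h2.prodMk h1).continuousAt
  rw [Measure.prod_restrict]
  refine IntegrableOn.of_forall_sdiff_eq_zero (s := Icc (-R) R ×ˢ Icc (-R') R')
    (hc.continuousOn.integrableOn_compact (isCompact_Icc.prod isCompact_Icc))
    ((measurableSet_flowDomain ψ O).prod (measurableSet_flowDomain ψ O')) fun q hq => ?_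
  by_cases h3 : ψ q.1 (base O) ∈ Q
  · by_cases h4 : ψ q.2 (base O') ∈ Q'
    · exact absurd ⟨abs_le.1 (hR _ hq.1.1 h3), abs_le.1 (hR' _ hq.1.2 h4)⟩ hq.2
    · rw [mul_comm, hQ0' _ (hx' _) h4]
  · exact hQ0 _ (hx _) h3 _

lemma orbitTrace_convolution (hf : f ∈ posConvAlgebra A) (hg : g ∈ posConvAlgebra A) :
    orbitTrace A ψ hfin base (groupoidConvolution A ψ f g) (fun _ => 1) =
      ∑ O ∈ hfin.toFinset, ∑ O' ∈ hfin.toFinset, ∫ u in flowDomain ψ O, ∫ v in flowDomain ψ O',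
        arrowKernel A ψ f (ψ u (base O)) (ψ v (base O')) *
          arrowKernel A ψ g (ψ v (base O')) (ψ u (base O)) := by
  have hψ := G.isSmoothFlow
  have hT2 : T2Space A := G.t2Space
  refine Finset.sum_congr rfl fun O hO => ?_
  rw [hfin.mem_toFinset] at hO
  rw [← integral_finsetSum _ fun O' hO' => (G.integrable_arrowKernel_mul hbase hf hg hO
    (hfin.mem_toFinset.1 hO')).integral_prod_left]
  refine integral_congr_ae (Eventually.of_forall fun u => ?_)
  have hx := hψ.not_mem_fixedPts_flow (hψ.not_mem_fixedPts_of_mem_orbit hO (hbase O hO)) u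
  simp only
  rw [one_mul, G.arrowKernel_convolution hf hg hx, G.kernelAction_eq_sum_orbits hf hfin hbase hx
    (continuous_iff_continuousAt.2 fun z => G.continuousAt_arrowKernel_left hg (Or.inr hx))]

/-- The contributions of the other orbits define a trace. -/
lemma orbitTrace_convolution_comm (hf : f ∈ posConvAlgebra A) (hg : g ∈ posConvAlgebra A) :
    orbitTrace A ψ hfin base (groupoidConvolution A ψ f g) (fun _ => 1) =
      orbitTrace A ψ hfin base (groupoidConvolution A ψ g f) (fun _ => 1) := by
  rw [G.orbitTrace_convolution hfin hbase hf hg, G.orbitTrace_convolution hfin hbase hg hf,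
    Finset.sum_comm]
  refine Finset.sum_congr rfl fun O hO => Finset.sum_congr rfl fun O' hO' => ?_
  rw [hfin.mem_toFinset] at hO hO'
  rw [integral_integral_swap (G.integrable_arrowKernel_mul hbase hf hg hO' hO)]
  simp only [mul_comm]

end IsNonDegenerateFlowGroupoid

/-! ### The contributions of the orbits as integrals over the reductions of the groupoid -/

lemma flowDomain_of_periodic {B : Type*} {ψ : ℝ → B → B} {O : Set B} (hO : O ∈ periodicOrbits ψ) :
    flowDomain ψ O = Ico 0 (orbitPeriod ψ O) := if_pos hO

lemma flowDomain_of_not_periodic {B : Type*} {ψ : ℝ → B → B} {O : Set B}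
    (hO : O ∉ periodicOrbits ψ) : flowDomain ψ O = univ := if_neg hO

lemma fiberSum_eq_sum {B : Type*} [TopologicalSpace B] {A : Set (GermArrow B)} {ψ : ℝ → B → B}
    {x₀ : B} {O : Set B} {F : GermArrow B → ℂ} {u : ℝ} (S : Finset (GermArrow B))
    (h1 : ∀ γ ∈ S, γ ∈ A ∧ γ.src ∈ O ∧ γ.tgt = ψ u x₀)
    (h2 : ∀ γ ∈ A, γ.src ∈ O → γ.tgt = ψ u x₀ → F γ ≠ 0 → γ ∈ S) :
    fiberSum A ψ x₀ O F u = ∑ γ ∈ S, F γ :=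
  finsum_mem_eq_sum_of_inter_support_eq F (s := {γ | γ ∈ A ∧ γ.src ∈ O ∧ γ.tgt = ψ u x₀}) <| by
    ext γ
    simp only [mem_inter_iff, Set.mem_ofPred_eq, Function.mem_support, Finset.mem_coe]
    exact ⟨fun h => ⟨h2 γ h.1.1 h.1.2.1 h.1.2.2 h.2, h.2⟩, fun h => ⟨h1 γ h.1, h.2⟩⟩

namespace IsSmoothFlow

variable {B : Type*} [TopologicalSpace B] [ChartedSpace ℝ B] [IsManifold 𝓘(ℝ, ℝ) ∞ B]
  {ψ : ℝ → B → B} (hψ : IsSmoothFlow 𝓘(ℝ, ℝ) ψ) {O : Set B} {x₀ : B}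

include hψ

lemma periodicCoord_spec (hO : O ∈ periodicOrbits ψ) (hx₀ : x₀ ∈ O) {x : B} (hx : x ∈ O) :
    periodicCoord ψ x₀ (orbitPeriod ψ O) x ∈ Ico 0 (orbitPeriod ψ O) ∧
      ψ (periodicCoord ψ x₀ (orbitPeriod ψ O) x) x₀ = x := by
  have h := hψ.exists_mem_flowDomain (hψ.periodicOrbits_subset hO) hx₀ hx
  rw [flowDomain_of_periodic hO] at h
  exact Classical.epsilon_spec h

lemma periodicCoord_flow (hO : O ∈ periodicOrbits ψ) (hx₀ : x₀ ∈ O) {v : ℝ}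
    (hv : v ∈ Ico 0 (orbitPeriod ψ O)) : periodicCoord ψ x₀ (orbitPeriod ψ O) (ψ v x₀) = v := by
  have hO' := hψ.periodicOrbits_subset hO
  have h := hψ.periodicCoord_spec hO hx₀ ((hψ.flow_mem_orbit_iff hO' v).2 hx₀)
  have hinj := hψ.injOn_flowDomain hO' hx₀
  rw [flowDomain_of_periodic hO] at hinj
  exact hinj h.1 hv h.2

lemma periodicCoord_flow_flow (hO : O ∈ periodicOrbits ψ) (hx₀ : x₀ ∈ O) {u v : ℝ}
    (hu : u ∈ Ico 0 (orbitPeriod ψ O)) (hv : v ∈ Ico 0 (orbitPeriod ψ O)) :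
    periodicCoord ψ x₀ (orbitPeriod ψ O) (ψ u (ψ v x₀)) =
      if u < orbitPeriod ψ O - v then u + v else u + v - orbitPeriod ψ O := by
  rw [← hψ.map_add]
  split_ifs with h
  · exact hψ.periodicCoord_flow hO hx₀ ⟨add_nonneg hu.1 hv.1, by linarith⟩
  · have h1 : ψ (orbitPeriod ψ O) x₀ = x₀ :=
      ((hψ.flow_eq_self_iff hO hx₀ _).2).2 ⟨1, by simp⟩
    have h2 : ψ (u + v) x₀ = ψ (u + v - orbitPeriod ψ O) x₀ := by
      conv_rhs => rw [← h1, ← hψ.map_add, sub_add_cancel]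
    rw [h2]
    exact hψ.periodicCoord_flow hO hx₀ ⟨by linarith, by linarith [hu.2, hv.2]⟩

lemma infiniteCoord_spec (hO : O ∈ infiniteOrbits ψ) (hx₀ : x₀ ∈ O) {x : B} (hx : x ∈ O) :
    ψ (infiniteCoord ψ x₀ x) x₀ = x := by
  obtain ⟨u, -, hu⟩ := hψ.exists_mem_flowDomain (hψ.infiniteOrbits_subset hO) hx₀ hx
  exact Classical.epsilon_spec (p := fun u => ψ u x₀ = x) ⟨u, hu⟩

lemma orbitSum_of_infinite (hO : O ∈ infiniteOrbits ψ) (hx₀ : x₀ ∈ O) {x y : B} (hx : x ∈ O)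
    (hy : y ∈ O) (F : ℝ → ℂ) :
    orbitSum ψ F x y = F (infiniteCoord ψ x₀ y - infiniteCoord ψ x₀ x) := by
  have hsx := hψ.infiniteCoord_spec hO hx₀ hx
  have hsy := hψ.infiniteCoord_spec hO hx₀ hy
  rw [hψ.orbitSum_eq_sum_hitTimes {infiniteCoord ψ x₀ y - infiniteCoord ψ x₀ x},
    Finset.sum_singleton]
  · intro t ht
    calc ψ t x = ψ (t + infiniteCoord ψ x₀ x) x₀ := by rw [hψ.map_add, hsx]
      _ = y := by rw [Finset.mem_singleton.1 ht, sub_add_cancel, hsy]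
  · intro t ht _
    rw [Finset.mem_singleton]
    have h1 : ψ (t + infiniteCoord ψ x₀ x - infiniteCoord ψ x₀ y) x₀ = x₀ := by
      rw [show t + infiniteCoord ψ x₀ x - infiniteCoord ψ x₀ y =
        -infiniteCoord ψ x₀ y + (t + infiniteCoord ψ x₀ x) by ring, hψ.map_add, hψ.map_add, hsx, ht]
      exact (congrArg _ hsy.symm).trans (hψ.neg_apply _ _)
    linarith [(hψ.flow_eq_self_iff_of_infinite hO hx₀ _).1 h1]

lemma orbitSum_of_periodic (hO : O ∈ periodicOrbits ψ) (hx₀ : x₀ ∈ O) {x y : B} (hx : x ∈ O)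
    (hy : y ∈ O) (F : ℝ → ℂ) (K : Finset ℤ)
    (hK : ∀ k ∉ K, F (k * orbitPeriod ψ O + (periodicCoord ψ x₀ (orbitPeriod ψ O) y
      - periodicCoord ψ x₀ (orbitPeriod ψ O) x)) = 0) :
    orbitSum ψ F x y = ∑ k ∈ K, F (k * orbitPeriod ψ O +
      (periodicCoord ψ x₀ (orbitPeriod ψ O) y - periodicCoord ψ x₀ (orbitPeriod ψ O) x)) := by
  classical
  have hsx := (hψ.periodicCoord_spec hO hx₀ hx).2
  have hsy := (hψ.periodicCoord_spec hO hx₀ hy).2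
  obtain ⟨hp, -⟩ := hψ.flow_eq_self_iff hO hx₀ 0
  set p := orbitPeriod ψ O
  set a := periodicCoord ψ x₀ p x
  set b := periodicCoord ψ x₀ p y
  have hinj : Function.Injective fun k : ℤ => (k : ℝ) * p + (b - a) := fun k l h => by
    have h1 : (k : ℝ) * p = l * p := add_right_cancel h
    exact_mod_cast mul_right_cancel₀ hp.ne' h1
  rw [hψ.orbitSum_eq_sum_hitTimes (K.image fun k : ℤ => (k : ℝ) * p + (b - a)),
    Finset.sum_image hinj.injOn]
  · intro t ht
    obtain ⟨k, -, rfl⟩ := Finset.mem_image.1 ht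
    refine (congrArg _ hsx.symm).trans ?_
    rw [← hψ.map_add, show (k : ℝ) * p + (b - a) + a = b + k * p by ring, hψ.map_add,
      ((hψ.flow_eq_self_iff hO hx₀ _).2).2 ⟨k, rfl⟩, hsy]
  · intro t ht hF
    have h1 : ψ (t + a - b) x₀ = x₀ := by
      rw [show t + a - b = -b + (t + a) by ring, hψ.map_add, hψ.map_add, hsx, ht]
      exact (congrArg _ hsy.symm).trans (hψ.neg_apply _ _)
    obtain ⟨k, hk⟩ := ((hψ.flow_eq_self_iff hO hx₀ _).2).1 h1
    have h2 : t = k * p + (b - a) := by linarith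
    refine Finset.mem_image.2 ⟨k, ?_, h2.symm⟩
    by_contra hkK
    exact hF (h2 ▸ hK k hkK)

end IsSmoothFlow

namespace IsFlowGroupoid

variable {B : Type*} [TopologicalSpace B] [ChartedSpace ℝ B] [IsManifold 𝓘(ℝ, ℝ) ∞ B]
  {A : Set (GermArrow B)} {ψ : ℝ → B → B} (G : IsFlowGroupoid A ψ) {f : GermArrow B → ℝ → ℂ}
  {O : Set B} {x₀ : B}

include G

lemma orbitSum_eq_zero_of_not_mem (hO : O ∈ properOrbits ψ) {x y : B} (hx : x ∉ O) (hy : y ∈ O)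
    (F : ℝ → ℂ) : orbitSum ψ F x y = 0 :=
  orbitSum_eq_zero fun t _ h => hx ((G.isSmoothFlow.flow_mem_orbit_iff hO t).1 (h ▸ hy))

lemma fiberSum_infiniteTerm (hO : O ∈ infiniteOrbits ψ) (hx₀ : x₀ ∈ O) (u : ℝ) :
    fiberSum A ψ x₀ O (infiniteTerm ψ x₀ f) u = arrowKernel A ψ f (ψ u x₀) (ψ u x₀) := by
  classical
  have hψ := G.isSmoothFlow
  have hO' := hψ.infiniteOrbits_subset hO
  have hu := (hψ.flow_mem_orbit_iff hO' u).2 hx₀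
  unfold fiberSum arrowKernel
  refine finsum_congr fun γ => ?_
  by_cases h : γ ∈ A ∧ γ.tgt = ψ u x₀
  · by_cases hs : γ.src ∈ O
    · rw [finsum_eq_if, finsum_eq_if, if_pos ⟨h.1, hs, h.2⟩, if_pos h,
        hψ.orbitSum_of_infinite hO hx₀ hs hu, infiniteTerm, h.2]
    · rw [finsum_eq_if, finsum_eq_if, if_neg fun h' => hs h'.2.1, if_pos h,
        G.orbitSum_eq_zero_of_not_mem hO' hs hu]
  · rw [finsum_eq_if, finsum_eq_if, if_neg fun h' => h ⟨h'.1, h'.2.2⟩, if_neg h]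

lemma exists_finset_periodicTerm (hf : f ∈ posConvAlgebra A) (hO : O ∈ periodicOrbits ψ)
    (hx₀ : x₀ ∈ O) : ∃ K : Finset ℤ,
      (∀ k ∉ K, ∀ u, fiberSum A ψ x₀ O (periodicTerm ψ x₀ O f k) u = 0) ∧
      ∀ u, ∑ k ∈ K, fiberSum A ψ x₀ O (periodicTerm ψ x₀ O f k) u =
        arrowKernel A ψ f (ψ u x₀) (ψ u x₀) := by
  classical
  have hψ := G.isSmoothFlow
  have hO' := hψ.periodicOrbits_subset hO
  obtain ⟨c, d, hc, hcd⟩ := posConv_exists_bounds hf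
  obtain ⟨hp, -⟩ := hψ.flow_eq_self_iff hO hx₀ 0
  set p := orbitPeriod ψ O with hpdef
  obtain ⟨N, hN⟩ := exists_nat_gt (d / p + 1)
  have hK : ∀ k ∉ Finset.Icc (-1 : ℤ) N, ∀ γ : GermArrow B, γ.src ∈ O → γ.tgt ∈ O →
      periodicTerm ψ x₀ O f k γ = 0 := by
    intro k hk γ hs ht
    have h1 := (hψ.periodicCoord_spec hO hx₀ hs).1
    have h2 := (hψ.periodicCoord_spec hO hx₀ ht).1
    refine hcd _ _ fun h3 => hk (Finset.mem_Icc.2 ⟨?_, ?_⟩)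
    · by_contra! h4
      have h5 : (k : ℝ) ≤ -1 := by exact_mod_cast h4.le
      have h6 : (k : ℝ) * p ≤ -1 * p := mul_le_mul_of_nonneg_right h5 hp.le
      linarith [h3.1, h2.2, h1.1]
    · by_contra! h4
      have h5 : (N : ℝ) ≤ k := by exact_mod_cast h4.le
      have h6 : (d / p + 1) * p < k * p := mul_lt_mul_of_pos_right (hN.trans_le h5) hp
      rw [add_mul, div_mul_cancel₀ _ hp.ne'] at h6
      linarith [h3.2, h2.1, h1.2]
  refine ⟨Finset.Icc (-1 : ℤ) N, fun k hk u => ?_, fun u => ?_⟩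
  · rw [fiberSum_eq_sum ∅ (by simp), Finset.sum_empty]
    intro γ _ hs ht h
    exact absurd (hK k hk γ hs (ht ▸ (hψ.flow_mem_orbit_iff hO' u).2 hx₀)) h
  · have hu := (hψ.flow_mem_orbit_iff hO' u).2 hx₀
    have hfin := G.posConv_finite_fiber hf (ψ u x₀)
    have hmem : ∀ γ, f γ ≠ 0 → γ ∈ A := fun γ h => by
      by_contra h'
      exact h (posConv_eq_zero hf h')
    rw [arrowKernel_eq_sum hfin.toFinset (fun γ hγ => ?_) fun γ _ ht h => ?_]
    · rw [← Finset.sum_filter_add_sum_filter_not hfin.toFinset (fun γ => γ.src ∈ O),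
        Finset.sum_eq_zero (s := hfin.toFinset.filter fun γ => γ.src ∉ O), add_zero,
        Finset.sum_congr rfl fun k _ =>
          fiberSum_eq_sum (hfin.toFinset.filter fun γ => γ.src ∈ O) ?_ ?_, Finset.sum_comm]
      · refine Finset.sum_congr rfl fun γ hγ => ?_
        obtain ⟨hγ1, hγ2⟩ := Finset.mem_filter.1 hγ
        obtain ⟨ht, -⟩ := (Finite.mem_toFinset hfin).1 hγ1
        rw [hψ.orbitSum_of_periodic hO hx₀ hγ2 hu (f γ) (Finset.Icc (-1 : ℤ) N)]
        · refine Finset.sum_congr rfl fun k _ => ?_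
          rw [periodicTerm, ht]
        · intro k hk
          have h1 := hK k hk γ hγ2 (ht ▸ hu)
          rwa [periodicTerm, ht] at h1
      · intro γ hγ
        obtain ⟨hγ1, hγ2⟩ := Finset.mem_filter.1 hγ
        obtain ⟨ht, h0⟩ := (Finite.mem_toFinset hfin).1 hγ1
        exact ⟨hmem γ h0, hγ2, ht⟩
      · intro γ _ hs ht h
        refine Finset.mem_filter.2 ⟨(Finite.mem_toFinset hfin).2 ⟨ht, fun h0 => h ?_⟩, hs⟩
        rw [periodicTerm, h0]
        rfl
      · intro γ hγ
        exact G.orbitSum_eq_zero_of_not_mem hO' (Finset.mem_filter.1 hγ).2 hu _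
    · obtain ⟨ht, h0⟩ := (Finite.mem_toFinset hfin).1 hγ
      exact ⟨hmem γ h0, ht⟩
    · exact (Finite.mem_toFinset hfin).2 ⟨ht, h⟩

/-- Only finitely many arrows with range `x` meet the support of `f` when they are moved by the
flow during a bounded time. -/
lemma finite_flow_fiber (hf : f ∈ posConvAlgebra A) (x : B) (c d : ℝ) :
    {γ : GermArrow B | γ ∈ A ∧ γ.tgt = x ∧ ∃ u ∈ Icc c d, f (γ.flow ψ u) ≠ 0}.Finite := by
  obtain ⟨L, hL, hLA, h0⟩ := posConv_exists_compact hf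
  have hcont : ContinuousOn (fun q : ℝ × GermArrow B => q.2.flow ψ (-q.1)) (Icc c d ×ˢ L) := by
    intro q hq
    exact (((G.continuousAt_flow (hLA hq.2) (-q.1)).comp
      (f := fun q : ℝ × GermArrow B => (-q.1, q.2))
      (by fun_prop : Continuous fun q : ℝ × GermArrow B => (-q.1, q.2)).continuousAt)
      ).continuousWithinAt
  refine (G.finite_fiber ((isCompact_Icc.prod hL).image_of_continuousOn hcont) ?_ x).subset ?_
  · rintro _ ⟨q, hq, rfl⟩
    exact G.flow_mem (hLA hq.2) _
  · rintro γ ⟨-, ht, u, hu, h⟩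
    refine ⟨⟨(u, γ.flow ψ u), ⟨hu, ?_⟩, G.flow_neg_flow γ u⟩, ht⟩
    by_contra h'
    exact h (h0 _ h')

lemma integrableOn_fiberSum_periodicTerm (hf : f ∈ posConvAlgebra A) (hO : O ∈ periodicOrbits ψ)
    (hx₀ : x₀ ∈ O) (k : ℤ) :
    IntegrableOn (fiberSum A ψ x₀ O (periodicTerm ψ x₀ O f k)) (Ico 0 (orbitPeriod ψ O)) := by
  classical
  have hψ := G.isSmoothFlow
  have hO' := hψ.periodicOrbits_subset hO
  set p := orbitPeriod ψ O with hpdef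
  have hfin := G.finite_flow_fiber hf x₀ 0 p
  set T := hfin.toFinset.filter fun γ => γ.src ∈ O with hT
  have hTmem : ∀ γ ∈ T, γ ∈ A ∧ γ.tgt = x₀ ∧ γ.src ∈ O := fun γ hγ => by
    obtain ⟨h1, h2⟩ := Finset.mem_filter.1 hγ
    obtain ⟨h3, h4, -⟩ := (Finite.mem_toFinset hfin).1 h1
    exact ⟨h3, h4, h2⟩
  set σ' : GermArrow B → ℝ := fun γ => periodicCoord ψ x₀ p γ.src with hσ
  have hint : IntegrableOn (fun u : ℝ => ∑ γ ∈ T, (Iio (p - σ' γ)).piecewise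
      (fun u => f (γ.flow ψ u) (k * p - σ' γ)) (fun u => f (γ.flow ψ u) (k * p + p - σ' γ)) u)
      (Ico 0 p) := by
    refine integrable_finsetSum _ fun γ hγ => ?_
    have hi : ∀ a : ℝ, IntegrableOn (fun u => f (γ.flow ψ u) a) (Ico 0 p) := fun a =>
      ((G.posConv_flow_continuous hf (hTmem γ hγ).1 continuous_id
        continuous_const).continuousOn.integrableOn_Icc).mono_set Ico_subset_Icc_self
    exact Integrable.piecewise measurableSet_Iio (hi _).integrableOn (hi _).integrableOn
  refine hint.congr_fun (fun u hu => ?_) measurableSet_Ico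
  have hinj : Function.Injective fun γ : GermArrow B => γ.flow ψ u := fun γ δ h => by
    rw [← G.flow_neg_flow γ u, ← G.flow_neg_flow δ u]
    exact congrArg (fun a => GermArrow.flow ψ (-u) a) h
  rw [fiberSum_eq_sum (T.image fun γ => γ.flow ψ u), Finset.sum_image hinj.injOn]
  · refine Finset.sum_congr rfl fun γ hγ => ?_
    obtain ⟨hA, ht, hs⟩ := hTmem γ hγ
    have hsc := hψ.periodicCoord_spec hO hx₀ hs
    have h1 := hψ.periodicCoord_flow_flow hO hx₀ hu hsc.1
    rw [hsc.2] at h1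
    rw [periodicTerm, G.tgt_flow, G.src_flow, ht, hψ.periodicCoord_flow hO hx₀ hu, h1]
    by_cases h : u < p - σ' γ
    · rw [piecewise_eq_of_mem (Iio (p - σ' γ)) _ _ h, if_pos h]
      congr 1
      simp only [hσ, ← hpdef]
      ring
    · rw [piecewise_eq_of_notMem (Iio (p - σ' γ)) _ _ h, if_neg h]
      congr 1
      simp only [hσ, ← hpdef]
      ring
  · intro γ hγ
    obtain ⟨δ, hδ, rfl⟩ := Finset.mem_image.1 hγ
    obtain ⟨hA, ht, hs⟩ := hTmem δ hδ
    exact ⟨G.flow_mem hA u, (hψ.flow_mem_orbit_iff hO' u).2 hs, by rw [G.tgt_flow, ht]⟩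
  · intro γ hA hs ht h
    refine Finset.mem_image.2 ⟨γ.flow ψ (-u), Finset.mem_filter.2
      ⟨(Finite.mem_toFinset hfin).2 ⟨G.flow_mem hA _, ?_, u, Ico_subset_Icc_self hu, ?_⟩, ?_⟩,
      G.flow_flow_neg γ u⟩
    · rw [G.tgt_flow, ht, hψ.neg_apply]
    · rw [G.flow_flow_neg]
      intro h0
      exact h (by rw [periodicTerm, h0]; rfl)
    · exact (hψ.flow_mem_orbit_iff hO' (-u)).2 hs

lemma summable_orbitIntegral_periodicTerm (hf : f ∈ posConvAlgebra A) (hO : O ∈ periodicOrbits ψ)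
    (hx₀ : x₀ ∈ O) : Summable (fun k : ℤ => orbitIntegral A ψ x₀ (Ico 0 (orbitPeriod ψ O)) O
      (periodicTerm ψ x₀ O f k)) ∧
    ∑' k : ℤ, orbitIntegral A ψ x₀ (Ico 0 (orbitPeriod ψ O)) O (periodicTerm ψ x₀ O f k) =
      ∫ u in flowDomain ψ O, arrowKernel A ψ f (ψ u x₀) (ψ u x₀) := by
  obtain ⟨K, hK, hsum⟩ := G.exists_finset_periodicTerm hf hO hx₀
  have h0 : ∀ k ∉ K, orbitIntegral A ψ x₀ (Ico 0 (orbitPeriod ψ O)) O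
      (periodicTerm ψ x₀ O f k) = 0 := fun k hk => by
    unfold orbitIntegral
    simp only [hK k hk, integral_zero]
  refine ⟨summable_of_ne_finset_zero h0, ?_⟩
  rw [tsum_eq_sum h0, flowDomain_of_periodic hO]
  unfold orbitIntegral
  rw [← integral_finsetSum _ fun k _ => G.integrableOn_fiberSum_periodicTerm hf hO hx₀ k]
  simp only [hsum]

end IsFlowGroupoid

namespace IsNonDegenerateFlowGroupoid

variable {B : Type*} [TopologicalSpace B] [ChartedSpace ℝ B] [IsManifold 𝓘(ℝ, ℝ) ∞ B]
  [T2Space B] [CompactSpace B]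
  {A : Set (GermArrow B)} {ψ : ℝ → B → B} (G : IsNonDegenerateFlowGroupoid A ψ)
  {f : GermArrow B → ℝ → ℂ} (hfin : (properOrbits ψ).Finite) (hfix : (fixedPts ψ).Finite)
  {base : Set B → B} (hbase : ∀ O ∈ properOrbits ψ, base O ∈ O)

include G hbase

lemma integrable_fiberSum_infiniteTerm (hf : f ∈ posConvAlgebra A) {O : Set B}
    (hO : O ∈ infiniteOrbits ψ) :
    Integrable (fiberSum A ψ (base O) O (infiniteTerm ψ (base O) f)) := by
  have hψ := G.isSmoothFlow
  have hO' := hψ.infiniteOrbits_subset hO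
  have h1 := G.integrableOn_mul_arrowKernel_diag hbase hf (η := fun _ => 1) continuous_const hO'
  rw [flowDomain_of_not_periodic
    (fun h => hψ.disjoint_periodicOrbits_infiniteOrbits.le_bot ⟨h, hO⟩), integrableOn_univ] at h1
  refine h1.congr (Eventually.of_forall fun u => ?_)
  change 1 * _ = _
  rw [one_mul, G.fiberSum_infiniteTerm hO (hbase O hO')]

lemma orbitTrace_one (hf : f ∈ posConvAlgebra A) : orbitTrace A ψ hfin base f (fun _ => 1) =
    (∑ᶠ (O : Set B) (_ : O ∈ periodicOrbits ψ), ∑' k : ℤ,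
      orbitIntegral A ψ (base O) (Ico 0 (orbitPeriod ψ O)) O (periodicTerm ψ (base O) O f k)) +
    ∑ᶠ (O : Set B) (_ : O ∈ infiniteOrbits ψ),
      orbitIntegral A ψ (base O) univ O (infiniteTerm ψ (base O) f) := by
  classical
  have hψ := G.isSmoothFlow
  have hp := hfin.subset hψ.periodicOrbits_subset
  have hi := hfin.subset hψ.infiniteOrbits_subset
  have hdisj := hψ.disjoint_periodicOrbits_infiniteOrbits
  have hsplit : hfin.toFinset = hp.toFinset ∪ hi.toFinset := by
    ext O
    simp [hψ.properOrbits_eq]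
  have hd : Disjoint hp.toFinset hi.toFinset := by
    rw [Finite.disjoint_toFinset]
    exact hdisj
  rw [finsum_mem_eq_finite_toFinset_sum _ hp, finsum_mem_eq_finite_toFinset_sum _ hi,
    orbitTrace, hsplit, Finset.sum_union hd]
  congr 1
  · refine Finset.sum_congr rfl fun O hO => ?_
    have hO := (Finite.mem_toFinset hp).1 hO
    rw [(G.summable_orbitIntegral_periodicTerm hf hO
      (hbase O (hψ.periodicOrbits_subset hO))).2]
    simp only [one_mul]
  · refine Finset.sum_congr rfl fun O hO => ?_
    have hO := (Finite.mem_toFinset hi).1 hO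
    rw [flowDomain_of_not_periodic fun h => hdisj.le_bot ⟨h, hO⟩, orbitIntegral]
    simp only [one_mul, G.fiberSum_infiniteTerm hO (hbase O (hψ.infiniteOrbits_subset hO))]

omit G hbase in
lemma fixedTrace_one : fixedTrace ψ hfix f (fun _ => 1) =
    ∑ᶠ (b : B) (_ : b ∈ fixedPts ψ), ∫ t in Ioi (0 : ℝ), f (GermArrow.unit b) t /
      ((|1 - Real.exp (flowExponent ψ b * t)| : ℝ) : ℂ) := by
  rw [finsum_mem_eq_finite_toFinset_sum _ hfix, fixedTrace]
  simp only [one_mul]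
  rfl

end IsNonDegenerateFlowGroupoid

namespace IsFlowGroupoid

variable {B : Type*} [TopologicalSpace B] [ChartedSpace ℝ B] [IsManifold 𝓘(ℝ, ℝ) ∞ B]
  [CompactSpace B] [T2Space B] [MeasurableSpace B] [BorelSpace B]
  {A : Set (GermArrow B)} {ψ : ℝ → B → B} (G : IsFlowGroupoid A ψ) {f : GermArrow B → ℝ → ℂ}

include G

lemma integrable_fiberIntegral_flow [T2Space A] {μ : Measure B} [IsFiniteMeasure μ]
    (hf : f ∈ posConvAlgebra A) (Ψ : smoothFun (𝓘(ℝ, ℝ).prod 𝓘(ℝ, ℝ)) (B × B)) :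
    Integrable (fun b => fiberIntegral A f (fun γ t => (Ψ : B × B → ℂ) (b, ψ t γ.src)) b) μ := by
  have hc := (G.contMDiff_fiberIntegral_flow hf Ψ.2).continuous
  have hi : IntegrableOn (fun b => fiberIntegral A f
      (fun γ t => (Ψ : B × B → ℂ) (b, ψ t γ.src)) b) univ μ :=
    hc.continuousOn.integrableOn_compact' isCompact_univ MeasurableSet.univ
  exact integrableOn_univ.1 hi

/-- The distributional kernel of an element of the convolution algebra is a distribution of
order zero. -/
lemma exists_distKernel [T2Space A] {μ : Measure B} (hμ : IsSmoothDensity μ)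
    (hf : f ∈ posConvAlgebra A) :
    ∃ k : smoothFun (𝓘(ℝ, ℝ).prod 𝓘(ℝ, ℝ)) (B × B) →ₗ[ℂ] ℂ, (∀ Ψ, k Ψ = distKernel A ψ μ f Ψ) ∧
      ∃ C : ℝ, ∀ (Ψ : smoothFun (𝓘(ℝ, ℝ).prod 𝓘(ℝ, ℝ)) (B × B)) (M : ℝ),
        (∀ q, ‖(Ψ : B × B → ℂ) q‖ ≤ M) → ‖k Ψ‖ ≤ C * M := by
  have := hμ.isFiniteMeasure
  have hcont : ∀ (Ψ : smoothFun (𝓘(ℝ, ℝ).prod 𝓘(ℝ, ℝ)) (B × B)) (b : B), ∀ γ ∈ A, γ.tgt = b →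
      Continuous fun t => (Ψ : B × B → ℂ) (b, ψ t γ.src) := fun Ψ b γ _ _ =>
    (show ContMDiff _ 𝓘(ℝ, ℂ) ∞ (Ψ : B × B → ℂ) from Ψ.2).continuous.comp
      (continuous_const.prodMk (G.isSmoothFlow.contMDiff_orbit γ.src).continuous)
  obtain ⟨C, hC⟩ := G.exists_fiberIntegral_bound hf
  refine ⟨{ toFun := fun Ψ => distKernel A ψ μ f Ψ
            map_add' := fun Ψ Ψ' => ?_
            map_smul' := fun c Ψ => ?_ }, fun Ψ => rfl, C * μ.real univ, fun Ψ M hM => ?_⟩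
  · change (∫ b, fiberIntegral A f (fun γ t => ((Ψ + Ψ' : smoothFun _ _) : B × B → ℂ)
      (b, ψ t γ.src)) b ∂μ) = (∫ b, fiberIntegral A f (fun γ t => (Ψ : B × B → ℂ)
      (b, ψ t γ.src)) b ∂μ) + ∫ b, fiberIntegral A f (fun γ t => (Ψ' : B × B → ℂ)
      (b, ψ t γ.src)) b ∂μ
    rw [← integral_add (G.integrable_fiberIntegral_flow hf Ψ)
      (G.integrable_fiberIntegral_flow hf Ψ')]
    exact integral_congr_ae (Eventually.of_forall fun b =>
      G.fiberIntegral_add_right hf (hcont Ψ b) (hcont Ψ' b))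
  · change (∫ b, fiberIntegral A f (fun γ t => ((c • Ψ : smoothFun _ _) : B × B → ℂ)
      (b, ψ t γ.src)) b ∂μ) = c * ∫ b, fiberIntegral A f (fun γ t => (Ψ : B × B → ℂ)
      (b, ψ t γ.src)) b ∂μ
    rw [← integral_const_mul]
    exact integral_congr_ae (Eventually.of_forall fun b => G.fiberIntegral_smul_right hf c)
  · change ‖∫ b, fiberIntegral A f (fun γ t => (Ψ : B × B → ℂ) (b, ψ t γ.src)) b ∂μ‖ ≤ _
    refine (norm_integral_le_of_norm_le_const (Eventually.of_forall fun b =>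
      hC b _ M fun γ t => hM _)).trans_eq ?_
    ring

lemma distKernel_mul {μ : Measure B} (hf : f ∈ posConvAlgebra A) (η ξ : B → ℂ) :
    distKernel A ψ μ f (fun q => η q.1 * ξ q.2) = ∫ b, η b * kernelAction A ψ f ξ b ∂μ := by
  refine integral_congr_ae (Eventually.of_forall fun b => ?_)
  change fiberIntegral A f (fun γ t => η b * ξ (ψ t γ.src)) b =
    η b * fiberIntegral A f (fun γ t => ξ (ψ t γ.src)) b
  exact G.fiberIntegral_smul_right hf (η b)

end IsFlowGroupoid

lemma hasDiagonalTrace_integralOperator_iff {B : Type*} [TopologicalSpace B] [ChartedSpace ℝ B]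
    [IsManifold 𝓘(ℝ, ℝ) ∞ B] [CompactSpace B] [T2Space B] [MeasurableSpace B] [BorelSpace B]
    {μ : Measure B} (hμ : IsSmoothDensity μ) {κ : B × B → ℂ} (hκ : Continuous κ) (τ : ℂ) :
    HasDiagonalTrace (integralOperator μ κ) τ ↔ τ = ∫ b, κ (b, b) ∂μ := by
  have h : diagonalIntegral hμ hκ ⟨fun _ => 1, contMDiff_const⟩ = ∫ b, κ (b, b) ∂μ := by
    change ∫ b, 1 * κ (b, b) ∂μ = _
    simp only [one_mul]
  rw [(isDiagonalRestriction_integralOperator hμ hκ).hasDiagonalTrace_iff, h]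

namespace IsNonDegenerateFlowGroupoid

variable {B : Type*} [TopologicalSpace B] [ChartedSpace ℝ B] [IsManifold 𝓘(ℝ, ℝ) ∞ B]
  [T2Space B] [CompactSpace B]
  {A : Set (GermArrow B)} {ψ : ℝ → B → B} (G : IsNonDegenerateFlowGroupoid A ψ)
  (hfin : (properOrbits ψ).Finite) (hfix : (fixedPts ψ).Finite)
  {base : Set B → B} (hbase : ∀ O ∈ properOrbits ψ, base O ∈ O)

/-- The trace on the convolution algebra: the integral of the restriction of the kernel to the
diagonal. -/
def diagonalTrace : posConvAlgebra A →ₗ[ℂ] ℂ where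
  toFun := fun f => orbitTrace A ψ hfin base f (fun _ => 1) + fixedTrace ψ hfix f (fun _ => 1)
  map_add' := fun f g => by
    rw [Submodule.coe_add, G.orbitTrace_add_left hfin hbase f.2 g.2 continuous_const,
      G.fixedTrace_add_left hfix f.2 g.2]
    ring
  map_smul' := fun c f => by
    rw [Submodule.coe_smul, orbitTrace_smul_left, fixedTrace_smul_left, RingHom.id_apply,
      smul_eq_mul]
    ring

end IsNonDegenerateFlowGroupoid

end

theorem proposition6p7 {n : ℕ} {V : Type*} [TopologicalSpace V] [ChartedSpace (FolModel n) V]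
    [IsManifold 𝓘(ℝ, FolModel n) ∞ V] [CompactSpace V] [T2Space V]
    (F : CodimOneFoliation n V)
    (φ : ℝ → V → V) (hφ : IsSmoothFlow 𝓘(ℝ, FolModel n) φ) (hcompat : F.Compatible φ)
    {B : Type*} [TopologicalSpace B] [ChartedSpace ℝ B] [IsManifold 𝓘(ℝ, ℝ) ∞ B]
    [CompactSpace B] [T2Space B] [MeasurableSpace B] [BorelSpace B]
    (ι : B → V) (hι : F.IsCompleteTransversal ι)
    (ψ : ℝ → B → B) (hψ : F.IsInducedFlow φ ι ψ)
    -- base-points on the orbits of the induced flow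
    (base : Set B → B) (hbase : ∀ O ∈ periodicOrbits ψ ∪ infiniteOrbits ψ, base O ∈ O) :
    -- the groupoid `H_B` of a non-degenerate flow is Hausdorff
    (F.NonDegenerate φ → T2Space (F.holonomyArrows ι)) ∧
    -- if `H_B` is Hausdorff, the convolution algebra acts on the smooth functions on `B` ...
    (T2Space (F.holonomyArrows ι) →
      ∃ (mul : posConvAlgebra (F.holonomyArrows ι) →ₗ[ℂ]
            posConvAlgebra (F.holonomyArrows ι) →ₗ[ℂ] posConvAlgebra (F.holonomyArrows ι))
        (π : posConvAlgebra (F.holonomyArrows ι) →ₗ[ℂ] Module.End ℂ (smoothFun 𝓘(ℝ, ℝ) B)),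
        (∀ f g, (mul f g : GermArrow B → ℝ → ℂ) = groupoidConvolution (F.holonomyArrows ι) ψ f g) ∧
        (∀ f g h, mul (mul f g) h = mul f (mul g h)) ∧
        (∀ f ξ, (π f ξ : B → ℂ) = kernelAction (F.holonomyArrows ι) ψ f ξ) ∧
        (∀ f g, π (mul f g) = π f * π g) ∧
        (∀ (f : posConvAlgebra (F.holonomyArrows ι)) (b : B),
          {γ : GermArrow B | γ.tgt = b ∧ (f : GermArrow B → ℝ → ℂ) γ ≠ 0}.Finite) ∧
        -- ... by distributional kernels ...
        (∀ μ : Measure B, IsSmoothDensity μ →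
          (∀ f : posConvAlgebra (F.holonomyArrows ι),
            (∃ k : smoothFun (𝓘(ℝ, ℝ).prod 𝓘(ℝ, ℝ)) (B × B) →ₗ[ℂ] ℂ,
              (∀ Ψ, k Ψ = distKernel (F.holonomyArrows ι) ψ μ f Ψ) ∧
              (∃ C : ℝ, ∀ (Ψ : smoothFun (𝓘(ℝ, ℝ).prod 𝓘(ℝ, ℝ)) (B × B)) (M : ℝ), (∀ q, ‖(Ψ : B × B → ℂ) q‖ ≤ M) → ‖k Ψ‖ ≤ C * M)) ∧
            (∀ η ξ : smoothFun 𝓘(ℝ, ℝ) B,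
              distKernel (F.holonomyArrows ι) ψ μ f
                  (fun q => (η : B → ℂ) q.1 * (ξ : B → ℂ) q.2) =
                ∫ b, (η : B → ℂ) b * (π f ξ : B → ℂ) b ∂μ) ∧
            -- ... that are smooth away from pairs of fixed points,
            IsSmoothKernelOn μ (distKernel (F.holonomyArrows ι) ψ μ f)
              (fixedPts ψ ×ˢ fixedPts ψ)ᶜ) ∧
          -- but may be singular on the diagonal at the fixed points
          (∀ b ∈ fixedPts ψ, ∃ f : posConvAlgebra (F.holonomyArrows ι),
            ¬ ∃ W ∈ 𝓝 (b, b), IsOpen W ∧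
              IsSmoothKernelOn μ (distKernel (F.holonomyArrows ι) ψ μ f) W))) ∧
    -- the integral of the restriction of the kernel to the diagonal is the operator trace on
    -- operators with smooth kernels
    (∀ (μ : Measure B) (κ : smoothFun (𝓘(ℝ, ℝ).prod 𝓘(ℝ, ℝ)) (B × B)), IsSmoothDensity μ →
      ∀ τ, HasDiagonalTrace (integralOperator μ κ) τ ↔ τ = ∫ b, (κ : B × B → ℂ) (b, b) ∂μ) ∧
    -- for a non-degenerate flow, it is defined on the whole convolution algebra, where it is a trace
    -- given by the sum over the three kinds of orbits
    (F.NonDegenerate φ →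
      (periodicOrbits ψ).Finite ∧ (infiniteOrbits ψ).Finite ∧ (fixedPts ψ).Finite ∧
      (∀ b ∈ fixedPts ψ, flowExponent ψ b ≠ 0 ∧ ∀ t w : ℝ,
        (mfderiv 𝓘(ℝ, ℝ) 𝓘(ℝ, ℝ) (ψ t) b : ℝ → ℝ) w = Real.exp (flowExponent ψ b * t) * w) ∧
      ∃ Tr : posConvAlgebra (F.holonomyArrows ι) →ₗ[ℂ] ℂ,
        (∀ (f : posConvAlgebra (F.holonomyArrows ι)) (τ : ℂ),
          HasDiagonalTrace (kernelAction (F.holonomyArrows ι) ψ f) τ ↔ τ = Tr f) ∧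
        (∀ (f : posConvAlgebra (F.holonomyArrows ι)) (μ : Measure B)
          (κ : smoothFun (𝓘(ℝ, ℝ).prod 𝓘(ℝ, ℝ)) (B × B)), IsSmoothDensity μ →
          (∀ ξ : smoothFun 𝓘(ℝ, ℝ) B,
            kernelAction (F.holonomyArrows ι) ψ f ξ = integralOperator μ κ ξ) →
          Tr f = ∫ b, (κ : B × B → ℂ) (b, b) ∂μ) ∧
        (∀ f g fg gf : posConvAlgebra (F.holonomyArrows ι),
          (fg : GermArrow B → ℝ → ℂ) = groupoidConvolution (F.holonomyArrows ι) ψ f g →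
          (gf : GermArrow B → ℝ → ℂ) = groupoidConvolution (F.holonomyArrows ι) ψ g f →
          Tr fg = Tr gf) ∧
        ∀ f : posConvAlgebra (F.holonomyArrows ι),
          -- convergence of the sums and integrals
          (∀ O ∈ periodicOrbits ψ,
            (∀ k : ℤ, IntegrableOn (fiberSum (F.holonomyArrows ι) ψ (base O) O
              (periodicTerm ψ (base O) O f k)) (Ico 0 (orbitPeriod ψ O))) ∧
            Summable (fun k : ℤ => orbitIntegral (F.holonomyArrows ι) ψ (base O)
              (Ico 0 (orbitPeriod ψ O)) O (periodicTerm ψ (base O) O f k))) ∧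
          (∀ O ∈ infiniteOrbits ψ, Integrable (fiberSum (F.holonomyArrows ι) ψ (base O) O
            (infiniteTerm ψ (base O) f))) ∧
          (∀ b ∈ fixedPts ψ, IntegrableOn (fun t : ℝ =>
            (f : GermArrow B → ℝ → ℂ) (GermArrow.unit b) t /
              ((|1 - Real.exp (flowExponent ψ b * t)| : ℝ) : ℂ)) (Ioi 0)) ∧
          -- the formula
          Tr f =
            (∑ᶠ (O : Set B) (_ : O ∈ periodicOrbits ψ), ∑' k : ℤ,
              orbitIntegral (F.holonomyArrows ι) ψ (base O) (Ico 0 (orbitPeriod ψ O)) O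
                (periodicTerm ψ (base O) O f k)) +
            (∑ᶠ (O : Set B) (_ : O ∈ infiniteOrbits ψ),
              orbitIntegral (F.holonomyArrows ι) ψ (base O) univ O
                (infiniteTerm ψ (base O) f)) +
            ∑ᶠ (b : B) (_ : b ∈ fixedPts ψ), ∫ t in Ioi (0 : ℝ),
              (f : GermArrow B → ℝ → ℂ) (GermArrow.unit b) t /
                ((|1 - Real.exp (flowExponent ψ b * t)| : ℝ) : ℂ)) := by
  set A := F.holonomyArrows ι with hA
  have hB := hψ.isSmoothFlow
  have G : IsFlowGroupoid A ψ :=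
    CodimOneFoliation.isFlowGroupoid_holonomyArrows hφ hcompat hι hψ
  have GN : F.NonDegenerate φ → IsNonDegenerateFlowGroupoid A ψ := fun hnd =>
    hnd.isNonDegenerateFlowGroupoid hφ hcompat hι hψ
  have hbase' : ∀ O ∈ properOrbits ψ, base O ∈ O := fun O hO => hbase O (hB.properOrbits_eq ▸ hO)
  refine ⟨fun hnd => (GN hnd).t2Space, fun hT2 => ?_, fun μ κ hμ τ => ?_, fun hnd => ?_⟩
  · refine ⟨G.convMul, G.kernelRep, fun f g => rfl, fun f g h => Subtype.ext ?_, fun f ξ => rfl,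
      fun f g => LinearMap.ext fun ξ => Subtype.ext ?_, fun f b => G.posConv_finite_fiber f.2 b,
      fun μ hμ => ⟨fun f => ⟨G.exists_distKernel hμ f.2, fun η ξ => ?_,
        G.isSmoothKernelOn_distKernel hμ f.2⟩, fun b hb => ?_⟩⟩
    · exact G.convolution_assoc f.2 g.2 h.2
    · exact G.kernelAction_convolution f.2 g.2 ξ.2.continuous
    · exact G.distKernel_mul f.2 η ξ
    · obtain ⟨f, hf, h⟩ := G.exists_not_isSmoothKernelOn hμ hb
      exact ⟨⟨f, hf⟩, h⟩
  · exact hasDiagonalTrace_integralOperator_iff hμ κ.2.continuous τ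
  · have G' := GN hnd
    have := G'.t2Space
    have hfin := hB.finite_properOrbits G'.flowExponent_ne_zero
    have hfix := hB.finite_fixedPts G'.flowExponent_ne_zero
    refine ⟨hfin.subset hB.periodicOrbits_subset, hfin.subset hB.infiniteOrbits_subset, hfix,
      fun b hb => ⟨G'.flowExponent_ne_zero b hb, fun t w => ?_⟩,
      G'.diagonalTrace hfin hfix hbase', fun f τ => ?_, fun f μ κ hμ h => ?_,
      fun f g fg gf hfg hgf => ?_, fun f => ⟨fun O hO => ⟨fun k => ?_, ?_⟩, fun O hO => ?_,
        fun b hb => G'.integrableOn_fixedContribution f.2 hb, ?_⟩⟩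
    · rw [mfderiv_flow_apply, flowDeriv_eq_exp hB hb]
    · exact (G'.isDiagonalRestriction_kernelAction hfin hfix hbase' f.2).hasDiagonalTrace_iff τ
    · have h1 := (G'.isDiagonalRestriction_kernelAction hfin hfix hbase' f.2).congr
        (Q := integralOperator μ κ) fun ξ hξ => (h ⟨ξ, hξ⟩).symm
      exact (hasDiagonalTrace_integralOperator_iff hμ κ.2.continuous _).1
        ((h1.hasDiagonalTrace_iff _).2 rfl)
    · change orbitTrace A ψ hfin base fg _ + fixedTrace ψ hfix fg _ =
        orbitTrace A ψ hfin base gf _ + fixedTrace ψ hfix gf _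
      rw [hfg, hgf, G'.orbitTrace_convolution_comm hfin hbase' f.2 g.2,
        G'.fixedTrace_convolution_comm hfix f.2 g.2]
    · exact G.integrableOn_fiberSum_periodicTerm f.2 hO (hbase O (Or.inl hO)) k
    · exact (G.summable_orbitIntegral_periodicTerm f.2 hO (hbase O (Or.inl hO))).1
    · exact G'.integrable_fiberSum_infiniteTerm hbase' f.2 hO
    · change orbitTrace A ψ hfin base f _ + fixedTrace ψ hfix f _ = _
      rw [G'.orbitTrace_one hfin hbase' f.2, IsNonDegenerateFlowGroupoid.fixedTrace_one hfix]
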